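/- **Theorem 3.** Let $\mathcal K=(\Sigma,\to,\ell)$ be a finite, nonempty (possibly non-total) Kripke structure. Let $R_{\mathrm{sim}}$ be its simulation preorder, that is, the largest relation $R\subseteq\Sigma\times\Sigma$ such that $(s,s')\in R$ implies $\ell(s)=\ell(s')$ and, for every $s\to t$, there is $s'\to t'$ with $(t,t')\in R$. Let $P_{\mathrm{sim}}$ be the partition of $\Sigma$ into the classes of the simulation equivalence $R_{\mathrm{sim}}\cap R_{\mathrm{sim}}^{-1}$, let $|P_{\mathrm{sim}}|$ be the number of its blocks, and let $|{\to}|$ be the number of transitions. Write $\mathrm{pre}(Y)=\{a\mid \exists b\in Y,\ a\to b\}$. The simulation algorithm $\mathsf{SA}$ maintains a partition $P$ of $\Sigma$, a relation $\mathrm{Rel}$ on $P$ and, for each block $B\in P$, a set $\mathrm{Remove}(B)\subseteq\Sigma$. In the beginning $P$ is the partition into classes of states with equal label, $\mathrm{Rel}$ is the identity, and $\mathrm{Remove}(B)=\Sigma\setminus\mathrm{pre}(\bigcup\mathrm{Rel}(B))$. As long as some block $B$ has $\mathrm{Remove}(B)\neq\varnothing$, such a block is selected, and the following is done: 1. $\mathrm{Remove}:=\mathrm{Remove}(B)$,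 $\mathrm{Remove}(B):=\varnothing$ and $B_{\mathrm{prev}}:=B$; 2. each block $D$ of $P$ is replaced by the nonempty ones among $D\cap\mathrm{Remove}$ and $D\setminus\mathrm{Remove}$; the new blocks inherit $\mathrm{Rel}$ and the remove set of their parent block; 3. for each $C\in P$ with $C\cap\mathrm{pre}(B_{\mathrm{prev}})\neq\varnothing$ and each $D\in P$ with $D\subseteq\mathrm{Remove}$: if $D\in\mathrm{Rel}(C)$, then $D$ is removed from $\mathrm{Rel}(C)$, and all the $s\in\mathrm{pre}(D)$ with $s\notin\mathrm{pre}(\bigcup\mathrm{Rel}(C))$ are added to $\mathrm{Remove}(C)$. $\mathsf{SA}$ is implemented with these data structures: the states of each block are kept in a doubly linked list, with pointers from the block to its first and last state and from each state to its block; the blocks are kept in a doubly linked list in which blocks whose remove set becomes nonempty are moved to the end; each block stores its remove set as a list and an array $\mathrm{RelCount}$ that holds for each state $x$ the number of transitions from $x$ into $\bigcup\mathrm{Rel}(B)$; and $\mathrm{Rel}$ is a resizable boolean matrix (capacities are doubled when needed). The input consists of the list of predecessors of each state and of the blocks of the initial partition. Time is the number of steps of a unit-cost random access machine. Space is the largest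 number of bits in the working memory during the run; the read-only input is not counted. Then $\mathsf{SA}$ halts and runs - in $O(|P_{\mathrm{sim}}|\cdot|{\to}|)$ time, provided that $|\Sigma|\le|{\to}|$ (for example if $\to$ is total), and - in $O(|P_{\mathrm{sim}}|\cdot|\Sigma|\cdot\log|\Sigma|)$ space, provided that $|\Sigma|\ge 2$. The constants are absolute. -/

import Mathlib

universe u

namespace SimAlg

/-! ### Kripke structures and simulation -/

/-- A Kripke structure with states `S` over the atomic propositions `AP`. -/
structure Kripke (S : Type) (AP : Type u) where
  /-- The transition relation (not necessarily total). -/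
  trans : S → S → Prop
  /-- The labeling of states. -/
  label : S → Set AP

/-- `R` is a simulation; `R s s'` reads: `s'` simulates `s`. -/
def Kripke.IsSimulation {S : Type} {AP : Type u} (K : Kripke S AP) (R : S → S → Prop) : Prop :=
  ∀ s s', R s s' → K.label s = K.label s' ∧
    ∀ t, K.trans s t → ∃ t', K.trans s' t' ∧ R t t'

/-- The simulation preorder: the union of all simulations. -/
def Kripke.simPreorder {S : Type} {AP : Type u} (K : Kripke S AP) (s s' : S) : Prop :=
  ∃ R : S → S → Prop, K.IsSimulation R ∧ R s s'

/-- The simulation partition: the classes of simulation equivalence. -/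
def Kripke.simPartition {S : Type} {AP : Type u} (K : Kripke S AP) : Set (Set S) :=
  {B | ∃ s, B = {t | K.simPreorder s t ∧ K.simPreorder t s}}

/-- The number of transitions. -/
noncomputable def Kripke.numTrans {S : Type} {AP : Type u} (K : Kripke S AP) : ℕ :=
  Set.ncard {p : S × S | K.trans p.1 p.2}

/-! ### The machine: a unit-cost RAM with registers and resizable arrays

A program is a structured command over finitely many registers, and over finitely many named
tables.  A table is a resizable array of rows, and each row is a resizable array of numbers; the
capacity of a resizable array is doubled when an element is appended to a full one, and the elements
are then copied at unit cost each.  The input is a family of read-only lists. -/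

/-- The two read-only input tables. -/
inductive InTab
  /-- Row `s` lists the predecessors of state `s`. -/
  | pre
  /-- The rows list the states of the blocks of the initial partition. -/
  | part

/-- The read-only input. -/
abbrev Input := InTab → List (List ℕ)

/-- Registers. -/
inductive Reg
  | num | cur | B | C | D | s | x | y | d | i | j | k
  deriving DecidableEq

instance : Fintype Reg :=
  ⟨{.num, .cur, .B, .C, .D, .s, .x, .y, .d, .i, .j, .k}, fun r => by cases r <;> decide⟩

/-- Names of the tables in the working memory. -/
inductive Tab
  /-- Doubly linked lists of states: successor and predecessor links. -/
  | nxt | prv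
  /-- Pointer from a state to its block. -/
  | blk
  /-- The doubly linked list of blocks: successor and predecessor links. -/
  | bnxt | bprv
  /-- Boolean marks on blocks. -/
  | mark
  /-- The local lists of a round: the remove set, the states of the selected block, the blocks
  touched by a split, the blocks inside the remove set, the blocks with a transition to the selected
  block. -/
  | rs | bp | tl | rl | cl
  /-- Per block: the remove set, the array of transition counts, the row of the boolean matrix. -/
  | remv | cnt | rel
  deriving DecidableEq

instance : Fintype Tab :=
  ⟨{.nxt, .prv, .blk, .bnxt, .bprv, .mark, .rs, .bp, .tl, .rl, .cl, .remv, .cnt, .rel},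
    fun a => by cases a <;> decide⟩

/-- A resizable array. -/
structure Vec where
  /-- The elements. -/
  data : List ℕ
  /-- The number of allocated cells. -/
  cap : ℕ

/-- A resizable array of resizable arrays. -/
structure Table where
  /-- The rows. -/
  rows : List Vec
  /-- The number of allocated row slots. -/
  cap : ℕ

/-- The working memory. -/
structure Store where
  /-- Contents of the registers. -/
  reg : Reg → ℕ
  /-- Contents of the tables. -/
  tab : Tab → Table

/-- The empty array, without any allocated cell. -/
def Vec.empty : Vec := ⟨[], 0⟩

/-- In the beginning all registers are `0` and each table consists of a single empty row. -/
def Store.start : Store := ⟨fun _ => 0, fun _ => ⟨[Vec.empty], 1⟩⟩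

/-- The capacity after appending to a resizable array of length `len` and capacity `cap`. -/
def grow (len cap : ℕ) : ℕ := if len < cap then cap else max 1 (2 * cap)

/-- The cost of copying when appending to a resizable array of length `len` and capacity `cap`. -/
def growCost (len cap : ℕ) : ℕ := if len < cap then 0 else len

/-- Append an element. -/
def Vec.push (v : Vec) (a : ℕ) : Vec := ⟨v.data ++ [a], grow v.data.length v.cap⟩

/-- Row `r` of table `a`. -/
def Store.row (m : Store) (a : Tab) (r : ℕ) : Vec := (m.tab a).rows.getD r Vec.empty

/-- Replace row `r` of table `a` by its image under `f`. -/
def Store.modifyRow (m : Store) (a : Tab) (r : ℕ) (f : Vec → Vec) : Store :=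
  ⟨m.reg, Function.update m.tab a ⟨(m.tab a).rows.modify r f, (m.tab a).cap⟩⟩

/-- Expressions. -/
inductive Expr
  /-- A constant. -/
  | lit (c : ℕ)
  /-- The contents of a register. -/
  | reg (r : Reg)
  /-- Addition. -/
  | add (e f : Expr)
  /-- Truncated subtraction. -/
  | sub (e f : Expr)
  /-- Equality test. -/
  | eq (e f : Expr)
  /-- Comparison. -/
  | lt (e f : Expr)
  /-- The entry in a row (second argument) and a column (third argument) of a table. -/
  | get (a : Tab) (e f : Expr)
  /-- The length of a row. -/
  | len (a : Tab) (e : Expr)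
  /-- The number of rows of an input table. -/
  | inRows (a : InTab)
  /-- The length of a row of an input table. -/
  | inLen (a : InTab) (e : Expr)
  /-- An entry of an input table. -/
  | inGet (a : InTab) (e f : Expr)

/-- The value of an expression; a false test is `0`, a true one `1`. -/
def Expr.eval (inp : Input) (m : Store) : Expr → ℕ
  | .lit c => c
  | .reg r => m.reg r
  | .add e f => e.eval inp m + f.eval inp m
  | .sub e f => e.eval inp m - f.eval inp m
  | .eq e f => if e.eval inp m = f.eval inp m then 1 else 0
  | .lt e f => if e.eval inp m < f.eval inp m then 1 else 0
  | .get a e f => (m.row a (e.eval inp m)).data.getD (f.eval inp m) 0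
  | .len a e => (m.row a (e.eval inp m)).data.length
  | .inRows a => (inp a).length
  | .inLen a e => ((inp a).getD (e.eval inp m) []).length
  | .inGet a e f => ((inp a).getD (e.eval inp m) []).getD (f.eval inp m) 0

/-- The cost of evaluating an expression: one step for each operation in it. -/
def Expr.cost : Expr → ℕ
  | .lit _ | .reg _ | .inRows _ => 1
  | .add e f | .sub e f | .eq e f | .lt e f | .get _ e f | .inGet _ e f => e.cost + f.cost + 1
  | .len _ e | .inLen _ e => e.cost + 1

/-- Elementary commands. -/
inductive Op
  /-- Assign to a register. -/
  | set (r : Reg) (e : Expr)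
  /-- `put a e f g` writes the value of `g` into row `e`, column `f` of table `a`. -/
  | put (a : Tab) (e f g : Expr)
  /-- `push a e g` appends the value of `g` to row `e` of table `a`. -/
  | push (a : Tab) (e g : Expr)
  /-- `clear a e` makes row `e` of table `a` empty (and keeps its capacity). -/
  | clear (a : Tab) (e : Expr)
  /-- Append an empty row to a table. -/
  | newRow (a : Tab)

/-- The effect of an elementary command. -/
def Op.run (inp : Input) (m : Store) : Op → Store
  | .set r e => ⟨Function.update m.reg r (e.eval inp m), m.tab⟩
  | .put a e f g => m.modifyRow a (e.eval inp m)
      fun v => ⟨v.data.set (f.eval inp m) (g.eval inp m), v.cap⟩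
  | .push a e g => m.modifyRow a (e.eval inp m) fun v => v.push (g.eval inp m)
  | .clear a e => m.modifyRow a (e.eval inp m) fun v => ⟨[], v.cap⟩
  | .newRow a => ⟨m.reg, Function.update m.tab a
      ⟨(m.tab a).rows ++ [Vec.empty], grow (m.tab a).rows.length (m.tab a).cap⟩⟩

/-- The cost of an elementary command, including the copying of a full array. -/
def Op.cost (inp : Input) (m : Store) : Op → ℕ
  | .set _ e => e.cost + 1
  | .put _ e f g => e.cost + f.cost + g.cost + 1
  | .push a e g => e.cost + g.cost + 1 +
      growCost (m.row a (e.eval inp m)).data.length (m.row a (e.eval inp m)).cap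
  | .clear _ e => e.cost + 1
  | .newRow a => 1 + growCost (m.tab a).rows.length (m.tab a).cap

/-- The size of an array in bits: all its cells have the width of the largest number in it, and its
length and its capacity are stored along with it. -/
def Vec.bits (v : Vec) : ℕ :=
  v.cap * ((v.data.map Nat.size).foldr max 0 + 1) + Nat.size v.data.length + Nat.size v.cap + 1

/-- The size of a table in bits: the slots for references to the rows, and the rows. -/
def Table.bits (t : Table) : ℕ := t.cap * (Nat.size t.cap + 1) + (t.rows.map Vec.bits).sum

/-- The size of the working memory in bits. -/
def Store.bits (m : Store) : ℕ := ∑ r : Reg, (Nat.size (m.reg r) + 1) + ∑ a : Tab, (m.tab a).bits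

/-- Commands. -/
inductive Cmd
  /-- An elementary command. -/
  | op (o : Op)
  /-- Sequential composition. -/
  | seq (p q : Cmd)
  /-- Conditional. -/
  | ite (e : Expr) (p q : Cmd)
  /-- Loop as long as the value of the expression is not `0`. -/
  | while (e : Expr) (p : Cmd)

/-- `Exec inp p m t b m'`: on input `inp`, the command `p` started in the memory `m` halts after
`t` steps in the memory `m'`, and the largest size of the memory on the way is `b` bits. -/
inductive Exec (inp : Input) : Cmd → Store → ℕ → ℕ → Store → Prop
  | op (o : Op) (m : Store) :
      Exec inp (.op o) m (o.cost inp m) (max m.bits (o.run inp m).bits) (o.run inp m)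
  | seq {p q : Cmd} {m₁ m₂ m₃ : Store} {t t' b b' : ℕ} :
      Exec inp p m₁ t b m₂ → Exec inp q m₂ t' b' m₃ →
      Exec inp (.seq p q) m₁ (t + t') (max b b') m₃
  | iteTrue {e : Expr} {p q : Cmd} {m m' : Store} {t b : ℕ} :
      e.eval inp m ≠ 0 → Exec inp p m t b m' → Exec inp (.ite e p q) m (e.cost + 1 + t) b m'
  | iteFalse {e : Expr} {p q : Cmd} {m m' : Store} {t b : ℕ} :
      e.eval inp m = 0 → Exec inp q m t b m' → Exec inp (.ite e p q) m (e.cost + 1 + t) b m'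
  | whileTrue {e : Expr} {p : Cmd} {m₁ m₂ m₃ : Store} {t t' b b' : ℕ} :
      e.eval inp m₁ ≠ 0 → Exec inp p m₁ t b m₂ → Exec inp (.while e p) m₂ t' b' m₃ →
      Exec inp (.while e p) m₁ (e.cost + 1 + t + t') (max b b') m₃
  | whileFalse {e : Expr} {p : Cmd} {m : Store} :
      e.eval inp m = 0 → Exec inp (.while e p) m (e.cost + 1) m.bits m

/-! ### Abbreviations for writing programs -/

section

open Reg

instance (c : ℕ) : OfNat Expr c := ⟨.lit c⟩
instance : Add Expr := ⟨.add⟩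
instance : Sub Expr := ⟨.sub⟩
instance : Coe Reg Expr := ⟨.reg⟩

/-- The entry `e` of a one-dimensional array (the only row of its table). -/
def rd (a : Tab) (e : Expr) : Expr := .get a 0 e
/-- The length of a one-dimensional array. -/
def size (a : Tab) : Expr := .len a 0
/-- The number of states. -/
def nStates : Expr := .inRows .pre

infixr:60 " ;; " => Cmd.seq

/-- Assignment to a register. -/
def assign (r : Reg) (e : Expr) : Cmd := .op (.set r e)
/-- Write into a one-dimensional array. -/
def wr (a : Tab) (e f : Expr) : Cmd := .op (.put a 0 e f)
/-- Append to a one-dimensional array. -/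
def push (a : Tab) (e : Expr) : Cmd := .op (.push a 0 e)
/-- Make a one-dimensional array empty. -/
def erase (a : Tab) : Cmd := .op (.clear a 0)
/-- Write into a row. -/
def wr₂ (a : Tab) (r e f : Expr) : Cmd := .op (.put a r e f)
/-- Append to a row. -/
def push₂ (a : Tab) (r e : Expr) : Cmd := .op (.push a r e)
/-- Append an empty row. -/
def newRow (a : Tab) : Cmd := .op (.newRow a)
/-- A conditional without alternative. -/
def ifThen (e : Expr) (p : Cmd) : Cmd := .ite e p (.op (.set x x))
/-- A loop for `r = lo, …, hi - 1`. -/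
def forRange (r : Reg) (lo hi : Expr) (p : Cmd) : Cmd :=
  assign r lo ;; .while (.lt r hi) (p ;; assign r (r + 1))
/-- A loop for `r` in the circular linked list of states with header node `h`. -/
def forList (r : Reg) (h : Expr) (p : Cmd) : Cmd :=
  assign r (rd .nxt h) ;; .while (.eq (.eq r h) 0) (p ;; assign r (rd .nxt r))

/-! ### The simulation algorithm

Blocks are numbered `1, 2, …`, and the register `num` holds the next free number.  The states of a
block are kept in a circular doubly linked list; its header, a node of the arrays `nxt` and `prv`
that is not a state, holds the pointers to the first and to the last state of the block.  A second
header of the block is for the part of it that is being split off.  The blocks form a circular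
doubly linked list with header `0` in the arrays `bnxt` and `bprv`; in this list the blocks with
empty remove set come first, and the register `cur` points to the first block with nonempty remove
set (it is `0` when there is none). -/

/-- The header node of block `b`. -/
def hd (b : Expr) : Expr := nStates + b + b
/-- The header node of the part of block `b` that is being split off. -/
def hdI (b : Expr) : Expr := nStates + b + b + 1

/-- In the doubly linked list with links `f` and `g`, let `q` follow `p`. -/
def link (f g : Tab) (p q : Expr) : Cmd := wr f p q ;; wr g q p
/-- Take the node `p` out of its list. -/
def unlink (f g : Tab) (p : Expr) : Cmd := link f g (rd g p) (rd f p)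
/-- Insert the node `p` at the end of the list with header `h`. -/
def linkLast (f g : Tab) (h p : Expr) : Cmd := link f g (rd g h) p ;; link f g p h
/-- Insert the node `p` at the beginning of the list with header `h`. -/
def linkFirst (f g : Tab) (h p : Expr) : Cmd := link f g p (rd f h) ;; link f g h p

/-- Move the states of the nonempty list with header `h` to the empty list with header `h'`. -/
def moveList (h h' : Expr) : Cmd :=
  link .nxt .prv h' (rd .nxt h) ;; link .nxt .prv (rd .prv h) h' ;; link .nxt .prv h h

/-- Add block `b` at the end of the list of blocks. -/
def appendBlock (b : Expr) : Cmd :=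
  linkLast .bnxt .bprv 0 b ;; ifThen (.eq cur 0) (assign cur b)
/-- Add block `b` at the beginning of the list of blocks. -/
def prependBlock (b : Expr) : Cmd := linkFirst .bnxt .bprv 0 b
/-- Move block `b` to the end of the list of blocks. -/
def moveAtTheEnd (b : Expr) : Cmd := unlink .bnxt .bprv b ;; appendBlock b

/-- A new block record with number `num`. -/
def newRecord : Cmd :=
  push .nxt (hd num) ;; push .prv (hd num) ;; push .nxt (hdI num) ;; push .prv (hdI num) ;;
  push .bnxt num ;; push .bprv num ;; push .mark 0

/-- New rows for the remove set, the transition counts and the relation of block `num`. -/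
def newRows : Cmd := newRow .remv ;; newRow .cnt ;; newRow .rel

/-- Build the lists of states and the blocks of the initial partition. -/
def setupPartition : Cmd :=
  forRange s 0 nStates (push .nxt s ;; push .prv s ;; push .blk 0) ;;
  newRecord ;; assign num 1 ;;
  forRange i 0 (.inRows .part)
    (newRecord ;; newRows ;;
    forRange k 0 (.inLen .part i)
      (assign s (.inGet .part i k) ;; wr .blk s num ;; linkLast .nxt .prv (hd num) s) ;;
    assign num (num + 1))

/-- The initial relation is the identity relation on blocks. -/
def setupRel : Cmd :=
  forRange i 1 num (forRange j 0 num (push₂ .rel i (.eq i j)))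

/-- Count, for each block `C` and each state `x`, the transitions from `x` to the union of the
blocks related to `C`. -/
def setupCount : Cmd :=
  forRange i 1 num (forRange x 0 nStates (push₂ .cnt i 0)) ;;
  forRange B 1 num (forList y (hd B) (forRange k 0 (.inLen .pre y)
    (assign x (.inGet .pre y k) ;;
    forRange C 1 num (ifThen (.get .rel C B)
      (wr₂ .cnt C x (.get .cnt C x + 1))))))

/-- The initial remove set of a block consists of all the states without a transition to the union
of the blocks related to it. -/
def setupRemove : Cmd :=
  forRange B 1 num
    (forRange x 0 nStates (ifThen (.eq (.get .cnt B x) 0) (push₂ .remv B x)) ;;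
    .ite (.eq (.len .remv B) 0) (prependBlock B) (appendBlock B))

/-- Select the first block `B` with nonempty remove set, copy its remove set to `rs` and its states
to `bp`, and make its remove set empty. -/
def selectBlock : Cmd :=
  assign B cur ;; assign cur (rd .bnxt cur) ;;
  erase .rs ;; forRange k 0 (.len .remv B) (push .rs (.get .remv B k)) ;;
  .op (.clear .remv B) ;;
  erase .bp ;; forList s (hd B) (push .bp s)

/-- Turn the part of block `D` that has been split off into a new block, which inherits the remove
set, the relation and the transition counts of `D`. -/
def newBlock : Cmd :=
  newRecord ;; newRows ;;
  moveList (hdI D) (hd num) ;;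
  forList s (hd num) (wr .blk s num) ;;
  forRange j 0 (.len .remv D) (push₂ .remv num (.get .remv D j)) ;;
  .ite (.eq (.len .remv D) 0) (prependBlock num) (appendBlock num) ;;
  forRange j 1 num (push₂ .rel j (.get .rel j D)) ;;
  forRange j 0 (num + 1) (push₂ .rel num (.get .rel D j)) ;;
  forRange x 0 nStates (push₂ .cnt num (.get .cnt D x)) ;;
  assign num (num + 1)

/-- Split the partition with respect to the set of states `rs`. -/
def splitBlocks : Cmd :=
  erase .tl ;;
  forRange k 0 (size .rs)
    (assign s (rd .rs k) ;; assign D (rd .blk s) ;;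
    ifThen (.eq (rd .nxt (hdI D)) (hdI D)) (push .tl D) ;;
    unlink .nxt .prv s ;; linkLast .nxt .prv (hdI D) s) ;;
  forRange k 0 (size .tl)
    (assign D (rd .tl k) ;;
    .ite (.eq (rd .nxt (hd D)) (hd D)) (moveList (hdI D) (hd D)) newBlock)

/-- Add block `b` to the list `l` unless it is marked, and mark it. -/
def collect (l : Tab) (b : Expr) : Cmd :=
  ifThen (.eq (rd .mark b) 0) (wr .mark b 1 ;; push l b)

/-- Remove the marks from the blocks in the list `l`. -/
def unmark (l : Tab) : Cmd := forRange k 0 (size l) (wr .mark (rd l k) 0)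

/-- List in `rl` the blocks contained in `rs`. -/
def removeList : Cmd :=
  erase .rl ;; forRange k 0 (size .rs) (collect .rl (rd .blk (rd .rs k))) ;; unmark .rl

/-- List in `cl` the blocks that have a transition to some state in `bp`. -/
def predList : Cmd :=
  erase .cl ;;
  forRange k 0 (size .bp)
    (assign y (rd .bp k) ;;
    forRange j 0 (.inLen .pre y) (collect .cl (rd .blk (.inGet .pre y j)))) ;;
  unmark .cl

/-- Remove the blocks `D` in `rl` from the relation of the blocks `C` in `cl`, and update transition
counts and remove sets. -/
def refineRel : Cmd :=
  forRange i 0 (size .cl) (assign C (rd .cl i) ;;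
    forRange j 0 (size .rl) (assign D (rd .rl j) ;;
      ifThen (.get .rel C D)
        (wr₂ .rel C D 0 ;;
        forList d (hd D) (forRange k 0 (.inLen .pre d)
          (assign x (.inGet .pre d k) ;;
          wr₂ .cnt C x (.get .cnt C x - 1) ;;
          ifThen (.eq (.get .cnt C x) 0)
            (ifThen (.eq (.len .remv C) 0) (moveAtTheEnd C) ;; push₂ .remv C x))))))

/-- The simulation algorithm. -/
def SA : Cmd :=
  setupPartition ;; setupRel ;; setupCount ;; setupRemove ;;
  .while cur (selectBlock ;; splitBlocks ;; removeList ;; predList ;; refineRel)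

end

/-! ### The input of the algorithm -/

/-- The input represents the Kripke structure `K`: row `s` of the first table lists the predecessors
of `s`, and the rows of the second table list the classes of the states with equal labels, all in any
order and without repetitions. -/
def Represents {n : ℕ} {AP : Type u} (inp : Input) (K : Kripke (Fin n) AP) : Prop :=
  ((inp .pre).length = n ∧
    ∀ (s : Fin n) (l : List ℕ), (inp .pre)[(s : ℕ)]? = some l →
      l.Nodup ∧ ∀ a : ℕ, a ∈ l ↔ ∃ r : Fin n, (r : ℕ) = a ∧ K.trans r s) ∧
  ((inp .part).Nodup ∧
    (∀ l ∈ inp .part, l.Nodup ∧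
      ∃ s : Fin n, ∀ a : ℕ, a ∈ l ↔ ∃ r : Fin n, (r : ℕ) = a ∧ K.label r = K.label s) ∧
    ∀ s : Fin n, ∃! l, l ∈ inp .part ∧ (s : ℕ) ∈ l)

end SimAlg

namespace SimAlg

/-! ### Abstract memories: the working memory without capacities -/

/-! Time. The blocks never separate two simulation equivalent states, so there are at most |P_sim|
of them at any moment. This needs the invariant `Good`: the relation is closed upwards under
simulation in its second argument, the remove set of a block is closed under simulation equivalence
and contains no predecessor of a related state, and (`cover`) if x → y and x' is related to x, then
x' has a transition to a state related to y, or x' lies in the remove set of y. `Step` describes a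
round in terms of states only, and `Step.good` shows that a round preserves the invariant; the
decisive point is `Step.R_up`, which uses `cover`.

Call a pair (s, x) live if x has a transition to a state related to s, or lies in the remove set of
s. A round for a block B kills all pairs of a state of B and a state of the remove set
(`Step.not_live`), and dead pairs stay dead (`Step.live_sub`). Hence the work of a round can be
charged to the decrease of three potentials, in which one coordinate ranges over representatives of
the simulation classes: `pot₁` pays for listing the predecessors of B and for visiting the pairs of
a block C with a transition to B and a block D inside the remove set; `pot₂` pays for everything
that is linear in the remove set, in particular for the moves of states during a split; `pot₃` pays
for scanning the predecessors of D when D is removed from the relation of C. Each potential is at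
most |P_sim| times the sum of the weights `wt`, and this sum is the number of states plus the number
of transitions. Creating a block costs O(n), since rows are copied, and happens fewer than |P_sim|
times. The lemmas `wp_round`, `wp_loop` and `wp_SA` add this up.

The program. The linked lists, counts and matrix rows are shown to realize `Step` by means of
weakest preconditions `WP` over memories without capacities. Syntactic frames (`Frame`) take care of
whatever a command does not touch; `Circ`, `StateLists`, `BlockInv`, `Core`, `CountsOk` and `Ready`
are the data structure invariants. Capacities come back in `AExec.sound`: the doubling of an array
creates at least as many cells as elements are copied, so that all the copying together costs no
more than the final number of cells.

Space. There is a fixed number of tables, each with at most |P_sim| + 1 rows, and no append is made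
to a row longer than 3n + 1; this leaves O(|P_sim| n) cells. A number in the memory grows by O(1)
per step, so it is at most n plus twice the elapsed time plus one (`Exec.tame`). The time is
polynomial in n, therefore O(log n) bits per cell suffice (`bitBound_le`). -/

/-- The working memory without the capacities of its arrays. -/
@[ext] structure Mem where
  /-- Contents of the registers. -/
  reg : Reg → ℕ
  /-- Number of rows of a table. -/
  nr : Tab → ℕ
  /-- Contents of a row of a table. -/
  row : Tab → ℕ → List ℕ

/-- An entry of a table. -/
def Mem.get (μ : Mem) (a : Tab) (r i : ℕ) : ℕ := (μ.row a r).getD i 0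
/-- Overwrite a register. -/
def Mem.setReg (μ : Mem) (r : Reg) (v : ℕ) : Mem := ⟨Function.update μ.reg r v, μ.nr, μ.row⟩
/-- Overwrite a row. -/
def Mem.setRow (μ : Mem) (a : Tab) (r : ℕ) (l : List ℕ) : Mem :=
  ⟨μ.reg, μ.nr, Function.update μ.row a (Function.update (μ.row a) r l)⟩
/-- Append an empty row to a table. -/
def Mem.addRow (μ : Mem) (a : Tab) : Mem :=
  ⟨μ.reg, Function.update μ.nr a (μ.nr a + 1), μ.row⟩

/-- The value of an expression in an abstract memory. -/
def Expr.ev (inp : Input) (μ : Mem) : Expr → ℕ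
  | .lit c => c
  | .reg r => μ.reg r
  | .add e f => e.ev inp μ + f.ev inp μ
  | .sub e f => e.ev inp μ - f.ev inp μ
  | .eq e f => if e.ev inp μ = f.ev inp μ then 1 else 0
  | .lt e f => if e.ev inp μ < f.ev inp μ then 1 else 0
  | .get a e f => μ.get a (e.ev inp μ) (f.ev inp μ)
  | .len a e => (μ.row a (e.ev inp μ)).length
  | .inRows a => (inp a).length
  | .inLen a e => ((inp a).getD (e.ev inp μ) []).length
  | .inGet a e f => ((inp a).getD (e.ev inp μ) []).getD (f.ev inp μ) 0

/-- The effect of an elementary command on an abstract memory. -/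
def Op.arun (inp : Input) (μ : Mem) : Op → Mem
  | .set r e => μ.setReg r (e.ev inp μ)
  | .put a e f g => μ.setRow a (e.ev inp μ)
      ((μ.row a (e.ev inp μ)).set (f.ev inp μ) (g.ev inp μ))
  | .push a e g => μ.setRow a (e.ev inp μ) (μ.row a (e.ev inp μ) ++ [g.ev inp μ])
  | .clear a e => μ.setRow a (e.ev inp μ) []
  | .newRow a => μ.addRow a

/-- An elementary command appends only to existing rows of length at most `N`. -/
def Op.Legal (inp : Input) (N : ℕ) (μ : Mem) : Op → Prop
  | .push a e _ => e.ev inp μ < μ.nr a ∧ (μ.row a (e.ev inp μ)).length ≤ N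
  | _ => True

/-- `AExec inp N p μ k μ'`: the command `p` started in the abstract memory `μ` halts after `k`
elementary commands and tests in `μ'`, and appends only to rows of length at most `N`. -/
inductive AExec (inp : Input) (N : ℕ) : Cmd → Mem → ℕ → Mem → Prop
  | op (o : Op) (μ : Mem) : o.Legal inp N μ → AExec inp N (.op o) μ 1 (o.arun inp μ)
  | seq {p q : Cmd} {μ₁ μ₂ μ₃ : Mem} {t t' : ℕ} :
      AExec inp N p μ₁ t μ₂ → AExec inp N q μ₂ t' μ₃ → AExec inp N (.seq p q) μ₁ (t + t') μ₃
  | iteTrue {e : Expr} {p q : Cmd} {μ μ' : Mem} {t : ℕ} :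
      e.ev inp μ ≠ 0 → AExec inp N p μ t μ' → AExec inp N (.ite e p q) μ (1 + t) μ'
  | iteFalse {e : Expr} {p q : Cmd} {μ μ' : Mem} {t : ℕ} :
      e.ev inp μ = 0 → AExec inp N q μ t μ' → AExec inp N (.ite e p q) μ (1 + t) μ'
  | whileTrue {e : Expr} {p : Cmd} {μ₁ μ₂ μ₃ : Mem} {t t' : ℕ} :
      e.ev inp μ₁ ≠ 0 → AExec inp N p μ₁ t μ₂ → AExec inp N (.while e p) μ₂ t' μ₃ →
      AExec inp N (.while e p) μ₁ (1 + t + t') μ₃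
  | whileFalse {e : Expr} {p : Cmd} {μ : Mem} :
      e.ev inp μ = 0 → AExec inp N (.while e p) μ 1 μ

/-- `m` is `μ` with capacities. -/
structure Abs (m : Store) (μ : Mem) : Prop where
  reg : m.reg = μ.reg
  nr : ∀ a, (m.tab a).rows.length = μ.nr a
  row : ∀ a r, (m.row a r).data = μ.row a r

theorem Abs.eval {m : Store} {μ : Mem} (h : Abs m μ) (inp : Input) (e : Expr) :
    e.eval inp m = e.ev inp μ := by
  induction e <;> simp_all [Expr.eval, Expr.ev, Mem.get, h.reg, h.row]

/-! ### Capacities -/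

/-- The number of cells of a table. -/
def Table.cells (t : Table) : ℕ := t.cap + (t.rows.map Vec.cap).sum
/-- The number of cells of the working memory. -/
def Store.cells (m : Store) : ℕ := ∑ a : Tab, (m.tab a).cells

/-- The old and the new summand stand on opposite sides in order to avoid truncated subtraction.
Serves the bookkeeping of cells when a single table changes. -/
theorem sum_update_add {ι : Type*} [Fintype ι] [DecidableEq ι] {β : Type*} (g : ι → β) (a : ι)
    (x : β) (f : β → ℕ) :
    ∑ i, f (Function.update g a x i) + f (g a) = ∑ i, f (g i) + f x := by
  rw [← Finset.add_sum_erase _ _ (Finset.mem_univ a),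
    ← Finset.add_sum_erase (f := fun i => f (g i)) (h := Finset.mem_univ a)]
  have : ∑ i ∈ Finset.univ.erase a, f (Function.update g a x i)
      = ∑ i ∈ Finset.univ.erase a, f (g i) := by
    refine Finset.sum_congr rfl fun i hi => ?_
    rw [Function.update_of_ne (Finset.ne_of_mem_erase hi)]
  rw [this, Function.update_self]; ring

theorem sum_modify_add (l : List Vec) (r : ℕ) (f : Vec → Vec) (g : Vec → ℕ) (h : r < l.length) :
    ((l.modify r f).map g).sum + g (l.getD r Vec.empty)
      = (l.map g).sum + g (f (l.getD r Vec.empty)) := by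
  induction l generalizing r with
  | nil => simp at h
  | cons v l ih =>
    cases r with
    | zero => simp; ring
    | succ r =>
      have := ih r (by simpa using h)
      simp at this ⊢
      omega

theorem modify_of_length_le {α : Type*} (l : List α) (r : ℕ) (f : α → α) (h : l.length ≤ r) :
    l.modify r f = l := by
  induction l generalizing r with
  | nil => simp
  | cons v l ih =>
    cases r with
    | zero => simp at h
    | succ r => simp [ih r (by simpa using h)]

/-- Outside the list `modify` does nothing, whereas the right-hand side applies `f` to the default
row. The two agree when `f` fixes the empty row, as writing and clearing do; appending needs an
existing row. -/
theorem getD_modify (l : List Vec) (r r' : ℕ) (f : Vec → Vec) (hf : r < l.length ∨ f Vec.empty = Vec.empty) :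
    (l.modify r f).getD r' Vec.empty =
      if r' = r then f (l.getD r Vec.empty) else l.getD r' Vec.empty := by
  induction l generalizing r r' with
  | nil => by_cases h : r' = r <;> simp_all
  | cons v l ih =>
    cases r with
    | zero => cases r' <;> simp
    | succ r =>
      cases r' with
      | zero => simp
      | succ r' =>
        have := ih r r' (by simpa using hf)
        simpa using this

/-- Every array fits into its capacity, and the capacities are at most twice the largest length
`N` that is allowed before an append. -/
def Table.Fits (N : ℕ) (t : Table) : Prop :=
  t.rows.length ≤ t.cap ∧ t.cap ≤ 2 * t.rows.length ∧
    ∀ v ∈ t.rows, v.data.length ≤ v.cap ∧ v.cap ≤ 2 * N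

theorem mem_modify {l : List Vec} {r : ℕ} {f : Vec → Vec} {v : Vec} (h : v ∈ l.modify r f) :
    v ∈ l ∨ (r < l.length ∧ v = f (l.getD r Vec.empty)) := by
  induction l generalizing r with
  | nil => simp at h
  | cons w l ih =>
    cases r with
    | zero => simp at h ⊢; tauto
    | succ r =>
      simp at h
      rcases h with h | h
      · simp [h]
      · rcases ih h with h | h
        · simp [h]
        · right; simpa using h

/-- An array that does not have room left has `len = cap`, so doubling adds at least `len` cells,
which pay for the copying. The last clause keeps the capacity within twice the length before the
append. -/
theorem le_grow {len cap : ℕ} (h : len ≤ cap) : len + 1 ≤ grow len cap ∧ cap ≤ grow len cap ∧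
    growCost len cap + cap ≤ grow len cap ∧ (grow len cap = cap ∨ grow len cap ≤ max 1 (2 * len)) := by
  unfold grow growCost
  split_ifs <;> omega

/-- The cost of an elementary command apart from copying. -/
def Op.exprCost : Op → ℕ
  | .set _ e => e.cost + 1
  | .put _ e f g => e.cost + f.cost + g.cost + 1
  | .push _ e g => e.cost + g.cost + 1
  | .clear _ e => e.cost + 1
  | .newRow _ => 1

/-- Every elementary command and every test costs at most `c`, apart from copying. -/
def Cmd.CostLE (c : ℕ) : Cmd → Bool
  | .op o => decide (o.exprCost ≤ c)
  | .seq p q => p.CostLE c && q.CostLE c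
  | .ite e p q => decide (e.cost + 1 ≤ c) && (p.CostLE c && q.CostLE c)
  | .while e p => decide (e.cost + 1 ≤ c) && p.CostLE c

theorem row_modifyRow (m : Store) (a : Tab) (r : ℕ) (f : Vec → Vec) (a' : Tab) (r' : ℕ)
    (hf : r < (m.tab a).rows.length ∨ f Vec.empty = Vec.empty) :
    (m.modifyRow a r f).row a' r' = if a' = a ∧ r' = r then f (m.row a r) else m.row a' r' := by
  unfold Store.row Store.modifyRow
  by_cases h : a' = a
  · subst h
    simp only [Function.update_self]
    rw [getD_modify _ _ _ _ hf]
    by_cases h2 : r' = r <;> simp [h2]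
  · simp [h]

theorem abs_modifyRow {m : Store} {μ : Mem} (h : Abs m μ) (a : Tab) (r : ℕ) (f : Vec → Vec)
    (hf : r < (m.tab a).rows.length ∨ f Vec.empty = Vec.empty) (l : List ℕ)
    (hl : (f (m.row a r)).data = l) : Abs (m.modifyRow a r f) (μ.setRow a r l) := by
  refine ⟨h.reg, fun a' => ?_, fun a' r' => ?_⟩
  · by_cases ha : a' = a
    · subst ha; simp [Store.modifyRow, Mem.setRow, h.nr]
    · simp [Store.modifyRow, Mem.setRow, ha, h.nr]
  · rw [row_modifyRow _ _ _ _ _ _ hf]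
    by_cases ha : a' = a
    · subst ha
      by_cases hr : r' = r
      · subst hr; simp [Mem.setRow, hl]
      · simp [Mem.setRow, hr, h.row]
    · simp [Mem.setRow, ha, h.row]

theorem fits_modifyRow {m : Store} {N : ℕ} (h : ∀ a, (m.tab a).Fits N) (a : Tab) (r : ℕ)
    (f : Vec → Vec)
    (hf : r < (m.tab a).rows.length → (f (m.row a r)).data.length ≤ (f (m.row a r)).cap ∧
      (f (m.row a r)).cap ≤ 2 * N) (a' : Tab) :
    ((m.modifyRow a r f).tab a').Fits N := by
  by_cases ha : a' = a
  · subst ha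
    obtain ⟨h1, h2, h3⟩ := h a'
    simp only [Store.modifyRow, Function.update_self]
    refine ⟨by simpa using h1, by simpa using h2, fun v hv => ?_⟩
    rcases mem_modify hv with hv | ⟨hr, rfl⟩
    · exact h3 v hv
    · exact hf hr
  · simpa [Store.modifyRow, ha] using h a'

theorem cells_modifyRow (m : Store) (a : Tab) (r : ℕ) (f : Vec → Vec) :
    (r < (m.tab a).rows.length ∧
      (m.modifyRow a r f).cells + (m.row a r).cap = m.cells + (f (m.row a r)).cap) ∨
    ((m.tab a).rows.length ≤ r ∧ (m.modifyRow a r f).cells = m.cells) := by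
  have h1 := sum_update_add m.tab a
    (⟨(m.tab a).rows.modify r f, (m.tab a).cap⟩ : Table) Table.cells
  by_cases hr : r < (m.tab a).rows.length
  · left
    refine ⟨hr, ?_⟩
    have h2 := sum_modify_add (m.tab a).rows r f Vec.cap hr
    simp only [Store.cells, Store.modifyRow, Store.row, Table.cells] at h1 h2 ⊢
    omega
  · right
    refine ⟨by omega, ?_⟩
    simp only [Store.cells, Store.modifyRow, Table.cells] at h1 ⊢
    rw [modify_of_length_le _ _ _ (by omega)] at h1 ⊢
    omega

theorem row_mem {m : Store} {a : Tab} {r : ℕ} (h : r < (m.tab a).rows.length) :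
    m.row a r ∈ (m.tab a).rows := by
  unfold Store.row
  rw [List.getD_eq_getElem _ _ h]; exact List.getElem_mem h

/-- The amortization for one command: the cost of copying reappears on the right as an increase of
`cells`. Legality matters for appends only, because a store ignores an append to a missing row and
an abstract memory does not. -/
theorem Op.run_sound {inp : Input} {N : ℕ} (hN : 1 ≤ N) {m : Store} {μ : Mem} (h : Abs m μ)
    (hm : ∀ a, (m.tab a).Fits N) (o : Op) (ho : o.Legal inp N μ) :
    Abs (o.run inp m) (o.arun inp μ) ∧ (∀ a, ((o.run inp m).tab a).Fits N) ∧
      o.cost inp m + m.cells ≤ o.exprCost + (o.run inp m).cells := by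
  cases o with
  | set r e =>
    refine ⟨⟨?_, h.nr, h.row⟩, hm, le_rfl⟩
    simp [Op.run, Op.arun, Mem.setReg, h.eval, h.reg]
  | put a e f g =>
    refine ⟨?_, ?_, ?_⟩
    · simp only [Op.run, Op.arun]
      rw [← h.eval]
      refine abs_modifyRow h _ _ _ (Or.inr (by simp [Vec.empty])) _ ?_
      simp [h.eval, h.row]
    · refine fits_modifyRow hm _ _ _ fun hr => ?_
      simpa using (hm a).2.2 _ (row_mem hr)
    · simp only [Op.run, Op.cost, Op.exprCost]
      rcases cells_modifyRow m a (e.eval inp m)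
        (fun v => ⟨v.data.set (f.eval inp m) (g.eval inp m), v.cap⟩) with h1 | h1
      · simp only at h1; omega
      · omega
  | push a e g =>
    obtain ⟨h1, h2⟩ := ho
    have hr : e.eval inp m < (m.tab a).rows.length := by rwa [h.eval, h.nr]
    obtain ⟨h3, h4⟩ := (hm a).2.2 _ (row_mem hr)
    rw [← h.eval, ← h.row] at h2
    obtain ⟨g1, g2, g3, g4⟩ := le_grow h3
    refine ⟨?_, ?_, ?_⟩
    · simp only [Op.run, Op.arun]
      rw [← h.eval]
      refine abs_modifyRow h _ _ _ (Or.inl hr) _ ?_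
      simp [h.eval, h.row, Vec.push]
    · refine fits_modifyRow hm _ _ _ fun _ => ?_
      simp only [Vec.push, List.length_append, List.length_singleton]
      omega
    · simp only [Op.run, Op.cost, Op.exprCost]
      rcases cells_modifyRow m a (e.eval inp m) (fun v => v.push (g.eval inp m)) with h5 | h5
      · simp only [Vec.push] at h5 ⊢; omega
      · omega
  | clear a e =>
    refine ⟨?_, ?_, ?_⟩
    · simp only [Op.run, Op.arun]
      rw [← h.eval]
      exact abs_modifyRow h _ _ _ (Or.inr (by simp [Vec.empty])) _ rfl
    · refine fits_modifyRow hm _ _ _ fun hr => ?_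
      have := (hm a).2.2 _ (row_mem hr)
      simp; omega
    · simp only [Op.run, Op.cost, Op.exprCost]
      rcases cells_modifyRow m a (e.eval inp m) (fun v => ⟨[], v.cap⟩) with h1 | h1
      · simp only at h1; omega
      · omega
  | newRow a =>
    obtain ⟨h1, h2, h3⟩ := hm a
    obtain ⟨g1, g2, g3, g4⟩ := le_grow h1
    refine ⟨⟨h.reg, fun a' => ?_, fun a' r' => ?_⟩, fun a' => ?_, ?_⟩
    · by_cases ha : a' = a
      · subst ha; simp [Op.run, Op.arun, Mem.addRow, h.nr]
      · simp [Op.run, Op.arun, Mem.addRow, h.nr, ha]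
    -- Missing rows are read as empty, so a new empty row is invisible except in `nr`.
    · rw [show (Op.arun inp μ (.newRow a)).row a' r' = μ.row a' r' from rfl, ← h.row]
      by_cases ha : a' = a
      · subst ha
        simp only [Op.run, Store.row, Function.update_self]
        by_cases hr : r' < (m.tab a').rows.length
        · rw [List.getD_append _ _ _ _ hr]
        · rw [List.getD_append_right _ _ _ _ (by omega), List.getD_eq_default _ _ (n := r') (by omega)]
          cases r' - (m.tab a').rows.length <;> simp
      · simp [Op.run, Store.row, ha]
    · by_cases ha : a' = a
      · subst ha
        simp only [Op.run, Function.update_self]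
        refine ⟨by simp; omega, by simp; omega, fun v hv => ?_⟩
        rcases List.mem_append.1 hv with hv | hv
        · exact h3 v hv
        · simp at hv; subst hv; simp [Vec.empty]
      · simpa [Op.run, ha] using hm a'
    · have h5 := sum_update_add m.tab a
        (⟨(m.tab a).rows ++ [Vec.empty], grow (m.tab a).rows.length (m.tab a).cap⟩ : Table)
        Table.cells
      simp only [Op.run, Op.cost, Op.exprCost, Store.cells, Table.cells, List.map_append,
        List.sum_append] at h5 ⊢
      simp [Vec.empty] at h5 ⊢
      omega

/-- An execution without capacities can be refined to one with capacities; copying is paid for by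
the new cells. -/
theorem AExec.sound {inp : Input} {N : ℕ} (hN : 1 ≤ N) {c : ℕ} {p : Cmd} {μ μ' : Mem} {k : ℕ}
    (hx : AExec inp N p μ k μ') (hc : p.CostLE c = true) (m : Store) (h : Abs m μ)
    (hm : ∀ a, (m.tab a).Fits N) :
    ∃ t b m', Exec inp p m t b m' ∧ Abs m' μ' ∧ (∀ a, (m'.tab a).Fits N) ∧
      t + m.cells ≤ c * k + m'.cells := by
  induction hx generalizing m with
  | op o μ ho =>
    obtain ⟨h1, h2, h3⟩ := Op.run_sound hN h hm o ho
    simp only [Cmd.CostLE, decide_eq_true_eq] at hc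
    exact ⟨_, _, _, Exec.op o m, h1, h2, by omega⟩
  | seq hp hq ihp ihq =>
    simp only [Cmd.CostLE, Bool.and_eq_true] at hc
    obtain ⟨t, b, m', h1, h2, h3, h4⟩ := ihp hc.1 m h hm
    obtain ⟨t', b', m'', g1, g2, g3, g4⟩ := ihq hc.2 m' h2 h3
    exact ⟨_, _, _, Exec.seq h1 g1, g2, g3, by rw [mul_add]; omega⟩
  | iteTrue he hp ih =>
    simp only [Cmd.CostLE, Bool.and_eq_true, decide_eq_true_eq] at hc
    obtain ⟨t, b, m', h1, h2, h3, h4⟩ := ih hc.2.1 m h hm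
    exact ⟨_, _, _, Exec.iteTrue (by rwa [h.eval]) h1, h2, h3, by rw [mul_add]; omega⟩
  | iteFalse he hp ih =>
    simp only [Cmd.CostLE, Bool.and_eq_true, decide_eq_true_eq] at hc
    obtain ⟨t, b, m', h1, h2, h3, h4⟩ := ih hc.2.2 m h hm
    exact ⟨_, _, _, Exec.iteFalse (by rwa [h.eval]) h1, h2, h3, by rw [mul_add]; omega⟩
  | whileTrue he hp hq ihp ihq =>
    have hc' := hc
    simp only [Cmd.CostLE, Bool.and_eq_true, decide_eq_true_eq] at hc
    obtain ⟨t, b, m', h1, h2, h3, h4⟩ := ihp hc.2 m h hm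
    obtain ⟨t', b', m'', g1, g2, g3, g4⟩ := ihq hc' m' h2 h3
    exact ⟨_, _, _, Exec.whileTrue (by rwa [h.eval]) h1 g1, g2, g3, by
      rw [mul_add, mul_add]; omega⟩
  | whileFalse he =>
    simp only [Cmd.CostLE, Bool.and_eq_true, decide_eq_true_eq] at hc
    exact ⟨_, _, _, Exec.whileFalse (by rwa [h.eval]), h, hm, by omega⟩

/-- The expressions are fixed by the program text, so a constant bound is a matter of evaluation. -/
theorem SA_costLE : SA.CostLE 40 = true := by decide

/-! ### Growth of the numbers in the memory -/

/-- Registers that hold nodes of linked lists of states; the other ones hold block numbers and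
counters. -/
def Reg.isNode : Reg → Bool
  | .s | .x | .y | .d => true
  | _ => false

/-- Tables that hold nodes of linked lists of states. -/
def Tab.isNode : Tab → Bool
  | .nxt | .prv | .rs | .bp | .remv => true
  | _ => false

/-- The value is at most the time. -/
def Expr.isLow : Expr → Bool
  | .lit c => decide (c ≤ 1)
  | .reg r => !r.isNode
  | .get a _ _ => !a.isNode
  | .sub e _ => e.isLow
  | .eq _ _ | .lt _ _ => true
  | _ => false

/-- The value is at most the time plus one. -/
def Expr.isLowSucc : Expr → Bool
  | .add e (.lit 1) => e.isLow
  | e => e.isLow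

/-- The value is at most the number of states plus twice the time. -/
def Expr.isMid : Expr → Bool
  | .reg _ | .get _ _ _ | .inGet _ _ _ => true
  | .add (.add (.inRows .pre) b) b' => b.isLow && b'.isLow
  | e => e.isLow

/-- The value is at most the number of states plus twice the time plus one. -/
def Expr.isMidSucc : Expr → Bool
  | .add e (.lit 1) => e.isMid
  | e => e.isMid

/-- The command keeps the bounds on the numbers in the memory. -/
def Op.isTame : Op → Bool
  | .set r e => if r.isNode then e.isMidSucc else e.isLowSucc
  | .put a _ _ g | .push a _ g => if a.isNode then g.isMidSucc else g.isLowSucc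
  | _ => true

/-- All elementary commands keep the bounds on the numbers in the memory. -/
def Cmd.isTame : Cmd → Bool
  | .op o => o.isTame
  | .seq p q | .ite _ p q => p.isTame && q.isTame
  | .while _ p => p.isTame

/-- A syntactic check: stored numbers are read from the memory or the input, raised by one, lowered,
or computed as a header node from a block number. This is all that is needed for slow growth. -/
theorem SA_isTame : SA.isTame = true := by decide

/-- The numbers in the memory are bounded: block numbers and counters by `T`, nodes of lists of
states by `n + 2 * T + 1`. -/
structure Store.Tame (n T : ℕ) (m : Store) : Prop where
  reg : ∀ r, m.reg r ≤ if r.isNode then n + 2 * T + 1 else T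
  tab : ∀ a, ∀ v ∈ (m.tab a).rows, ∀ z ∈ v.data, z ≤ if a.isNode then n + 2 * T + 1 else T
  rows : ∀ a, (m.tab a).rows.length ≤ (m.tab a).cap
  data : ∀ a, ∀ v ∈ (m.tab a).rows, v.data.length ≤ v.cap

theorem Store.Tame.mono {n T T' : ℕ} {m : Store} (h : m.Tame n T) (hT : T ≤ T') : m.Tame n T' := by
  refine ⟨fun r => (h.reg r).trans ?_, fun a v hv z hz => (h.tab a v hv z hz).trans ?_, h.rows,
    h.data⟩ <;> split_ifs <;> omega

theorem Store.Tame.get {n T : ℕ} {m : Store} (h : m.Tame n T) (a : Tab) (r i : ℕ) :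
    (m.row a r).data.getD i 0 ≤ if a.isNode then n + 2 * T + 1 else T := by
  unfold Store.row
  by_cases hr : r < (m.tab a).rows.length
  · rw [List.getD_eq_getElem _ _ hr]
    by_cases hi : i < ((m.tab a).rows[r]).data.length
    · rw [List.getD_eq_getElem _ _ hi]
      exact h.tab a _ (List.getElem_mem hr) _ (List.getElem_mem hi)
    · rw [List.getD_eq_default _ _ (by omega)]; exact Nat.zero_le _
  · rw [List.getD_eq_default (m.tab a).rows _ (by omega)]; simp [Vec.empty]

/-- The hypothesis `1 ≤ T` covers the literals and the results of tests; for this reason the clock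
starts at `1` below. -/
theorem Store.Tame.low {n T : ℕ} {m : Store} (h : m.Tame n T) (hT : 1 ≤ T) (inp : Input)
    (e : Expr) (he : e.isLow = true) : e.eval inp m ≤ T := by
  induction e with
  | lit c => simp [Expr.isLow] at he; simp [Expr.eval]; omega
  | reg r => exact (h.reg r).trans (by simp_all [Expr.isLow])
  | add => simp [Expr.isLow] at he
  | sub e f ih _ => have := ih (by simpa [Expr.isLow] using he); simp only [Expr.eval]; omega
  | eq => simp only [Expr.eval]; split_ifs <;> omega
  | lt => simp only [Expr.eval]; split_ifs <;> omega
  | get a e f => exact (h.get a _ _).trans (by simp_all [Expr.isLow])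
  | len => simp [Expr.isLow] at he
  | inRows => simp [Expr.isLow] at he
  | inLen => simp [Expr.isLow] at he
  | inGet => simp [Expr.isLow] at he

theorem Store.Tame.lowSucc {n T : ℕ} {m : Store} (h : m.Tame n T) (hT : 1 ≤ T) (inp : Input)
    (e : Expr) (he : e.isLowSucc = true) : e.eval inp m ≤ T + 1 := by
  unfold Expr.isLowSucc at he
  split at he
  · have := h.low hT inp _ he; simp only [Expr.eval]; omega
  · have := h.low hT inp _ he; omega

theorem Store.Tame.mid {n T : ℕ} {m : Store} (h : m.Tame n T) (hT : 1 ≤ T) {inp : Input}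
    (hn : (inp .pre).length ≤ n) (hi : ∀ a, ∀ l ∈ inp a, ∀ z ∈ l, z ≤ n)
    (e : Expr) (he : e.isMid = true) : e.eval inp m ≤ n + 2 * T + 1 := by
  unfold Expr.isMid at he
  split at he
  · exact (h.reg _).trans (by split_ifs <;> omega)
  · exact (h.get _ _ _).trans (by split_ifs <;> omega)
  · rename_i a e f
    simp only [Expr.eval]
    by_cases hr : e.eval inp m < (inp a).length
    · rw [List.getD_eq_getElem (inp a) _ hr]
      by_cases hj : f.eval inp m < ((inp a)[e.eval inp m]).length
      · rw [List.getD_eq_getElem _ _ hj]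
        have := hi a _ (List.getElem_mem hr) _ (List.getElem_mem hj)
        omega
      · rw [List.getD_eq_default _ _ (by omega)]; omega
    · rw [List.getD_eq_default (inp a) _ (by omega)]; simp
  · simp only [Bool.and_eq_true] at he
    have h1 := h.low hT inp _ he.1
    have h2 := h.low hT inp _ he.2
    simp only [Expr.eval]; omega
  · have := h.low hT inp _ he; omega

theorem Store.Tame.midSucc {n T : ℕ} {m : Store} (h : m.Tame n T) (hT : 1 ≤ T) {inp : Input}
    (hn : (inp .pre).length ≤ n) (hi : ∀ a, ∀ l ∈ inp a, ∀ z ∈ l, z ≤ n)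
    (e : Expr) (he : e.isMidSucc = true) : e.eval inp m ≤ n + 2 * (T + 1) + 1 := by
  unfold Expr.isMidSucc at he
  split at he
  · have := h.mid hT hn hi _ he; simp only [Expr.eval]; omega
  · have := h.mid hT hn hi _ he; omega

theorem Store.Tame.modifyRow {n T : ℕ} {m : Store} (h : m.Tame n T) (a : Tab) (r : ℕ)
    (f : Vec → Vec)
    (hf : ∀ v, v.data.length ≤ v.cap → (f v).data.length ≤ (f v).cap ∧
      ∀ z ∈ (f v).data, z ∈ v.data ∨ z ≤ if a.isNode then n + 2 * T + 1 else T) :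
    (m.modifyRow a r f).Tame n T := by
  refine ⟨h.reg, fun a' v hv z hz => ?_, fun a' => ?_, fun a' v hv => ?_⟩
  · by_cases ha : a' = a
    · subst ha
      simp only [Store.modifyRow, Function.update_self] at hv
      rcases mem_modify hv with hv | ⟨hr, rfl⟩
      · exact h.tab a' v hv z hz
      · rcases (hf _ (h.data _ _ (row_mem hr))).2 z hz with hz | hz
        · exact h.tab a' _ (row_mem hr) z hz
        · exact hz
    · exact h.tab a' v (by simpa [Store.modifyRow, ha] using hv) z hz
  · by_cases ha : a' = a
    · subst ha; simpa [Store.modifyRow] using h.rows a'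
    · simpa [Store.modifyRow, ha] using h.rows a'
  · by_cases ha : a' = a
    · subst ha
      simp only [Store.modifyRow, Function.update_self] at hv
      rcases mem_modify hv with hv | ⟨hr, rfl⟩
      · exact h.data a' v hv
      · exact (hf _ (h.data _ _ (row_mem hr))).1
    · exact h.data a' v (by simpa [Store.modifyRow, ha] using hv)

/-- One command raises a counter by at most one and a node number by at most two, so the bound
advances with the clock. No command releases cells. -/
theorem Op.run_tame {n T : ℕ} {m : Store} (h : m.Tame n T) (hT : 1 ≤ T) {inp : Input}
    (hn : (inp .pre).length ≤ n) (hi : ∀ a, ∀ l ∈ inp a, ∀ z ∈ l, z ≤ n)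
    (o : Op) (ho : o.isTame = true) :
    (o.run inp m).Tame n (T + 1) ∧ m.cells ≤ (o.run inp m).cells := by
  have h' := h.mono (Nat.le_succ T)
  have key : ∀ (b : Bool) (g : Expr), (if b then g.isMidSucc else g.isLowSucc) = true →
      g.eval inp m ≤ if b then n + 2 * (T + 1) + 1 else T + 1 := by
    intro b g hg
    cases b with
    | false => simpa using h.lowSucc hT inp g (by simpa using hg)
    | true => simpa using h.midSucc hT hn hi g (by simpa using hg)
  cases o with
  | set r e =>
    refine ⟨⟨fun r' => ?_, h'.tab, h'.rows, h'.data⟩, le_rfl⟩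
    by_cases hr : r' = r
    · subst hr
      simpa [Op.run] using key r'.isNode e (by simpa [Op.isTame] using ho)
    · simpa [Op.run, hr] using h'.reg r'
  | put a e f g =>
    refine ⟨h'.modifyRow _ _ _ fun v hv => ⟨by simpa using hv, fun z hz => ?_⟩, ?_⟩
    · rcases List.mem_or_eq_of_mem_set hz with hz | rfl
      · exact Or.inl hz
      · exact Or.inr (key a.isNode g (by simpa [Op.isTame] using ho))
    · rcases cells_modifyRow m a (e.eval inp m)
        (fun v => ⟨v.data.set (f.eval inp m) (g.eval inp m), v.cap⟩) with h1 | h1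
      · simp only [Op.run] at h1 ⊢; omega
      · simp only [Op.run]; omega
  | push a e g =>
    refine ⟨h'.modifyRow _ _ _ fun v hv => ⟨?_, fun z hz => ?_⟩, ?_⟩
    · simpa [Vec.push] using (le_grow hv).1
    · simp only [Vec.push, List.mem_append, List.mem_singleton] at hz
      rcases hz with hz | rfl
      · exact Or.inl hz
      · exact Or.inr (key a.isNode g (by simpa [Op.isTame] using ho))
    · rcases cells_modifyRow m a (e.eval inp m) (fun v => v.push (g.eval inp m)) with h1 | h1
      · have := (le_grow (h.data a _ (row_mem h1.1))).2.1
        simp only [Op.run, Vec.push] at h1 ⊢; omega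
      · simp only [Op.run]; omega
  | clear a e =>
    refine ⟨h'.modifyRow _ _ _ fun v hv => ⟨by simp, fun z hz => by simp at hz⟩, ?_⟩
    rcases cells_modifyRow m a (e.eval inp m) (fun v => ⟨[], v.cap⟩) with h1 | h1
    · simp only [Op.run] at h1 ⊢; omega
    · simp only [Op.run]; omega
  | newRow a =>
    have g := le_grow (h.rows a)
    refine ⟨⟨h'.reg, fun a' v hv z hz => ?_, fun a' => ?_, fun a' v hv => ?_⟩, ?_⟩
    · by_cases ha : a' = a
      · subst ha
        simp only [Op.run, Function.update_self, List.mem_append, List.mem_singleton] at hv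
        rcases hv with hv | rfl
        · exact h'.tab a' v hv z hz
        · simp [Vec.empty] at hz
      · exact h'.tab a' v (by simpa [Op.run, ha] using hv) z hz
    · by_cases ha : a' = a
      · subst ha; simpa [Op.run] using g.1
      · simpa [Op.run, ha] using h.rows a'
    · by_cases ha : a' = a
      · subst ha
        simp only [Op.run, Function.update_self, List.mem_append, List.mem_singleton] at hv
        rcases hv with hv | rfl
        · exact h'.data a' v hv
        · simp [Vec.empty]
      · exact h'.data a' v (by simpa [Op.run, ha] using hv)
    · have h5 := sum_update_add m.tab a
        (⟨(m.tab a).rows ++ [Vec.empty], grow (m.tab a).rows.length (m.tab a).cap⟩ : Table)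
        Table.cells
      simp only [Op.run, Store.cells, Table.cells, List.map_append, List.sum_append] at h5 ⊢
      simp [Vec.empty] at h5 ⊢
      omega

/-- A bound on the size in bits. -/
def bitBound (n cells T : ℕ) : ℕ := (cells + 12) * (Nat.size (n + 2 * T + 1) + Nat.size cells + 5)

theorem bitBound_mono {n c c' T T' : ℕ} (hc : c ≤ c') (hT : T ≤ T') :
    bitBound n c T ≤ bitBound n c' T' := by
  unfold bitBound
  have h1 := Nat.size_le_size hc
  have h2 : Nat.size (n + 2 * T + 1) ≤ Nat.size (n + 2 * T' + 1) := Nat.size_le_size (by omega)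
  exact Nat.mul_le_mul (by omega) (by omega)

theorem foldr_max_le (l : List ℕ) (b : ℕ) (h : ∀ z ∈ l, z ≤ b) : l.foldr max 0 ≤ b := by
  induction l with
  | nil => simp
  | cons a l ih => simp at h ⊢; exact ⟨h.1, ih h.2⟩

theorem card_reg : Fintype.card Reg = 12 := by decide

/-- Every cell is charged with the width of the largest admissible number, the width of a row
reference, and a constant that absorbs the stored lengths and capacities. -/
theorem Store.Tame.bits_le {n T : ℕ} {m : Store} (h : m.Tame n T) :
    m.bits ≤ bitBound n m.cells T := by
  set W := Nat.size (n + 2 * T + 1) with hW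
  set C := Nat.size m.cells with hC
  have hW1 : 1 ≤ W := by rw [hW]; exact Nat.lt_size.2 (by simp)
  have hreg : ∑ r : Reg, (Nat.size (m.reg r) + 1) ≤ 12 * (W + 1) := by
    have : ∑ r : Reg, (Nat.size (m.reg r) + 1) ≤ ∑ _r : Reg, (W + 1) :=
      Finset.sum_le_sum fun r _ => by
        have := Nat.size_le_size ((h.reg r).trans
          (show _ ≤ n + 2 * T + 1 by split_ifs <;> omega))
        omega
    refine this.trans ?_
    rw [Finset.sum_const, Finset.card_univ, card_reg, smul_eq_mul]
  have hcell : ∀ a, (m.tab a).cells ≤ m.cells := fun a =>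
    Finset.single_le_sum (f := fun a => (m.tab a).cells) (fun _ _ => Nat.zero_le _)
      (Finset.mem_univ a)
  have htab : ∀ a, (m.tab a).bits ≤ (m.tab a).cells * (W + C + 5) := by
    intro a
    have hv : ∀ v ∈ (m.tab a).rows, v.bits ≤ v.cap * (W + 3) + 1 := by
      intro v hv
      have h1 : (v.data.map Nat.size).foldr max 0 ≤ W := by
        refine foldr_max_le _ _ fun z hz => ?_
        obtain ⟨y, hy, rfl⟩ := List.mem_map.1 hz
        exact Nat.size_le_size ((h.tab a v hv y hy).trans (by split_ifs <;> omega))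
      -- A crude estimate is enough here: the bits of the length and of the capacity of a row amount
      -- to at most two per allocated cell.
      have h2 : ∀ z : ℕ, Nat.size z ≤ z := fun z => Nat.size_le.2 Nat.lt_two_pow_self
      have h3 := h.data a v hv
      have h4 := h2 v.data.length
      have h5 := h2 v.cap
      have h6 := Nat.mul_le_mul_left v.cap (Nat.add_le_add_right h1 1)
      unfold Vec.bits
      nlinarith
    have h1 : ((m.tab a).rows.map Vec.bits).sum
        ≤ ((m.tab a).rows.map Vec.cap).sum * (W + 3) + (m.tab a).rows.length := by
      generalize (m.tab a).rows = l at hv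
      induction l with
      | nil => simp
      | cons v l ih =>
        have h1 := ih fun v hv' => hv v (by simp [hv'])
        have h2 := hv v (by simp)
        simp only [List.map_cons, List.sum_cons, List.length_cons]
        nlinarith
    have h2 : Nat.size (m.tab a).cap ≤ C := Nat.size_le_size ((Nat.le_add_right _ _).trans (hcell a))
    have h3 := h.rows a
    have h4 := Nat.mul_le_mul_left (m.tab a).cap h2
    unfold Table.bits Table.cells
    generalize ((m.tab a).rows.map Vec.cap).sum = S at h1
    have h5 := Nat.zero_le (S * (C + 2))
    have h6 := Nat.zero_le ((m.tab a).cap * W)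
    nlinarith
  have : ∑ a : Tab, (m.tab a).bits ≤ m.cells * (W + C + 5) := by
    unfold Store.cells
    rw [Finset.sum_mul]
    exact Finset.sum_le_sum fun a _ => htab a
  unfold Store.bits bitBound
  rw [← hW, ← hC]
  nlinarith

/-- Since cells are never released and the clock only advances, the peak size in bits is controlled
by the final number of cells and the total time. -/
theorem Exec.tame {n : ℕ} {inp : Input}
    (hn : (inp .pre).length ≤ n) (hi : ∀ a, ∀ l ∈ inp a, ∀ z ∈ l, z ≤ n) {p : Cmd}
    {m m' : Store} {t b : ℕ} (hx : Exec inp p m t b m') (hp : p.isTame = true) {T : ℕ}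
    (hT : 1 ≤ T) (h : m.Tame n T) :
    m'.Tame n (T + t) ∧ m.cells ≤ m'.cells ∧ b ≤ bitBound n m'.cells (T + t) := by
  induction hx generalizing T with
  | op o m =>
    obtain ⟨h1, h2⟩ := Op.run_tame h hT hn hi o hp
    have h3 : 1 ≤ o.cost inp m := by cases o <;> simp only [Op.cost] <;> omega
    have h4 := h1.mono (show T + 1 ≤ T + o.cost inp m by omega)
    exact ⟨h4, h2, max_le (h.bits_le.trans (bitBound_mono h2 (by omega))) h4.bits_le⟩
  | seq hp hq ihp ihq =>
    simp only [Cmd.isTame, Bool.and_eq_true] at hp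
    obtain ⟨h1, h2, h3⟩ := ihp hp.1 hT h
    obtain ⟨h4, h5, h6⟩ := ihq hp.2 (by omega) h1
    rw [← add_assoc]
    exact ⟨h4, h2.trans h5, max_le (h3.trans (bitBound_mono h5 (by omega))) h6⟩
  | iteTrue he _ ih =>
    simp only [Cmd.isTame, Bool.and_eq_true] at hp
    obtain ⟨h1, h2, h3⟩ := ih hp.1 hT h
    exact ⟨h1.mono (by omega), h2, h3.trans (bitBound_mono le_rfl (by omega))⟩
  | iteFalse he _ ih =>
    simp only [Cmd.isTame, Bool.and_eq_true] at hp
    obtain ⟨h1, h2, h3⟩ := ih hp.2 hT h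
    exact ⟨h1.mono (by omega), h2, h3.trans (bitBound_mono le_rfl (by omega))⟩
  | whileTrue he _ _ ihp ihq =>
    obtain ⟨h1, h2, h3⟩ := ihp hp hT h
    obtain ⟨h4, h5, h6⟩ := ihq hp (by omega) h1
    exact ⟨h4.mono (by omega), h2.trans h5, max_le (h3.trans (bitBound_mono h5 (by omega)))
      (h6.trans (bitBound_mono le_rfl (by omega)))⟩
  | whileFalse he =>
    exact ⟨h.mono (by omega), le_rfl, h.bits_le.trans (bitBound_mono le_rfl (by omega))⟩

/-! ### Elementary facts on lists and abstract memories -/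

theorem getD_set (l : List ℕ) (i v j : ℕ) :
    (l.set i v).getD j 0 = if j = i ∧ i < l.length then v else l.getD j 0 := by
  simp only [List.getD_eq_getElem?_getD, List.getElem?_set]
  by_cases h : i = j
  · subst h
    by_cases h2 : i < l.length
    · simp [h2]
    · simp [h2]
  · simp [h, Ne.symm h]

theorem getD_append_singleton (l : List ℕ) (v j : ℕ) :
    (l ++ [v]).getD j 0 = if j = l.length then v else l.getD j 0 := by
  rcases lt_trichotomy j l.length with h | h | h
  · rw [List.getD_append _ _ _ _ h, if_neg (by omega)]
  · subst h; simp
  · rw [List.getD_eq_default _ _ (by simp; omega), List.getD_eq_default _ _ (by omega),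
      if_neg (by omega)]

namespace Mem

variable (μ : Mem) (a b : Tab) (r r' i v : ℕ) (q q' : Reg) (l : List ℕ)

@[simp] theorem reg_setReg : (μ.setReg q v).reg q' = if q' = q then v else μ.reg q' := by
  simp [setReg, Function.update_apply]
@[simp] theorem nr_setReg : (μ.setReg q v).nr = μ.nr := rfl
@[simp] theorem row_setReg : (μ.setReg q v).row = μ.row := rfl
@[simp] theorem get_setReg : (μ.setReg q v).get = μ.get := rfl
@[simp] theorem reg_setRow : (μ.setRow a r l).reg = μ.reg := rfl
@[simp] theorem nr_setRow : (μ.setRow a r l).nr = μ.nr := rfl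
@[simp] theorem row_setRow :
    (μ.setRow a r l).row b r' = if b = a ∧ r' = r then l else μ.row b r' := by
  by_cases h : b = a
  · subst h; simp [setRow, Function.update_apply]
  · simp [setRow, h]
@[simp] theorem get_setRow : (μ.setRow a r l).get b r' i =
    if b = a ∧ r' = r then l.getD i 0 else μ.get b r' i := by
  unfold get; rw [row_setRow]; split_ifs <;> rfl
@[simp] theorem reg_addRow : (μ.addRow a).reg = μ.reg := rfl
@[simp] theorem row_addRow : (μ.addRow a).row = μ.row := rfl
@[simp] theorem get_addRow : (μ.addRow a).get = μ.get := rfl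
@[simp] theorem nr_addRow : (μ.addRow a).nr b = if b = a then μ.nr a + 1 else μ.nr b := by
  simp [addRow, Function.update_apply]

theorem setReg_self : μ.setReg q (μ.reg q) = μ := by
  simp [setReg]

theorem setRow_setRow (l' : List ℕ) : (μ.setRow a r l).setRow a r l' = μ.setRow a r l' := by
  simp [setRow]

theorem setRow_comm (h : a ≠ b) (l' : List ℕ) :
    (μ.setRow a r l).setRow b r' l' = (μ.setRow b r' l').setRow a r l := by
  simp only [setRow, mk.injEq, true_and]
  rw [Function.update_of_ne h.symm, Function.update_of_ne h, Function.update_comm h]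

theorem get_of_length_le {μ : Mem} {a : Tab} {r i : ℕ} (h : (μ.row a r).length ≤ i) :
    μ.get a r i = 0 := List.getD_eq_default _ _ h

theorem get_eq_getElem {μ : Mem} {a : Tab} {r i : ℕ} (h : i < (μ.row a r).length) :
    μ.get a r i = (μ.row a r)[i] := List.getD_eq_getElem _ _ h

end Mem

section
variable (inp : Input) (μ : Mem)
@[simp] theorem ev_lit (c : ℕ) : (Expr.lit c).ev inp μ = c := rfl
@[simp] theorem ev_zero : (0 : Expr).ev inp μ = 0 := rfl
@[simp] theorem ev_one : (1 : Expr).ev inp μ = 1 := rfl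
@[simp] theorem ev_reg (r : Reg) : (Expr.reg r).ev inp μ = μ.reg r := rfl
@[simp] theorem ev_add (e f : Expr) : (e + f).ev inp μ = e.ev inp μ + f.ev inp μ := rfl
@[simp] theorem ev_sub (e f : Expr) : (e - f).ev inp μ = e.ev inp μ - f.ev inp μ := rfl
@[simp] theorem ev_eq (e f : Expr) :
    (Expr.eq e f).ev inp μ = if e.ev inp μ = f.ev inp μ then 1 else 0 := rfl
@[simp] theorem ev_lt (e f : Expr) :
    (Expr.lt e f).ev inp μ = if e.ev inp μ < f.ev inp μ then 1 else 0 := rfl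
@[simp] theorem ev_get (a : Tab) (e f : Expr) :
    (Expr.get a e f).ev inp μ = μ.get a (e.ev inp μ) (f.ev inp μ) := rfl
@[simp] theorem ev_len (a : Tab) (e : Expr) :
    (Expr.len a e).ev inp μ = (μ.row a (e.ev inp μ)).length := rfl
@[simp] theorem ev_inRows (a : InTab) : (Expr.inRows a).ev inp μ = (inp a).length := rfl
@[simp] theorem ev_inLen (a : InTab) (e : Expr) :
    (Expr.inLen a e).ev inp μ = ((inp a).getD (e.ev inp μ) []).length := rfl
@[simp] theorem ev_inGet (a : InTab) (e f : Expr) :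
    (Expr.inGet a e f).ev inp μ = ((inp a).getD (e.ev inp μ) []).getD (f.ev inp μ) 0 := rfl
@[simp] theorem ev_rd (a : Tab) (e : Expr) : (rd a e).ev inp μ = μ.get a 0 (e.ev inp μ) := rfl
@[simp] theorem ev_size (a : Tab) : (size a).ev inp μ = (μ.row a 0).length := rfl
@[simp] theorem ev_nStates : nStates.ev inp μ = (inp .pre).length := rfl
@[simp] theorem ev_hd (e : Expr) :
    (hd e).ev inp μ = (inp .pre).length + e.ev inp μ + e.ev inp μ := rfl
@[simp] theorem ev_hdI (e : Expr) :
    (hdI e).ev inp μ = (inp .pre).length + e.ev inp μ + e.ev inp μ + 1 := rfl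
end

/-! ### Weakest preconditions -/

/-- The command halts, and the number of its steps and the final memory satisfy `Q`. -/
def WP (inp : Input) (N : ℕ) (p : Cmd) (Q : ℕ → Mem → Prop) (μ : Mem) : Prop :=
  ∃ k μ', AExec inp N p μ k μ' ∧ Q k μ'

section
variable {inp : Input} {N : ℕ} {p q : Cmd} {Q Q' : ℕ → Mem → Prop} {μ : Mem} {e : Expr}

theorem WP.mono (h : WP inp N p Q μ) (hQ : ∀ k μ', Q k μ' → Q' k μ') : WP inp N p Q' μ :=
  let ⟨k, μ', h1, h2⟩ := h; ⟨k, μ', h1, hQ _ _ h2⟩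

/-- The rules of `AExec` are invertible, so the rules for `WP` are equivalences and can be used for
rewriting. -/
theorem wp_seq : WP inp N (p ;; q) Q μ ↔
    WP inp N p (fun k μ' => WP inp N q (fun k' μ'' => Q (k + k') μ'') μ') μ := by
  constructor
  · rintro ⟨k, μ', h, hQ⟩
    cases h with
    | seq h1 h2 => exact ⟨_, _, h1, _, _, h2, hQ⟩
  · rintro ⟨k, μ', h, k', μ'', h', hQ⟩
    exact ⟨_, _, .seq h h', hQ⟩

theorem wp_op {o : Op} : WP inp N (.op o) Q μ ↔ o.Legal inp N μ ∧ Q 1 (o.arun inp μ) := by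
  constructor
  · rintro ⟨k, μ', h, hQ⟩
    cases h with
    | op _ _ h => exact ⟨h, hQ⟩
  · rintro ⟨h, hQ⟩
    exact ⟨_, _, .op _ _ h, hQ⟩

theorem wp_ite : WP inp N (.ite e p q) Q μ ↔
    (e.ev inp μ ≠ 0 → WP inp N p (fun k => Q (1 + k)) μ) ∧
    (e.ev inp μ = 0 → WP inp N q (fun k => Q (1 + k)) μ) := by
  constructor
  · rintro ⟨k, μ', h, hQ⟩
    cases h with
    | iteTrue he h => exact ⟨fun _ => ⟨_, _, h, hQ⟩, fun h => absurd h he⟩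
    | iteFalse he h => exact ⟨fun h => absurd he h, fun _ => ⟨_, _, h, hQ⟩⟩
  · rintro ⟨h1, h2⟩
    by_cases he : e.ev inp μ = 0
    · obtain ⟨k, μ', h, hQ⟩ := h2 he
      exact ⟨_, _, .iteFalse he h, hQ⟩
    · obtain ⟨k, μ', h, hQ⟩ := h1 he
      exact ⟨_, _, .iteTrue he h, hQ⟩

theorem wp_while : WP inp N (.while e p) Q μ ↔
    (e.ev inp μ ≠ 0 → WP inp N p (fun k μ' =>
      WP inp N (.while e p) (fun k' μ'' => Q (1 + k + k') μ'') μ') μ) ∧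
    (e.ev inp μ = 0 → Q 1 μ) := by
  constructor
  · rintro ⟨k, μ', h, hQ⟩
    cases h with
    | whileTrue he h h' => exact ⟨fun _ => ⟨_, _, h, _, _, h', hQ⟩, fun h => absurd h he⟩
    | whileFalse he => exact ⟨fun h => absurd he h, fun _ => hQ⟩
  · rintro ⟨h1, h2⟩
    by_cases he : e.ev inp μ = 0
    · exact ⟨_, _, .whileFalse he, h2 he⟩
    · obtain ⟨k, μ', h, k', μ'', h', hQ⟩ := h1 he
      exact ⟨_, _, .whileTrue he h h', hQ⟩

theorem wp_set {r : Reg} : WP inp N (.op (.set r e)) Q μ ↔ Q 1 (μ.setReg r (e.ev inp μ)) := by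
  rw [wp_op]; simp [Op.Legal, Op.arun]

theorem wp_assign {r : Reg} : WP inp N (assign r e) Q μ ↔ Q 1 (μ.setReg r (e.ev inp μ)) := wp_set

theorem wp_put {a : Tab} {f g : Expr} : WP inp N (.op (.put a e f g)) Q μ ↔
    Q 1 (μ.setRow a (e.ev inp μ) ((μ.row a (e.ev inp μ)).set (f.ev inp μ) (g.ev inp μ))) := by
  rw [wp_op]; simp [Op.Legal, Op.arun]

theorem wp_wr {a : Tab} {f : Expr} : WP inp N (wr a e f) Q μ ↔
    Q 1 (μ.setRow a 0 ((μ.row a 0).set (e.ev inp μ) (f.ev inp μ))) := wp_put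

theorem wp_wr₂ {a : Tab} {f g : Expr} : WP inp N (wr₂ a e f g) Q μ ↔
    Q 1 (μ.setRow a (e.ev inp μ) ((μ.row a (e.ev inp μ)).set (f.ev inp μ) (g.ev inp μ))) := wp_put

theorem wp_push₂ {a : Tab} {g : Expr} : WP inp N (push₂ a e g) Q μ ↔
    (e.ev inp μ < μ.nr a ∧ (μ.row a (e.ev inp μ)).length ≤ N) ∧
    Q 1 (μ.setRow a (e.ev inp μ) (μ.row a (e.ev inp μ) ++ [g.ev inp μ])) := wp_op

theorem wp_push {a : Tab} {g : Expr} : WP inp N (push a g) Q μ ↔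
    (0 < μ.nr a ∧ (μ.row a 0).length ≤ N) ∧
    Q 1 (μ.setRow a 0 (μ.row a 0 ++ [g.ev inp μ])) := wp_op

theorem wp_clear {a : Tab} : WP inp N (.op (.clear a e)) Q μ ↔
    Q 1 (μ.setRow a (e.ev inp μ) []) := by
  rw [wp_op]; simp [Op.Legal, Op.arun]

theorem wp_erase {a : Tab} : WP inp N (erase a) Q μ ↔ Q 1 (μ.setRow a 0 []) := wp_clear

theorem wp_newRow {a : Tab} : WP inp N (newRow a) Q μ ↔ Q 1 (μ.addRow a) := by
  unfold newRow; rw [wp_op]; simp [Op.Legal, Op.arun]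

/-- The missing alternative is the assignment of `x` to itself: it costs one step beyond the test
and changes nothing, although frames report `x` as modified. -/
theorem wp_ifThen : WP inp N (ifThen e p) Q μ ↔
    (e.ev inp μ ≠ 0 → WP inp N p (fun k => Q (1 + k)) μ) ∧ (e.ev inp μ = 0 → Q 2 μ) := by
  unfold ifThen
  rw [wp_ite, wp_set, ev_reg, Mem.setReg_self]

end

/-! ### Frames -/

/-- The registers that a command assigns to. -/
def Cmd.modReg : Cmd → Reg → Bool
  | .op (.set r _), r' => r' == r
  | .op _, _ => false
  | .seq p q, r | .ite _ p q, r => p.modReg r || q.modReg r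
  | .while _ p, r => p.modReg r

/-- The tables that a command modifies. -/
def Cmd.modTab : Cmd → Tab → Bool
  | .op (.set _ _), _ => false
  | .op (.put b _ _ _), a | .op (.push b _ _), a | .op (.clear b _), a | .op (.newRow b), a => a == b
  | .seq p q, r | .ite _ p q, r => p.modTab r || q.modTab r
  | .while _ p, r => p.modTab r

/-- The tables to which a command appends rows. -/
def Cmd.modNr : Cmd → Tab → Bool
  | .op (.newRow b), a => a == b
  | .op _, _ => false
  | .seq p q, r | .ite _ p q, r => p.modNr r || q.modNr r
  | .while _ p, r => p.modNr r

/-- The tables in which a command changes the lengths of rows. -/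
def Cmd.modLen : Cmd → Tab → Bool
  | .op (.push b _ _), a | .op (.clear b _), a => a == b
  | .op _, _ => false
  | .seq p q, r | .ite _ p q, r => p.modLen r || q.modLen r
  | .while _ p, r => p.modLen r

/-- The memories differ only in what the command `p` modifies. -/
structure Frame (p : Cmd) (μ μ' : Mem) : Prop where
  reg : ∀ r, p.modReg r = false → μ'.reg r = μ.reg r
  nr : ∀ a, p.modNr a = false → μ'.nr a = μ.nr a
  row : ∀ a, p.modTab a = false → μ'.row a = μ.row a
  len : ∀ a, p.modLen a = false → ∀ r, (μ'.row a r).length = (μ.row a r).length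

theorem Frame.refl (p : Cmd) (μ : Mem) : Frame p μ μ :=
  ⟨fun _ _ => rfl, fun _ _ => rfl, fun _ _ => rfl, fun _ _ _ => rfl⟩

theorem Frame.get {p : Cmd} {μ μ' : Mem} (h : Frame p μ μ') (a : Tab) (ha : p.modTab a = false) :
    μ'.get a = μ.get a := by
  funext r i; simp [Mem.get, h.row a ha]

theorem Frame.trans {p : Cmd} {μ₁ μ₂ μ₃ : Mem} (h : Frame p μ₁ μ₂) (h' : Frame p μ₂ μ₃) :
    Frame p μ₁ μ₃ :=
  ⟨fun r hr => (h'.reg r hr).trans (h.reg r hr), fun a ha => (h'.nr a ha).trans (h.nr a ha),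
    fun a ha => (h'.row a ha).trans (h.row a ha),
    fun a ha r => (h'.len a ha r).trans (h.len a ha r)⟩

theorem Frame.mono {p q : Cmd} {μ μ' : Mem} (h : Frame p μ μ')
    (hr : ∀ r, q.modReg r = false → p.modReg r = false)
    (hn : ∀ a, q.modNr a = false → p.modNr a = false)
    (ha : ∀ a, q.modTab a = false → p.modTab a = false)
    (hl : ∀ a, q.modLen a = false → p.modLen a = false) : Frame q μ μ' :=
  ⟨fun r h' => h.reg r (hr r h'), fun a h' => h.nr a (hn a h'), fun a h' => h.row a (ha a h'),
    fun a h' => h.len a (hl a h')⟩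

theorem Frame.setReg {p : Cmd} {r : Reg} (hr : p.modReg r = true) (μ : Mem) (v : ℕ) :
    Frame p μ (μ.setReg r v) :=
  ⟨fun q hq => by rw [Mem.reg_setReg, if_neg]; rintro rfl; simp [hr] at hq,
    fun _ _ => rfl, fun _ _ => rfl, fun _ _ _ => rfl⟩

/-- The functions `modReg`, `modTab`, `modNr` and `modLen` are syntactic overapproximations. For
concrete programs they evaluate, so most frame conditions below are closed by `rfl`. -/
theorem AExec.frame {inp : Input} {N : ℕ} {p : Cmd} {μ μ' : Mem} {k : ℕ}
    (h : AExec inp N p μ k μ') : Frame p μ μ' := by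
  induction h with
  | op o μ _ =>
    cases o with
    | set r e =>
      exact ⟨fun r' h => by simp_all [Cmd.modReg, Op.arun], fun _ _ => rfl, fun _ _ => rfl,
        fun _ _ _ => rfl⟩
    | newRow b =>
      exact ⟨fun _ _ => rfl, fun a h => by simp_all [Cmd.modNr, Op.arun], fun _ _ => rfl,
        fun _ _ _ => rfl⟩
    | put a e f g =>
      refine ⟨fun _ _ => rfl, fun _ _ => rfl, fun a h => by
        funext r'; simp_all [Cmd.modTab, Op.arun], fun a _ r' => ?_⟩
      simp only [Op.arun, Mem.row_setRow]
      split_ifs with h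
      · simp [h.1, h.2]
      · rfl
    | _ =>
      exact ⟨fun _ _ => rfl, fun _ _ => rfl, fun a h => by
        funext r'; simp_all [Cmd.modTab, Op.arun], fun a h r' => by
        simp_all [Cmd.modLen, Op.arun]⟩
  | seq _ _ ih ih' =>
    exact (ih.mono (by simp +contextual [Cmd.modReg]) (by simp +contextual [Cmd.modNr])
      (by simp +contextual [Cmd.modTab]) (by simp +contextual [Cmd.modLen])).trans
      (ih'.mono (by simp +contextual [Cmd.modReg]) (by simp +contextual [Cmd.modNr])
      (by simp +contextual [Cmd.modTab]) (by simp +contextual [Cmd.modLen]))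
  | iteTrue _ _ ih =>
    exact ih.mono (by simp +contextual [Cmd.modReg]) (by simp +contextual [Cmd.modNr])
      (by simp +contextual [Cmd.modTab]) (by simp +contextual [Cmd.modLen])
  | iteFalse _ _ ih =>
    exact ih.mono (by simp +contextual [Cmd.modReg]) (by simp +contextual [Cmd.modNr])
      (by simp +contextual [Cmd.modTab]) (by simp +contextual [Cmd.modLen])
  | whileTrue _ _ _ ih ih' =>
    exact (ih.mono (by simp [Cmd.modReg]) (by simp [Cmd.modNr]) (by simp [Cmd.modTab])
      (by simp [Cmd.modLen])).trans ih'
  | whileFalse _ => exact Frame.refl _ _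

section
variable {inp : Input} {N : ℕ} {p q : Cmd} {Q Q' : ℕ → Mem → Prop} {μ : Mem} {e : Expr}

theorem WP.frame (h : WP inp N p Q μ) : WP inp N p (fun k μ' => Q k μ' ∧ Frame p μ μ') μ :=
  let ⟨k, μ', h1, h2⟩ := h; ⟨k, μ', h1, h2, h1.frame⟩

/-- The rule of consequence, with the frame. -/
theorem WP.conseq (h : WP inp N p Q μ) (hQ : ∀ k μ', Q k μ' → Frame p μ μ' → Q' k μ') :
    WP inp N p Q' μ := h.frame.mono fun k μ' h => hQ k μ' h.1 h.2

theorem modReg_forRange {r r' : Reg} {lo hi : Expr} :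
    (forRange r lo hi p).modReg r' = ((r' == r) || p.modReg r') := by
  simp only [forRange, assign, Cmd.modReg]; cases (r' == r) <;> simp

theorem modTab_forRange {r : Reg} {a : Tab} {lo hi : Expr} :
    (forRange r lo hi p).modTab a = p.modTab a := by
  simp [forRange, assign, Cmd.modTab]

theorem Frame.forRange {r : Reg} {lo hi : Expr} {μ' : Mem} (h : Frame p μ μ') :
    Frame (forRange r lo hi p) μ μ' :=
  h.mono (by intro q hq; rw [modReg_forRange] at hq; simp_all)
    (by simp [SimAlg.forRange, assign, Cmd.modNr]) (by simp [SimAlg.forRange, assign, Cmd.modTab])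
    (by simp [SimAlg.forRange, assign, Cmd.modLen])

theorem modReg_forList {r r' : Reg} {h : Expr} :
    (forList r h p).modReg r' = ((r' == r) || p.modReg r') := by
  simp only [forList, assign, Cmd.modReg]; cases (r' == r) <;> simp

theorem modTab_forList {r : Reg} {a : Tab} {h : Expr} :
    (forList r h p).modTab a = p.modTab a := by
  simp [forList, assign, Cmd.modTab]

theorem Frame.forList {r : Reg} {h : Expr} {μ' : Mem} (hF : Frame p μ μ') :
    Frame (forList r h p) μ μ' :=
  hF.mono (by intro q hq; rw [modReg_forList] at hq; simp_all)
    (by simp [SimAlg.forList, assign, Cmd.modNr]) (by simp [SimAlg.forList, assign, Cmd.modTab])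
    (by simp [SimAlg.forList, assign, Cmd.modLen])

/-- The rule for loops over a range: `I i t` is the invariant before the round for `i`, after `t`
steps. -/
theorem wp_forRange_of_reg {r : Reg} {lo hi : Expr} (L H : ℕ) (I : ℕ → ℕ → Mem → Prop)
    (hL : lo.ev inp μ = L)
    (h0 : I (L) 1 (μ.setReg r (L)))
    (hH : ∀ i t μ', I i t μ' → μ'.reg r = i → Frame (forRange r lo hi p) μ μ' → hi.ev inp μ' = H)
    (hs : ∀ i t μ', L ≤ i → i < H → I i t μ' → μ'.reg r = i →
      Frame (forRange r lo hi p) μ μ' →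
      WP inp N p (fun t' μ'' => μ''.reg r = i ∧ I (i + 1) (t + t' + 2) (μ''.setReg r (i + 1))) μ')
    (hq : ∀ t μ', I (max (L) H) t μ' → μ'.reg r = max (L) H →
      Frame (forRange r lo hi p) μ μ' → Q (t + 1) μ') :
    WP inp N (forRange r lo hi p) Q μ := by
  subst hL
  -- Induction on the number `j` of remaining rounds; the maximum makes this uniform in the case of
  -- an empty range.
  have key : ∀ j i t μ', max (lo.ev inp μ) H = i + j → lo.ev inp μ ≤ i → I i t μ' → μ'.reg r = i →
      Frame (forRange r lo hi p) μ μ' →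
      WP inp N (.while (.lt r hi) (p ;; assign r (r + 1))) (fun k => Q (t + k)) μ' := by
    intro j
    induction j with
    | zero =>
      intro i t μ' hm hi1 hI hri hF
      rw [wp_while]
      have hH' := hH i t μ' hI hri hF
      have : H ≤ i := by omega
      refine ⟨fun hne => ?_, fun _ => ?_⟩
      · simp [hH', hri] at hne; omega
      · subst hri
        rw [Nat.add_zero] at hm
        exact hq t μ' (hm ▸ hI) hm.symm hF
    | succ j ih =>
      intro i t μ' hm hi1 hI hri hF
      rw [wp_while]
      have hH' := hH i t μ' hI hri hF
      have hiH : i < H := by omega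
      refine ⟨fun _ => ?_, fun he => ?_⟩
      · rw [wp_seq]
        refine (hs i t μ' hi1 hiH hI hri hF).conseq fun t' μ'' ⟨h1, hI'⟩ hF' => ?_
        rw [wp_assign]
        simp only [ev_add, ev_reg, ev_one, h1]
        have h2 : Frame (forRange r lo hi p) μ' μ'' := hF'.forRange
        have h3 : Frame (forRange r lo hi p) μ'' (μ''.setReg r (i + 1)) :=
          Frame.setReg (by simp [modReg_forRange]) _ _
        refine (ih (i + 1) _ _ (by omega) (by omega) hI' (by simp) ((hF.trans h2).trans h3)).mono ?_
        intro k μ3 hQ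
        rwa [show t + (1 + (t' + 1) + k) = t + t' + 2 + k by ring]
      · simp [hH', hri] at he; omega
  unfold forRange
  rw [wp_seq, wp_assign]
  refine key _ (lo.ev inp μ) 1 _ (Nat.add_sub_of_le (le_max_left _ _)).symm le_rfl h0 (by simp)
    (Frame.setReg (by simp [modReg_forRange]) _ _)

/-- The rule for loops over a range whose body does not modify the loop register. -/
theorem wp_forRange {r : Reg} {lo hi : Expr} (L H : ℕ) (I : ℕ → ℕ → Mem → Prop)
    (hr : p.modReg r = false) (hL : lo.ev inp μ = L)
    (h0 : I (L) 1 (μ.setReg r (L)))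
    (hH : ∀ i t μ', I i t μ' → μ'.reg r = i → Frame (forRange r lo hi p) μ μ' → hi.ev inp μ' = H)
    (hs : ∀ i t μ', L ≤ i → i < H → I i t μ' → μ'.reg r = i →
      Frame (forRange r lo hi p) μ μ' →
      WP inp N p (fun t' μ'' => I (i + 1) (t + t' + 2) (μ''.setReg r (i + 1))) μ')
    (hq : ∀ t μ', I (max (L) H) t μ' → μ'.reg r = max (L) H →
      Frame (forRange r lo hi p) μ μ' → Q (t + 1) μ') :
    WP inp N (forRange r lo hi p) Q μ :=
  wp_forRange_of_reg L H I hL h0 hH (fun i t μ' h1 h2 hI hri hF =>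
    (hs i t μ' h1 h2 hI hri hF).conseq fun _ _ hI' hF' => ⟨by rw [hF'.reg r hr, hri], hI'⟩) hq

end

/-! ### Doubly linked lists -/

/-- From `a` along `l` to `z`, successors are given by `f` and predecessors by `g`. -/
def Links (f g : ℕ → ℕ) : ℕ → List ℕ → ℕ → Prop
  | a, [], z => f a = z ∧ g z = a
  | a, b :: l, z => f a = b ∧ g b = a ∧ Links f g b l z

/-- The circular doubly linked list with header `h` and elements `l`. -/
structure Circ (f g : ℕ → ℕ) (h : ℕ) (l : List ℕ) : Prop where
  links : Links f g h l h
  nodup : (h :: l).Nodup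

section
variable {f g f' g' : ℕ → ℕ} {a b h h' p z : ℕ} {l l₁ l₂ : List ℕ}

theorem links_append : Links f g a (l₁ ++ b :: l₂) z ↔ Links f g a l₁ b ∧ Links f g b l₂ z := by
  induction l₁ generalizing a with
  | nil => simp [Links, and_assoc]
  | cons c l ih => simp [Links, ih, and_assoc]

theorem Links.congr (h : Links f g a l z) (hf : ∀ c ∈ a :: l, f' c = f c)
    (hg : ∀ c ∈ z :: l, g' c = g c) : Links f' g' a l z := by
  induction l generalizing a with
  | nil => simp_all [Links]
  | cons c l ih =>
    obtain ⟨h1, h2, h3⟩ := h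
    refine ⟨by rw [hf a (by simp), h1], by rw [hg c (by simp), h2], ih h3 ?_ ?_⟩
    · intro c hc; exact hf c (by simp at hc ⊢; tauto)
    · intro c hc; exact hg c (by simp at hc ⊢; tauto)

theorem Circ.congr (hc : Circ f g h l) (hf : ∀ c ∈ h :: l, f' c = f c)
    (hg : ∀ c ∈ h :: l, g' c = g c) : Circ f' g' h l :=
  ⟨hc.links.congr hf hg, hc.nodup⟩

/-- Redirect the end of a list. -/
theorem Links.redirect (hl : Links f g a l z) (hn : (a :: l).Nodup) (hz : z ∉ l) (hp : p ∉ l) :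
    Links (Function.update f (g z) p) (Function.update g p (g z)) a l p := by
  induction l generalizing a with
  | nil =>
    obtain ⟨h1, h2⟩ := hl
    simp [Links, h2]
  | cons c l ih =>
    obtain ⟨h1, h2, h3⟩ := hl
    simp only [List.mem_cons, not_or] at hz hp
    have hz' : g z ∈ c :: l := by
      clear ih h1 h2 hn hz hp
      induction l generalizing c with
      | nil => simp [h3.2]
      | cons d l ih => exact List.mem_cons_of_mem _ (ih _ h3.2.2)
    refine ⟨?_, ?_, ih h3 hn.of_cons hz.2 hp.2⟩
    · rw [Function.update_of_ne, h1]
      rintro rfl; exact (List.nodup_cons.1 hn).1 hz'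
    · rw [Function.update_of_ne (Ne.symm hp.1), h2]

theorem Links.last_mem (hl : Links f g a l z) : g z ∈ a :: l := by
  induction l generalizing a with
  | nil => simp [hl.2]
  | cons d l ih => exact List.mem_cons_of_mem _ (ih hl.2.2)

theorem Links.first_mem (hl : Links f g a l z) : f a ∈ z :: l := by
  cases l with
  | nil => simp [hl.1]
  | cons d l => simp [hl.1]

/-- The updates are nested in the order of the writes made by `linkLast`. The end of the old list is
redirected from the header to the new node, which also covers the empty list, where the last node is
the header. -/
theorem Circ.insertLast (hc : Circ f g h l) (hp : p ∉ h :: l) :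
    Circ (Function.update (Function.update f (g h) p) p h)
      (Function.update (Function.update g p (g h)) h p) h (l ++ [p]) := by
  have hp' := hp
  simp only [List.mem_cons, not_or] at hp
  have hn := List.nodup_cons.1 hc.nodup
  refine ⟨?_, ?_⟩
  · rw [links_append]
    refine ⟨(hc.links.redirect hc.nodup hn.1 hp.2).congr ?_ ?_, ?_⟩
    · intro c hc'
      exact Function.update_of_ne (by rintro rfl; exact hp' hc') _ _
    · intro c hc'
      refine Function.update_of_ne ?_ _ _
      rintro rfl
      rcases List.mem_cons.1 hc' with h1 | h1
      · exact hp.1 h1.symm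
      · exact hn.1 h1
    · simp [Links]
  · have : ¬ h = p := fun h => hp.1 h.symm
    have h2 := hn.2
    simp [List.nodup_append, hn.1, this, h2]
    intro a ha; rintro rfl; exact hp.2 ha

theorem Circ.insertFirst (hc : Circ f g h l) (hp : p ∉ h :: l) :
    Circ (Function.update (Function.update f p (f h)) h p)
      (Function.update (Function.update g (f h) p) p h) h (p :: l) := by
  have hp' := hp
  simp only [List.mem_cons, not_or] at hp
  have hn := List.nodup_cons.1 hc.nodup
  refine ⟨⟨by simp, by simp, ?_⟩, ?_⟩
  · obtain ⟨h1, -⟩ := hc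
    cases l with
    | nil =>
      obtain ⟨h2, h3⟩ := h1
      refine ⟨?_, ?_⟩
      · rw [Function.update_of_ne hp.1]; simp [h2]
      · rw [Function.update_of_ne (Ne.symm hp.1)]; simp [h2]
    | cons c l =>
      obtain ⟨h2, h3, h4⟩ := h1
      have hch : c ≠ h := by rintro rfl; exact hn.1 (by simp)
      have hcp : c ≠ p := by rintro rfl; exact hp.2 (by simp)
      refine ⟨?_, ?_, h4.congr ?_ ?_⟩
      · rw [Function.update_of_ne hp.1]; simp [h2]
      · rw [Function.update_of_ne hcp]; simp [h2]
      · intro d hd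
        rw [Function.update_of_ne, Function.update_of_ne]
        · rintro rfl; exact hp.2 hd
        · rintro rfl; exact hn.1 hd
      · intro d hd
        rw [h2, Function.update_of_ne, Function.update_of_ne]
        · rintro rfl
          rcases List.mem_cons.1 hd with h5 | h5
          · exact hch h5
          · exact (List.nodup_cons.1 hn.2).1 h5
        · rintro rfl
          rcases List.mem_cons.1 hd with h5 | h5
          · exact hp.1 h5
          · exact hp.2 (by simp [h5])
  · have : ¬ h = p := fun h => hp.1 h.symm
    simp [hn.1, hn.2, this, hp.2]

/-- Cut the list at the node: the end of the left segment is redirected to the successor, and the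
right segment does not contain any of the changed entries. -/
theorem Circ.remove (hc : Circ f g h (l₁ ++ p :: l₂)) :
    Circ (Function.update f (g p) (f p)) (Function.update g (f p) (g p)) h (l₁ ++ l₂) := by
  have hn := hc.nodup
  have hl := hc.links
  rw [links_append] at hl
  obtain ⟨hl1, hl2⟩ := hl
  simp only [List.nodup_cons, List.mem_append, List.mem_cons, not_or, List.nodup_append] at hn
  obtain ⟨⟨n1, n2, n3⟩, n4, ⟨n5, n6⟩, n7⟩ := hn
  refine ⟨?_, ?_⟩
  · have hgp := hl1.last_mem
    cases l₂ with
    | nil =>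
      obtain ⟨h2, h3⟩ := hl2
      rw [List.append_nil, h2]
      refine hl1.redirect (by simp [n1, n4]) (fun h => n7 _ h p (by simp) rfl) n1
    | cons c l =>
      obtain ⟨h2, h3, h4⟩ := hl2
      simp only [List.mem_cons, not_or] at n3 n5 n7
      have n6' := List.nodup_cons.1 n6
      rw [links_append, h2]
      refine ⟨hl1.redirect (by simp [n1, n4]) (fun h => n7 _ h p (by simp) rfl)
        (fun h => n7 _ h c (by simp) rfl), h4.congr ?_ ?_⟩
      · intro d hd
        refine Function.update_of_ne ?_ _ _
        rintro rfl
        rcases List.mem_cons.1 hgp with h5 | h5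
        · rw [h5] at hd; simp at hd; tauto
        · exact n7 _ h5 _ (by simp at hd; tauto) rfl
      · intro d hd
        refine Function.update_of_ne ?_ _ _
        rintro rfl
        rcases List.mem_cons.1 hd with h5 | h5
        · exact n3.1 h5.symm
        · exact n6'.1 h5
  · simp only [List.nodup_cons, List.mem_append, not_or, List.nodup_append]
    exact ⟨⟨n1, n3⟩, n4, n6, fun a ha b hb => n7 a ha b (by simp [hb])⟩

theorem Circ.eq_nil_iff (hc : Circ f g h l) : f h = h ↔ l = [] := by
  have h1 := hc.links
  have h2 := hc.nodup
  cases l with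
  | nil => simpa using h1.1
  | cons a l =>
    obtain ⟨h3, -⟩ := h1
    simp at h2
    simp [h3, Ne.symm h2.1.1]

theorem circ_nil : Circ f g h [] ↔ f h = h ∧ g h = h := by
  constructor
  · intro hc; exact hc.links
  · intro hc; exact ⟨hc, by simp⟩

/-- Move a nonempty list to another header. -/
theorem Circ.rehead (hc : Circ f g h l) (hl : l ≠ []) (hh : h' ∉ h :: l) :
    let F := Function.update (Function.update (Function.update f h' (f h)) (g h) h') h h
    let G := Function.update (Function.update (Function.update g (f h) h') h' (g h)) h h
    Circ F G h' l ∧ Circ F G h [] := by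
  intro F G
  simp only [List.mem_cons, not_or] at hh
  have hn := List.nodup_cons.1 hc.nodup
  refine ⟨⟨?_, by simp [hn.2, hh.2]⟩, circ_nil.2 ⟨by simp [F], by simp [G]⟩⟩
  obtain ⟨h1, -⟩ := hc
  cases l with
  | nil => exact absurd rfl hl
  | cons c l =>
    obtain ⟨h2, h3, h4⟩ := h1
    simp only [List.mem_cons, not_or] at hh hn
    have h5 := h4.last_mem
    have h6 : g h ≠ h := by
      intro h7; rw [h7] at h5; rcases List.mem_cons.1 h5 with h8 | h8
      · exact hn.1.1 h8
      · exact hn.1.2 h8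
    have h6' : g h ≠ h' := by
      intro h7; rw [h7] at h5; rcases List.mem_cons.1 h5 with h8 | h8
      · exact hh.2.1 h8
      · exact hh.2.2 h8
    refine ⟨?_, ?_, (h4.redirect hn.2 hn.1.2 hh.2.2).congr ?_ ?_⟩
    · simp only [F]
      rw [Function.update_of_ne hh.1, Function.update_of_ne (Ne.symm h6')]; simp [h2]
    · simp only [G]
      rw [Function.update_of_ne (Ne.symm hn.1.1), Function.update_of_ne (Ne.symm hh.2.1)]; simp [h2]
    · intro d hd
      have hdh : d ≠ h := by
        rintro rfl; rcases List.mem_cons.1 hd with h8 | h8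
        · exact hn.1.1 h8
        · exact hn.1.2 h8
      have hdh' : d ≠ h' := by
        rintro rfl; rcases List.mem_cons.1 hd with h8 | h8
        · exact hh.2.1 h8
        · exact hh.2.2 h8
      simp only [F]
      rw [Function.update_of_ne hdh]
      simp only [Function.update_apply]
      split_ifs <;> simp_all
    · intro d hd
      have hdh : d ≠ h := by
        rintro rfl; rcases List.mem_cons.1 hd with h8 | h8
        · exact hh.1 h8.symm
        · exact hn.1.2 h8
      have hdc : d ≠ c := by
        rintro rfl; rcases List.mem_cons.1 hd with h8 | h8
        · exact hh.2.1 h8.symm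
        · exact (List.nodup_cons.1 hn.2).1 h8
      simp only [G]
      rw [Function.update_of_ne hdh]
      simp only [Function.update_apply, h2]
      split_ifs <;> simp_all

end

/-! ### Programs that traverse and modify linked lists -/

theorem Mem.get_setRow_fun (μ : Mem) (a b : Tab) (r r' : ℕ) (l : List ℕ) :
    (μ.setRow a r l).get b r' = if b = a ∧ r' = r then fun i => l.getD i 0 else μ.get b r' := by
  funext i; rw [Mem.get_setRow]; split_ifs <;> rfl

section
variable {inp : Input} {N : ℕ} {p q : Cmd} {Q Q' : ℕ → Mem → Prop} {μ : Mem} {e : Expr}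

/-- The rule for loops over a linked list of states: `I l₁ t` is the invariant after the rounds for
the states in `l₁`, after `t` steps. -/
theorem wp_forList {r : Reg} {h : Expr} (hv : ℕ) (l : List ℕ) (I : List ℕ → ℕ → Mem → Prop)
    (hr : p.modReg r = false) (hn : p.modTab .nxt = false)
    (hh : ∀ μ', Frame (forList r h p) μ μ' → h.ev inp μ' = hv)
    (hc : Circ (μ.get .nxt 0) (μ.get .prv 0) hv l)
    (h0 : ∀ v, I [] 1 (μ.setReg r v))
    (hs : ∀ l₁ a l₂ t μ', l = l₁ ++ a :: l₂ → I l₁ t μ' → μ'.reg r = a →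
      Frame (forList r h p) μ μ' →
      WP inp N p (fun t' μ'' => ∀ v, I (l₁ ++ [a]) (t + t' + 2) (μ''.setReg r v)) μ')
    (hq : ∀ t μ', I l t μ' → Frame (forList r h p) μ μ' → Q (t + 1) μ') :
    WP inp N (forList r h p) Q μ := by
  have hset : ∀ μ' v, Frame (forList r h p) μ' (μ'.setReg r v) :=
    fun μ' v => Frame.setReg (by simp [modReg_forList]) _ _
  have hnxt : (forList r h p).modTab .nxt = false := by rw [modTab_forList]; exact hn
  -- Induction on the states still to be visited. The links can be read in the initial memory, since
  -- the body does not modify `nxt`.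
  have key : ∀ l₂ l₁ a t μ', l = l₁ ++ l₂ → Links (μ.get .nxt 0) (μ.get .prv 0) a l₂ hv →
      I l₁ t μ' → μ'.reg r = μ.get .nxt 0 a → Frame (forList r h p) μ μ' →
      WP inp N (.while (.eq (.eq r h) 0) (p ;; assign r (rd .nxt r))) (fun k => Q (t + k)) μ' := by
    intro l₂
    induction l₂ with
    | nil =>
      intro l₁ a t μ' hl hL hI hri hF
      rw [wp_while]
      refine ⟨fun hne => ?_, fun _ => hq t μ' (by simpa [hl] using hI) hF⟩
      simp [hh μ' hF, hri, hL.1] at hne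
    | cons b l₂ ih =>
      intro l₁ a t μ' hl hL hI hri hF
      have hb : b ≠ hv := by
        rintro rfl; have := (List.nodup_cons.1 hc.nodup).1; simp [hl] at this
      rw [hL.1] at hri
      rw [wp_while]
      refine ⟨fun _ => ?_, fun he => ?_⟩
      · rw [wp_seq]
        refine (hs l₁ b l₂ t μ' hl hI hri hF).conseq fun t' μ'' hI' hF' => ?_
        rw [wp_assign]
        have h1 : μ''.reg r = b := by rw [hF'.reg r hr, hri]
        have h2 : Frame (forList r h p) μ' μ'' := hF'.forList
        have h3 := hF.trans h2
        have h4 : μ''.get .nxt = μ.get .nxt := h3.get _ hnxt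
        simp only [ev_rd, ev_reg, h1, h4]
        refine (ih (l₁ ++ [b]) b _ _ (by simp [hl]) hL.2.2 (hI' _) (by simp)
          (h3.trans (hset _ _))).mono ?_
        intro k μ3 hQ
        rwa [show t + (1 + (t' + 1) + k) = t + t' + 2 + k by ring]
      · simp [hh μ' hF, hri, hb] at he
  unfold forList
  rw [wp_seq, wp_assign]
  have := hh μ (Frame.refl _ _)
  exact key l [] hv 1 _ (by simp) hc.links (h0 _) (by simp [this]) (hset _ _)

/-- Loops that append entries to a fixed row. -/
theorem wp_forRange_push {r : Reg} {lo hi e g : Expr} {b : Tab} (L H rb : ℕ) (v : ℕ → ℕ)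
    (hlo : lo.ev inp μ = L)
    (hhi : ∀ i l, hi.ev inp ((μ.setReg r i).setRow b rb l) = H)
    (he : ∀ i l, e.ev inp ((μ.setReg r i).setRow b rb l) = rb)
    (hg : ∀ i l, L ≤ i → i < H → g.ev inp ((μ.setReg r i).setRow b rb l) = v i)
    (hnr : rb < μ.nr b) (hN : (μ.row b rb).length + (H - L) ≤ N + 1)
    (hQ : ∀ t, t ≤ 3 * (H - L) + 2 →
      Q t ((μ.setReg r (max L H)).setRow b rb (μ.row b rb ++ (List.range' L (H - L)).map v))) :
    WP inp N (forRange r lo hi (push₂ b e g)) Q μ := by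
  refine wp_forRange L H (fun i t μ' => t ≤ 3 * (i - L) + 1 ∧
    μ' = (μ.setReg r i).setRow b rb (μ.row b rb ++ (List.range' L (i - L)).map v)) rfl hlo
    ?_ ?_ ?_ ?_
  · simp only [Nat.sub_self, List.range'_zero, List.map_nil, List.append_nil, le_refl,
      mul_zero, zero_add, true_and]
    ext <;> simp
    split_ifs with h
    · rw [h.1, h.2]
    · rfl
  · rintro i t μ' ⟨-, rfl⟩ - -
    exact hhi _ _
  · rintro i t μ' h1 h2 ⟨ht, rfl⟩ - -
    rw [wp_push₂, he, hg _ _ h1 h2]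
    refine ⟨⟨by simpa using hnr, by simp; omega⟩, ?_, ?_⟩
    · have : i + 1 - L = i - L + 1 := by omega
      omega
    · have : i + 1 - L = i - L + 1 := by omega
      rw [this, List.range'_1_concat]
      have h3 : L + (i - L) = i := by omega
      ext <;> simp [h3]
      · split_ifs <;> rfl
      · split_ifs <;> simp
  · rintro t μ' ⟨ht, rfl⟩ - -
    have h1 : max L H - L = H - L := by omega
    rw [h1] at ht ⊢
    exact hQ _ (by omega)

theorem map_get_range (μ : Mem) (a : Tab) (r k : ℕ) (hk : k = (μ.row a r).length) :
    (List.range' 0 k).map (μ.get a r) = μ.row a r := by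
  subst hk
  refine List.ext_getElem (by simp) fun i h1 h2 => ?_
  simp [Mem.get_eq_getElem h2]

/-- Translates a write into an array to a function update, the form in which the lemmas on `Circ`
are stated. -/
theorem getD_set_fun {l : List ℕ} {i v : ℕ} (h : i < l.length) :
    (fun j => (l.set i v).getD j 0) = Function.update (fun j => l.getD j 0) i v := by
  funext j; rw [getD_set, Function.update_apply]; simp [h]

/-- The second write evaluates both expressions again, in the memory already changed by the first
one; this is why their values are assumed twice. -/
theorem wp_link {f g : Tab} {p q : Expr} {a b : ℕ} (hp : p.ev inp μ = a) (hq : q.ev inp μ = b)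
    (hp' : p.ev inp (μ.setRow f 0 ((μ.row f 0).set a b)) = a)
    (hq' : q.ev inp (μ.setRow f 0 ((μ.row f 0).set a b)) = b) (hfg : f ≠ g)
    (hQ : Q 2 ((μ.setRow f 0 ((μ.row f 0).set a b)).setRow g 0 ((μ.row g 0).set b a))) :
    WP inp N (link f g p q) Q μ := by
  unfold link
  rw [wp_seq, wp_wr, wp_wr, hp, hq, hp', hq']
  simpa [hfg.symm] using hQ

/-- Two rows in two different one-dimensional arrays are replaced. -/
theorem Mem.setRow_pair (μ : Mem) {f g : Tab} (hfg : f ≠ g) (l l' m m' : List ℕ) :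
    (((μ.setRow f 0 l).setRow g 0 m).setRow f 0 l').setRow g 0 m'
      = (μ.setRow f 0 l').setRow g 0 m' := by
  rw [Mem.setRow_comm _ g f 0 0 _ hfg.symm, Mem.setRow_setRow, Mem.setRow_setRow]

theorem Circ.mem_of_prev {f g : ℕ → ℕ} {h : ℕ} {l : List ℕ} (hc : Circ f g h l) :
    g h ∈ h :: l := hc.links.last_mem

theorem Circ.mem_of_next {f g : ℕ → ℕ} {h : ℕ} {l : List ℕ} (hc : Circ f g h l) :
    f h ∈ h :: l := hc.links.first_mem

/-- The postcondition forgets how the new rows arise and keeps only their lengths, the new circular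
list and the entries that lie outside of it. -/
theorem wp_linkLast {f g : Tab} (hfg : f ≠ g) {h p : Expr} {hv pv : ℕ} {l : List ℕ}
    (hh : ∀ μ' : Mem, μ'.reg = μ.reg → h.ev inp μ' = hv)
    (hp : ∀ μ' : Mem, μ'.reg = μ.reg → p.ev inp μ' = pv)
    (hc : Circ (μ.get f 0) (μ.get g 0) hv l) (hpl : pv ∉ hv :: l)
    (hf : ∀ c ∈ pv :: hv :: l, c < (μ.row f 0).length)
    (hg : ∀ c ∈ pv :: hv :: l, c < (μ.row g 0).length)
    (hQ : ∀ lf lg, lf.length = (μ.row f 0).length → lg.length = (μ.row g 0).length →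
      Circ (fun i => lf.getD i 0) (fun i => lg.getD i 0) hv (l ++ [pv]) →
      (∀ c, c ∉ pv :: hv :: l → lf.getD c 0 = μ.get f 0 c) →
      (∀ c, c ∉ pv :: hv :: l → lg.getD c 0 = μ.get g 0 c) →
      Q 4 ((μ.setRow f 0 lf).setRow g 0 lg)) :
    WP inp N (linkLast f g h p) Q μ := by
  have h1 := hc.mem_of_prev
  have hpv := hpl
  simp only [List.mem_cons, not_or] at hpl
  unfold linkLast
  rw [wp_seq]
  refine wp_link (a := μ.get g 0 hv) (b := pv) (by simp [hh μ rfl]) (hp _ rfl) ?_ (hp _ rfl) hfg ?_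
  · simp [hh (μ.setRow f 0 _) rfl, hfg.symm]
  refine wp_link (a := pv) (b := hv) (hp _ rfl) (hh _ rfl) (hp _ rfl) (hh _ rfl) hfg ?_
  rw [Mem.setRow_pair _ hfg]
  have hlf : μ.get g 0 hv < (μ.row f 0).length := hf _ (List.mem_cons_of_mem _ h1)
  have hif := hc.insertLast hpv
  simp only [Mem.row_setRow, hfg, and_true, if_true, if_false]
  refine hQ _ _ (by simp) (by simp) ?_ ?_ ?_
  · rw [getD_set_fun (by simpa using hf pv (by simp)), getD_set_fun hlf,
      getD_set_fun (by simpa using hg hv (by simp)), getD_set_fun (hg pv (by simp))]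
    exact hif
  · intro c hcn
    rw [getD_set, getD_set, if_neg, if_neg]
    · rfl
    · rintro ⟨rfl, -⟩; exact hcn (List.mem_cons_of_mem _ h1)
    · rintro ⟨rfl, -⟩; simp at hcn
  · intro c hcn
    rw [getD_set, getD_set, if_neg, if_neg]
    · rfl
    · rintro ⟨rfl, -⟩; simp at hcn
    · rintro ⟨rfl, -⟩; simp at hcn

theorem wp_linkFirst {f g : Tab} (hfg : f ≠ g) {h p : Expr} {hv pv : ℕ} {l : List ℕ}
    (hh : ∀ μ' : Mem, μ'.reg = μ.reg → h.ev inp μ' = hv)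
    (hp : ∀ μ' : Mem, μ'.reg = μ.reg → p.ev inp μ' = pv)
    (hc : Circ (μ.get f 0) (μ.get g 0) hv l) (hpl : pv ∉ hv :: l)
    (hf : ∀ c ∈ pv :: hv :: l, c < (μ.row f 0).length)
    (hg : ∀ c ∈ pv :: hv :: l, c < (μ.row g 0).length)
    (hQ : ∀ lf lg, lf.length = (μ.row f 0).length → lg.length = (μ.row g 0).length →
      Circ (fun i => lf.getD i 0) (fun i => lg.getD i 0) hv (pv :: l) →
      (∀ c, c ∉ pv :: hv :: l → lf.getD c 0 = μ.get f 0 c) →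
      (∀ c, c ∉ pv :: hv :: l → lg.getD c 0 = μ.get g 0 c) →
      Q 4 ((μ.setRow f 0 lf).setRow g 0 lg)) :
    WP inp N (linkFirst f g h p) Q μ := by
  have h1 := hc.mem_of_next
  have hpv := hpl
  simp only [List.mem_cons, not_or] at hpl
  unfold linkFirst
  rw [wp_seq]
  refine wp_link (a := pv) (b := μ.get f 0 hv) (hp _ rfl) (by simp [hh μ rfl]) (hp _ rfl) ?_ hfg ?_
  · simp only [ev_rd, hh (μ.setRow f 0 _) rfl, Mem.get_setRow, and_self, if_true]
    rw [getD_set, if_neg]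
    · rfl
    · rintro ⟨h, -⟩; exact hpl.1 h.symm
  refine wp_link (a := hv) (b := pv) (hh _ rfl) (hp _ rfl) (hh _ rfl) (hp _ rfl) hfg ?_
  rw [Mem.setRow_pair _ hfg]
  have hlg : μ.get f 0 hv < (μ.row g 0).length := hg _ (List.mem_cons_of_mem _ h1)
  have hif := hc.insertFirst hpv
  simp only [Mem.row_setRow, hfg, and_true, if_true, if_false]
  refine hQ _ _ (by simp) (by simp) ?_ ?_ ?_
  · rw [getD_set_fun (by simpa using hf hv (by simp)), getD_set_fun (hf pv (by simp)),
      getD_set_fun (by simpa using hg pv (by simp)), getD_set_fun hlg]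
    exact hif
  · intro c hcn
    rw [getD_set, getD_set, if_neg, if_neg]
    · rfl
    · rintro ⟨rfl, -⟩; simp at hcn
    · rintro ⟨rfl, -⟩; simp at hcn
  · intro c hcn
    rw [getD_set, getD_set, if_neg, if_neg]
    · rfl
    · rintro ⟨rfl, -⟩; exact hcn (List.mem_cons_of_mem _ h1)
    · rintro ⟨rfl, -⟩; simp at hcn

theorem Circ.next_mem {f g : ℕ → ℕ} {h p : ℕ} {l₁ l₂ : List ℕ} (hc : Circ f g h (l₁ ++ p :: l₂)) :
    f p ∈ h :: (l₁ ++ l₂) ∧ g p ∈ h :: (l₁ ++ l₂) := by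
  have hl := hc.links
  rw [links_append] at hl
  have h1 := hl.1.last_mem
  have h2 := hl.2.first_mem
  simp only [List.mem_cons, List.mem_append] at h1 h2 ⊢
  tauto

theorem wp_unlink {f g : Tab} (hfg : f ≠ g) {p : Expr} {hv pv : ℕ} {l₁ l₂ : List ℕ}
    (hp : ∀ μ' : Mem, μ'.reg = μ.reg → p.ev inp μ' = pv)
    (hc : Circ (μ.get f 0) (μ.get g 0) hv (l₁ ++ pv :: l₂))
    (hf : ∀ c ∈ hv :: (l₁ ++ pv :: l₂), c < (μ.row f 0).length)
    (hg : ∀ c ∈ hv :: (l₁ ++ pv :: l₂), c < (μ.row g 0).length)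
    (hQ : ∀ lf lg, lf.length = (μ.row f 0).length → lg.length = (μ.row g 0).length →
      Circ (fun i => lf.getD i 0) (fun i => lg.getD i 0) hv (l₁ ++ l₂) →
      (∀ c, c ∉ hv :: (l₁ ++ l₂) → lf.getD c 0 = μ.get f 0 c) →
      (∀ c, c ∉ hv :: (l₁ ++ l₂) → lg.getD c 0 = μ.get g 0 c) →
      Q 2 ((μ.setRow f 0 lf).setRow g 0 lg)) :
    WP inp N (unlink f g p) Q μ := by
  obtain ⟨h1, h2⟩ := hc.next_mem
  have hs : ∀ c ∈ hv :: (l₁ ++ l₂), c ∈ hv :: (l₁ ++ pv :: l₂) := by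
    intro c; simp only [List.mem_cons, List.mem_append]; tauto
  unfold unlink
  refine wp_link (a := μ.get g 0 pv) (b := μ.get f 0 pv) (by simp [hp μ rfl]) (by simp [hp μ rfl])
    ?_ ?_ hfg (hQ _ _ (by simp) (by simp) ?_ ?_ ?_)
  · simp [hp (μ.setRow f 0 _) rfl, hfg.symm]
  · simp only [ev_rd, hp (μ.setRow f 0 _) rfl, Mem.get_setRow, and_self, if_true]
    rw [getD_set]; split_ifs <;> rfl
  · rw [getD_set_fun (hf _ (hs _ h2)), getD_set_fun (hg _ (hs _ h1))]
    exact hc.remove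
  · intro c hcn
    rw [getD_set, if_neg]
    · rfl
    · rintro ⟨rfl, -⟩; exact hcn h2
  · intro c hcn
    rw [getD_set, if_neg]
    · rfl
    · rintro ⟨rfl, -⟩; exact hcn h1

theorem wp_moveList {h h' : Expr} {hv hv' : ℕ} {l : List ℕ}
    (hh : ∀ μ' : Mem, μ'.reg = μ.reg → h.ev inp μ' = hv)
    (hh' : ∀ μ' : Mem, μ'.reg = μ.reg → h'.ev inp μ' = hv')
    (hc : Circ (μ.get .nxt 0) (μ.get .prv 0) hv l) (hl : l ≠ []) (hvl : hv' ∉ hv :: l)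
    (hf : ∀ c ∈ hv' :: hv :: l, c < (μ.row .nxt 0).length)
    (hg : ∀ c ∈ hv' :: hv :: l, c < (μ.row .prv 0).length)
    (hQ : ∀ lf lg, lf.length = (μ.row .nxt 0).length → lg.length = (μ.row .prv 0).length →
      Circ (fun i => lf.getD i 0) (fun i => lg.getD i 0) hv' l →
      Circ (fun i => lf.getD i 0) (fun i => lg.getD i 0) hv [] →
      (∀ c, c ∉ hv' :: hv :: l → lf.getD c 0 = μ.get .nxt 0 c) →
      (∀ c, c ∉ hv' :: hv :: l → lg.getD c 0 = μ.get .prv 0 c) →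
      Q 6 ((μ.setRow .nxt 0 lf).setRow .prv 0 lg)) :
    WP inp N (moveList h h') Q μ := by
  have h1 := hc.mem_of_next
  have h2 := hc.mem_of_prev
  have h3 : μ.get .nxt 0 hv ≠ hv := fun h => hl (hc.eq_nil_iff.1 h)
  have hne : hv' ≠ hv := by rintro rfl; simp at hvl
  have hif := hc.rehead hl hvl
  have hfg : Tab.nxt ≠ Tab.prv := by decide
  unfold moveList
  rw [wp_seq]
  refine wp_link (a := hv') (b := μ.get .nxt 0 hv) (hh' _ rfl) (by simp [hh μ rfl]) (hh' _ rfl) ?_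
    hfg ?_
  · simp only [ev_rd, hh (μ.setRow .nxt 0 _) rfl, Mem.get_setRow, and_self, if_true]
    rw [getD_set, if_neg]
    · rfl
    · rintro ⟨h, -⟩; exact hne h.symm
  have h4 : ∀ μ', μ'.reg = μ.reg → μ'.get .prv 0 hv = μ.get .prv 0 hv →
      (rd .prv h).ev inp μ' = μ.get .prv 0 hv := by
    intro μ' h5 h6; simp [hh μ' h5, h6]
  have h5 : ((μ.row .prv 0).set (μ.get .nxt 0 hv) hv').getD hv 0 = μ.get .prv 0 hv := by
    rw [getD_set, if_neg]
    · rfl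
    · rintro ⟨h, -⟩; exact h3 h.symm
  rw [wp_seq]
  refine wp_link (a := μ.get .prv 0 hv) (b := hv') (h4 _ rfl (by simp [-List.getD_eq_getElem?_getD, h5])) (hh' _ rfl)
    (h4 _ rfl (by simp [-List.getD_eq_getElem?_getD, h5])) (hh' _ rfl) hfg ?_
  refine wp_link (a := hv) (b := hv) (hh _ rfl) (hh _ rfl) (hh _ rfl) (hh _ rfl) hfg ?_
  rw [Mem.setRow_pair _ hfg, Mem.setRow_pair _ hfg]
  simp only [Mem.row_setRow, and_true, if_true, if_false, reduceCtorEq]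
  have f1 := hf hv' (by simp)
  have f2 := hf hv (by simp)
  have f3 := hf _ (List.mem_cons_of_mem _ h2)
  have g1 := hg hv' (by simp)
  have g2 := hg hv (by simp)
  have g3 := hg _ (List.mem_cons_of_mem _ h1)
  have e1 : (fun i => ((((μ.row .nxt 0).set hv' (μ.get .nxt 0 hv)).set (μ.get .prv 0 hv) hv').set
      hv hv).getD i 0) = Function.update (Function.update (Function.update (μ.get .nxt 0) hv'
        (μ.get .nxt 0 hv)) (μ.get .prv 0 hv) hv') hv hv := by
    rw [getD_set_fun (by simpa using f2), getD_set_fun (by simpa using f3), getD_set_fun f1]; rfl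
  have e2 : (fun i => ((((μ.row .prv 0).set (μ.get .nxt 0 hv) hv').set hv' (μ.get .prv 0 hv)).set
      hv hv).getD i 0) = Function.update (Function.update (Function.update (μ.get .prv 0)
        (μ.get .nxt 0 hv) hv') hv' (μ.get .prv 0 hv)) hv hv := by
    rw [getD_set_fun (by simpa using g2), getD_set_fun (by simpa using g1), getD_set_fun g3]; rfl
  refine hQ _ _ (by simp) (by simp) ?_ ?_ ?_ ?_
  · rw [e1, e2]; exact hif.1
  · rw [e1, e2]; exact hif.2
  · intro c hcn
    rw [congrFun e1 c, Function.update_of_ne, Function.update_of_ne, Function.update_of_ne]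
    · rintro rfl; simp at hcn
    · rintro rfl; exact hcn (List.mem_cons_of_mem _ h2)
    · rintro rfl; simp at hcn
  · intro c hcn
    rw [congrFun e2 c, Function.update_of_ne, Function.update_of_ne, Function.update_of_ne]
    · rintro rfl; exact hcn (List.mem_cons_of_mem _ h1)
    · rintro rfl; simp at hcn
    · rintro rfl; simp at hcn

end

/-! ### The refinement step -/

/-- A transition system on `{0, …, n - 1}`, given by the lists `pr y` of predecessors of `y`, with a
simulation `le`, and a set `reps` that meets every class of the simulation equivalence. -/
structure System (n : ℕ) (pr : ℕ → List ℕ) (le : ℕ → ℕ → Prop) (reps : Finset ℕ) : Prop where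
  pr_lt : ∀ x y, x ∈ pr y → x < n ∧ y < n
  le_lt : ∀ a b, le a b → a < n ∧ b < n
  le_step : ∀ a b y, le a b → a ∈ pr y → ∃ y', b ∈ pr y' ∧ le y y'
  reps_lt : ∀ e ∈ reps, e < n
  exists_rep : ∀ s, s < n → ∃ e ∈ reps, le s e ∧ le e s

/-- The states with a transition to a state that is related to `s`. -/
def Pre (pr : ℕ → List ℕ) (R : ℕ → ℕ → Prop) (s x : ℕ) : Prop := ∃ y, x ∈ pr y ∧ R s y

/-- The states that are not yet processed for the block of `s`. -/
def Live (pr : ℕ → List ℕ) (R M : ℕ → ℕ → Prop) (s x : ℕ) : Prop := Pre pr R s x ∨ M s x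

/-- The invariant of the refinement: `blk` gives the blocks, `R s t` says that the block of `t` is
related to the block of `s`, and `M s` is the remove set of the block of `s`. -/
structure Good (n : ℕ) (pr : ℕ → List ℕ) (le : ℕ → ℕ → Prop) (blk : ℕ → ℕ) (R M : ℕ → ℕ → Prop) :
    Prop where
  blk_eq : ∀ s t, le s t → le t s → blk s = blk t
  R_left : ∀ s s' t, blk s = blk s' → R s t → R s' t
  R_up : ∀ s t t', s < n → R s t → le t t' → R s t'
  M_lt : ∀ s x, M s x → x < n
  M_left : ∀ s s' x, blk s = blk s' → M s x → M s' x
  M_pre : ∀ s x, s < n → M s x → ¬ Pre pr R s x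
  M_eqv : ∀ s x x', s < n → M s x → le x x' → le x' x → M s x'
  cover : ∀ x y x', x ∈ pr y → R x x' → Live pr R M y x'

/-- The effect of one round of the algorithm, which processes the remove set of the block of `b`. -/
structure Step (n : ℕ) (pr : ℕ → List ℕ) (b : ℕ) (blk : ℕ → ℕ) (R M : ℕ → ℕ → Prop) (blk' : ℕ → ℕ)
    (R' M' : ℕ → ℕ → Prop) : Prop where
  lt : b < n
  blk_iff : ∀ s t, s < n → t < n → (blk' s = blk' t ↔ blk s = blk t ∧ (M b s ↔ M b t))
  R_iff : ∀ s t, s < n →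
    (R' s t ↔ R s t ∧ ¬ (M b t ∧ ∃ x y, x ∈ pr y ∧ blk' x = blk' s ∧ blk y = blk b))
  M_iff : ∀ s x, s < n → (M' s x ↔ (M s x ∧ blk s ≠ blk b) ∨ (Pre pr R s x ∧ ¬ Pre pr R' s x))

section
variable {n : ℕ} {pr : ℕ → List ℕ} {le : ℕ → ℕ → Prop} {reps : Finset ℕ} {b : ℕ}
  {blk blk' : ℕ → ℕ} {R M R' M' : ℕ → ℕ → Prop}

/-- A simulating state answers the transition by one whose target simulates the old target, and the
relation is closed upwards. -/
theorem Good.pre_up (hS : System n pr le reps) (hG : Good n pr le blk R M) {s t t' : ℕ} (hs : s < n)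
    (h : Pre pr R s t) (hle : le t t') : Pre pr R s t' := by
  obtain ⟨y, hy, hR⟩ := h
  obtain ⟨y', hy', hle'⟩ := hS.le_step t t' y hle hy
  exact ⟨y', hy', hG.R_up s y y' hs hR hle'⟩

theorem Step.R_sub (hT : Step n pr b blk R M blk' R' M') {s t : ℕ} (hs : s < n) (h : R' s t) :
    R s t := ((hT.R_iff s t hs).1 h).1

theorem Step.pre_sub (hT : Step n pr b blk R M blk' R' M') {s t : ℕ} (hs : s < n)
    (h : Pre pr R' s t) : Pre pr R s t :=
  let ⟨y, hy, hR⟩ := h; ⟨y, hy, hT.R_sub hs hR⟩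

/-- If `t'` were cut off from `s` because of a transition `x → y` into the selected block, then `t`
is not in its remove set, as otherwise `t` would have been cut off too. By `cover`, `t` has a
transition to a state related to `y`; then so has `t'`, which contradicts that `t'` is in the remove
set. -/
theorem Step.R_up (hS : System n pr le reps) (hG : Good n pr le blk R M)
    (hT : Step n pr b blk R M blk' R' M') {s t t' : ℕ} (hs : s < n) (h : R' s t) (hle : le t t') :
    R' s t' := by
  rw [hT.R_iff s _ hs] at h ⊢
  refine ⟨hG.R_up s t t' hs h.1 hle, ?_⟩
  rintro ⟨hM, x, y, hxy, hx, hy⟩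
  have hlt := hS.pr_lt x y hxy
  have hnM : ¬ M b t := fun hMt => h.2 ⟨hMt, x, y, hxy, hx, hy⟩
  have hxR : R x t := hG.R_left s x t ((hT.blk_iff x s hlt.1 hs).1 hx).1.symm h.1
  rcases hG.cover x y t hxy hxR with ⟨z, hz, hR⟩ | h1
  · have h2 : Pre pr R b t := ⟨z, hz, hG.R_left _ _ _ hy hR⟩
    exact hG.M_pre b t' hT.lt hM (hG.pre_up hS hT.lt h2 hle)
  · exact hnM (hG.M_left _ _ _ hy h1)

/-- Only `R_up` and `cover` require an idea. For `cover`, a state that loses its last transition to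
related states enters the new remove set, and a discarded remove set does no harm because exactly
the pairs that depended on it are deleted. The compatibility of the new relation and remove sets
with the blocks is assumed, as it is immediate for data stored per block. -/
theorem Step.good (hS : System n pr le reps) (hG : Good n pr le blk R M)
    (hT : Step n pr b blk R M blk' R' M')
    (hR : ∀ s s' t, blk' s = blk' s' → R' s t → R' s' t)
    (hM : ∀ s s' x, blk' s = blk' s' → M' s x → M' s' x) (hMlt : ∀ s x, M' s x → x < n) :
    Good n pr le blk' R' M' where
  blk_eq s t h1 h2 := (hT.blk_iff s t (hS.le_lt s t h1).1 (hS.le_lt s t h1).2).2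
    ⟨hG.blk_eq s t h1 h2, fun h => hG.M_eqv b s t hT.lt h h1 h2,
      fun h => hG.M_eqv b t s hT.lt h h2 h1⟩
  R_left := hR
  R_up s t t' hs h hle := hT.R_up hS hG hs h hle
  M_lt := hMlt
  M_left := hM
  M_pre s x hs h hp := by
    rcases (hT.M_iff s x hs).1 h with h1 | h1
    · exact hG.M_pre s x hs h1.1 (hT.pre_sub hs hp)
    · exact h1.2 hp
  M_eqv s x x' hs h h1 h2 := by
    rw [hT.M_iff s _ hs] at h ⊢
    rcases h with h | h
    · exact Or.inl ⟨hG.M_eqv s x x' hs h.1 h1 h2, h.2⟩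
    · refine Or.inr ⟨hG.pre_up hS hs h.1 h1, ?_⟩
      rintro ⟨y, hy, hR'⟩
      obtain ⟨y', hy', hle'⟩ := hS.le_step x' x y h2 hy
      exact h.2 ⟨y', hy', hT.R_up hS hG hs hR' hle'⟩
  cover x y x' hxy h := by
    obtain ⟨hx, hy⟩ := hS.pr_lt x y hxy
    obtain ⟨h1, h2⟩ := (hT.R_iff x x' hx).1 h
    have key : Pre pr R y x' → Live pr R' M' y x' := fun h3 => by
      by_cases h4 : Pre pr R' y x'
      · exact Or.inl h4
      · exact Or.inr ((hT.M_iff y x' hy).2 (Or.inr ⟨h3, h4⟩))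
    rcases hG.cover x y x' hxy h1 with h3 | h3
    · exact key h3
    · by_cases hb : blk y = blk b
      · exact absurd ⟨hG.M_left y b x' hb h3, x, y, hxy, rfl, hb⟩ h2
      · exact Or.inr ((hT.M_iff y x' hy).2 (Or.inl ⟨h3, hb⟩))

/-- New elements of remove sets were predecessors of related states before, hence live already. -/
theorem Step.live_sub (hT : Step n pr b blk R M blk' R' M') {s x : ℕ} (hs : s < n)
    (h : Live pr R' M' s x) : Live pr R M s x := by
  rcases h with h | h
  · exact Or.inl (hT.pre_sub hs h)
  · rcases (hT.M_iff s x hs).1 h with h | h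
    · exact Or.inr h.1
    · exact Or.inl h.1

/-- A processed state can never return: it has no transition to related states, and only states that
lose such a transition are added to remove sets. -/
theorem Step.not_live (hG : Good n pr le blk R M) (hT : Step n pr b blk R M blk' R' M') {s x : ℕ}
    (hs : s < n) (hb : blk s = blk b) (hM : M b x) : ¬ Live pr R' M' s x := by
  have h1 := hG.M_pre s x hs (hG.M_left b s x hb.symm hM)
  rintro (h | h)
  · exact h1 (hT.pre_sub hs h)
  · rcases (hT.M_iff s x hs).1 h with h | h
    · exact h.2 hb
    · exact h1 h.1

/-! ### Potentials -/

/-- The weight of a state: one more than the number of its predecessors. -/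
def wt (pr : ℕ → List ℕ) (s : ℕ) : ℕ := (pr s).length + 1

open Classical in
/-- Weighted number of pairs of a state and a class that is not yet processed for it. -/
noncomputable def pot₁ (n : ℕ) (pr : ℕ → List ℕ) (reps : Finset ℕ) (R M : ℕ → ℕ → Prop) : ℕ :=
  ∑ y ∈ Finset.range n, wt pr y * (reps.filter fun e => Live pr R M y e).card

open Classical in
/-- Number of pairs of a class and a state that is not yet processed for it. -/
noncomputable def pot₂ (n : ℕ) (pr : ℕ → List ℕ) (reps : Finset ℕ) (R M : ℕ → ℕ → Prop) : ℕ :=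
  ∑ e ∈ reps, ((Finset.range n).filter fun x => Live pr R M e x).card

open Classical in
/-- Weighted number of pairs of a class and a state that is related to it. -/
noncomputable def pot₃ (n : ℕ) (pr : ℕ → List ℕ) (reps : Finset ℕ) (R : ℕ → ℕ → Prop) : ℕ :=
  ∑ e ∈ reps, ∑ d ∈ (Finset.range n).filter fun d => R e d, wt pr d

theorem pot₁_le (R M : ℕ → ℕ → Prop) :
    pot₁ n pr reps R M ≤ (∑ y ∈ Finset.range n, wt pr y) * reps.card := by
  classical
  unfold pot₁
  rw [Finset.sum_mul]
  exact Finset.sum_le_sum fun y _ => Nat.mul_le_mul_left _ (Finset.card_filter_le _ _)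

theorem pot₂_le (R M : ℕ → ℕ → Prop) : pot₂ n pr reps R M ≤ n * reps.card := by
  classical
  unfold pot₂
  refine (Finset.sum_le_card_nsmul _ _ n fun e _ => ?_).trans (by rw [smul_eq_mul, mul_comm])
  exact (Finset.card_filter_le _ _).trans (by simp)

theorem pot₃_le (R : ℕ → ℕ → Prop) :
    pot₃ n pr reps R ≤ (∑ y ∈ Finset.range n, wt pr y) * reps.card := by
  classical
  unfold pot₃
  refine (Finset.sum_le_card_nsmul _ _ _ fun e _ => ?_).trans (by rw [smul_eq_mul, mul_comm])
  exact Finset.sum_le_sum_of_subset (Finset.filter_subset _ _)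

/-- Each block inside the remove set contains a representative, and these representatives cease to
be live for all states of the selected block. Thus the product of the weight of the selected block
and the number of blocks to be removed is paid for. -/
theorem Step.pot₁_add_le (hS : System n pr le reps) (hG : Good n pr le blk R M)
    (hT : Step n pr b blk R M blk' R' M') (hG' : Good n pr le blk' R' M')
    {Bs rl : List ℕ} (hBs : Bs.Nodup) (hBs' : ∀ y ∈ Bs, y < n ∧ blk y = blk b) (hrl : rl.Nodup)
    (hrl' : ∀ D ∈ rl, ∃ x, M b x ∧ blk' x = D) :
    pot₁ n pr reps R' M' + (Bs.map (wt pr)).sum * rl.length ≤ pot₁ n pr reps R M := by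
  classical
  -- Remove sets are closed under simulation equivalence, so a state of the block can be replaced by
  -- its representative, which lies in the same block.
  have hcard : rl.length ≤ (reps.filter fun e => M b e).card := by
    rw [← List.toFinset_card_of_nodup hrl]
    refine (Finset.card_le_card ?_).trans (Finset.card_image_le (f := blk'))
    intro D hD
    obtain ⟨x, hx, rfl⟩ := hrl' D (by simpa using hD)
    obtain ⟨e, he, h1, h2⟩ := hS.exists_rep x (hG.M_lt _ _ hx)
    refine Finset.mem_image.2 ⟨e, Finset.mem_filter.2 ⟨he, hG.M_eqv b x e hT.lt hx h1 h2⟩, ?_⟩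
    exact hG'.blk_eq e x h2 h1
  have hsum : (Bs.map (wt pr)).sum * rl.length
      ≤ ∑ y ∈ Finset.range n, if y ∈ Bs then wt pr y * rl.length else 0 := by
    rw [← List.sum_toFinset _ hBs, Finset.sum_mul, ← Finset.sum_filter]
    refine Finset.sum_le_sum_of_subset fun y hy => ?_
    simp only [List.mem_toFinset] at hy
    simpa [hy] using (hBs' y hy).1
  refine (Nat.add_le_add_left hsum _).trans ?_
  unfold pot₁
  rw [← Finset.sum_add_distrib]
  refine Finset.sum_le_sum fun y hy => ?_
  have hy := Finset.mem_range.1 hy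
  split_ifs with h
  · rw [← mul_add]
    refine Nat.mul_le_mul_left _ ((Nat.add_le_add_left hcard _).trans ?_)
    rw [← Finset.card_union_of_disjoint]
    · refine Finset.card_le_card (Finset.union_subset ?_ ?_)
      · exact Finset.monotone_filter_right _ fun e he h => hT.live_sub hy h
      · exact Finset.monotone_filter_right _ fun e he h' =>
          Or.inr (hG.M_left b y e (hBs' y h).2.symm h')
    · rw [Finset.disjoint_filter]
      exact fun e he h1 h2 => hT.not_live hG hy (hBs' y h).2 h2 h1
  · rw [add_zero]
    refine Nat.mul_le_mul_left _ (Finset.card_le_card ?_)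
    exact Finset.monotone_filter_right _ fun e he h => hT.live_sub hy h

/-- The representative of `b` lies in the selected block, and all pairs of it with a state of the
remove set die. -/
theorem Step.pot₂_add_le (hS : System n pr le reps) (hG : Good n pr le blk R M)
    (hT : Step n pr b blk R M blk' R' M') {Rm : List ℕ} (hRm : Rm.Nodup)
    (hRm' : ∀ x ∈ Rm, M b x) :
    pot₂ n pr reps R' M' + Rm.length ≤ pot₂ n pr reps R M := by
  classical
  obtain ⟨e, he, h1, h2⟩ := hS.exists_rep b hT.lt
  have heb := hG.blk_eq e b h2 h1
  have hen := hS.reps_lt e he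
  unfold pot₂
  rw [← Finset.add_sum_erase _ _ he, ← Finset.add_sum_erase (h := he)]
  have h3 : ∑ e ∈ reps.erase e, ((Finset.range n).filter fun x => Live pr R' M' e x).card ≤
      ∑ e ∈ reps.erase e, ((Finset.range n).filter fun x => Live pr R M e x).card :=
    Finset.sum_le_sum fun s hs => Finset.card_le_card
      (Finset.monotone_filter_right _ fun x _ h =>
        hT.live_sub (hS.reps_lt s (Finset.mem_of_mem_erase hs)) h)
  have h4 : ((Finset.range n).filter fun x => Live pr R' M' e x).card + Rm.length ≤
      ((Finset.range n).filter fun x => Live pr R M e x).card := by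
    rw [← List.toFinset_card_of_nodup hRm, ← Finset.card_union_of_disjoint]
    · refine Finset.card_le_card (Finset.union_subset ?_ ?_)
      · exact Finset.monotone_filter_right _ fun x _ h => hT.live_sub hen h
      · intro x hx
        have hx := hRm' x (by simpa using hx)
        exact Finset.mem_filter.2 ⟨Finset.mem_range.2 (hG.M_lt _ _ hx),
          Or.inr (hG.M_left b e x heb.symm hx)⟩
    · rw [Finset.disjoint_left]
      intro x hx hx'
      exact hT.not_live hG hen heb (hRm' x (by simpa using hx')) (Finset.mem_filter.1 hx).2
  omega

/-- When `D` is removed from the relation of `C`, a representative inside `C` loses all the states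
of `D`, and their weights pay for scanning the predecessor lists of `D`. Distinct blocks `C` have
distinct representatives and distinct blocks `D` are disjoint, so nothing is charged twice. -/
theorem Step.pot₃_add_le (hS : System n pr le reps)
    (hT : Step n pr b blk R M blk' R' M') (hG' : Good n pr le blk' R' M')
    {cl rl : List ℕ} (hcl : cl.Nodup) (hrl : rl.Nodup)
    (hcl' : ∀ C ∈ cl, ∃ x y, x ∈ pr y ∧ blk' x = C ∧ blk y = blk b)
    (hrl' : ∀ D ∈ rl, ∀ x, x < n → blk' x = D → M b x)
    (rel : ℕ → ℕ → ℕ) (hrel : ∀ s t, s < n → t < n → rel (blk' s) (blk' t) ≠ 0 → R s t)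
    (W : ℕ → ℕ) (hW : ∀ D ∈ rl, W D = ∑ d ∈ (Finset.range n).filter (fun d => blk' d = D), wt pr d) :
    pot₃ n pr reps R' + (cl.map fun C => (rl.map fun D => if rel C D ≠ 0 then W D else 0).sum).sum
      ≤ pot₃ n pr reps R := by
  classical
  set g : ℕ → ℕ := fun C => (rl.map fun D => if rel C D ≠ 0 then W D else 0).sum with hg
  -- Choosing a representative in each block of `cl` is injective, which turns the sum over blocks
  -- into a sum over representatives.
  have hcl2 : (cl.map g).sum ≤ ∑ e ∈ reps, if blk' e ∈ cl then g (blk' e) else 0 := by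
    have hrep : ∀ C ∈ cl, ∃ e ∈ reps, blk' e = C := by
      intro C hC
      obtain ⟨x, y, hxy, rfl, -⟩ := hcl' C hC
      obtain ⟨e, he, h1, h2⟩ := hS.exists_rep x (hS.pr_lt x y hxy).1
      exact ⟨e, he, hG'.blk_eq e x h2 h1⟩
    choose! f hf1 hf2 using hrep
    rw [← List.sum_toFinset _ hcl, ← Finset.sum_filter]
    have hinj : Set.InjOn f (cl.toFinset : Set ℕ) := by
      intro C hC C' hC' h
      simp only [List.coe_toFinset, Set.mem_ofPred_eq] at hC hC'
      rw [← hf2 C hC, ← hf2 C' hC', h]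
    have : ∑ C ∈ cl.toFinset, g C = ∑ e ∈ cl.toFinset.image f, g (blk' e) := by
      rw [Finset.sum_image hinj]
      exact Finset.sum_congr rfl fun C hC => by rw [hf2 C (by simpa using hC)]
    rw [this]
    refine Finset.sum_le_sum_of_subset fun e he => ?_
    obtain ⟨C, hC, rfl⟩ := Finset.mem_image.1 he
    have hC : C ∈ cl := by simpa using hC
    exact Finset.mem_filter.2 ⟨hf1 C hC, by rwa [hf2 C hC]⟩
  refine (Nat.add_le_add_left hcl2 _).trans ?_
  unfold pot₃
  rw [← Finset.sum_add_distrib]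
  refine Finset.sum_le_sum fun e he => ?_
  have hen := hS.reps_lt e he
  split_ifs with hC
  · have h1 : g (blk' e) ≤ ∑ d ∈ (Finset.range n).filter (fun d => R e d ∧ ¬ R' e d), wt pr d := by
      have h2 : g (blk' e) = ∑ D ∈ rl.toFinset, ∑ d ∈ (Finset.range n).filter
          (fun d => blk' d = D ∧ rel (blk' e) D ≠ 0), wt pr d := by
        simp only [hg]
        rw [← List.sum_toFinset _ hrl]
        refine Finset.sum_congr rfl fun D hD => ?_
        split_ifs with h
        · rw [hW D (by simpa using hD)]; simp [h]
        · symm; apply Finset.sum_eq_zero; intro d hd; simp_all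
      rw [h2, ← Finset.sum_biUnion]
      · refine Finset.sum_le_sum_of_subset fun d hd => ?_
        simp only [Finset.mem_biUnion, List.mem_toFinset, Finset.mem_filter, Finset.mem_range] at hd
        obtain ⟨D, hD, hd, rfl, hr⟩ := hd
        refine Finset.mem_filter.2 ⟨Finset.mem_range.2 hd, hrel e d hen hd hr, fun h => ?_⟩
        obtain ⟨x, y, h3, h4, h5⟩ := hcl' _ hC
        exact ((hT.R_iff e d hen).1 h).2 ⟨hrl' _ hD d hd rfl, x, y, h3, h4, h5⟩
      · intro D _ D' _ hne
        simp only [Function.onFun]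
        rw [Finset.disjoint_filter]
        rintro d - ⟨h1, -⟩ ⟨h2, -⟩
        exact hne (h1.symm.trans h2)
    refine (Nat.add_le_add_left h1 _).trans ?_
    rw [← Finset.sum_union]
    · refine Finset.sum_le_sum_of_subset (Finset.union_subset ?_ ?_)
      · exact Finset.monotone_filter_right _ fun d _ h => hT.R_sub hen h
      · exact Finset.monotone_filter_right _ fun d _ h => h.1
    · rw [Finset.disjoint_filter]
      exact fun d _ h1 h2 => h2.2 h1
  · rw [add_zero]
    refine Finset.sum_le_sum_of_subset ?_
    exact Finset.monotone_filter_right _ fun d _ h => hT.R_sub hen h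

/-- A function that is constant on the classes of the simulation equivalence takes at most as many
values as there are representatives. -/
theorem System.le_card (hS : System n pr le reps) (blk : ℕ → ℕ) (k : ℕ)
    (hb : ∀ s t, le s t → le t s → blk s = blk t)
    (hk : ∀ i, 1 ≤ i → i ≤ k → ∃ s, s < n ∧ blk s = i) : k ≤ reps.card := by
  have : k = (Finset.Icc 1 k).card := by simp
  rw [this]
  refine (Finset.card_le_card ?_).trans (Finset.card_image_le (f := blk))
  intro i hi
  rw [Finset.mem_Icc] at hi
  obtain ⟨s, hs, rfl⟩ := hk i hi.1 hi.2
  obtain ⟨e, he, h1, h2⟩ := hS.exists_rep s hs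
  exact Finset.mem_image.2 ⟨e, he, hb e s h2 h1⟩

end

/-! ### The list of blocks -/

/-- In the list of blocks, `l₁` comes before the block in the register `cur` and `l₂` after it. -/
structure BlockList (μ : Mem) (l₁ l₂ : List ℕ) : Prop where
  circ : Circ (μ.get .bnxt 0) (μ.get .bprv 0) 0 (l₁ ++ l₂)
  cur : μ.reg .cur = l₂.headD 0

section
variable {inp : Input} {N : ℕ} {p q : Cmd} {Q : ℕ → Mem → Prop} {μ : Mem} {e : Expr} {b : ℕ}
  {l₁ l₂ : List ℕ}

theorem BlockList.congr {μ' : Mem} (h : BlockList μ l₁ l₂) (h1 : μ'.row .bnxt 0 = μ.row .bnxt 0)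
    (h2 : μ'.row .bprv 0 = μ.row .bprv 0) (h3 : μ'.reg .cur = μ.reg .cur) :
    BlockList μ' l₁ l₂ := by
  have e1 : μ'.get .bnxt 0 = μ.get .bnxt 0 := by funext i; simp [Mem.get, h1]
  have e2 : μ'.get .bprv 0 = μ.get .bprv 0 := by funext i; simp [Mem.get, h2]
  exact ⟨by rw [e1, e2]; exact h.circ, by rw [h3]; exact h.cur⟩

/-- The header `0` is not a block number, so it can serve as the value of `cur` when no block is
left to be processed. -/
theorem BlockList.cur_eq_zero (h : BlockList μ l₁ l₂) : μ.reg .cur = 0 ↔ l₂ = [] := by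
  rw [h.cur]
  cases l₂ with
  | nil => simp
  | cons a l =>
    have := (List.nodup_cons.1 h.circ.nodup).1
    simp only [List.mem_append, List.mem_cons, not_or] at this
    simp [Ne.symm this.2.1]

/-- Frames report `x` as modified because of the dummy assignment in `ifThen`; that its value
persists is therefore part of the postcondition, and `wp_decrement` relies on it. -/
theorem wp_appendBlock (he : ∀ μ' : Mem, μ'.reg = μ.reg → e.ev inp μ' = b)
    (h : BlockList μ l₁ l₂) (hb : b ∉ 0 :: (l₁ ++ l₂))
    (hf : ∀ c ∈ b :: 0 :: (l₁ ++ l₂), c < (μ.row .bnxt 0).length)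
    (hg : ∀ c ∈ b :: 0 :: (l₁ ++ l₂), c < (μ.row .bprv 0).length)
    (hQ : ∀ t μ', t ≤ 6 → Frame (appendBlock e) μ μ' → μ'.reg .x = μ.reg .x →
      BlockList μ' l₁ (l₂ ++ [b]) → Q t μ') :
    WP inp N (appendBlock e) Q μ := by
  refine WP.conseq (Q := fun t μ' => t ≤ 6 ∧ μ'.reg .x = μ.reg .x ∧ BlockList μ' l₁ (l₂ ++ [b])) ?_
    fun t μ' h hF => hQ t μ' h.1 hF h.2.1 h.2.2
  unfold appendBlock
  rw [wp_seq]
  refine wp_linkLast (by decide) (fun _ _ => rfl) he h.circ hb hf hg fun lf lg _ _ hc _ _ => ?_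
  rw [List.append_assoc] at hc
  have hc1 := h.cur_eq_zero
  have hc2 := h.cur
  rw [wp_ifThen, wp_assign]
  constructor
  · intro h0
    simp only [ev_eq, ev_reg, ev_zero, Mem.reg_setRow, hc1] at h0
    have h0 : l₂ = [] := by by_contra h; simp [h] at h0
    subst h0
    have h1 := he ((μ.setRow .bnxt 0 lf).setRow .bprv 0 lg) rfl
    exact ⟨by omega, by simp, ⟨by simpa [Mem.get_setRow_fun] using hc, by simp [h1]⟩⟩
  · intro h0
    simp only [ev_eq, ev_reg, ev_zero, Mem.reg_setRow, hc1] at h0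
    have h0 : l₂ ≠ [] := by intro h; simp [h] at h0
    refine ⟨by omega, by simp, ⟨by simpa [Mem.get_setRow_fun] using hc, ?_⟩⟩
    simp only [Mem.reg_setRow, hc2]
    cases l₂ <;> simp at h0 ⊢

theorem wp_prependBlock (he : ∀ μ' : Mem, μ'.reg = μ.reg → e.ev inp μ' = b)
    (h : BlockList μ l₁ l₂) (hb : b ∉ 0 :: (l₁ ++ l₂))
    (hf : ∀ c ∈ b :: 0 :: (l₁ ++ l₂), c < (μ.row .bnxt 0).length)
    (hg : ∀ c ∈ b :: 0 :: (l₁ ++ l₂), c < (μ.row .bprv 0).length)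
    (hQ : ∀ t μ', t ≤ 6 → Frame (prependBlock e) μ μ' → BlockList μ' (b :: l₁) l₂ → Q t μ') :
    WP inp N (prependBlock e) Q μ := by
  refine WP.conseq (Q := fun t μ' => t ≤ 6 ∧ BlockList μ' (b :: l₁) l₂) ?_
    fun t μ' h hF => hQ t μ' h.1 hF h.2
  unfold prependBlock
  refine wp_linkFirst (by decide) (fun _ _ => rfl) he h.circ hb hf hg fun lf lg _ _ hc _ _ => ?_
  exact ⟨by omega, ⟨by simpa [Mem.get_setRow_fun] using hc, by simpa using h.cur⟩⟩

/-- The block comes from the front part, so taking it out leaves `cur` valid; `cur` changes only if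
the rear part was empty. -/
theorem wp_moveAtTheEnd (he : ∀ μ' : Mem, μ'.reg = μ.reg → e.ev inp μ' = b) {l₁' : List ℕ}
    (h : BlockList μ (l₁ ++ b :: l₁') l₂)
    (hf : ∀ c ∈ 0 :: (l₁ ++ b :: l₁' ++ l₂), c < (μ.row .bnxt 0).length)
    (hg : ∀ c ∈ 0 :: (l₁ ++ b :: l₁' ++ l₂), c < (μ.row .bprv 0).length)
    (hQ : ∀ t μ', t ≤ 8 → Frame (moveAtTheEnd e) μ μ' → μ'.reg .x = μ.reg .x →
      BlockList μ' (l₁ ++ l₁') (l₂ ++ [b]) → Q t μ') :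
    WP inp N (moveAtTheEnd e) Q μ := by
  refine WP.conseq (Q := fun t μ' => t ≤ 8 ∧ μ'.reg .x = μ.reg .x ∧
    BlockList μ' (l₁ ++ l₁') (l₂ ++ [b])) ?_ fun t μ' h hF => hQ t μ' h.1 hF h.2.1 h.2.2
  unfold moveAtTheEnd
  rw [wp_seq]
  have hc := h.circ
  have hn := hc.nodup
  simp only [List.append_assoc, List.cons_append] at hc hf hg hn
  have hs : ∀ c, c ∈ b :: 0 :: (l₁ ++ (l₁' ++ l₂)) ↔ c ∈ 0 :: (l₁ ++ b :: (l₁' ++ l₂)) := by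
    intro c; simp only [List.mem_cons, List.mem_append]; tauto
  refine wp_unlink (by decide) he hc hf hg fun lf lg hlf hlg hc' _ _ => ?_
  refine wp_appendBlock (l₁ := l₁ ++ l₁') (l₂ := l₂) (b := b) (fun μ' hμ => he μ' hμ) ⟨?_, ?_⟩
    ?_ ?_ ?_ fun t μ' ht _ hx hB => ⟨by omega, by simpa using hx, hB⟩
  · simpa [Mem.get_setRow_fun] using hc'
  · simpa using h.cur
  · have := hn.perm (List.perm_middle (l₁ := 0 :: l₁))
    simpa using (List.nodup_cons.1 this).1
  · intro c hc
    rw [List.append_assoc, hs] at hc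
    simpa [hlf] using hf c hc
  · intro c hc
    rw [List.append_assoc, hs] at hc
    simpa [hlg] using hg c hc

end

/-! ### The lists of states -/

/-- `L b` lists the states of block `b`, except for those that are being split off, which are listed
by `LI b`. -/
structure StateLists (n k : ℕ) (f g blk : ℕ → ℕ) (L LI : ℕ → List ℕ) : Prop where
  circ : ∀ b, 1 ≤ b → b < k → Circ f g (n + b + b) (L b)
  circI : ∀ b, 1 ≤ b → b < k → Circ f g (n + b + b + 1) (LI b)
  mem : ∀ b, 1 ≤ b → b < k → ∀ s, s ∈ L b ∨ s ∈ LI b ↔ s < n ∧ blk s = b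
  disj : ∀ b, 1 ≤ b → b < k → ∀ s, s ∈ L b → s ∉ LI b

section
variable {n k : ℕ} {f g f' g' blk blk' : ℕ → ℕ} {L LI : ℕ → List ℕ}

/-- Changing the lists of one block. -/
theorem StateLists.update (h : StateLists n k f g blk L LI) {D : ℕ} {l lI : List ℕ}
    (hfr : ∀ c, c ≠ n + D + D → c ≠ n + D + D + 1 → ¬ (c < n ∧ blk c = D) →
      f' c = f c ∧ g' c = g c)
    (hl : Circ f' g' (n + D + D) l) (hlI : Circ f' g' (n + D + D + 1) lI)
    (hm : ∀ s, s ∈ l ∨ s ∈ lI ↔ s < n ∧ blk s = D) (hd : ∀ s ∈ l, s ∉ lI) :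
    StateLists n k f' g' blk (Function.update L D l) (Function.update LI D lI) := by
  refine ⟨fun b h1 h2 => ?_, fun b h1 h2 => ?_, fun b h1 h2 s => ?_, fun b h1 h2 s => ?_⟩ <;>
    by_cases hb : b = D
  · subst hb; simpa using hl
  · rw [Function.update_of_ne hb]
    -- The lists of other blocks survive because headers of different blocks are different nodes and
    -- every state lies in just one block.
    have key : ∀ c ∈ (n + b + b) :: L b, f' c = f c ∧ g' c = g c := by
      intro c hc
      rcases List.mem_cons.1 hc with rfl | hc
      · exact hfr _ (by omega) (by omega) (by omega)
      · have := (h.mem b h1 h2 c).1 (Or.inl hc)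
        exact hfr _ (by omega) (by omega) (by omega)
    exact (h.circ b h1 h2).congr (fun c hc => (key c hc).1) fun c hc => (key c hc).2
  · subst hb; simpa using hlI
  · rw [Function.update_of_ne hb]
    have key : ∀ c ∈ (n + b + b + 1) :: LI b, f' c = f c ∧ g' c = g c := by
      intro c hc
      rcases List.mem_cons.1 hc with rfl | hc
      · exact hfr _ (by omega) (by omega) (by omega)
      · have := (h.mem b h1 h2 c).1 (Or.inr hc)
        exact hfr _ (by omega) (by omega) (by omega)
    exact (h.circI b h1 h2).congr (fun c hc => (key c hc).1) fun c hc => (key c hc).2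
  · subst hb; simpa using hm s
  · rw [Function.update_of_ne hb, Function.update_of_ne hb]; exact h.mem b h1 h2 s
  · subst hb; simpa using hd s
  · rw [Function.update_of_ne hb, Function.update_of_ne hb]; exact h.disj b h1 h2 s

/-- Changing the block of some of the states to a new block. -/
theorem StateLists.reblock (h : StateLists n k f g blk L LI) {D : ℕ} {l l' : List ℕ}
    (hD : 1 ≤ D ∧ D < k) (hblk : ∀ s, blk' s = blk s ∨ (blk s = D ∧ blk' s = k))
    (hfr : ∀ c, c ≠ n + D + D → c ≠ n + D + D + 1 → c ≠ n + k + k → c ≠ n + k + k + 1 →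
      ¬ (c < n ∧ blk c = D) → f' c = f c ∧ g' c = g c)
    (hl : Circ f' g' (n + D + D) l) (hlI : Circ f' g' (n + D + D + 1) [])
    (hl' : Circ f' g' (n + k + k) l') (hlI' : Circ f' g' (n + k + k + 1) [])
    (hm : ∀ s, s ∈ l ↔ s < n ∧ blk' s = D) (hm' : ∀ s, s ∈ l' ↔ s < n ∧ blk' s = k) :
    StateLists n (k + 1) f' g' blk' (Function.update (Function.update L D l) k l')
      (Function.update (Function.update LI D []) k []) := by
  have hDk : D ≠ k := by omega
  refine ⟨fun b h1 h2 => ?_, fun b h1 h2 => ?_, fun b h1 h2 s => ?_, fun b h1 h2 s => ?_⟩ <;>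
    by_cases hbk : b = k
  · subst hbk; simpa using hl'
  · rw [Function.update_of_ne hbk]
    by_cases hb : b = D
    · subst hb; simpa using hl
    rw [Function.update_of_ne hb]
    have key : ∀ c ∈ (n + b + b) :: L b, f' c = f c ∧ g' c = g c := by
      intro c hc
      rcases List.mem_cons.1 hc with rfl | hc
      · exact hfr _ (by omega) (by omega) (by omega) (by omega) (by omega)
      · have := (h.mem b h1 (by omega) c).1 (Or.inl hc)
        exact hfr _ (by omega) (by omega) (by omega) (by omega) (by omega)
    exact (h.circ b h1 (by omega)).congr (fun c hc => (key c hc).1) fun c hc => (key c hc).2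
  · subst hbk; simpa using hlI'
  · rw [Function.update_of_ne hbk]
    by_cases hb : b = D
    · subst hb; simpa using hlI
    rw [Function.update_of_ne hb]
    have key : ∀ c ∈ (n + b + b + 1) :: LI b, f' c = f c ∧ g' c = g c := by
      intro c hc
      rcases List.mem_cons.1 hc with rfl | hc
      · exact hfr _ (by omega) (by omega) (by omega) (by omega) (by omega)
      · have := (h.mem b h1 (by omega) c).1 (Or.inr hc)
        exact hfr _ (by omega) (by omega) (by omega) (by omega) (by omega)
    exact (h.circI b h1 (by omega)).congr (fun c hc => (key c hc).1) fun c hc => (key c hc).2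
  · subst hbk; simpa using hm' s
  · rw [Function.update_of_ne hbk, Function.update_of_ne hbk]
    by_cases hb : b = D
    · subst hb; simpa using hm s
    · rw [Function.update_of_ne hb, Function.update_of_ne hb, h.mem b h1 (by omega) s]
      rcases hblk s with h3 | h3
      · rw [h3]
      · constructor <;> rintro ⟨-, h4⟩ <;> omega
  · subst hbk; simp
  · rw [Function.update_of_ne hbk, Function.update_of_ne hbk]
    by_cases hb : b = D
    · subst hb; simp
    · rw [Function.update_of_ne hb, Function.update_of_ne hb]; exact h.disj b h1 (by omega) s

end

section
variable {inp : Input} {N : ℕ} {Q : ℕ → Mem → Prop} {μ : Mem} {b : ℕ} {l₁ l₂ Lb : List ℕ}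

/-! ### Selecting a block -/

/-- The selected block need not be moved: its remove set becomes empty and it is the first one of
the rear part, so advancing `cur` by one place moves the boundary past it. -/
theorem wp_selectBlock (hB : BlockList μ l₁ (b :: l₂))
    (hc : Circ (μ.get .nxt 0) (μ.get .prv 0) ((inp .pre).length + b + b) Lb)
    (hN : (μ.row .remv b).length ≤ N) (hN' : Lb.length ≤ N)
    (hrs : μ.nr .rs = 1) (hbp : μ.nr .bp = 1)
    (hQ : ∀ t μ', t ≤ 12 + 3 * (μ.row .remv b).length + 3 * Lb.length → Frame selectBlock μ μ' →
      μ'.reg .B = b → μ'.row .rs 0 = μ.row .remv b → μ'.row .bp 0 = Lb →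
      μ'.row .remv b = [] → (∀ c, c ≠ b → μ'.row .remv c = μ.row .remv c) →
      BlockList μ' (l₁ ++ [b]) l₂ → Q t μ') :
    WP inp N selectBlock Q μ := by
  refine WP.conseq (Q := fun t μ' => t ≤ 12 + 3 * (μ.row .remv b).length + 3 * Lb.length ∧
      μ'.reg .B = b ∧ μ'.row .rs 0 = μ.row .remv b ∧ μ'.row .bp 0 = Lb ∧
      μ'.row .remv b = [] ∧ (∀ c, c ≠ b → μ'.row .remv c = μ.row .remv c) ∧
      BlockList μ' (l₁ ++ [b]) l₂) ?_
    fun t μ' ⟨h1, h2, h3, h4, h5, h6, h7⟩ hF => hQ t μ' h1 hF h2 h3 h4 h5 h6 h7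
  have hcur : μ.reg .cur = b := hB.cur
  -- For the last block the successor is the header `0`, which is the default value of `headD`.
  have hnext : μ.get .bnxt 0 b = l₂.headD 0 := by
    have := hB.circ.links
    rw [links_append] at this
    cases l₂ with
    | nil => exact this.2.1
    | cons c l => exact this.2.1
  unfold selectBlock
  simp only [wp_seq, wp_assign, wp_erase, ev_reg, ev_rd, Mem.reg_setReg, hcur, reduceCtorEq, if_false]
  refine wp_forRange_push 0 (μ.row .remv b).length 0 (μ.get .remv b) rfl ?_ ?_ ?_ (by simp [hrs])
    (by simp; omega) ?_
  · intro i l; simp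
  · intro i l; rfl
  · intro i l _ _; simp
  intro t ht
  rw [wp_clear]
  refine wp_forList ((inp .pre).length + b + b) Lb (fun l₁' t' μ' => t' = 3 * l₁'.length + 1 ∧
      μ'.nr .bp = 1 ∧
      μ'.reg .B = b ∧ μ'.row .rs 0 = μ.row .remv b ∧ μ'.row .bp 0 = l₁' ∧
      μ'.row .remv b = [] ∧ (∀ c, c ≠ b → μ'.row .remv c = μ.row .remv c) ∧
      BlockList μ' (l₁ ++ [b]) l₂) rfl rfl ?_ ?_ ?_ ?_ ?_
  · intro μ' hF
    have := hF.reg .B rfl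
    simp at this
    simp [this]
  · simpa [Mem.get_setRow_fun] using hc
  · intro v
    refine ⟨rfl, by simp [hbp], by simp, by simp [map_get_range], by simp, by simp,
      fun c hc => by simp [hc], ?_, ?_⟩
    · simpa [Mem.get_setRow_fun] using hB.circ
    · simp [hnext]
  · rintro m₁ a m₂ t' μ' hl ⟨h1, h0, h2, h3, h4, h5, h6, h7⟩ hr -
    have : m₁.length < Lb.length := by simp [hl]
    rw [wp_push]
    refine ⟨⟨by omega, by rw [h4]; omega⟩, fun v => ⟨by simp; omega, by simpa using h0,
      by simpa using h2,
      by simpa using h3, by simp [h4, hr], by simpa using h5, by simpa using h6, ?_⟩⟩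
    exact h7.congr (by simp) (by simp) (by simp)
  · rintro t' μ' ⟨h1, h0, h2, h3, h4, h5, h6, h7⟩ -
    refine ⟨?_, h2, h3, h4, h5, h6, h7⟩
    omega

end

/-! ### The shape of the memory -/

/-- The sizes of the tables when the block numbers below `k` are in use. -/
structure Shape (n k : ℕ) (μ : Mem) : Prop where
  nxt : (μ.row .nxt 0).length = n + 2 * k
  prv : (μ.row .prv 0).length = n + 2 * k
  blk : (μ.row .blk 0).length = n
  bnxt : (μ.row .bnxt 0).length = k
  bprv : (μ.row .bprv 0).length = k
  mark : (μ.row .mark 0).length = k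
  nr : ∀ a, a ≠ .remv → a ≠ .cnt → a ≠ .rel → μ.nr a = 1
  nr_remv : μ.nr .remv = k
  nr_cnt : μ.nr .cnt = k
  nr_rel : μ.nr .rel = k

/-- The blocks with empty remove set come first in the list of blocks. -/
def BlockInv (k : ℕ) (μ : Mem) : Prop :=
  ∃ l₁ l₂, BlockList μ l₁ l₂ ∧ (∀ b, b ∈ l₁ ++ l₂ ↔ 1 ≤ b ∧ b < k) ∧
    (∀ b ∈ l₁, μ.row .remv b = []) ∧ ∀ b ∈ l₂, μ.row .remv b ≠ []

section
variable {inp : Input} {N n k : ℕ} {Q : ℕ → Mem → Prop} {μ μ' : Mem}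

theorem Shape.of_frame {p : Cmd} (h : Shape n k μ) (hF : Frame p μ μ')
    (hr : ∀ a, p.modNr a = false)
    (hl : ∀ a ∈ [Tab.nxt, .prv, .blk, .bnxt, .bprv, .mark], p.modLen a = false) :
    Shape n k μ' where
  nxt := by rw [hF.len _ (hl _ (by simp)), h.nxt]
  prv := by rw [hF.len _ (hl _ (by simp)), h.prv]
  blk := by rw [hF.len _ (hl _ (by simp)), h.blk]
  bnxt := by rw [hF.len _ (hl _ (by simp)), h.bnxt]
  bprv := by rw [hF.len _ (hl _ (by simp)), h.bprv]
  mark := by rw [hF.len _ (hl _ (by simp)), h.mark]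
  nr a h1 h2 h3 := by rw [hF.nr _ (hr _), h.nr a h1 h2 h3]
  nr_remv := by rw [hF.nr _ (hr _), h.nr_remv]
  nr_cnt := by rw [hF.nr _ (hr _), h.nr_cnt]
  nr_rel := by rw [hF.nr _ (hr _), h.nr_rel]

/-! ### New records -/

/-- The two appended entries land at the indices `n + 2k` and `n + 2k + 1` and contain these
indices, so both headers start as empty circular lists. -/
theorem wp_newRecord (hk : μ.reg .num = k) (hn : (inp .pre).length = n) (hN : n + 2 * k + 1 ≤ N)
    (h1 : (μ.row .nxt 0).length = n + 2 * k) (h2 : (μ.row .prv 0).length = n + 2 * k)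
    (h3 : (μ.row .bnxt 0).length = k) (h4 : (μ.row .bprv 0).length = k)
    (h5 : (μ.row .mark 0).length = k)
    (hr : ∀ a ∈ [Tab.nxt, .prv, .bnxt, .bprv, .mark], μ.nr a = 1)
    (hQ : ∀ μ', Frame newRecord μ μ' →
      μ'.row .nxt 0 = μ.row .nxt 0 ++ [n + k + k, n + k + k + 1] →
      μ'.row .prv 0 = μ.row .prv 0 ++ [n + k + k, n + k + k + 1] →
      μ'.row .bnxt 0 = μ.row .bnxt 0 ++ [k] →
      μ'.row .bprv 0 = μ.row .bprv 0 ++ [k] →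
      μ'.row .mark 0 = μ.row .mark 0 ++ [0] → Q 7 μ') :
    WP inp N newRecord Q μ := by
  refine WP.conseq (Q := fun t μ' => t = 7 ∧
      μ'.row .nxt 0 = μ.row .nxt 0 ++ [n + k + k, n + k + k + 1] ∧
      μ'.row .prv 0 = μ.row .prv 0 ++ [n + k + k, n + k + k + 1] ∧
      μ'.row .bnxt 0 = μ.row .bnxt 0 ++ [k] ∧
      μ'.row .bprv 0 = μ.row .bprv 0 ++ [k] ∧
      μ'.row .mark 0 = μ.row .mark 0 ++ [0]) ?_
    fun t μ' ⟨h1, h2, h3, h4, h5, h6⟩ hF => h1 ▸ hQ μ' hF h2 h3 h4 h5 h6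
  simp only [List.mem_cons, List.not_mem_nil, or_false, forall_eq_or_imp, forall_eq] at hr
  unfold newRecord
  simp [wp_seq, wp_push, hk, hn, hr, h1, h2, h3, h4, h5]
  omega

theorem wp_newRows (hQ : Frame newRows μ (((μ.addRow .remv).addRow .cnt).addRow .rel) →
      Q 3 (((μ.addRow .remv).addRow .cnt).addRow .rel)) :
    WP inp N newRows Q μ := by
  refine WP.conseq (Q := fun t μ' => t = 3 ∧ μ' = ((μ.addRow .remv).addRow .cnt).addRow .rel) ?_
    fun t μ' ⟨h1, h2⟩ hF => by subst h1 h2; exact hQ hF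
  unfold newRows
  simp [wp_seq, wp_newRow]

theorem getD_append_pair (l : List ℕ) (v w j : ℕ) :
    (l ++ [v, w]).getD j 0 =
      if j = l.length then v else if j = l.length + 1 then w else l.getD j 0 := by
  rw [show l ++ [v, w] = (l ++ [v]) ++ [w] by simp, getD_append_singleton, getD_append_singleton]
  simp only [List.length_append, List.length_singleton]
  split_ifs <;> first | rfl | omega

theorem length_le_of_nodup_of_lt {l : List ℕ} (h : l.Nodup) (hn : ∀ x ∈ l, x < n) :
    l.length ≤ n := by
  rw [← List.toFinset_card_of_nodup h]
  refine (Finset.card_le_card (t := Finset.range n) fun x hx => ?_).trans (by simp)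
  simpa using hn x (by simpa using hx)

open Reg in
/-- A new column of the relation. -/
theorem wp_newColumn {D₀ : ℕ} (hk : μ.reg .num = k) (hD : μ.reg .D = D₀) (hD' : D₀ < k)
    (hnr : k ≤ μ.nr .rel)
    (hl : ∀ b, 1 ≤ b → b < k → (μ.row .rel b).length = k) (hN : k ≤ N)
    (hQ : ∀ t μ', t ≤ 3 * k + 2 →
      Frame (forRange j 1 num (push₂ .rel j (.get .rel j D))) μ μ' →
      (∀ b, μ'.row .rel b = if 1 ≤ b ∧ b < k then μ.row .rel b ++ [μ.get .rel b D₀]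
        else μ.row .rel b) → Q t μ') :
    WP inp N (forRange j 1 num (push₂ .rel j (.get .rel j D))) Q μ := by
  refine wp_forRange 1 k (fun i t μ' => t ≤ 3 * i ∧ ∀ b, μ'.row .rel b =
    if 1 ≤ b ∧ b < i then μ.row .rel b ++ [μ.get .rel b D₀] else μ.row .rel b) rfl rfl ?_ ?_ ?_ ?_
  · refine ⟨by simp, fun b => ?_⟩
    simp only [Mem.row_setReg]
    rw [if_neg (by omega)]
  · intro i t μ' _ _ hF
    simp [hF.reg .num rfl, hk]
  · intro i t μ' h1 h2 ⟨ht, h3⟩ hri hF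
    have hrow : μ'.row .rel i = μ.row .rel i := by rw [h3, if_neg (by omega)]
    have hD2 := hF.reg .D rfl
    rw [wp_push₂]
    simp only [ev_reg, hri, ev_get, hD2, hD, Mem.get, hrow]
    rw [hF.nr .rel rfl, hl i h1 h2]
    refine ⟨⟨by omega, hN⟩, by omega, fun b => ?_⟩
    simp only [Mem.row_setReg, Mem.row_setRow, true_and]
    by_cases hb : b = i
    · subst hb
      simp [h1]
    · rw [if_neg hb, h3]
      have : (1 ≤ b ∧ b < i + 1) ↔ (1 ≤ b ∧ b < i) := by omega
      simp only [this, Mem.get]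
  · intro t μ' ⟨ht, h3⟩ _ hF
    refine hQ _ _ ?_ hF ?_
    · have : max 1 k ≤ k := by omega
      omega
    · intro b
      rw [h3]
      have : (1 ≤ b ∧ b < max 1 k) ↔ (1 ≤ b ∧ b < k) := by omega
      simp only [this]

end

/-! ### Turning a part that has been split off into a block -/

section
variable {inp : Input} {N n k : ℕ} {Q : ℕ → Mem → Prop} {μ μ' : Mem} {L LI : ℕ → List ℕ}

/-- Two blocks with the same parent when `k` has been split off from `D`. -/
def parent (k D c : ℕ) : ℕ := if c = k then D else c

open Reg in
theorem wp_relabel {h : Expr} {hv v : ℕ} {l : List ℕ}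
    (hh : ∀ μ', Frame (forList s h (wr .blk s num)) μ μ' → h.ev inp μ' = hv)
    (hc : Circ (μ.get .nxt 0) (μ.get .prv 0) hv l) (hv' : μ.reg .num = v)
    (hl : ∀ s ∈ l, s < (μ.row .blk 0).length)
    (hQ : ∀ t μ', t ≤ 3 * l.length + 2 → Frame (forList s h (wr .blk s num)) μ μ' →
      (∀ s, μ'.get .blk 0 s = if s ∈ l then v else μ.get .blk 0 s) → Q t μ') :
    WP inp N (forList s h (wr .blk s num)) Q μ := by
  refine wp_forList hv l (fun l₁ t μ' => t ≤ 3 * l₁.length + 1 ∧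
    ∀ s, μ'.get .blk 0 s = if s ∈ l₁ then v else μ.get .blk 0 s) rfl rfl hh hc ?_ ?_ ?_
  · intro w; simp
  · intro l₁ a l₂ t μ' hl' ⟨h1, h2⟩ hr hF
    rw [wp_wr]
    intro w
    refine ⟨by simp; omega, fun s => ?_⟩
    have h3 : a < (μ'.row .blk 0).length := by
      rw [hF.len .blk rfl]; exact hl a (by simp [hl'])
    simp only [Mem.get_setReg, Mem.get_setRow, and_self, if_true, ev_reg, hr]
    rw [getD_set, hF.reg .num rfl, hv']
    by_cases hs : s = a
    · subst hs; simp [h3]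
    · have := h2 s
      simp only [Mem.get] at this
      simp only [hs, false_and, if_false, this]
      simp [hs, Mem.get]
  · intro t μ' ⟨h1, h2⟩ hF
    exact hQ _ _ (by omega) hF h2

/-- Insert a new block into the list of blocks. -/
theorem wp_insertBlock {e e' : Expr} {r : ℕ} {l₁ l₂ : List ℕ} (hk : 1 ≤ k)
    (hB : BlockList μ l₁ l₂) (hm : ∀ b, b ∈ l₁ ++ l₂ ↔ 1 ≤ b ∧ b < k)
    (h1 : ∀ b ∈ l₁, μ.row .remv b = []) (h2 : ∀ b ∈ l₂, μ.row .remv b ≠ [])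
    (hlen : k < (μ.row .bnxt 0).length) (hlen' : k < (μ.row .bprv 0).length)
    (he : ∀ μ' : Mem, μ'.reg = μ.reg → e.ev inp μ' = k) (he' : e'.ev inp μ = r)
    (hr : μ.row .remv r = [] ↔ μ.row .remv k = [])
    (hQ : ∀ t μ', t ≤ 7 → Frame (.ite (.eq (.len .remv e') 0) (prependBlock e) (appendBlock e)) μ μ' →
      BlockInv (k + 1) μ' → Q t μ') :
    WP inp N (.ite (.eq (.len .remv e') 0) (prependBlock e) (appendBlock e)) Q μ := by
  refine WP.conseq (Q := fun t μ' => t ≤ 7 ∧ BlockInv (k + 1) μ') ?_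
    fun t μ' ⟨h1, h2⟩ hF => hQ t μ' h1 hF h2
  have hk0 : k ∉ 0 :: (l₁ ++ l₂) := by
    rw [List.mem_cons, hm]; omega
  have hlt : ∀ c ∈ k :: 0 :: (l₁ ++ l₂), c < k + 1 := by
    intro c hc
    simp only [List.mem_cons, hm] at hc
    omega
  rw [wp_ite]
  constructor
  · intro hne
    have hrk : μ.row .remv k = [] := by
      rw [← hr]; by_contra h; simp [he', h] at hne
    refine wp_prependBlock he hB hk0 (fun c hc => by have := hlt c hc; omega)
      (fun c hc => by have := hlt c hc; omega) fun t μ' ht hF hB' => ⟨by omega, k :: l₁, l₂, hB', ?_⟩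
    rw [hF.row .remv rfl]
    refine ⟨fun b => ?_, ?_, h2⟩
    · simp only [List.cons_append, List.mem_cons, hm]; omega
    · simpa [hrk] using h1
  · intro heq
    have hrk : μ.row .remv k ≠ [] := by
      rw [Ne, ← hr]; intro h; simp [he', h] at heq
    refine wp_appendBlock he hB hk0 (fun c hc => by have := hlt c hc; omega)
      (fun c hc => by have := hlt c hc; omega) fun t μ' ht hF _ hB' =>
        ⟨by omega, l₁, l₂ ++ [k], hB', ?_⟩
    rw [hF.row .remv rfl]
    refine ⟨fun b => ?_, h1, ?_⟩
    · rw [← List.append_assoc, List.mem_append, hm, List.mem_singleton]; omega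
    · intro b hb
      rcases List.mem_append.1 hb with hb | hb
      · exact h2 b hb
      · rw [List.mem_singleton.1 hb]; exact hrk

-- All the data of the new block are copied from its parent, so in the final memory the rows and
-- columns of `k` look like those of `D₀` before; `parent` expresses this uniformly. The assumption
-- `k ≤ n` keeps all appends within the length `3n + 1`.
open Reg in
theorem wp_newBlock {D₀ : ℕ} (hnum : μ.reg .num = k) (hD : μ.reg .D = D₀) (hD₀ : 1 ≤ D₀ ∧ D₀ < k)
    (hn : (inp .pre).length = n) (hkn : k ≤ n) (hN : 3 * n + 1 ≤ N)
    (hS : Shape n k μ) (hcnt : ∀ b, 1 ≤ b → b < k → (μ.row .cnt b).length = n)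
    (hrel : ∀ b, 1 ≤ b → b < k → (μ.row .rel b).length = k)
    (hempty : ∀ b, k ≤ b → μ.row .remv b = [] ∧ μ.row .cnt b = [] ∧ μ.row .rel b = [])
    (hL : StateLists n k (μ.get .nxt 0) (μ.get .prv 0) (μ.get .blk 0) L LI) (hLI : LI D₀ ≠ [])
    (hblk : ∀ s, s < n → μ.get .blk 0 s < k) (hB : BlockInv k μ) (hrem : (μ.row .remv D₀).length ≤ n)
    (hQ : ∀ t μ', t ≤ 15 * n + 60 → Frame newBlock μ μ' → μ'.reg .num = k + 1 →
      Shape n (k + 1) μ' → (∀ b, 1 ≤ b → b < k + 1 → (μ'.row .cnt b).length = n) →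
      (∀ b, 1 ≤ b → b < k + 1 → (μ'.row .rel b).length = k + 1) →
      (∀ b, k + 1 ≤ b → μ'.row .remv b = [] ∧ μ'.row .cnt b = [] ∧ μ'.row .rel b = []) →
      StateLists n (k + 1) (μ'.get .nxt 0) (μ'.get .prv 0) (μ'.get .blk 0)
        (Function.update L k (LI D₀)) (Function.update (Function.update LI D₀ []) k []) →
      BlockInv (k + 1) μ' →
      (∀ s, μ'.get .blk 0 s = if s ∈ LI D₀ then k else μ.get .blk 0 s) →
      (∀ b, μ'.row .remv b = μ.row .remv (parent k D₀ b)) →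
      (∀ b, μ'.row .cnt b = μ.row .cnt (parent k D₀ b)) →
      (∀ b c, 1 ≤ b → b < k + 1 → c < k + 1 →
        μ'.get .rel b c = μ.get .rel (parent k D₀ b) (parent k D₀ c)) →
      (∀ b, μ'.get .mark 0 b = μ.get .mark 0 b) → Q t μ') :
    WP inp N newBlock Q μ := by
  have hpD : parent k D₀ k = D₀ := by simp [parent]
  have hpne : ∀ c, c ≠ k → parent k D₀ c = c := fun c hc => by simp [parent, hc]
  have hLIlen : (LI D₀).length ≤ n := by
    refine length_le_of_nodup_of_lt (hL.circI D₀ hD₀.1 hD₀.2).nodup.of_cons fun x hx => ?_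
    exact ((hL.mem D₀ hD₀.1 hD₀.2 x).1 (Or.inr hx)).1
  have hLImem : ∀ x ∈ LI D₀, x < n ∧ μ.get .blk 0 x = D₀ := fun x hx =>
    (hL.mem D₀ hD₀.1 hD₀.2 x).1 (Or.inr hx)
  obtain ⟨l₁, l₂, hB, hBm, hB1, hB2⟩ := hB
  -- Makes the frame of the whole command available as a hypothesis at the end of the symbolic
  -- execution.
  refine WP.conseq (Q' := Q) (Q := fun t μ' => Frame newBlock μ μ' → Q t μ') ?_ (fun t μ' h hF => h hF)
  unfold newBlock
  rw [wp_seq]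
  refine wp_newRecord hnum hn (by omega) hS.nxt hS.prv hS.bnxt hS.bprv hS.mark
    (by intro a ha; apply hS.nr <;> (rintro rfl; simp at ha)) fun μ₁ hF1 n1 p1 bn1 bp1 m1 => ?_
  rw [wp_seq]
  refine wp_newRows fun _ => ?_
  generalize hμ2 : ((μ₁.addRow .remv).addRow .cnt).addRow .rel = μ₂
  have reg2 : μ₂.reg = μ.reg := by
    subst hμ2; funext r; exact hF1.reg r rfl
  have row2 : μ₂.row = μ₁.row := by subst hμ2; rfl
  have nr2 : ∀ a, μ₂.nr a = if a = .remv ∨ a = .cnt ∨ a = .rel then μ.nr a + 1 else μ.nr a := by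
    intro a; subst hμ2
    have := fun a => hF1.nr a rfl
    cases a <;> simp [this]
  have nxt2 : ∀ i, μ₂.get .nxt 0 i = if i = n + k + k then n + k + k else
      if i = n + k + k + 1 then n + k + k + 1 else μ.get .nxt 0 i := by
    intro i
    have := getD_append_pair (μ.row .nxt 0) (n + k + k) (n + k + k + 1) i
    rw [hS.nxt] at this
    rw [Mem.get, row2, n1, this, show n + 2 * k = n + k + k by ring]; rfl
  have prv2 : ∀ i, μ₂.get .prv 0 i = if i = n + k + k then n + k + k else
      if i = n + k + k + 1 then n + k + k + 1 else μ.get .prv 0 i := by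
    intro i
    have := getD_append_pair (μ.row .prv 0) (n + k + k) (n + k + k + 1) i
    rw [hS.prv] at this
    rw [Mem.get, row2, p1, this, show n + 2 * k = n + k + k by ring]; rfl
  have same2 : ∀ a, a = .blk ∨ a = .remv ∨ a = .cnt ∨ a = .rel → μ₂.row a = μ.row a := by
    rintro a (rfl | rfl | rfl | rfl) <;> rw [row2] <;> exact hF1.row _ rfl
  have lenN : (μ₂.row .nxt 0).length = n + 2 * (k + 1) := by
    rw [row2, n1]; simp [hS.nxt]; ring
  have lenP : (μ₂.row .prv 0).length = n + 2 * (k + 1) := by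
    rw [row2, p1]; simp [hS.prv]; ring
  clear hμ2
  -- the part that has been split off
  have hcI : Circ (μ₂.get .nxt 0) (μ₂.get .prv 0) (n + D₀ + D₀ + 1) (LI D₀) := by
    refine (hL.circI D₀ hD₀.1 hD₀.2).congr ?_ ?_ <;>
    · intro c hc
      have : c < n + k + k := by
        rcases List.mem_cons.1 hc with rfl | hc
        · omega
        · have := hLImem c hc; omega
      first | rw [nxt2] | rw [prv2]
      rw [if_neg (by omega), if_neg (by omega)]
  rw [wp_seq]
  refine wp_moveList (hv := n + D₀ + D₀ + 1) (hv' := n + k + k) ?_ ?_ hcI hLI ?_ ?_ ?_ ?_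
  · intro μ' h; simp [h, reg2, hD, hn]
  · intro μ' h; simp [h, reg2, hnum, hn]
  · intro hc
    rcases List.mem_cons.1 hc with h | h
    · omega
    · have := hLImem _ h; omega
  · intro c hc
    rw [lenN]
    simp only [List.mem_cons] at hc
    rcases hc with rfl | rfl | hc
    · omega
    · omega
    · have := hLImem c hc; omega
  · intro c hc
    rw [lenP]
    simp only [List.mem_cons] at hc
    rcases hc with rfl | rfl | hc
    · omega
    · omega
    · have := hLImem c hc; omega
  intro lf lg hlf hlg hc1 hc2 hfr1 hfr2
  generalize hμ3 : (μ₂.setRow .nxt 0 lf).setRow .prv 0 lg = μ₃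
  have reg3 : μ₃.reg = μ.reg := by subst hμ3; exact reg2
  have nr3 : μ₃.nr = μ₂.nr := by subst hμ3; rfl
  have nxt3 : μ₃.get .nxt 0 = fun i => lf.getD i 0 := by subst hμ3; simp [Mem.get_setRow_fun]
  have prv3 : μ₃.get .prv 0 = fun i => lg.getD i 0 := by subst hμ3; simp [Mem.get_setRow_fun]
  have row3 : ∀ a, a ≠ .nxt → a ≠ .prv → μ₃.row a = μ₂.row a := by
    intro a h1 h2; subst hμ3; funext r; simp [h1, h2]
  have lenN3 : (μ₃.row .nxt 0).length = n + 2 * (k + 1) := by subst hμ3; simp [hlf, lenN]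
  have lenP3 : (μ₃.row .prv 0).length = n + 2 * (k + 1) := by subst hμ3; simp [hlg, lenP]
  clear hμ3
  rw [wp_seq]
  refine wp_relabel (hv := n + k + k) (v := k) (l := LI D₀) ?_ (by rw [nxt3, prv3]; exact hc1)
    (by rw [reg3, hnum]) ?_ fun t4 μ₄ ht4 hF4 blk4 => ?_
  · intro μ' hF
    have := hF.reg .num rfl
    simp [this, reg3, hnum, hn]
  · intro s hs
    rw [row3 _ (by decide) (by decide), same2 _ (by simp), hS.blk]
    exact (hLImem s hs).1
  have reg4 : ∀ r, r ≠ .s → μ₄.reg r = μ.reg r := by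
    intro r hr; rw [hF4.reg r (by cases r <;> first | rfl | exact absurd rfl hr), reg3]
  have row4 : ∀ a, a ≠ .nxt → a ≠ .prv → a ≠ .blk → μ₄.row a = μ₂.row a := by
    intro a h1 h2 h3
    rw [hF4.row a (by cases a <;> first | rfl | exact absurd rfl h3), row3 a h1 h2]
  have nr4 : μ₄.nr = μ₂.nr := by rw [← nr3]; funext a; exact hF4.nr a rfl
  have remv4 : μ₄.row .remv = μ.row .remv := by
    rw [row4 _ (by decide) (by decide) (by decide), same2 _ (by simp)]
  -- the remove set
  rw [wp_seq]
  refine wp_forRange_push 0 (μ.row .remv D₀).length k (μ.get .remv D₀) rfl ?_ ?_ ?_ ?_ ?_ ?_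
  · intro i l; simp [reg4, hD, remv4, hD₀.2.ne]
  · intro i l; simp [reg4, hnum]
  · intro i l _ _; simp [reg4, hD, hD₀.2.ne, Mem.get, remv4]
  · rw [nr4, nr2]; simp [hS.nr_remv]
  · rw [remv4, (hempty k le_rfl).1]; simp; omega
  intro t5 ht5
  rw [remv4, (hempty k le_rfl).1, Nat.sub_zero, map_get_range _ _ _ _ rfl, List.nil_append]
  generalize hμ5 : (μ₄.setReg Reg.j (max 0 (μ.row .remv D₀).length)).setRow .remv k
    (μ.row .remv D₀) = μ₅
  have reg5 : ∀ r, r ≠ .s → r ≠ .j → μ₅.reg r = μ.reg r := by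
    intro r h1 h2; subst hμ5; simp [h2, reg4 r h1]
  have nr5 : μ₅.nr = μ₂.nr := by subst hμ5; exact nr4
  have row5 : ∀ a, a ≠ .remv → μ₅.row a = μ₄.row a := by
    intro a h1; subst hμ5; funext r; simp [h1]
  have remv5 : ∀ b, μ₅.row .remv b = μ.row .remv (parent k D₀ b) := by
    intro b; subst hμ5
    by_cases hb : b = k
    · subst hb; simp [hpD]
    · simp [hb, hpne b hb, remv4]
  clear hμ5
  have bn5 : μ₅.row .bnxt 0 = μ.row .bnxt 0 ++ [k] := by
    rw [row5 _ (by decide), row4 _ (by decide) (by decide) (by decide), row2, bn1]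
  have bp5 : μ₅.row .bprv 0 = μ.row .bprv 0 ++ [k] := by
    rw [row5 _ (by decide), row4 _ (by decide) (by decide) (by decide), row2, bp1]
  rw [wp_seq]
  refine wp_insertBlock (k := k) (r := D₀) (l₁ := l₁) (l₂ := l₂) (by omega) ⟨?_, ?_⟩ hBm ?_ ?_ ?_ ?_
    ?_ ?_ ?_ fun t6 μ₆ ht6 hF6 hB6 => ?_
  · refine hB.circ.congr ?_ ?_ <;>
    · intro c hc
      simp only [List.mem_cons, hBm] at hc
      first
        | rw [Mem.get, bn5, getD_append_singleton, hS.bnxt]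
        | rw [Mem.get, bp5, getD_append_singleton, hS.bprv]
      rw [if_neg (by omega)]; rfl
  · rw [reg5 _ (by decide) (by decide), hB.cur]
  · intro b hb
    have := (hBm b).1 (by simp [hb])
    rw [remv5, hpne b (by omega), hB1 b hb]
  · intro b hb
    have := (hBm b).1 (by simp [hb])
    rw [remv5, hpne b (by omega)]; exact hB2 b hb
  · rw [bn5]; simp [hS.bnxt]
  · rw [bp5]; simp [hS.bprv]
  · intro μ' h; simp [h, reg5, hnum]
  · simp [reg5, hD]
  · rw [remv5, remv5, hpD, hpne D₀ hD₀.2.ne]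
  have reg6 : ∀ r, r ≠ .s → r ≠ .j → r ≠ .cur → r ≠ .x → μ₆.reg r = μ.reg r := by
    intro r h1 h2 h3 h4
    rw [hF6.reg r (by cases r <;> first | rfl | exact absurd rfl h3 | exact absurd rfl h4),
      reg5 r h1 h2]
  have nr6 : μ₆.nr = μ₂.nr := by rw [← nr5]; funext a; exact hF6.nr a rfl
  have rel6 : μ₆.row .rel = μ.row .rel := by
    rw [hF6.row _ rfl, row5 _ (by decide), row4 _ (by decide) (by decide) (by decide),
      same2 _ (by simp)]
  -- the relation
  rw [wp_seq]
  refine wp_newColumn (k := k) (D₀ := D₀) (by simp [reg6, hnum]) (by simp [reg6, hD]) hD₀.2 ?_ ?_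
    (by omega) fun t7 μ₇ ht7 hF7 rel7 => ?_
  · rw [nr6, nr2]; simp [hS.nr_rel]
  · rw [rel6]; exact hrel
  have reg7 : ∀ r, r ≠ .s → r ≠ .j → r ≠ .cur → r ≠ .x → μ₇.reg r = μ.reg r := by
    intro r h1 h2 h3 h4
    rw [hF7.reg r (by cases r <;> first | rfl | exact absurd rfl h2), reg6 r h1 h2 h3 h4]
  have nr7 : μ₇.nr = μ₂.nr := by rw [← nr6]; funext a; exact hF7.nr a rfl
  have rel6' : ∀ b, μ₆.get .rel b D₀ = μ.get .rel b D₀ := by intro b; rw [Mem.get, rel6]; rfl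
  simp only [rel6, rel6'] at rel7
  have rel7k : μ₇.row .rel k = [] := by rw [rel7, if_neg (by omega), (hempty k le_rfl).2.2]
  rw [wp_seq]
  -- The new column has been appended to all old rows by now, so the row of `D₀` that is copied
  -- already contains the entry for `k`.
  refine wp_forRange_push 0 (k + 1) k (μ₇.get .rel D₀) rfl ?_ ?_ ?_ ?_ ?_ ?_
  · intro i l; simp [reg7, hnum]
  · intro i l; simp [reg7, hnum]
  · intro i l _ _; simp [reg7, hD, hD₀.2.ne]
  · rw [nr7, nr2]; simp [hS.nr_rel]
  · rw [rel7k]; simp; omega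
  intro t8 ht8
  have rel7D : (μ₇.row .rel D₀).length = k + 1 := by
    rw [rel7, if_pos hD₀]; simp [hrel D₀ hD₀.1 hD₀.2]
  rw [rel7k, Nat.sub_zero, map_get_range _ _ _ _ rel7D.symm, List.nil_append]
  -- the transition counts
  have cnt7 : μ₇.row .cnt = μ.row .cnt := by
    rw [hF7.row _ rfl, hF6.row _ rfl, row5 _ (by decide),
      row4 _ (by decide) (by decide) (by decide), same2 _ (by simp)]
  rw [wp_seq]
  refine wp_forRange_push 0 n k (μ.get .cnt D₀) rfl ?_ ?_ ?_ ?_ ?_ ?_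
  · intro i l; exact hn
  · intro i l; simp [reg7, hnum]
  · intro i l _ _; simp [reg7, hD, hD₀.2.ne, Mem.get, cnt7]
  · simp only [Mem.nr_setRow, Mem.nr_setReg]
    rw [nr7, nr2]; simp [hS.nr_cnt]
  · simp [cnt7, (hempty k le_rfl).2.1]; omega
  intro t9 ht9
  rw [wp_assign]
  intro hF
  have e1 : μ₇.row .nxt = μ₃.row .nxt := by
    rw [hF7.row _ rfl, hF6.row _ rfl, row5 _ (by decide), hF4.row _ rfl]
  have e2 : μ₇.row .prv = μ₃.row .prv := by
    rw [hF7.row _ rfl, hF6.row _ rfl, row5 _ (by decide), hF4.row _ rfl]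
  have e3 : μ₇.row .blk = μ₄.row .blk := by
    rw [hF7.row _ rfl, hF6.row _ rfl, row5 _ (by decide)]
  have e4 : μ₇.row .remv = μ₅.row .remv := by
    rw [hF7.row _ rfl, hF6.row _ rfl]
  have e5 : μ₇.row .mark = μ₁.row .mark := by
    rw [hF7.row _ rfl, hF6.row _ rfl, row5 _ (by decide),
      row4 _ (by decide) (by decide) (by decide), row2]
  have e6 : ∀ b, ((μ₇.setReg j (max 0 (k + 1))).setRow .rel k (μ₇.row .rel D₀)).row .cnt b
      = μ.row .cnt b := by intro b; simp [cnt7]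
  have hcntD := hcnt D₀ hD₀.1 hD₀.2
  rw [e6, (hempty k le_rfl).2.1, List.nil_append, Nat.sub_zero, map_get_range _ _ _ _ hcntD.symm] at hF ⊢
  have blk7 : ∀ s, μ₇.get .blk 0 s = if s ∈ LI D₀ then k else μ.get .blk 0 s := by
    intro s
    have := blk4 s
    simp only [Mem.get] at this ⊢
    rw [e3, this, row3 _ (by decide) (by decide), same2 _ (by simp)]
  have nxt7 : μ₇.get .nxt 0 = fun i => lf.getD i 0 := by
    rw [← nxt3]; funext i; simp only [Mem.get, e1]
  have prv7 : μ₇.get .prv 0 = fun i => lg.getD i 0 := by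
    rw [← prv3]; funext i; simp only [Mem.get, e2]
  refine hQ _ _ ?_ hF ?_ ?_ ?_ ?_ ?_ ?_ ?_ ?_ ?_ ?_ ?_ ?_
  · omega
  · simp [reg7, hnum]
  · have bl7 : ∀ a, a = .bnxt ∨ a = .bprv → (μ₇.row a 0).length = (μ₅.row a 0).length := by
      rintro a (rfl | rfl) <;> rw [hF7.row _ rfl, hF6.len _ rfl]
    refine ⟨?_, ?_, ?_, ?_, ?_, ?_, ?_, ?_, ?_, ?_⟩
    · simp [e1, lenN3]
    · simp [e2, lenP3]
    · simp only [Mem.row_setReg, Mem.row_setRow, reduceCtorEq, false_and, if_false, e3]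
      rw [hF4.len _ rfl, row3 _ (by decide) (by decide), same2 _ (by simp), hS.blk]
    · simp [bl7, bn5, hS.bnxt]
    · simp [bl7, bp5, hS.bprv]
    · simp [e5, m1, hS.mark]
    · intro a h1 h2 h3
      simp [nr7, nr2, h1, h2, h3, hS.nr a h1 h2 h3]
    · simp [nr7, nr2, hS.nr_remv]
    · simp [nr7, nr2, hS.nr_cnt]
    · simp [nr7, nr2, hS.nr_rel]
  · intro b h1 h2
    by_cases hb : b = k
    · simp [hb, hcntD]
    · simp [hb, cnt7]; exact hcnt b h1 (by omega)
  · intro b h1 h2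
    by_cases hb : b = k
    · simp [hb, rel7D]
    · have : 1 ≤ b ∧ b < k := by omega
      simp [hb, rel7, this]; exact hrel b h1 (by omega)
  · intro b hb
    have h1 : b ≠ k := by omega
    have h2 := hempty b (by omega)
    have h3 : ¬ b < k := by omega
    simp [h1, e4, remv5, hpne b h1, cnt7, rel7, h2, h3]
  · simp only [Mem.get_setReg, Mem.get_setRow_fun, reduceCtorEq, false_and, if_false, nxt7, prv7]
    have := hL.reblock (D := D₀) (f' := fun i => lf.getD i 0) (g' := fun i => lg.getD i 0)
      (blk' := μ₇.get .blk 0) (l := L D₀) (l' := LI D₀) hD₀ ?_ ?_ ?_ hc2 hc1 ?_ ?_ ?_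
    · simpa using this
    · intro s; rw [blk7]; split_ifs with h
      · exact Or.inr ⟨(hLImem s h).2, rfl⟩
      · exact Or.inl rfl
    · intro c h1 h2 h3 h4 h5
      have h6 : c ∉ (n + k + k) :: (n + D₀ + D₀ + 1) :: LI D₀ := by
        simp only [List.mem_cons, not_or]
        exact ⟨h3, h2, fun h => h5 (hLImem c h)⟩
      refine ⟨(hfr1 c h6).trans ?_, (hfr2 c h6).trans ?_⟩
      · rw [nxt2, if_neg h3, if_neg h4]
      · rw [prv2, if_neg h3, if_neg h4]
    · refine (hL.circ D₀ hD₀.1 hD₀.2).congr ?_ ?_ <;>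
      · intro c hc
        have h7 : c ≠ n + D₀ + D₀ + 1 ∧ c ≠ n + k + k ∧ c ≠ n + k + k + 1 ∧ c ∉ LI D₀ := by
          rcases List.mem_cons.1 hc with rfl | hc
          · refine ⟨by omega, by omega, by omega, fun h => ?_⟩
            have := hLImem _ h; omega
          · have := (hL.mem D₀ hD₀.1 hD₀.2 c).1 (Or.inl hc)
            exact ⟨by omega, by omega, by omega, hL.disj D₀ hD₀.1 hD₀.2 c hc⟩
        have h6 : c ∉ (n + k + k) :: (n + D₀ + D₀ + 1) :: LI D₀ := by
          simp only [List.mem_cons, not_or]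
          exact ⟨h7.2.1, h7.1, h7.2.2.2⟩
        first
          | exact (hfr1 c h6).trans (by rw [nxt2, if_neg h7.2.1, if_neg h7.2.2.1])
          | exact (hfr2 c h6).trans (by rw [prv2, if_neg h7.2.1, if_neg h7.2.2.1])
    · have h6 : n + k + k + 1 ∉ (n + k + k) :: (n + D₀ + D₀ + 1) :: LI D₀ := by
        simp only [List.mem_cons, not_or]
        refine ⟨by omega, by omega, fun h => ?_⟩
        have := hLImem _ h; omega
      refine circ_nil.2 ⟨(hfr1 _ h6).trans ?_, (hfr2 _ h6).trans ?_⟩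
      · rw [nxt2, if_neg (by omega), if_pos rfl]
      · rw [prv2, if_neg (by omega), if_pos rfl]
    · intro s
      rw [blk7]
      split_ifs with h
      · constructor
        · intro h'; exact absurd h (hL.disj D₀ hD₀.1 hD₀.2 s h')
        · intro h'; omega
      · rw [← hL.mem D₀ hD₀.1 hD₀.2 s]; simp [h]
    · intro s
      rw [blk7]
      split_ifs with h
      · simp [h, (hLImem s h).1]
      · simp only [h, false_iff]
        rintro ⟨h1, h2⟩
        have := hblk s h1
        omega
  · obtain ⟨m₁, m₂, hBB, hBBm, hBB1, hBB2⟩ := hB6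
    have r7 : μ₇.row .remv = μ₆.row .remv := hF7.row _ rfl
    refine ⟨m₁, m₂, ?_, hBBm, ?_, ?_⟩
    · refine hBB.congr ?_ ?_ ?_
      · simp [hF7.row .bnxt rfl]
      · simp [hF7.row .bprv rfl]
      · simp [hF7.reg .cur rfl]
    · intro b hb; simpa [r7] using hBB1 b hb
    · intro b hb; simpa [r7] using hBB2 b hb
  · intro s
    simp only [Mem.get_setReg, Mem.get_setRow_fun, reduceCtorEq, false_and, if_false, blk7]
  · intro b; simp [e4, remv5]
  · intro b
    by_cases hb : b = k
    · simp [hb, hpD]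
    · simp [hb, hpne b hb, cnt7]
  · intro b c hb1 hb2 hc2
    have key : ∀ b, 1 ≤ b → b < k → c < k + 1 →
        μ₇.get .rel b c = μ.get .rel b (parent k D₀ c) := by
      intro b h1 h2 h3
      rw [Mem.get, rel7, if_pos ⟨h1, h2⟩, getD_append_singleton, hrel b h1 h2]
      by_cases hc : c = k
      · rw [if_pos hc, hc, hpD]
      · rw [if_neg hc, hpne c hc]; rfl
    simp only [Mem.get_setReg, Mem.get_setRow_fun, reduceCtorEq, false_and, if_false, true_and]
    by_cases hb : b = k
    · rw [if_pos hb, hb, hpD, ← key D₀ hD₀.1 hD₀.2 hc2]; rfl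
    · rw [if_neg hb, hpne b hb, key b hb1 (by omega) hc2]
  · intro b
    simp only [Mem.get_setReg, Mem.get_setRow_fun, reduceCtorEq, false_and, if_false]
    rw [Mem.get, e5, m1, getD_append_singleton]
    split_ifs with h
    · rw [Mem.get_of_length_le]; rw [hS.mark, h, hS.mark]
    · rfl

end

/-! ### Splitting the partition with respect to the remove set -/

section
variable {inp : Input} {N n k : ℕ} {Q : ℕ → Mem → Prop} {μ μ' : Mem} {L LI : ℕ → List ℕ}

theorem take_succ_of_lt {l : List ℕ} {i : ℕ} (h : i < l.length) :
    l.take (i + 1) = l.take i ++ [l.getD i 0] := by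
  rw [List.getD_eq_getElem _ _ h, List.take_append_getElem h]

theorem getD_not_mem_take {l : List ℕ} {i : ℕ} (hl : l.Nodup) (h : i < l.length) :
    l.getD i 0 ∉ l.take i := by
  have h1 : (l.take (i + 1)).Nodup := hl.sublist (List.take_sublist _ _)
  rw [take_succ_of_lt h, List.nodup_append] at h1
  intro h2
  exact h1.2.2 _ h2 _ (by simp) rfl

theorem getD_mem {l : List ℕ} {i : ℕ} (h : i < l.length) : l.getD i 0 ∈ l := by
  rw [List.getD_eq_getElem _ _ h]; exact List.getElem_mem h

open Reg in
/-- Splitting off the states of the remove set. -/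
theorem wp_splitOff {R : List ℕ} (hn : (inp .pre).length = n) (hkn : k ≤ N + 1)
    (hN : (μ.row .nxt 0).length = n + 2 * k) (hP : (μ.row .prv 0).length = n + 2 * k)
    (htl : μ.nr .tl = 1) (htl0 : μ.row .tl 0 = [])
    (hL : StateLists n k (μ.get .nxt 0) (μ.get .prv 0) (μ.get .blk 0) L fun _ => [])
    (hR : μ.row .rs 0 = R) (hRn : R.Nodup)
    (hRm : ∀ s ∈ R, s < n ∧ 1 ≤ μ.get .blk 0 s ∧ μ.get .blk 0 s < k)
    (hQ : ∀ t μ' L' LI' T, t ≤ 14 * R.length + 2 →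
      Frame (forRange Reg.k 0 (size .rs)
        (assign s (rd .rs Reg.k) ;; assign D (rd .blk s) ;;
        ifThen (.eq (rd .nxt (hdI D)) (hdI D)) (push .tl D) ;;
        unlink .nxt .prv s ;; linkLast .nxt .prv (hdI D) s)) μ μ' →
      StateLists n k (μ'.get .nxt 0) (μ'.get .prv 0) (μ.get .blk 0) L' LI' →
      (∀ b s, 1 ≤ b → b < k → (s ∈ LI' b ↔ s ∈ R ∧ μ.get .blk 0 s = b)) →
      μ'.row .tl 0 = T → T.Nodup → (∀ b, b ∈ T ↔ 1 ≤ b ∧ b < k ∧ LI' b ≠ []) → Q t μ') :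
    WP inp N (forRange Reg.k 0 (size .rs)
        (assign s (rd .rs Reg.k) ;; assign D (rd .blk s) ;;
        ifThen (.eq (rd .nxt (hdI D)) (hdI D)) (push .tl D) ;;
        unlink .nxt .prv s ;; linkLast .nxt .prv (hdI D) s)) Q μ := by
  refine wp_forRange 0 R.length (fun i t μ' => t ≤ 14 * i + 1 ∧ ∃ L' LI' T,
      StateLists n k (μ'.get .nxt 0) (μ'.get .prv 0) (μ.get .blk 0) L' LI' ∧
      (∀ b s, 1 ≤ b → b < k → (s ∈ LI' b ↔ s ∈ R.take i ∧ μ.get .blk 0 s = b)) ∧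
      μ'.row .tl 0 = T ∧ T.Nodup ∧ (∀ b, b ∈ T ↔ 1 ≤ b ∧ b < k ∧ LI' b ≠ []))
    rfl rfl ?_ ?_ ?_ ?_
  · exact ⟨le_rfl, L, fun _ => [], [], hL, by simp, by simpa using htl0, by simp, by simp⟩
  · intro i t μ' _ _ hF
    simp [hF.row .rs rfl, hR]
  · rintro i t μ' - hi ⟨ht, L', LI', T, hL', hLI', hT, hTn, hTm⟩ hri hF
    have hs0 := hRm _ (getD_mem hi)
    have hs1 := getD_not_mem_take hRn hi
    have hget : μ'.get .rs 0 i = R.getD i 0 := by rw [Mem.get, hF.row .rs rfl, hR]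
    have hblk : μ'.get .blk = μ.get .blk := hF.get .blk rfl
    rw [take_succ_of_lt hi]
    set σ := R.getD i 0 with hσ
    set δ := μ.get .blk 0 σ with hδ
    obtain ⟨hσn, hδ1, hδ2⟩ := hs0
    -- The remove set has no repetitions, so this state has not been moved yet.
    have hσI : σ ∉ LI' δ := by rw [hLI' δ σ hδ1 hδ2]; exact fun h => hs1 h.1
    have hσL : σ ∈ L' δ := ((hL'.mem δ hδ1 hδ2 σ).2 ⟨hσn, rfl⟩).resolve_right hσI
    obtain ⟨l₁, l₂, hl⟩ := List.append_of_mem hσL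
    have hc := hL'.circ δ hδ1 hδ2
    have hcI := hL'.circI δ hδ1 hδ2
    have hlt : ∀ c ∈ L' δ, c < n ∧ μ.get .blk 0 c = δ := fun c hc =>
      (hL'.mem δ hδ1 hδ2 c).1 (Or.inl hc)
    have hltI : ∀ c ∈ LI' δ, c < n ∧ μ.get .blk 0 c = δ := fun c hc =>
      (hL'.mem δ hδ1 hδ2 c).1 (Or.inr hc)
    have hlenN : (μ'.row .nxt 0).length = n + 2 * k := by rw [hF.len .nxt rfl, hN]
    have hlenP : (μ'.row .prv 0).length = n + 2 * k := by rw [hF.len .prv rfl, hP]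
    have hTlen : T.length ≤ k - 1 := by
      rw [← List.toFinset_card_of_nodup hTn]
      refine (Finset.card_le_card (t := Finset.Ico 1 k) fun b hb => ?_).trans (by simp)
      have := (hTm b).1 (by simpa using hb)
      simp; omega
    -- An empty split-off part means that the block is touched for the first time; this test keeps
    -- `tl` free of repetitions.
    have hemp : μ'.get .nxt 0 (n + δ + δ + 1) = n + δ + δ + 1 ↔ LI' δ = [] := hcI.eq_nil_iff
    -- the relinking
    have main : ∀ (μ₂ : Mem) (t₀ : ℕ), t₀ ≤ 4 → μ₂.row .nxt = μ'.row .nxt →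
        μ₂.row .prv = μ'.row .prv → μ₂.reg .s = σ → μ₂.reg .D = δ →
        μ₂.row .tl 0 = (if LI' δ = [] then T ++ [δ] else T) →
        WP inp N (unlink .nxt .prv s ;; linkLast .nxt .prv (hdI D) s) (fun t' μ'' =>
          (t + (t₀ + t') + 2 ≤ 14 * (i + 1) + 1 ∧ ∃ L' LI' T,
          StateLists n k ((μ''.setReg Reg.k (i + 1)).get .nxt 0)
            ((μ''.setReg Reg.k (i + 1)).get .prv 0) (μ.get .blk 0) L' LI' ∧
          (∀ b s, 1 ≤ b → b < k → (s ∈ LI' b ↔ s ∈ R.take i ++ [σ] ∧ μ.get .blk 0 s = b)) ∧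
          (μ''.setReg Reg.k (i + 1)).row .tl 0 = T ∧ T.Nodup ∧
          (∀ b, b ∈ T ↔ 1 ≤ b ∧ b < k ∧ LI' b ≠ []))) μ₂ := by
      intro μ₂ t₀ ht₀ hrN hrP hrs hrD hrT
      have hgN : μ₂.get .nxt = μ'.get .nxt := by funext r i; simp [Mem.get, hrN]
      have hgP : μ₂.get .prv = μ'.get .prv := by funext r i; simp [Mem.get, hrP]
      have hcc := hc
      rw [hl] at hc
      have hn1 := hc.nodup
      simp only [List.nodup_cons, List.mem_append, List.mem_cons, not_or, List.nodup_append] at hn1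
      rw [wp_seq]
      refine wp_unlink (by decide) (hv := n + δ + δ) (pv := σ) (l₁ := l₁) (l₂ := l₂) ?_
        (by rw [hgN, hgP]; exact hc) ?_ ?_ ?_
      · intro ν h; simp [h, hrs]
      · intro c hc
        rw [← hl] at hc
        rw [hrN, hlenN]
        rcases List.mem_cons.1 hc with rfl | hc
        · omega
        · have := hlt c hc; omega
      · intro c hc
        rw [← hl] at hc
        rw [hrP, hlenP]
        rcases List.mem_cons.1 hc with rfl | hc
        · omega
        · have := hlt c hc; omega
      intro lf lg hlf hlg hc1 hf1 hf2
      have hll : ∀ c, c ∈ l₁ ++ l₂ → c ∈ L' δ ∧ c ≠ σ := by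
        intro c hc
        refine ⟨by rw [hl]; simp at hc ⊢; tauto, ?_⟩
        rintro rfl
        rcases List.mem_append.1 hc with h | h
        · exact hn1.2.2.2 _ h _ (Or.inl rfl) rfl
        · exact hn1.2.2.1.1 h
      have hIout : ∀ c ∈ (n + δ + δ + 1) :: LI' δ, c ∉ (n + δ + δ) :: (l₁ ++ l₂) := by
        intro c hc hc'
        rcases List.mem_cons.1 hc with rfl | hc
        · rcases List.mem_cons.1 hc' with h | h
          · omega
          · have := hlt _ (hll _ h).1; omega
        · rcases List.mem_cons.1 hc' with rfl | h
          · have := hltI _ hc; omega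
          · exact hL'.disj δ hδ1 hδ2 c (hll _ h).1 hc
      have hcI' : Circ (fun i => lf.getD i 0) (fun i => lg.getD i 0) (n + δ + δ + 1) (LI' δ) := by
        refine hcI.congr (fun c hc => ?_) (fun c hc => ?_)
        · rw [hf1 c (hIout c hc), hgN]
        · rw [hf2 c (hIout c hc), hgP]
      refine wp_linkLast (by decide) (hv := n + δ + δ + 1) (pv := σ) (l := LI' δ) ?_ ?_
        (by simpa [Mem.get_setRow_fun] using hcI') ?_ ?_ ?_ ?_
      · intro ν h; simp [h, hn, hrD]
      · intro ν h; simp [h, hrs]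
      · intro hc
        rcases List.mem_cons.1 hc with h | h
        · omega
        · exact hσI h
      · intro c hc
        simp only [Mem.row_setRow, reduceCtorEq, false_and, if_false, and_self, if_true, hlf, hrN,
          hlenN]
        simp only [List.mem_cons] at hc
        rcases hc with rfl | rfl | hc
        · omega
        · omega
        · have := hltI c hc; omega
      · intro c hc
        simp only [Mem.row_setRow, and_self, if_true, hlg, hrP, hlenP]
        simp only [List.mem_cons] at hc
        rcases hc with rfl | rfl | hc
        · omega
        · omega
        · have := hltI c hc; omega
      intro lf' lg' _ _ hc2 hf1' hf2'
      rw [Mem.setRow_pair _ (by decide)]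
      simp only [Mem.get_setRow_fun, reduceCtorEq, false_and, if_false, and_self, if_true] at hf1' hf2'
      refine ⟨by omega, Function.update L' δ (l₁ ++ l₂), Function.update LI' δ (LI' δ ++ [σ]),
        if LI' δ = [] then T ++ [δ] else T, ?_, ?_, ?_, ?_, ?_⟩
      · simp only [Mem.get_setReg, Mem.get_setRow_fun, reduceCtorEq, false_and, if_false, and_self,
          if_true]
        have hout : ∀ c ∈ (n + δ + δ) :: (l₁ ++ l₂), c ∉ σ :: (n + δ + δ + 1) :: LI' δ := by
          intro c hc hc'
          rcases List.mem_cons.1 hc' with rfl | hc'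
          · rcases List.mem_cons.1 hc with h | h
            · omega
            · exact (hll _ h).2 rfl
          · exact hIout c hc' hc
        refine hL'.update ?_ ?_ hc2 ?_ ?_
        · intro c h1 h2 h3
          have g1 : c ∉ σ :: (n + δ + δ + 1) :: LI' δ := by
            simp only [List.mem_cons, not_or]
            exact ⟨fun h => h3 ⟨by omega, by rw [h]⟩, h2, fun h => h3 (hltI c h)⟩
          have g2 : c ∉ (n + δ + δ) :: (l₁ ++ l₂) := by
            rw [List.mem_cons, not_or]
            exact ⟨h1, fun h => h3 (hlt c (hll c h).1)⟩
          refine ⟨?_, ?_⟩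
          · rw [hf1' c g1, hf1 c g2, hgN]
          · rw [hf2' c g1, hf2 c g2, hgP]
        · exact hc1.congr (fun c hc => hf1' c (hout c hc)) fun c hc => hf2' c (hout c hc)
        · intro c
          rw [← hL'.mem δ hδ1 hδ2 c, hl]
          simp only [List.mem_append, List.mem_cons, List.not_mem_nil, or_false]
          tauto
        · intro c hc hc'
          rcases List.mem_append.1 hc' with h | h
          · exact hL'.disj δ hδ1 hδ2 c (hll c hc).1 h
          · exact (hll c hc).2 (by simpa using h)
      · intro b c hb1 hb2
        by_cases hb : b = δ
        · rw [hb, Function.update_self, List.mem_append, List.mem_append, hLI' δ c hδ1 hδ2]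
          constructor
          · rintro (h | h)
            · exact ⟨Or.inl h.1, h.2⟩
            · have : c = σ := by simpa using h
              exact ⟨Or.inr h, by rw [this]⟩
          · rintro ⟨h | h, h2⟩
            · exact Or.inl ⟨h, h2⟩
            · exact Or.inr h
        · rw [Function.update_of_ne hb, hLI' b c hb1 hb2, List.mem_append]
          constructor
          · exact fun h => ⟨Or.inl h.1, h.2⟩
          · rintro ⟨h | h, h2⟩
            · exact ⟨h, h2⟩
            · have : c = σ := by simpa using h
              rw [this] at h2
              exact absurd h2.symm hb
      · simp [hrT]
      · split_ifs with h
        · have : δ ∉ T := by rw [hTm]; simp [h]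
          rw [List.nodup_append]
          refine ⟨hTn, by simp, fun a ha b hb => ?_⟩
          rintro rfl
          exact this (by rw [← List.mem_singleton.1 hb]; exact ha)
        · exact hTn
      · intro b
        by_cases hb : b = δ
        · rw [hb, Function.update_self]
          split_ifs with h
          · simp [hδ1, hδ2]
          · rw [hTm]; simp [hδ1, hδ2, h]
        · rw [Function.update_of_ne hb, ← hTm]
          split_ifs with h
          · simp [hb]
          · rfl
    rw [wp_seq, wp_assign, wp_seq, wp_assign, wp_seq, wp_ifThen]
    simp only [ev_reg, ev_rd, ev_hdI, ev_eq, Mem.reg_setReg, Mem.get_setReg, hri, hget, hblk, hn,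
      if_true, ← hδ, reduceCtorEq, if_false, hemp, wp_push]
    constructor
    · intro h
      have h : LI' δ = [] := by by_contra h'; simp [h'] at h
      refine ⟨⟨by simp [hF.nr .tl rfl, htl], by simp [hT]; omega⟩, ?_⟩
      refine (main _ 4 le_rfl ?_ ?_ ?_ ?_ ?_).mono ?_
      · funext r; simp
      · funext r; simp
      · simp
      · simp
      · simp [h, hT]
      · intro t' μ'' h; exact ⟨by omega, h.2⟩
    · intro h
      have h : LI' δ ≠ [] := by intro h'; simp [h'] at h
      refine (main _ 4 le_rfl ?_ ?_ ?_ ?_ ?_).mono ?_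
      · funext r; simp
      · funext r; simp
      · simp
      · simp
      · simp [h, hT]
      · intro t' μ'' h; exact ⟨by omega, h.2⟩
  · rintro t μ' ⟨ht, L', LI', T, hL', hLI', hT, hTn, hTm⟩ - hF
    simp only [Nat.zero_le, max_eq_right, List.take_length] at ht hLI'
    exact hQ _ μ' L' LI' T (by omega) hF hL' hLI' hT hTn hTm

/-- The invariant of the data structures; `L` and `LI` give the linked lists of states. -/
structure Core (n k : ℕ) (μ : Mem) (L LI : ℕ → List ℕ) : Prop where
  num : μ.reg .num = k
  shape : Shape n k μ
  cnt_len : ∀ b, 1 ≤ b → b < k → (μ.row .cnt b).length = n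
  rel_len : ∀ b, 1 ≤ b → b < k → (μ.row .rel b).length = k
  empty : ∀ b, k ≤ b → μ.row .remv b = [] ∧ μ.row .cnt b = [] ∧ μ.row .rel b = []
  lists : StateLists n k (μ.get .nxt 0) (μ.get .prv 0) (μ.get .blk 0) L LI
  blocks : BlockInv k μ
  blk : ∀ s, s < n → 1 ≤ μ.get .blk 0 s ∧ μ.get .blk 0 s < k
  nonempty : ∀ b, 1 ≤ b → b < k → ∃ s, s < n ∧ μ.get .blk 0 s = b
  mark : ∀ b, μ.get .mark 0 b = 0
  pos : 1 ≤ k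

/-- The blocks in `T` of the memory `μ` have been split with respect to the set `R`. -/
structure SplitInv (n : ℕ) (μ μ' : Mem) (R T : List ℕ) : Prop where
  remv : ∀ s, s < n → μ'.row .remv (μ'.get .blk 0 s) = μ.row .remv (μ.get .blk 0 s)
  cnt : ∀ s, s < n → μ'.row .cnt (μ'.get .blk 0 s) = μ.row .cnt (μ.get .blk 0 s)
  rel : ∀ s t, s < n → t < n → μ'.get .rel (μ'.get .blk 0 s) (μ'.get .blk 0 t) =
    μ.get .rel (μ.get .blk 0 s) (μ.get .blk 0 t)
  blk : ∀ s t, s < n → t < n → (μ'.get .blk 0 s = μ'.get .blk 0 t ↔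
    μ.get .blk 0 s = μ.get .blk 0 t ∧ (μ.get .blk 0 s ∈ T → (s ∈ R ↔ t ∈ R)))

/-- The pigeonhole principle, by which the number of nonempty blocks is bounded by the number of
states. -/
theorem le_of_surj (f : ℕ → ℕ) (m : ℕ) (h : ∀ i, 1 ≤ i → i ≤ m → ∃ s, s < n ∧ f s = i) :
    m ≤ n := by
  have : m = (Finset.Icc 1 m).card := by simp
  rw [this]
  refine (Finset.card_le_card (t := (Finset.range n).image f) ?_).trans
    (Finset.card_image_le.trans (by simp))
  intro i hi
  rw [Finset.mem_Icc] at hi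
  obtain ⟨s, hs, rfl⟩ := h i hi.1 hi.2
  exact Finset.mem_image.2 ⟨s, Finset.mem_range.2 hs, rfl⟩

theorem Core.le (h : Core n k μ L LI) : k ≤ n + 1 := by
  have := le_of_surj (μ.get .blk 0) (k - 1) fun i h1 h2 => h.nonempty i h1 (by omega)
  omega

theorem StateLists.congr_right {f g blk : ℕ → ℕ} {LI' : ℕ → List ℕ}
    (h : StateLists n k f g blk L LI) (he : ∀ b, 1 ≤ b → b < k → LI b = LI' b) :
    StateLists n k f g blk L LI' :=
  ⟨h.circ, fun b h1 h2 => he b h1 h2 ▸ h.circI b h1 h2, fun b h1 h2 => he b h1 h2 ▸ h.mem b h1 h2,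
    fun b h1 h2 => he b h1 h2 ▸ h.disj b h1 h2⟩

open Reg in
/-- Turning the parts that have been split off into blocks. -/
theorem wp_splitOn {R T : List ℕ} (hn : (inp .pre).length = n) (hN : 3 * n + 1 ≤ N)
    (hC : Core n k μ L LI) (hrem : ∀ b, 1 ≤ b → b < k → (μ.row .remv b).length ≤ n)
    (hLI : ∀ b s, 1 ≤ b → b < k → (s ∈ LI b ↔ s ∈ R ∧ μ.get .blk 0 s = b))
    (hT : μ.row .tl 0 = T) (hTn : T.Nodup) (hTm : ∀ b, b ∈ T ↔ 1 ≤ b ∧ b < k ∧ LI b ≠ [])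
    (hQ : ∀ t μ' k' L', t + (15 * n + 70) * k ≤ 20 * T.length + 2 + (15 * n + 70) * k' →
      Frame (forRange Reg.k 0 (size .tl)
        (assign D (rd .tl Reg.k) ;;
        .ite (.eq (rd .nxt (hd D)) (hd D)) (moveList (hdI D) (hd D)) newBlock)) μ μ' →
      Core n k' μ' L' (fun _ => []) → SplitInv n μ μ' R T → Q t μ') :
    WP inp N (forRange Reg.k 0 (size .tl)
        (assign D (rd .tl Reg.k) ;;
        .ite (.eq (rd .nxt (hd D)) (hd D)) (moveList (hdI D) (hd D)) newBlock)) Q μ := by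
  -- The cost of a new block is booked on the next free number `k'`. New numbers are at least `k`,
  -- hence not in `T`, so the blocks still to be treated are as they were.
  refine wp_forRange 0 T.length (fun i t μ' => ∃ k' L' LI',
      t + (15 * n + 70) * k ≤ 20 * i + 1 + (15 * n + 70) * k' ∧
      Core n k' μ' L' LI' ∧ SplitInv n μ μ' R (T.take i) ∧ k ≤ k' ∧
      (∀ b ∈ T.drop i, (∀ s, s ∈ LI' b ↔ s ∈ R ∧ μ.get .blk 0 s = b) ∧
        ∀ s, s < n → (μ'.get .blk 0 s = b ↔ μ.get .blk 0 s = b)) ∧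
      (∀ b, 1 ≤ b → b < k' → b ∉ T.drop i → LI' b = []))
    rfl rfl ?_ ?_ ?_ ?_
  · refine ⟨k, L, LI, by omega, ?_, ⟨fun _ _ => rfl, fun _ _ => rfl, fun _ _ _ _ => rfl, ?_⟩,
      le_rfl, ?_, ?_⟩
    · refine ⟨by simpa using hC.num, hC.shape.of_frame (p := assign Reg.k 0) ?_ (fun _ => rfl)
        (fun _ _ => rfl), hC.cnt_len, hC.rel_len, hC.empty, hC.lists, ?_, hC.blk, hC.nonempty,
        hC.mark, hC.pos⟩
      · exact Frame.setReg rfl _ _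
      · obtain ⟨l₁, l₂, h, h'⟩ := hC.blocks
        exact ⟨l₁, l₂, h.congr rfl rfl (by simp), h'⟩
    · intro s t _ _; simp
    · intro b hb
      have := (hTm b).1 (by simpa using hb)
      exact ⟨fun s => hLI b s this.1 this.2.1, fun s _ => Iff.rfl⟩
    · intro b h1 h2 hb
      by_contra h
      exact hb (by simpa using (hTm b).2 ⟨h1, h2, h⟩)
  · intro i t μ' _ _ hF
    simp [hF.row .tl rfl, hT]
  · rintro i t μ' - hi ⟨k', L', LI', ht, hC', hS, hkk, hrest, hdone⟩ hri hF
    have hget : μ'.get .tl 0 i = T.getD i 0 := by rw [Mem.get, hF.row .tl rfl, hT]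
    have hdrop : T.drop i = T.getD i 0 :: T.drop (i + 1) := by
      rw [List.getD_eq_getElem _ _ hi, List.drop_eq_getElem_cons hi]
    have hδT : T.getD i 0 ∈ T := getD_mem hi
    rw [wp_seq, wp_assign, take_succ_of_lt hi]
    simp only [ev_rd, ev_reg, hri, hget]
    set δ := T.getD i 0 with hδ
    rw [hdrop] at hrest hdone
    have hδnot : δ ∉ T.drop (i + 1) := by
      have : (T.drop i).Nodup := hTn.sublist (List.drop_sublist _ _)
      rw [hdrop] at this; exact (List.nodup_cons.1 this).1
    obtain ⟨hδ1, hδ2, hδ3⟩ := (hTm δ).1 hδT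
    have hδk : δ < k' := by omega
    obtain ⟨hδLI, hδblk⟩ := hrest δ (by simp)
    have hδne : LI' δ ≠ [] := by
      obtain ⟨s, hs⟩ := List.exists_mem_of_ne_nil _ hδ3
      exact List.ne_nil_of_mem ((hδLI s).2 ((hLI δ s hδ1 hδ2).1 hs))
    have hc := hC'.lists.circ δ hδ1 hδk
    have hcI := hC'.lists.circI δ hδ1 hδk
    have hm := hC'.lists.mem δ hδ1 hδk
    have hd := hC'.lists.disj δ hδ1 hδk
    have hemp : μ'.get .nxt 0 (n + δ + δ) = n + δ + δ ↔ L' δ = [] := hc.eq_nil_iff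
    have hCs : Core n k' (μ'.setReg D δ) L' LI' := by
      refine ⟨by simpa using hC'.num, hC'.shape.of_frame (p := assign D 0) ?_ (fun _ => rfl)
        (fun _ _ => rfl), hC'.cnt_len, hC'.rel_len, hC'.empty, hC'.lists, ?_, hC'.blk, hC'.nonempty,
        hC'.mark, hC'.pos⟩
      · exact Frame.setReg rfl _ _
      · obtain ⟨l₁, l₂, h, h'⟩ := hC'.blocks
        exact ⟨l₁, l₂, h.congr rfl rfl (by simp), h'⟩
    rw [wp_ite]
    simp only [ev_eq, ev_rd, ev_hd, ev_reg, Mem.reg_setReg, if_true, hn, Mem.get_setReg, hemp]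
    constructor
    · intro h0
      have h0 : L' δ = [] := by by_contra h'; simp [h'] at h0
      have hlen := hC'.shape
      have hlt : ∀ c ∈ LI' δ, c < n := fun c hc => ((hm c).1 (Or.inr hc)).1
      refine WP.conseq (Q := fun t μ' => t = 6 ∧ StateLists n k' (μ'.get .nxt 0) (μ'.get .prv 0)
        (μ'.get .blk 0) (Function.update L' δ (LI' δ)) (Function.update LI' δ [])) ?_ ?_
      · refine wp_moveList (hv := n + δ + δ + 1) (hv' := n + δ + δ) (l := LI' δ) ?_ ?_ hcI hδne
          ?_ ?_ ?_ ?_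
        · intro ν h; simp [h, hn]
        · intro ν h; simp [h, hn]
        · intro h
          rcases List.mem_cons.1 h with h | h
          · omega
          · have := hlt _ h; omega
        · intro c hc
          simp only [Mem.row_setReg, hlen.nxt]
          simp only [List.mem_cons] at hc
          rcases hc with rfl | rfl | hc
          · omega
          · omega
          · have := hlt _ hc; omega
        · intro c hc
          simp only [Mem.row_setReg, hlen.prv]
          simp only [List.mem_cons] at hc
          rcases hc with rfl | rfl | hc
          · omega
          · omega
          · have := hlt _ hc; omega
        · intro lf lg _ _ hc1 hc2 hf1 hf2
          refine ⟨rfl, ?_⟩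
          simp only [Mem.get_setReg, Mem.get_setRow_fun, reduceCtorEq, false_and, if_false, and_self,
            if_true]
          refine hC'.lists.update ?_ hc1 hc2 ?_ ?_
          · intro c h1 h2 h3
            have : c ∉ (n + δ + δ) :: (n + δ + δ + 1) :: LI' δ := by
              simp only [List.mem_cons, not_or]
              exact ⟨h1, h2, fun h => h3 ((hm c).1 (Or.inr h))⟩
            exact ⟨hf1 c this, hf2 c this⟩
          · intro s; rw [← hm s, h0]; simp
          · simp
      · rintro t' μ'' ⟨rfl, hL''⟩ hF'
        have hblk : μ''.get .blk = μ'.get .blk := hF'.get .blk rfl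
        have hrelg : μ''.get .rel = μ'.get .rel := hF'.get .rel rfl
        have hremv : μ''.row .remv = μ'.row .remv := hF'.row .remv rfl
        have hcnt : μ''.row .cnt = μ'.row .cnt := hF'.row .cnt rfl
        have hrel : μ''.row .rel = μ'.row .rel := hF'.row .rel rfl
        refine ⟨k', _, _, by omega, ⟨?_, ?_, ?_, ?_, ?_, hL'', ?_, ?_, ?_, ?_, hC'.pos⟩, ?_, hkk, ?_, ?_⟩
        · have := hF'.reg .num rfl
          simp [this, hC'.num]
        · have := hCs.shape.of_frame hF' (fun _ => rfl) (by
            intro a ha; simp only [List.mem_cons, List.not_mem_nil, or_false] at ha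
            rcases ha with rfl | rfl | rfl | rfl | rfl | rfl <;> rfl)
          exact this.of_frame (p := assign Reg.k 0) (Frame.setReg rfl _ _) (fun _ => rfl)
            (fun _ _ => rfl)
        · simpa [hcnt] using hC'.cnt_len
        · simpa [hrel] using hC'.rel_len
        · simpa [hremv, hcnt, hrel] using hC'.empty
        · obtain ⟨l₁, l₂, h, h'⟩ := hCs.blocks
          refine ⟨l₁, l₂, h.congr ?_ ?_ ?_, ?_⟩
          · simp [hF'.row .bnxt rfl]
          · simp [hF'.row .bprv rfl]
          · simp [hF'.reg .cur rfl]
          · simpa [hremv] using h'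
        · simpa [hblk] using hC'.blk
        · simpa [hblk] using hC'.nonempty
        · simpa [hF'.get .mark rfl] using hC'.mark
        · refine ⟨?_, ?_, ?_, ?_⟩
          · simpa [hblk, hremv] using hS.remv
          · simpa [hblk, hcnt] using hS.cnt
          · simpa [hblk, hrelg] using hS.rel
          · intro s u hs hu
            simp only [Mem.get_setReg, hblk]
            rw [hS.blk s u hs hu]
            refine and_congr_right fun hsu => ⟨fun h h2 => ?_, fun h h2 => h (by simp [h2])⟩
            rcases List.mem_append.1 h2 with h2 | h2
            · exact h h2
            · have h3 : μ.get .blk 0 s = δ := by simpa using h2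
              -- Nothing stays behind in this case: the block lies inside `R` as a whole, and
              -- splitting it has no effect.
              have key : ∀ w, w < n → μ.get .blk 0 w = δ → w ∈ R := fun w hw hwb => by
                have := (hm w).2 ⟨hw, (hδblk w hw).2 hwb⟩
                rw [h0] at this
                exact ((hδLI w).1 (by simpa using this)).1
              simp [key s hs h3, key u hu (hsu ▸ h3)]
        · intro b hb
          obtain ⟨h1, h2⟩ := hrest b (by simp [hb])
          have hbδ : b ≠ δ := by rintro rfl; exact hδnot hb
          rw [Function.update_of_ne hbδ]
          exact ⟨h1, by simpa [hblk] using h2⟩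
        · intro b hb1 hb2 hb
          by_cases hbδ : b = δ
          · rw [hbδ, Function.update_self]
          · rw [Function.update_of_ne hbδ]
            exact hdone b hb1 hb2 (by simp [hbδ, hb])
    · intro h0
      have h0 : L' δ ≠ [] := by intro h'; simp [h'] at h0
      -- After the split all the numbers up to `k'` belong to nonempty blocks. This gives `k' ≤ n`,
      -- which the creation of the block requires.
      have hnew : ∀ i, 1 ≤ i → i ≤ k' → ∃ s, s < n ∧
          (if s ∈ LI' δ then k' else μ'.get .blk 0 s) = i := by
        intro i h1 h2
        by_cases hik : i = k'
        · obtain ⟨s, hs⟩ := List.exists_mem_of_ne_nil _ hδne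
          exact ⟨s, ((hm s).1 (Or.inr hs)).1, by rw [if_pos hs, hik]⟩
        · by_cases hiδ : i = δ
          · obtain ⟨s, hs⟩ := List.exists_mem_of_ne_nil _ h0
            obtain ⟨h3, h4⟩ := (hm s).1 (Or.inl hs)
            exact ⟨s, h3, by rw [if_neg (hd s hs), h4, hiδ]⟩
          · obtain ⟨s, hs, hsi⟩ := hC'.nonempty i h1 (by omega)
            refine ⟨s, hs, ?_⟩
            rw [if_neg, hsi]
            intro h
            exact hiδ (hsi.symm.trans ((hm s).1 (Or.inr h)).2)
      have hk'n : k' ≤ n := le_of_surj _ k' hnew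
      have hremδ : (μ'.row .remv δ).length ≤ n := by
        obtain ⟨s, hs, hsi⟩ := hC'.nonempty δ hδ1 hδk
        rw [← hsi, hS.remv s hs]; exact hrem _ (hC.blk s hs).1 (hC.blk s hs).2
      refine wp_newBlock (k := k') (D₀ := δ) (n := n) (L := L') (LI := LI') hCs.num (by simp)
        ⟨hδ1, hδk⟩ hn hk'n hN hCs.shape hCs.cnt_len hCs.rel_len hCs.empty hCs.lists hδne
        (fun s hs => (hCs.blk s hs).2) hCs.blocks hremδ ?_
      intro t' μ'' ht' hF' hnum hsh hcl hrl hem hsl hbi hblk hremv hcnt hrel hmark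
      simp only [Mem.get_setReg, Mem.row_setReg] at hblk hremv hcnt hrel hmark
      -- The parent of the new block of a state is its old block; hence data stored per block are
      -- unchanged when they are indexed by states.
      have hpar : ∀ s, s < n → parent k' δ (if s ∈ LI' δ then k' else μ'.get .blk 0 s)
          = μ'.get .blk 0 s := by
        intro s hs
        split_ifs with h
        · rw [((hm s).1 (Or.inr h)).2]; simp [parent]
        · have := (hC'.blk s hs).2
          rw [parent, if_neg (by omega)]
      have hb' : ∀ s, s < n → 1 ≤ (if s ∈ LI' δ then k' else μ'.get .blk 0 s) ∧
          (if s ∈ LI' δ then k' else μ'.get .blk 0 s) < k' + 1 := by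
        intro s hs
        have := hC'.blk s hs
        split_ifs <;> omega
      refine ⟨k' + 1, _, _, ?_, ⟨?_, ?_, ?_, ?_, ?_, hsl, ?_, ?_, ?_, ?_, by omega⟩, ?_, by omega,
        ?_, ?_⟩
      · have : (15 * n + 70) * (k' + 1) = (15 * n + 70) * k' + (15 * n + 70) := by ring
        omega
      · simpa using hnum
      · exact hsh.of_frame (p := assign Reg.k 0) (Frame.setReg rfl _ _) (fun _ => rfl)
            (fun _ _ => rfl)
      · exact hcl
      · exact hrl
      · exact hem
      · obtain ⟨l₁, l₂, h, h'⟩ := hbi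
        exact ⟨l₁, l₂, h.congr rfl rfl (by simp), h'⟩
      · simp only [Mem.get_setReg, hblk]
        exact hb'
      · intro b hb1 hb2
        simp only [Mem.get_setReg, hblk]
        exact hnew b hb1 (by omega)
      · intro b; simp only [Mem.get_setReg, hmark]; exact hC'.mark b
      · refine ⟨fun s hs => ?_, fun s hs => ?_, fun s u hs hu => ?_, fun s u hs hu => ?_⟩
        · simp only [Mem.get_setReg, Mem.row_setReg, hblk, hremv, hpar s hs]; exact hS.remv s hs
        · simp only [Mem.get_setReg, Mem.row_setReg, hblk, hcnt, hpar s hs]; exact hS.cnt s hs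
        · simp only [Mem.get_setReg, hblk]
          rw [hrel _ _ (hb' s hs).1 (hb' s hs).2 (hb' u hu).2, hpar s hs, hpar u hu]
          exact hS.rel s u hs hu
        · simp only [Mem.get_setReg, hblk]
          have hIs := hδLI s
          have hIu := hδLI u
          have hbs := hδblk s hs
          have hbu := hδblk u hu
          have hls := (hC'.blk s hs).2
          have hlu := (hC'.blk u hu).2
          have hind := hS.blk s u hs hu
          have e1 : ∀ w, w ∈ List.take i T ++ [δ] ↔ w ∈ List.take i T ∨ w = δ := by simp
          rw [e1]
          have hδ0 : δ ∉ T.take i := getD_not_mem_take hTn hi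
          split_ifs with h1 h2 h2
          · rw [hIs] at h1; rw [hIu] at h2
            simp [h1, h2]
          · rw [hIs] at h1; rw [hIu] at h2
            constructor
            · intro h; omega
            · rintro ⟨h3, h4⟩
              exact absurd ⟨(h4 (Or.inr h1.2)).1 h1.1, h3.symm.trans h1.2⟩ h2
          · rw [hIs] at h1; rw [hIu] at h2
            constructor
            · intro h; omega
            · rintro ⟨h3, h4⟩
              exact absurd ⟨(h4 (Or.inr (h3.trans h2.2))).2 h2.1, h3.trans h2.2⟩ h1
          · rw [hIs] at h1; rw [hIu] at h2
            rw [hind]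
            refine and_congr_right fun h3 => ⟨fun h4 h5 => ?_, fun h4 h5 => h4 (Or.inl h5)⟩
            rcases h5 with h5 | h5
            · exact h4 h5
            · have h6 := h3.symm.trans h5
              exact ⟨fun h => absurd ⟨h, h5⟩ h1, fun h => absurd ⟨h, h6⟩ h2⟩
      · intro b hb
        obtain ⟨h1, h2⟩ := hrest b (by simp [hb])
        have hbδ : b ≠ δ := by rintro rfl; exact hδnot hb
        have hbT := (hTm b).1 (List.mem_of_mem_drop hb)
        have hbk : b ≠ k' := by omega
        rw [Function.update_of_ne hbk, Function.update_of_ne hbδ]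
        refine ⟨h1, fun s hs => ?_⟩
        simp only [hblk]
        rw [← h2 s hs]
        split_ifs with h
        · have := ((hm s).1 (Or.inr h)).2
          omega
        · rfl
      · intro b hb1 hb2 hb
        by_cases hbk : b = k'
        · rw [hbk, Function.update_self]
        rw [Function.update_of_ne hbk]
        by_cases hbδ : b = δ
        · rw [hbδ, Function.update_self]
        · rw [Function.update_of_ne hbδ]
          exact hdone b hb1 (by omega) (by simp [hbδ, hb])
  · rintro t μ' ⟨k', L', LI', ht, hC', hS, hkk, hrest, hdone⟩ - hF
    simp only [Nat.zero_le, max_eq_right, List.take_length, List.drop_length] at ht hS hdone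
    refine hQ _ μ' k' L' (by omega) hF ?_ hS
    exact ⟨hC'.num, hC'.shape, hC'.cnt_len, hC'.rel_len, hC'.empty,
      hC'.lists.congr_right fun b h1 h2 => hdone b h1 h2 (by simp), hC'.blocks, hC'.blk,
      hC'.nonempty, hC'.mark, hC'.pos⟩

/-- Splitting the partition with respect to a set of states. -/
theorem wp_splitBlocks {R : List ℕ} (hn : (inp .pre).length = n) (hN : 3 * n + 1 ≤ N)
    (hC : Core n k μ L fun _ => []) (hrem : ∀ b, 1 ≤ b → b < k → (μ.row .remv b).length ≤ n)
    (hR : μ.row .rs 0 = R) (hRn : R.Nodup) (hRm : ∀ s ∈ R, s < n)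
    (hQ : ∀ t μ' k' L', t + (15 * n + 70) * k ≤ 34 * R.length + 5 + (15 * n + 70) * k' →
      Frame splitBlocks μ μ' → Core n k' μ' L' (fun _ => []) →
      (∀ s, s < n → μ'.row .remv (μ'.get .blk 0 s) = μ.row .remv (μ.get .blk 0 s)) →
      (∀ s, s < n → μ'.row .cnt (μ'.get .blk 0 s) = μ.row .cnt (μ.get .blk 0 s)) →
      (∀ s t, s < n → t < n → μ'.get .rel (μ'.get .blk 0 s) (μ'.get .blk 0 t) =
        μ.get .rel (μ.get .blk 0 s) (μ.get .blk 0 t)) →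
      (∀ s t, s < n → t < n → (μ'.get .blk 0 s = μ'.get .blk 0 t ↔
        μ.get .blk 0 s = μ.get .blk 0 t ∧ (s ∈ R ↔ t ∈ R))) → Q t μ') :
    WP inp N splitBlocks Q μ := by
  refine WP.conseq (Q := fun t μ' => Frame splitBlocks μ μ' → Q t μ') ?_ fun t μ' h hF => h hF
  have hkn := hC.le
  unfold splitBlocks
  rw [wp_seq, wp_erase, wp_seq]
  refine wp_splitOff (n := n) (k := k) (L := L) (R := R) hn (by omega) ?_ ?_ ?_ ?_ ?_ ?_ hRn ?_ ?_
  · simpa using hC.shape.nxt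
  · simpa using hC.shape.prv
  · exact hC.shape.nr _ (by decide) (by decide) (by decide)
  · simp
  · simpa [Mem.get_setRow_fun] using hC.lists
  · simpa using hR
  · intro s hs
    simpa using ⟨hRm s hs, hC.blk s (hRm s hs)⟩
  intro t₁ μ₁ L₁ LI₁ T ht₁ hF₁ hL₁ hLI₁ hT hTn hTm
  simp only [Mem.get_setRow, reduceCtorEq, false_and, if_false, Mem.get_setRow_fun] at hL₁ hLI₁
  have row₁ : ∀ a, a ≠ .tl → a ≠ .nxt → a ≠ .prv → μ₁.row a = μ.row a := by
    intro a h1 h2 h3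
    rw [hF₁.row a (by cases a <;> first | rfl | exact absurd rfl h1 | exact absurd rfl h2 |
      exact absurd rfl h3)]
    funext r; simp [h1]
  have blk₁ : μ₁.get .blk = μ.get .blk := by
    funext r i; simp [Mem.get, row₁ _]
  have rel₁ : μ₁.get .rel = μ.get .rel := by
    funext r i; simp [Mem.get, row₁ _]
  have hsh : Shape n k μ₁ := by
    refine (Shape.of_frame (μ := μ.setRow .tl 0 []) ?_ hF₁ (fun _ => rfl) ?_)
    · exact ⟨by simp [hC.shape.nxt], by simp [hC.shape.prv], by simp [hC.shape.blk],
        by simp [hC.shape.bnxt], by simp [hC.shape.bprv], by simp [hC.shape.mark], hC.shape.nr,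
        hC.shape.nr_remv, hC.shape.nr_cnt, hC.shape.nr_rel⟩
    · intro a ha; simp only [List.mem_cons, List.not_mem_nil, or_false] at ha
      rcases ha with rfl | rfl | rfl | rfl | rfl | rfl <;> rfl
  have hC₁ : Core n k μ₁ L₁ LI₁ := by
    refine ⟨?_, hsh, ?_, ?_, ?_, ?_, ?_, ?_, ?_, ?_, hC.pos⟩
    · rw [hF₁.reg .num rfl]; exact hC.num
    · rw [row₁ _ (by decide) (by decide) (by decide)]; exact hC.cnt_len
    · rw [row₁ _ (by decide) (by decide) (by decide)]; exact hC.rel_len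
    · rw [row₁ .remv (by decide) (by decide) (by decide), row₁ .cnt (by decide) (by decide)
        (by decide), row₁ .rel (by decide) (by decide) (by decide)]; exact hC.empty
    · rw [blk₁]; exact hL₁
    · obtain ⟨l₁, l₂, h, h'⟩ := hC.blocks
      refine ⟨l₁, l₂, h.congr ?_ ?_ ?_, ?_⟩
      · rw [row₁ _ (by decide) (by decide) (by decide)]
      · rw [row₁ _ (by decide) (by decide) (by decide)]
      · rw [hF₁.reg .cur rfl]; rfl
      · rw [row₁ _ (by decide) (by decide) (by decide)]; exact h'
    · rw [blk₁]; exact hC.blk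
    · rw [blk₁]; exact hC.nonempty
    · intro b; rw [hF₁.get .mark rfl]; simpa using hC.mark b
  -- Every touched block contains a state of `R`, so the second loop is linear in `R` as well, apart
  -- from the creation of blocks.
  have hTR : T.length ≤ R.length := by
    rw [← List.toFinset_card_of_nodup hTn, ← List.toFinset_card_of_nodup hRn]
    refine (Finset.card_le_card (t := R.toFinset.image (μ.get .blk 0)) fun b hb => ?_).trans
      Finset.card_image_le
    obtain ⟨h1, h2, h3⟩ := (hTm b).1 (by simpa using hb)
    obtain ⟨s, hs⟩ := List.exists_mem_of_ne_nil _ h3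
    obtain ⟨h4, h5⟩ := (hLI₁ b s h1 h2).1 hs
    exact Finset.mem_image.2 ⟨s, by simpa using h4, h5⟩
  refine wp_splitOn (R := R) hn hN hC₁ ?_ ?_ hT hTn hTm ?_
  · rw [row₁ _ (by decide) (by decide) (by decide)]; exact hrem
  · rw [blk₁]; exact hLI₁
  intro t₂ μ₂ k' L' ht₂ hF₂ hC₂ hS hF
  refine hQ _ _ k' L' (by omega) hF hC₂ ?_ ?_ ?_ ?_
  · intro s hs; rw [hS.remv s hs, blk₁, row₁ _ (by decide) (by decide) (by decide)]
  · intro s hs; rw [hS.cnt s hs, blk₁, row₁ _ (by decide) (by decide) (by decide)]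
  · intro s u hs hu; rw [hS.rel s u hs hu, blk₁, rel₁]
  · intro s u hs hu
    rw [hS.blk s u hs hu, blk₁]
    refine and_congr_right fun h => ⟨fun h1 => ?_, fun h1 _ => h1⟩
    have key : ∀ w, w < n → w ∈ R → μ.get .blk 0 w ∈ T := by
      intro w hw hwR
      have := hC.blk w hw
      exact (hTm _).2 ⟨this.1, this.2, List.ne_nil_of_mem ((hLI₁ _ w this.1 this.2).2 ⟨hwR, rfl⟩)⟩
    by_cases hsT : μ.get .blk 0 s ∈ T
    · exact h1 hsT
    · exact ⟨fun h2 => absurd (key s hs h2) hsT, fun h2 => absurd (h ▸ key u hu h2) hsT⟩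

end

/-! ### Listing blocks without repetitions by means of marks -/

/-- The predecessors of a state, according to the input. -/
def prd (inp : Input) (y : ℕ) : List ℕ := (inp .pre).getD y []

section
variable {inp : Input} {N n k : ℕ} {Q : ℕ → Mem → Prop} {μ μ' : Mem} {l : Tab} {X : List ℕ}

/-- The table `l` lists the marked blocks. -/
structure Marked (l : Tab) (k : ℕ) (μ : Mem) (X : List ℕ) : Prop where
  row : μ.row l 0 = X
  nodup : X.Nodup
  lt : ∀ b ∈ X, b < k
  mark : ∀ b, μ.get .mark 0 b = if b ∈ X then 1 else 0

theorem Marked.congr (h : Marked l k μ X) (h1 : μ'.row l 0 = μ.row l 0)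
    (h2 : μ'.row .mark 0 = μ.row .mark 0) : Marked l k μ' X :=
  ⟨h1.trans h.row, h.nodup, h.lt, fun b => by rw [Mem.get, h2]; exact h.mark b⟩

/-- The mark is a membership test in constant time, so that the cost of a list does not depend on
its length so far. -/
theorem wp_collect {e : Expr} {v : ℕ} (hl : l ≠ .mark) (hX : Marked l k μ X)
    (he : ∀ μ' : Mem, μ'.reg = μ.reg → (∀ a, a ≠ .mark → a ≠ l → μ'.row a = μ.row a) →
      e.ev inp μ' = v)
    (hv : v < k) (hk : (μ.row .mark 0).length = k) (hN : k ≤ N) (hnr : μ.nr l = 1)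
    (hQ : ∀ t μ' X', t ≤ 4 → Marked l k μ' X' → (∀ b, b ∈ X' ↔ b ∈ X ∨ b = v) →
      X'.length ≤ X.length + 1 → Q t μ') :
    WP inp N (collect l e) Q μ := by
  have he0 : e.ev inp μ = v := he μ rfl fun _ _ _ => rfl
  have he1 : e.ev inp (μ.setRow .mark 0 ((μ.row .mark 0).set v 1)) = v := by
    refine he _ rfl fun a h1 h2 => ?_
    funext r; simp [h1]
  unfold collect
  rw [wp_ifThen]
  simp only [ev_eq, ev_rd, he0, ev_zero, wp_seq, wp_wr, wp_push, ev_one, he1]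
  have hm := hX.mark v
  constructor
  · intro h
    have h0 : v ∉ X := by intro h'; simp [hm, h'] at h
    have hlen : X.length ≤ k := length_le_of_nodup_of_lt hX.nodup hX.lt
    refine ⟨⟨by simp [hnr], by simp [hl, hX.row]; omega⟩, hQ _ _ (X ++ [v]) (by omega) ⟨?_, ?_, ?_, ?_⟩ ?_ ?_⟩
    · simp [hl, hX.row]
    · rw [List.nodup_append]
      refine ⟨hX.nodup, by simp, fun a ha b hb => ?_⟩
      rw [List.mem_singleton.1 hb]; rintro rfl; exact h0 ha
    · intro b hb
      rcases List.mem_append.1 hb with hb | hb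
      · exact hX.lt b hb
      · rwa [List.mem_singleton.1 hb]
    · intro b
      have := hX.mark b
      simp only [Mem.get_setRow, hl.symm, false_and, if_false, and_self, if_true]
      rw [getD_set, hk]
      by_cases hb : b = v
      · simp [hb, hv]
      · simp only [hb, false_and, if_false]
        rw [show (μ.row .mark 0).getD b 0 = μ.get .mark 0 b from rfl, this]
        simp [hb]
    · simp
    · simp
  · intro h
    have h0 : v ∈ X := by by_contra h'; simp [hm, h'] at h
    refine hQ _ _ X (by omega) hX (fun b => ?_) (by omega)
    constructor
    · exact Or.inl
    · rintro (hb | rfl)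
      · exact hb
      · exact h0

-- Marks are reset by going through the list itself, at a cost independent of the number of all
-- blocks.
open Reg in
theorem wp_unmark (hl : l ≠ .mark) (hX : Marked l k μ X) (hk : (μ.row .mark 0).length = k)
    (hQ : ∀ t μ', t ≤ 3 * X.length + 2 → Frame (unmark l) μ μ' →
      (∀ b, μ'.get .mark 0 b = 0) → Q t μ') :
    WP inp N (unmark l) Q μ := by
  unfold unmark
  refine wp_forRange 0 X.length (fun i t μ' => t ≤ 3 * i + 1 ∧
    ∀ b, μ'.get .mark 0 b = if b ∈ X.drop i then 1 else 0) rfl rfl ?_ ?_ ?_ ?_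
  · simpa using hX.mark
  · intro i t μ' _ _ hF
    have : μ'.row l = μ.row l :=
      hF.row l (by rw [modTab_forRange]; simpa [wr, Cmd.modTab] using hl)
    simp [this, hX.row]
  · rintro i t μ' - hi ⟨ht, hm⟩ hri hF
    have hrow : μ'.row l = μ.row l :=
      hF.row l (by rw [modTab_forRange]; simpa [wr, Cmd.modTab] using hl)
    have hlen : (μ'.row .mark 0).length = k := by
      rw [hF.len .mark (by simp [forRange, assign, wr, Cmd.modLen]), hk]
    rw [wp_wr]
    refine ⟨by omega, fun b => ?_⟩
    have hmb := hm b
    have hd : X.drop i = X.getD i 0 :: X.drop (i + 1) := by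
      rw [List.getD_eq_getElem _ _ hi, List.drop_eq_getElem_cons hi]
    have hnd : (X.drop i).Nodup := hX.nodup.sublist (List.drop_sublist _ _)
    rw [hd] at hmb hnd
    simp only [ev_rd, ev_reg, hri, ev_zero, Mem.get_setReg, Mem.get_setRow, and_self, if_true]
    have hg : μ'.get l 0 i = X.getD i 0 := by rw [Mem.get, hrow, hX.row]
    rw [getD_set, hg, hlen]
    by_cases hb : b = X.getD i 0
    · rw [hb, if_neg (List.nodup_cons.1 hnd).1, if_pos ⟨rfl, hX.lt _ (getD_mem hi)⟩]
    · rw [if_neg (fun h => hb h.1), show (μ'.row .mark 0).getD b 0 = μ'.get .mark 0 b from rfl, hmb]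
      simp only [List.mem_cons, hb, false_or]
  · rintro t μ' ⟨ht, hm⟩ - hF
    simp only [Nat.zero_le, max_eq_right, List.drop_length, List.not_mem_nil, if_false] at ht hm
    exact hQ _ _ (by omega) hF hm

open Reg in
/-- Listing the blocks of the states in the remove set. -/
theorem wp_removeList {R : List ℕ} (hR : μ.row .rs 0 = R) (hnr : μ.nr .rl = 1)
    (hmark : ∀ b, μ.get .mark 0 b = 0) (hk : (μ.row .mark 0).length = k) (hN : k ≤ N)
    (hRm : ∀ s ∈ R, μ.get .blk 0 s < k)
    (hQ : ∀ t μ' X, t ≤ 9 * R.length + 6 → Frame removeList μ μ' →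
      μ'.row .rl 0 = X → X.Nodup → (∀ b, b ∈ X ↔ ∃ s ∈ R, μ.get .blk 0 s = b) →
      X.length ≤ R.length →
      (∀ b, μ'.get .mark 0 b = 0) → Q t μ') :
    WP inp N removeList Q μ := by
  refine WP.conseq (Q := fun t μ' => Frame removeList μ μ' → Q t μ') ?_ fun t μ' h hF => h hF
  unfold removeList
  rw [wp_seq, wp_erase, wp_seq]
  refine wp_forRange 0 R.length (fun i t μ' => t ≤ 6 * i + 1 ∧ ∃ X, Marked .rl k μ' X ∧
    X.length ≤ i ∧ ∀ b, b ∈ X ↔ ∃ s ∈ R.take i, μ.get .blk 0 s = b) rfl rfl ?_ ?_ ?_ ?_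
  · refine ⟨le_rfl, [], ⟨by simp, by simp, by simp, by simpa using hmark⟩, by simp, by simp⟩
  · intro i t μ' _ _ hF
    simp [hF.row .rs rfl, hR]
  · rintro i t μ' - hi ⟨ht, X, hX, hXl, hXm⟩ hri hF
    have hrs : ∀ j, μ'.get .rs 0 j = R.getD j 0 := by
      intro j; rw [Mem.get, hF.row .rs rfl]; simp [hR]
    have hb : ∀ j, μ'.get .blk 0 j = μ.get .blk 0 j := by
      intro j; rw [Mem.get, hF.row .blk rfl]; simp [Mem.get]
    refine wp_collect (v := μ.get .blk 0 (R.getD i 0)) (by decide) hX ?_ (hRm _ (getD_mem hi)) ?_ hN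
      ?_ ?_
    · intro ν h1 h2
      have e1 : ν.get .blk 0 = μ.get .blk 0 := by
        funext j; rw [← hb, Mem.get, h2 _ (by decide) (by decide)]; rfl
      have e2 : ν.get .rs 0 i = R.getD i 0 := by
        rw [← hrs, Mem.get, h2 _ (by decide) (by decide)]; rfl
      simp only [ev_rd, ev_reg, h1, hri, e1, e2]
    · rw [hF.len .mark rfl]; simpa using hk
    · rw [hF.nr .rl rfl]; simpa using hnr
    · intro t' μ'' X' ht' hX' hXm' hXl'
      refine ⟨by omega, X', hX'.congr rfl rfl, by omega, fun b => ?_⟩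
      rw [hXm', hXm, take_succ_of_lt hi]
      constructor
      · rintro (⟨s, hs, h⟩ | rfl)
        · exact ⟨s, by simp [hs], h⟩
        · exact ⟨R.getD i 0, by simp, rfl⟩
      · rintro ⟨s, hs, h⟩
        rcases List.mem_append.1 hs with hs | hs
        · exact Or.inl ⟨s, hs, h⟩
        · rw [List.mem_singleton.1 hs] at h; exact Or.inr h.symm
  · rintro t μ' ⟨ht, X, hX, hXl, hXm⟩ - hF
    simp only [Nat.zero_le, max_eq_right, List.take_length] at ht hXm hXl
    refine wp_unmark (by decide) hX ?_ fun t' μ'' ht' hF' hm hFF => ?_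
    · rw [hF.len .mark rfl]; simpa using hk
    · refine hQ _ _ X (by omega) hFF ?_ hX.nodup hXm hXl hm
      rw [hF'.row .rl rfl, hX.row]

open Reg in
/-- Listing the blocks of the predecessors of the selected block. -/
theorem wp_predList {Bs : List ℕ} (hB : μ.row .bp 0 = Bs) (hnr : μ.nr .cl = 1)
    (hmark : ∀ b, μ.get .mark 0 b = 0) (hk : (μ.row .mark 0).length = k) (hN : k ≤ N)
    (hm : ∀ y, ∀ x ∈ prd inp y, μ.get .blk 0 x < k)
    (hQ : ∀ t μ' X, t ≤ 12 * (Bs.map (wt (prd inp))).sum + 6 → Frame predList μ μ' →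
      μ'.row .cl 0 = X → X.Nodup →
      (∀ b, b ∈ X ↔ ∃ y ∈ Bs, ∃ x ∈ prd inp y, μ.get .blk 0 x = b) →
      X.length ≤ (Bs.map (wt (prd inp))).sum →
      (∀ b, μ'.get .mark 0 b = 0) → Q t μ') :
    WP inp N predList Q μ := by
  refine WP.conseq (Q := fun t μ' => Frame predList μ μ' → Q t μ') ?_ fun t μ' h hF => h hF
  unfold predList
  rw [wp_seq, wp_erase, wp_seq]
  refine wp_forRange 0 Bs.length (fun i t μ' => t ≤ 9 * ((Bs.take i).map (wt (prd inp))).sum + 1 ∧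
    ∃ X, Marked .cl k μ' X ∧ X.length ≤ ((Bs.take i).map (wt (prd inp))).sum ∧
    ∀ b, b ∈ X ↔ ∃ y ∈ Bs.take i, ∃ x ∈ prd inp y, μ.get .blk 0 x = b) rfl rfl ?_ ?_ ?_ ?_
  · refine ⟨by simp, [], ⟨by simp, by simp, by simp, by simpa using hmark⟩, by simp, by simp⟩
  · intro i t μ' _ _ hF
    simp [hF.row .bp rfl, hB]
  · rintro i t μ' - hi ⟨ht, X, hX, hXl, hXm⟩ hri hF
    have hbp : μ'.get .bp 0 i = Bs.getD i 0 := by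
      rw [Mem.get, hF.row .bp rfl]; simp [hB]
    have hb : ∀ j, μ'.get .blk 0 j = μ.get .blk 0 j := by
      intro j; rw [Mem.get, hF.row .blk rfl]; simp [Mem.get]
    rw [wp_seq, wp_assign]
    simp only [ev_rd, ev_reg, hri, hbp, take_succ_of_lt hi, List.map_append, List.sum_append,
      List.map_singleton, List.sum_singleton]
    set y₀ := Bs.getD i 0 with hy₀
    refine wp_forRange 0 (prd inp y₀).length (fun j t' μ'' => t' ≤ 6 * j + 1 ∧
      ∃ X', Marked .cl k μ'' X' ∧ X'.length ≤ X.length + j ∧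
      ∀ b, b ∈ X' ↔ b ∈ X ∨ ∃ x ∈ (prd inp y₀).take j, μ.get .blk 0 x = b) rfl rfl ?_ ?_ ?_ ?_
    · exact ⟨le_rfl, X, hX.congr rfl rfl, by simp, by simp⟩
    · intro j t' μ'' _ _ hF'
      have := hF'.reg .y rfl
      simp only [ev_inLen, ev_reg, this, Mem.reg_setReg, if_true]; rfl
    · rintro j t' μ'' - hj ⟨ht', X', hX', hXl', hXm'⟩ hrj hF'
      have hy := hF'.reg .y rfl
      simp only [Mem.reg_setReg, if_true] at hy
      have hb' : ∀ j, μ''.get .blk 0 j = μ.get .blk 0 j := by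
        intro j; rw [Mem.get, hF'.row .blk rfl]; exact hb j
      refine wp_collect (v := μ.get .blk 0 ((prd inp y₀).getD j 0)) (by decide) hX' ?_
        (hm y₀ _ (getD_mem hj)) ?_ hN ?_ ?_
      · intro ν h1 h2
        have e1 : ν.get .blk 0 = μ.get .blk 0 := by
          funext j; rw [← hb', Mem.get, h2 _ (by decide) (by decide)]; rfl
        simp only [ev_rd, ev_inGet, ev_reg, h1, hrj, e1, hy]; rfl
      · rw [hF'.len .mark rfl, Mem.row_setReg, hF.len .mark rfl]; simpa using hk
      · rw [hF'.nr .cl rfl, Mem.nr_setReg, hF.nr .cl rfl]; simpa using hnr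
      · intro t'' μ3 X'' ht'' hX'' hXm'' hXl''
        refine ⟨by omega, X'', hX''.congr rfl rfl, by omega, fun b => ?_⟩
        rw [hXm'', hXm', take_succ_of_lt hj]
        constructor
        · rintro ((h | ⟨s, hs, h⟩) | rfl)
          · exact Or.inl h
          · exact Or.inr ⟨s, by simp [hs], h⟩
          · exact Or.inr ⟨_, List.mem_append_right _ (List.mem_singleton.2 rfl), rfl⟩
        · rintro (h | ⟨s, hs, h⟩)
          · exact Or.inl (Or.inl h)
          · rcases List.mem_append.1 hs with hs | hs
            · exact Or.inl (Or.inr ⟨s, hs, h⟩)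
            · rw [List.mem_singleton.1 hs] at h; exact Or.inr h.symm
    · rintro t' μ'' ⟨ht', X', hX', hXl', hXm'⟩ - hF'
      simp only [Nat.zero_le, max_eq_right, List.take_length] at ht' hXm' hXl'
      have hw : wt (prd inp) y₀ = (prd inp y₀).length + 1 := rfl
      refine ⟨by omega, X', hX'.congr rfl rfl, by omega, fun b => ?_⟩
      rw [hXm', hXm]
      constructor
      · rintro (⟨y, hy, h⟩ | h)
        · exact ⟨y, by simp [hy], h⟩
        · exact ⟨y₀, by simp, h⟩
      · rintro ⟨y, hy, h⟩
        rcases List.mem_append.1 hy with hy | hy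
        · exact Or.inl ⟨y, hy, h⟩
        · rw [List.mem_singleton.1 hy] at h; exact Or.inr h
  · rintro t μ' ⟨ht, X, hX, hXl, hXm⟩ - hF
    simp only [Nat.zero_le, max_eq_right, List.take_length] at ht hXm hXl
    refine wp_unmark (by decide) hX ?_ fun t' μ'' ht' hF' hm hFF => ?_
    · rw [hF.len .mark rfl]; simpa using hk
    · refine hQ _ _ X (by omega) hFF ?_ hX.nodup hXm hXl hm
      rw [hF'.row .cl rfl, hX.row]

end

/-! ### Removing pairs from the relation: transition counts and remove sets -/

section
variable {inp : Input} {N n k : ℕ} {Q : ℕ → Mem → Prop} {μ ν : Mem} {L : ℕ → List ℕ}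

/-- The transition counts are those of the relation. -/
def CountsOk (inp : Input) (n k : ℕ) (μ : Mem) : Prop :=
  ∀ b, 1 ≤ b → b < k → ∀ z, μ.get .cnt b z = ((Finset.range n).filter fun w =>
    z ∈ prd inp w ∧ μ.get .rel b (μ.get .blk 0 w) ≠ 0).card

/-- The remove sets have been extended by the states whose counts dropped to `0` on the way from
the memory `μ` to the memory `ν`. -/
structure Dropped (k : ℕ) (μ ν : Mem) : Prop where
  cnt_len : ∀ b, (ν.row .cnt b).length = (μ.row .cnt b).length
  cnt_le : ∀ b z, ν.get .cnt b z ≤ μ.get .cnt b z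
  out : ∀ b, ¬ (1 ≤ b ∧ b < k) → ν.row .cnt b = μ.row .cnt b
  remv : ∀ b, ∃ Z, ν.row .remv b = μ.row .remv b ++ Z ∧ Z.Nodup ∧
    ∀ z, z ∈ Z ↔ 0 < μ.get .cnt b z ∧ ν.get .cnt b z = 0
  blocks : BlockInv k ν

theorem Dropped.refl (h : BlockInv k μ) : Dropped k μ μ :=
  ⟨fun _ => rfl, fun _ _ => le_rfl, fun _ _ => rfl, fun b => ⟨[], by simp, by simp, fun z => by simp; omega⟩, h⟩

theorem Dropped.congr {ν' : Mem} (h : Dropped k μ ν) (h1 : ν'.row .cnt = ν.row .cnt)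
    (h2 : ν'.row .remv = ν.row .remv) (h3 : ν'.row .bnxt = ν.row .bnxt)
    (h4 : ν'.row .bprv = ν.row .bprv) (h5 : ν'.reg .cur = ν.reg .cur) : Dropped k μ ν' := by
  have hg : ν'.get .cnt = ν.get .cnt := by funext r i; rw [Mem.get, h1]; rfl
  refine ⟨by rw [h1]; exact h.cnt_len, by rw [hg]; exact h.cnt_le, by rw [h1]; exact h.out, ?_, ?_⟩
  · rw [h2, hg]; exact h.remv
  · obtain ⟨l₁, l₂, h6, h7⟩ := h.blocks
    exact ⟨l₁, l₂, h6.congr (by rw [h3]) (by rw [h4]) h5, by rw [h2]; exact h7⟩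

theorem lt_of_get_pos {a : Tab} {r i : ℕ} (h : 0 < μ.get a r i) : i < (μ.row a r).length := by
  by_contra h'
  rw [Mem.get, List.getD_eq_default _ _ (by omega)] at h
  omega

/-- Old elements have count `0` and new ones had a positive count, so no state is entered twice;
this bounds the row and makes the appends legal. -/
theorem Dropped.length_le (h : Dropped k μ ν) {b : ℕ} (hn : (μ.row .remv b).Nodup)
    (hr : ∀ z ∈ μ.row .remv b, z < n ∧ μ.get .cnt b z = 0) (hc : (μ.row .cnt b).length ≤ n) :
    (ν.row .remv b).length ≤ n := by
  obtain ⟨Z, h1, h2, h3⟩ := h.remv b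
  rw [h1]
  refine length_le_of_nodup_of_lt ?_ ?_
  · rw [List.nodup_append]
    refine ⟨hn, h2, fun z hz w hw => ?_⟩
    rintro rfl
    have := (hr z hz).2
    have := ((h3 z).1 hw).1
    omega
  · intro z hz
    rcases List.mem_append.1 hz with hz | hz
    · exact (hr z hz).1
    · exact (lt_of_get_pos ((h3 z).1 hz).1).trans_le hc

open Reg in
/-- Decrementing a count. -/
theorem wp_decrement {C₀ x₀ : ℕ} (hC : ν.reg .C = C₀) (hx : ν.reg .x = x₀) (hC₀ : 1 ≤ C₀ ∧ C₀ < k)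
    (hd : Dropped k μ ν) (hpos : 0 < ν.get .cnt C₀ x₀)
    (hf : (ν.row .bnxt 0).length = k) (hg : (ν.row .bprv 0).length = k) (hnr : ν.nr .remv = k)
    (hlen : (ν.row .remv C₀).length ≤ N)
    (hQ : ∀ t ν', t ≤ 12 → Dropped k μ ν' →
      (∀ b z, ν'.get .cnt b z = if b = C₀ ∧ z = x₀ then ν.get .cnt b z - 1 else ν.get .cnt b z) →
      Q t ν') :
    WP inp N (wr₂ .cnt C x (.get .cnt C x - 1) ;;
          ifThen (.eq (.get .cnt C x) 0)
            (ifThen (.eq (.len .remv C) 0) (moveAtTheEnd C) ;; push₂ .remv C x)) Q ν := by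
  have hlt := lt_of_get_pos hpos
  rw [wp_seq, wp_wr₂]
  simp only [ev_reg, hC, hx, ev_sub, ev_get, ev_one]
  set ν₁ := ν.setRow .cnt C₀ ((ν.row .cnt C₀).set x₀ (ν.get .cnt C₀ x₀ - 1)) with hν₁
  have hcnt : ∀ b z, ν₁.get .cnt b z =
      if b = C₀ ∧ z = x₀ then ν.get .cnt b z - 1 else ν.get .cnt b z := by
    intro b z
    rw [hν₁, Mem.get_setRow]
    by_cases hb : b = C₀
    · subst hb
      simp only [true_and, if_true]
      rw [getD_set]
      by_cases hz : z = x₀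
      · subst hz; rw [if_pos ⟨rfl, hlt⟩, if_pos rfl]
      · rw [if_neg (fun h => hz h.1), if_neg hz]; rfl
    · simp [hb]
  have hcl : ∀ b, (ν₁.row .cnt b).length = (μ.row .cnt b).length := by
    intro b
    rw [← hd.cnt_len, hν₁, Mem.row_setRow]
    split_ifs with h
    · rw [List.length_set, h.2]
    · rfl
  have hcle : ∀ b z, ν₁.get .cnt b z ≤ μ.get .cnt b z := by
    intro b z
    have := hd.cnt_le b z
    rw [hcnt]; split_ifs <;> omega
  have hout : ∀ b, ¬ (1 ≤ b ∧ b < k) → ν₁.row .cnt b = μ.row .cnt b := by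
    intro b hb
    have : b ≠ C₀ := by rintro rfl; exact hb hC₀
    rw [← hd.out b hb, hν₁]; simp [this]
  have hr1 : ν₁.row .remv = ν.row .remv := by funext r; simp [hν₁]
  have hn1 : ν₁.row .bnxt = ν.row .bnxt := by funext r; simp [hν₁]
  have hp1 : ν₁.row .bprv = ν.row .bprv := by funext r; simp [hν₁]
  have hbi : BlockInv k ν₁ := by
    obtain ⟨l₁, l₂, h1, h2⟩ := hd.blocks
    exact ⟨l₁, l₂, h1.congr (by rw [hn1]) (by rw [hp1]) (by simp [hν₁]), by rw [hr1]; exact h2⟩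
  rw [wp_ifThen]
  simp only [ev_eq, ev_get, ev_reg, ev_zero]
  have hC1 : ν₁.reg .C = C₀ := by simp [hν₁, hC]
  have hx1 : ν₁.reg .x = x₀ := by simp [hν₁, hx]
  simp only [hC1, hx1]
  have hcx : ν₁.get .cnt C₀ x₀ = ν.get .cnt C₀ x₀ - 1 := by rw [hcnt, if_pos ⟨rfl, rfl⟩]
  constructor
  · intro h
    have h0 : ν₁.get .cnt C₀ x₀ = 0 := by by_contra h'; simp [h'] at h
    -- Common to both cases, whether the block had to be moved or not: it is already outside the
    -- front part when its remove set receives the new element.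
    have finish : ∀ ν₂ : Mem, ν₂.reg .C = C₀ → ν₂.reg .x = x₀ → ν₂.nr .remv = k →
        ν₂.row .cnt = ν₁.row .cnt → ν₂.row .remv = ν₁.row .remv →
        (∃ l₁ l₂, BlockList ν₂ l₁ l₂ ∧ (∀ b, b ∈ l₁ ++ l₂ ↔ 1 ≤ b ∧ b < k) ∧ C₀ ∉ l₁ ∧
          (∀ b ∈ l₁, ν.row .remv b = []) ∧ ∀ b ∈ l₂, b ≠ C₀ → ν.row .remv b ≠ []) →
        ∀ t₀, t₀ ≤ 9 → WP inp N (push₂ .remv C x) (fun t => Q (1 + (1 + (t₀ + t)))) ν₂ := by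
      intro ν₂ e1 e2 e3 e4 e5 ⟨l₁, l₂, h1, h2, h3, h4, h5⟩ t₀ ht₀
      rw [wp_push₂]
      simp only [ev_reg, e1, e2, e3, e5, hr1]
      refine ⟨⟨hC₀.2, hlen⟩, hQ _ _ (by omega) ?_ ?_⟩
      · have hg2 : (ν₂.setRow .remv C₀ (ν.row .remv C₀ ++ [x₀])).get .cnt = ν₁.get .cnt := by
          funext r i; simp [Mem.get, e4]
        refine ⟨?_, by rw [hg2]; exact hcle, ?_, ?_, l₁, l₂, h1.congr (by simp) (by simp) rfl,
          h2, ?_, ?_⟩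
        · intro b; simp only [Mem.row_setRow, reduceCtorEq, false_and, if_false, e4]; exact hcl b
        · intro b; simp only [Mem.row_setRow, reduceCtorEq, false_and, if_false, e4]; exact hout b
        · intro b
          obtain ⟨Z, g1, g2, g3⟩ := hd.remv b
          rw [hg2]
          by_cases hb : b = C₀
          · subst hb
            refine ⟨Z ++ [x₀], by simp [g1], ?_, ?_⟩
            · rw [List.nodup_append]
              refine ⟨g2, by simp, fun z hz w hw => ?_⟩
              rw [List.mem_singleton.1 hw]
              rintro rfl
              have := ((g3 z).1 hz).2
              omega
            · intro z
              rw [List.mem_append, g3, List.mem_singleton]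
              by_cases hz : z = x₀
              · subst hz
                have := hd.cnt_le b z
                simp only [h0, or_true, and_true, true_iff]; omega
              · rw [hcnt, if_neg (fun h => hz h.2)]; simp [hz]
          · refine ⟨Z, by simp [hb, e5, hr1, g1], g2, fun z => ?_⟩
            rw [g3, hcnt, if_neg (fun h => hb h.1)]
        · intro b hb
          have : b ≠ C₀ := by rintro rfl; exact h3 hb
          simp only [Mem.row_setRow, this, and_false, if_false, e5, hr1]
          exact h4 b hb
        · intro b hb
          by_cases hbC : b = C₀
          · simp [hbC]
          · simp only [Mem.row_setRow, hbC, and_false, if_false, e5, hr1]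
            exact h5 b hb hbC
      · intro b z
        rw [← hcnt]; simp [Mem.get, e4]
    rw [wp_seq, wp_ifThen]
    simp only [ev_eq, ev_len, ev_reg, ev_zero]
    simp only [hC1, hr1]
    obtain ⟨l₁, l₂, h1, h2, h3, h4⟩ := hbi
    rw [hr1] at h3 h4
    have hCm := (h2 C₀).2 hC₀
    constructor
    · intro h5
      have h5 : ν.row .remv C₀ = [] := by by_contra h'; simp [h'] at h5
      have h6 : C₀ ∈ l₁ := (List.mem_append.1 hCm).resolve_right fun h => h4 _ h h5
      obtain ⟨p, q, rfl⟩ := List.append_of_mem h6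
      have hn := h1.circ.nodup
      simp only [List.nodup_cons, List.nodup_append, List.mem_cons] at hn
      refine wp_moveAtTheEnd (b := C₀) (l₁ := p) (l₁' := q) (l₂ := l₂) ?_ h1 ?_ ?_ ?_
      · intro ν' h; simp only [ev_reg, h, hC1]
      · intro c hc
        rw [hn1, hf]
        rcases List.mem_cons.1 hc with rfl | hc
        · omega
        · exact ((h2 c).1 hc).2
      · intro c hc
        rw [hp1, hg]
        rcases List.mem_cons.1 hc with rfl | hc
        · omega
        · exact ((h2 c).1 hc).2
      · intro t ν₂ ht hF hx2 hB
        refine finish ν₂ ?_ ?_ ?_ ?_ ?_ ⟨_, _, hB, ?_, ?_, ?_, ?_⟩ _ (by omega)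
        · rw [hF.reg .C rfl, hC1]
        · rw [hx2, hx1]
        · rw [hF.nr .remv rfl]; exact hnr
        · exact hF.row .cnt rfl
        · exact hF.row .remv rfl
        · intro b
          rw [← h2 b]
          simp only [List.mem_append, List.mem_cons, List.not_mem_nil, or_false]
          tauto
        · intro h
          rcases List.mem_append.1 h with h | h
          · exact hn.2.1.2.2 _ h _ (Or.inl rfl) rfl
          · exact hn.2.1.2.1.1 h
        · intro b hb
          refine h3 b ?_
          simp only [List.mem_append, List.mem_cons] at hb ⊢; tauto
        · intro b hb hbC
          refine h4 b ?_
          simp only [List.mem_append, List.mem_cons, List.not_mem_nil, or_false] at hb; tauto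
    · intro h5
      have h5 : ν.row .remv C₀ ≠ [] := by intro h'; simp [h'] at h5
      refine finish ν₁ hC1 hx1 (by simpa [hν₁] using hnr) rfl rfl ⟨l₁, l₂, h1, h2, ?_, h3, ?_⟩ _ (by omega)
      · exact fun h => h5 (h3 _ h)
      · exact fun b hb _ => h4 b hb
  · intro h
    have h0 : ν₁.get .cnt C₀ x₀ ≠ 0 := by intro h'; simp [h'] at h
    refine hQ _ _ (by omega) ⟨hcl, hcle, hout, ?_, hbi⟩ hcnt
    intro b
    obtain ⟨Z, g1, g2, g3⟩ := hd.remv b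
    refine ⟨Z, by rw [hr1, g1], g2, fun z => ?_⟩
    rw [g3, hcnt]
    split_ifs with h
    · obtain ⟨rfl, rfl⟩ := h
      rw [← hcx]
      omega
    · rfl

/-- The assumptions on the memory `μ` at the beginning of the refinement of the relation. -/
structure Ready (inp : Input) (N n k : ℕ) (μ : Mem) (L : ℕ → List ℕ) : Prop where
  core : Core n k μ L fun _ => []
  states : (inp .pre).length = n
  bound : n ≤ N
  prd_nodup : ∀ w, (prd inp w).Nodup
  nodup : ∀ b, 1 ≤ b → b < k → (μ.row .remv b).Nodup
  remv : ∀ b, 1 ≤ b → b < k → ∀ z ∈ μ.row .remv b, z < n ∧ μ.get .cnt b z = 0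

theorem Dropped.length_le' (hμ : Ready inp N n k μ L) (h : Dropped k μ ν) {b : ℕ} (hb : 1 ≤ b ∧ b < k) :
    (ν.row .remv b).length ≤ N :=
  (h.length_le (hμ.nodup b hb.1 hb.2) (hμ.remv b hb.1 hb.2) (hμ.core.cnt_len b hb.1 hb.2).le).trans hμ.bound

open Reg in
/-- Decrementing the counts of the predecessors of the states of a block. -/
theorem wp_removeBlock {C₀ D₀ : ℕ} (hμ : Ready inp N n k μ L) (hD₀ : 1 ≤ D₀ ∧ D₀ < k)
    (hF₀ : Frame refineRel μ ν) (hC : ν.reg .C = C₀) (hD : ν.reg .D = D₀) (hC₀ : 1 ≤ C₀ ∧ C₀ < k)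
    (hdr : Dropped k μ ν) (hcount : ∀ z, ((L D₀).flatMap (prd inp)).count z ≤ ν.get .cnt C₀ z)
    (hQ : ∀ t ν', t ≤ 15 * ((L D₀).map (wt (prd inp))).sum + 2 → Dropped k μ ν' →
      (∀ b z, ν'.get .cnt b z + (if b = C₀ then ((L D₀).flatMap (prd inp)).count z else 0) =
        ν.get .cnt b z) → Q t ν') :
    WP inp N (forList d (hd D) (forRange Reg.k 0 (.inLen .pre d)
          (assign x (.inGet .pre d Reg.k) ;;
          wr₂ .cnt C x (.get .cnt C x - 1) ;;
          ifThen (.eq (.get .cnt C x) 0)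
            (ifThen (.eq (.len .remv C) 0) (moveAtTheEnd C) ;; push₂ .remv C x)))) Q ν := by
  refine wp_forList (n + D₀ + D₀) (L D₀) (fun l t ν' => t ≤ 15 * (l.map (wt (prd inp))).sum + 1 ∧
    Dropped k μ ν' ∧ ∀ b z, ν'.get .cnt b z +
      (if b = C₀ then (l.flatMap (prd inp)).count z else 0) = ν.get .cnt b z) rfl rfl ?_ ?_ ?_ ?_ ?_
  · intro ν' hF
    simp [hμ.states, hF.reg .D rfl, hD]
  · have := hμ.core.lists.circ D₀ hD₀.1 hD₀.2
    rwa [← hF₀.get .nxt rfl, ← hF₀.get .prv rfl] at this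
  · intro v
    exact ⟨by simp, hdr.congr rfl rfl rfl rfl rfl, by simp⟩
  · rintro l₁ a l₂ t ν₁ hl ⟨ht, hd₁, hc₁⟩ ha hF
    refine wp_forRange 0 (prd inp a).length (fun i t' ν' => t' ≤ 15 * i + 1 ∧
      Dropped k μ ν' ∧ ∀ b z, ν'.get .cnt b z +
      (if b = C₀ then (l₁.flatMap (prd inp)).count z + ((prd inp a).take i).count z else 0)
        = ν.get .cnt b z) rfl rfl ?_ ?_ ?_ ?_
    · exact ⟨le_rfl, hd₁.congr rfl rfl rfl rfl rfl, by simpa using hc₁⟩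
    · intro i t' ν' _ _ hF'
      simp only [ev_inLen, ev_reg, hF'.reg .d rfl, ha]; rfl
    · rintro i t' ν₂ - hi ⟨ht', hd₂, hc₂⟩ hri hF'
      have hF₂ : Frame (forList d (hd D) (forRange Reg.k 0 (.inLen .pre d)
          (assign x (.inGet .pre d Reg.k) ;;
          wr₂ .cnt C x (.get .cnt C x - 1) ;;
          ifThen (.eq (.get .cnt C x) 0)
            (ifThen (.eq (.len .remv C) 0) (moveAtTheEnd C) ;; push₂ .remv C x)))) ν ν₂ :=
        hF.trans hF'.forList
      rw [wp_seq, wp_assign]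
      have hx : (Expr.inGet .pre d Reg.k).ev inp ν₂ = (prd inp a).getD i 0 := by
        simp only [ev_inGet, ev_reg, hF'.reg .d rfl, ha, hri]; rfl
      rw [hx]
      set x₀ := (prd inp a).getD i 0 with hx₀
      -- The occurrences not yet processed include this one, and the count is at least their number;
      -- so the truncated subtraction is a true one.
      have hpos : 0 < ν₂.get .cnt C₀ x₀ := by
        have h1 := hc₂ C₀ x₀
        have h2 := hcount x₀
        rw [hl] at h2
        simp only [if_true, List.flatMap_append, List.flatMap_cons, List.count_append] at h1 h2
        have h3 : ((prd inp a).take (i + 1)).count x₀ ≤ (prd inp a).count x₀ :=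
          (List.take_sublist _ _).count_le _
        rw [take_succ_of_lt hi, List.count_append, ← hx₀, List.count_singleton_self] at h3
        omega
      refine wp_decrement (μ := μ) (C₀ := C₀) (x₀ := x₀) ?_ ?_ hC₀ (hd₂.congr rfl rfl rfl rfl rfl) ?_ ?_
        ?_ ?_ ?_ ?_
      · simp [hF₂.reg .C rfl, hC]
      · simp
      · simpa using hpos
      · simp [hF₂.len .bnxt rfl, hF₀.len .bnxt rfl, hμ.core.shape.bnxt]
      · simp [hF₂.len .bprv rfl, hF₀.len .bprv rfl, hμ.core.shape.bprv]
      · simp [hF₂.nr .remv rfl, hF₀.nr .remv rfl, hμ.core.shape.nr_remv]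
      · simpa using hd₂.length_le' hμ hC₀
      · intro t₃ ν₃ ht₃ hd₃ hc₃
        refine ⟨by omega, hd₃.congr rfl rfl rfl rfl rfl, fun b z => ?_⟩
        have h1 := hc₂ b z
        rw [take_succ_of_lt hi, ← hx₀]
        simp only [Mem.get_setReg] at hc₃ ⊢
        rw [hc₃]
        by_cases hb : b = C₀
        · subst hb
          simp only [if_true, true_and, List.count_append, List.count_singleton] at h1 ⊢
          by_cases hz : z = x₀
          · subst hz; simp; omega
          · have : (x₀ == z) = false := by simpa using fun h => hz h.symm
            simp [hz, this]; omega
        · simpa [hb] using h1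
    · rintro t' ν₂ ⟨ht', hd₂, hc₂⟩ - hF'
      simp only [Nat.zero_le, max_eq_right, List.take_length] at ht' hc₂
      intro v
      have hw : wt (prd inp) a = (prd inp a).length + 1 := rfl
      refine ⟨by simp [hw]; omega, hd₂.congr rfl rfl rfl rfl rfl, fun b z => ?_⟩
      rw [← hc₂ b z]
      simp
  · rintro t ν' ⟨ht, hd', hc'⟩ -
    exact hQ _ _ (by omega) hd' hc'

/-- Predecessor lists have no repetitions, so each state of the block contributes zero or one. This
connects the decrements made by the loop with the counts required by `CountsOk`. -/
theorem StateLists.count_flatMap {f g blk : ℕ → ℕ} (h : StateLists n k f g blk L fun _ => [])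
    (hp : ∀ w, (prd inp w).Nodup) {b : ℕ} (hb : 1 ≤ b ∧ b < k) (z : ℕ) :
    ((L b).flatMap (prd inp)).count z = ((Finset.range n).filter fun w =>
      z ∈ prd inp w ∧ blk w = b).card := by
  have h1 : (L b).Nodup := (List.nodup_cons.1 (h.circ b hb.1 hb.2).nodup).2
  have h2 := h.mem b hb.1 hb.2
  rw [List.count_flatMap, ← List.sum_toFinset _ h1, Finset.card_filter]
  have h3 : (L b).toFinset = (Finset.range n).filter fun w => blk w = b := by
    ext w
    have := h2 w
    simp only [List.not_mem_nil, or_false] at this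
    simp [this]
  rw [h3, Finset.sum_filter]
  refine Finset.sum_congr rfl fun w _ => ?_
  simp only [Function.comp, List.Nodup.count (hp w)]
  split_ifs <;> simp_all

open Reg in
/-- Removing a block from the relation. -/
theorem wp_removePair {C₀ D₀ : ℕ} (hμ : Ready inp N n k μ L) (hD₀ : 1 ≤ D₀ ∧ D₀ < k)
    (hF₀ : Frame refineRel μ ν) (hC : ν.reg .C = C₀) (hD : ν.reg .D = D₀) (hC₀ : 1 ≤ C₀ ∧ C₀ < k)
    (hdr : Dropped k μ ν) (hcnt : CountsOk inp n k ν)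
    (hQ : ∀ t ν', t ≤ 4 + (if ν.get .rel C₀ D₀ ≠ 0 then
        15 * ((L D₀).map (wt (prd inp))).sum else 0) → Dropped k μ ν' → CountsOk inp n k ν' →
      (∀ b e, ν'.get .rel b e = if b = C₀ ∧ e = D₀ then 0 else ν.get .rel b e) → Q t ν') :
    WP inp N (ifThen (.get .rel C D)
        (wr₂ .rel C D 0 ;;
        forList d (hd D) (forRange Reg.k 0 (.inLen .pre d)
          (assign x (.inGet .pre d Reg.k) ;;
          wr₂ .cnt C x (.get .cnt C x - 1) ;;
          ifThen (.eq (.get .cnt C x) 0)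
            (ifThen (.eq (.len .remv C) 0) (moveAtTheEnd C) ;; push₂ .remv C x))))) Q ν := by
  rw [wp_ifThen]
  simp only [ev_get, ev_reg, hC, hD]
  constructor
  · intro hne
    have hlt : D₀ < (ν.row .rel C₀).length := lt_of_get_pos (Nat.pos_of_ne_zero hne)
    rw [wp_seq, wp_wr₂]
    simp only [ev_reg, hC, hD, ev_zero]
    set ν₁ := ν.setRow .rel C₀ ((ν.row .rel C₀).set D₀ 0) with hν₁
    have hrel : ∀ b e, ν₁.get .rel b e = if b = C₀ ∧ e = D₀ then 0 else ν.get .rel b e := by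
      intro b e
      rw [hν₁, Mem.get_setRow]
      by_cases hb : b = C₀
      · subst hb
        simp only [true_and, if_true]
        rw [getD_set]
        by_cases he : e = D₀
        · subst he; rw [if_pos ⟨rfl, hlt⟩, if_pos rfl]
        · rw [if_neg (fun h => he h.1), if_neg he]; rfl
      · simp [hb]
    have hF₁ : Frame refineRel μ ν₁ := by
      refine hF₀.trans ⟨fun _ _ => rfl, fun _ _ => rfl, fun a ha => ?_, fun a ha r => ?_⟩
      · have : a ≠ .rel := by rintro rfl; exact absurd ha (by decide)
        funext r; simp [hν₁, this]
      · rw [hν₁, Mem.row_setRow]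
        split_ifs with h
        · rw [List.length_set, h.1, h.2]
        · rfl
    have hblk : ν₁.get .blk = μ.get .blk := hF₁.get .blk rfl
    have hblk' : ν.get .blk = μ.get .blk := hF₀.get .blk rfl
    -- The transitions counted for `C₀` are divided into those that remain and those that lead to
    -- `D₀`; the loop subtracts exactly the latter.
    have hsplit : ∀ z, ν.get .cnt C₀ z = ((Finset.range n).filter fun w =>
        z ∈ prd inp w ∧ ν₁.get .rel C₀ (ν₁.get .blk 0 w) ≠ 0).card +
        ((L D₀).flatMap (prd inp)).count z := by
      intro z
      rw [hcnt C₀ hC₀.1 hC₀.2, hμ.core.lists.count_flatMap hμ.prd_nodup hD₀, ← Finset.card_union_of_disjoint]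
      · congr 1
        ext w
        simp only [Finset.mem_filter, Finset.mem_range, Finset.mem_union, hrel, hblk, hblk', true_and]
        by_cases hw : μ.get .blk 0 w = D₀
        · simp [hw, hne]
        · simp [hw]
      · rw [Finset.disjoint_filter]
        rintro w - ⟨-, h1⟩ ⟨-, h2⟩
        rw [hrel, hblk, if_pos ⟨rfl, h2⟩] at h1
        exact h1 rfl
    refine WP.conseq (Q := fun t ν' => t ≤ 15 * ((L D₀).map (wt (prd inp))).sum + 2 ∧ Dropped k μ ν' ∧
      ∀ b z, ν'.get .cnt b z + (if b = C₀ then ((L D₀).flatMap (prd inp)).count z else 0) =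
        ν₁.get .cnt b z) (wp_removeBlock hμ hD₀ hF₁ hC hD hC₀ ?_ ?_ fun t ν' h1 h2 h3 => ⟨h1, h2, h3⟩) ?_
    · exact hdr.congr (by funext r; simp [hν₁]) (by funext r; simp [hν₁]) (by funext r; simp [hν₁])
        (by funext r; simp [hν₁]) rfl
    · intro z
      have := hsplit z
      have h2 : ν₁.get .cnt C₀ z = ν.get .cnt C₀ z := by simp [hν₁]
      omega
    · rintro t ν' ⟨ht, hd', hc'⟩ hF'
      have hrel' : ν'.get .rel = ν₁.get .rel := hF'.get .rel rfl
      have hblk2 : ν'.get .blk = μ.get .blk := (hF'.get .blk rfl).trans hblk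
      refine hQ _ _ ?_ hd' ?_ (by rw [hrel']; exact hrel)
      · rw [if_pos hne]; omega
      · intro b h1 h2 z
        have h3 := hc' b z
        have h4 : ν₁.get .cnt b z = ν.get .cnt b z := by simp [hν₁]
        rw [h4] at h3
        rw [hrel', hblk2]
        by_cases hb : b = C₀
        · subst hb
          have := hsplit z
          rw [hblk] at this
          simp only [if_true] at h3
          omega
        · rw [if_neg hb, add_zero] at h3
          rw [h3, hcnt b h1 h2]
          simp only [hrel, hb, false_and, if_false, hblk']
  · intro h0
    refine hQ _ _ (by omega) hdr hcnt fun b e => ?_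
    split_ifs with h
    · rw [h.1, h.2, h0]
    · rfl

open Reg in
/-- The refinement of the relation. -/
theorem wp_refineRel {cl rl : List ℕ} (hμ : Ready inp N n k μ L) (hcl : μ.row .cl 0 = cl)
    (hrl : μ.row .rl 0 = rl) (hcln : cl.Nodup) (hrln : rl.Nodup)
    (hclm : ∀ b ∈ cl, 1 ≤ b ∧ b < k) (hrlm : ∀ b ∈ rl, 1 ≤ b ∧ b < k) (hcnt : CountsOk inp n k μ)
    (hQ : ∀ t μ', t ≤ 2 + (cl.map fun b => 5 + (rl.map fun e => 7 + (if μ.get .rel b e ≠ 0 then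
        15 * ((L e).map (wt (prd inp))).sum else 0)).sum).sum →
      Frame refineRel μ μ' → Dropped k μ μ' → CountsOk inp n k μ' →
      (∀ b e, μ'.get .rel b e = if b ∈ cl ∧ e ∈ rl then 0 else μ.get .rel b e) → Q t μ') :
    WP inp N refineRel Q μ := by
  unfold refineRel
  refine wp_forRange 0 cl.length (fun i t ν => t ≤ 1 + ((cl.take i).map fun b =>
      5 + (rl.map fun e => 7 + (if μ.get .rel b e ≠ 0 then
        15 * ((L e).map (wt (prd inp))).sum else 0)).sum).sum ∧ Dropped k μ ν ∧ CountsOk inp n k ν ∧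
      ∀ b e, ν.get .rel b e = if b ∈ cl.take i ∧ e ∈ rl then 0 else μ.get .rel b e) rfl rfl ?_ ?_ ?_ ?_
  · exact ⟨by simp, (Dropped.refl hμ.core.blocks).congr rfl rfl rfl rfl rfl, hcnt, by simp⟩
  · intro i t ν _ _ hF
    simp [hF.row .cl rfl, hcl]
  · rintro i t ν - hi ⟨ht, hd₁, hc₁, hr₁⟩ hri hF
    have hF : Frame refineRel μ ν := hF
    have hget : ν.get .cl 0 i = cl.getD i 0 := by rw [Mem.get, hF.row .cl rfl, hcl]
    rw [wp_seq, wp_assign]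
    simp only [ev_rd, ev_reg, hri, hget]
    have hC₀ := hclm _ (getD_mem hi)
    have hC₁ := getD_not_mem_take hcln hi
    rw [take_succ_of_lt hi]
    set C₀ := cl.getD i 0 with hC₀'
    refine wp_forRange 0 rl.length (fun j t' ν' => t' ≤ 1 + ((rl.take j).map fun e =>
        7 + (if μ.get .rel C₀ e ≠ 0 then 15 * ((L e).map (wt (prd inp))).sum else 0)).sum ∧
      Dropped k μ ν' ∧ CountsOk inp n k ν' ∧
      ∀ b e, ν'.get .rel b e = if (b ∈ cl.take i ∧ e ∈ rl) ∨ (b = C₀ ∧ e ∈ rl.take j) then 0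
        else μ.get .rel b e) rfl rfl ?_ ?_ ?_ ?_
    · exact ⟨by simp, hd₁.congr rfl rfl rfl rfl rfl, hc₁, by simpa using hr₁⟩
    · intro j t' ν' _ _ hF'
      have h1 := hF'.row .rl rfl
      have h2 := hF.row .rl rfl
      simp [h1, h2, hrl]
    · rintro j t' ν' - hj ⟨ht', hd₂, hc₂, hr₂⟩ hrj hF'
      have hF₂ : Frame refineRel ν ν' := by
        refine Frame.trans (Frame.setReg (by simp [refineRel, modReg_forRange, assign, Cmd.modReg]) _ _)
          (hF'.mono ?_ ?_ ?_ ?_)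
        · intro r hr; cases r <;> first | rfl | exact absurd hr (by decide)
        all_goals intro a ha; cases a <;> first | rfl | exact absurd ha (by decide)
      have hF₂ := hF.trans hF₂
      have hgetj : ν'.get .rl 0 j = rl.getD j 0 := by rw [Mem.get, hF₂.row .rl rfl, hrl]
      have hCν : ν'.reg .C = C₀ := by rw [hF'.reg .C rfl]; simp
      rw [wp_seq, wp_assign]
      simp only [ev_rd, ev_reg, hrj, hgetj]
      have hD₀ := hrlm _ (getD_mem hj)
      have hD₁ := getD_not_mem_take hrln hj
      rw [take_succ_of_lt hj]
      set D₀ := rl.getD j 0 with hD₀'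
      have hF₃ : Frame refineRel ν' (ν'.setReg .D D₀) := Frame.setReg rfl _ _
      refine wp_removePair hμ hD₀ (hF₂.trans hF₃) (C₀ := C₀) (by simpa using hCν) (by simp) hC₀
        (hd₂.congr rfl rfl rfl rfl rfl) hc₂ ?_
      intro t₃ ν₃ ht₃ hd₃ hc₃ hr₃
      -- As neither list has repetitions, this entry has not been cleared before, and the cost can
      -- be stated in terms of the relation at the start.
      have hkey : (ν'.setReg .D D₀).get .rel C₀ D₀ = μ.get .rel C₀ D₀ := by
        rw [Mem.get_setReg, hr₂, if_neg]
        rintro (h | h)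
        · exact hC₁ h.1
        · exact hD₁ h.2
      rw [hkey] at ht₃
      refine ⟨?_, hd₃.congr rfl rfl rfl rfl rfl, hc₃, fun b e => ?_⟩
      · simp only [List.map_append, List.sum_append, List.map_singleton, List.sum_singleton]
        omega
      · simp only [Mem.get_setReg] at hr₃ ⊢
        rw [hr₃, hr₂]
        by_cases h1 : b = C₀ ∧ e = D₀
        · rw [if_pos h1, if_pos]; right; simp [h1]
        · rw [if_neg h1]
          congr 1
          simp only [List.mem_append, List.mem_singleton, eq_iff_iff]
          tauto
    · rintro t' ν' ⟨ht', hd₂, hc₂, hr₂⟩ - -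
      simp only [Nat.zero_le, max_eq_right, List.take_length] at ht' hr₂
      refine ⟨?_, hd₂.congr rfl rfl rfl rfl rfl, hc₂, fun b e => ?_⟩
      · simp only [List.map_append, List.sum_append, List.map_singleton, List.sum_singleton]
        omega
      · simp only [Mem.get_setReg, hr₂, List.mem_append, List.mem_singleton]
        congr 1
        simp only [eq_iff_iff]
        tauto
  · rintro t ν ⟨ht, hd', hc', hr'⟩ - hF
    simp only [Nat.zero_le, max_eq_right, List.take_length] at ht hr'
    exact hQ _ _ (by omega) hF hd' hc' hr'

end

/-! ### Building the initial partition -/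

/-- The blocks of the initial partition, according to the input. -/
def prt (inp : Input) (i : ℕ) : List ℕ := (inp .part).getD i []

/-- The input partitions the states. -/
structure PartOk (inp : Input) (n : ℕ) : Prop where
  nodup : ∀ i, (prt inp i).Nodup
  ne_nil : ∀ i, i < (inp .part).length → prt inp i ≠ []
  lt : ∀ i, ∀ z ∈ prt inp i, z < n
  disj : ∀ i j z, z ∈ prt inp i → z ∈ prt inp j → i = j
  cover : ∀ z, z < n → ∃ i, z ∈ prt inp i

section
variable {inp : Input} {N n k : ℕ} {Q : ℕ → Mem → Prop} {μ ν : Mem} {L : ℕ → List ℕ}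

theorem PartOk.lt_length {i z : ℕ} (h : z ∈ prt inp i) : i < (inp .part).length := by
  by_contra h'
  rw [prt, List.getD_eq_default _ _ (by omega)] at h
  simp at h

/-- Choosing a state in each row is injective, since the rows are disjoint. -/
theorem PartOk.length_le (h : PartOk inp n) : (inp .part).length ≤ n := by
  have : ∀ i, i < (inp .part).length → ∃ z, z ∈ prt inp i := fun i hi =>
    List.exists_mem_of_ne_nil _ (h.ne_nil i hi)
  choose! f hf using this
  have h1 : ((Finset.range (inp .part).length).image f).card = (inp .part).length := by
    rw [Finset.card_image_of_injOn, Finset.card_range]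
    intro i hi j hj hij
    simp only [Finset.coe_range, Set.mem_Iio] at hi hj
    exact h.disj i j (f i) (hf i hi) (hij ▸ hf j hj)
  rw [← h1]
  refine (Finset.card_le_card (t := Finset.range n) fun z hz => ?_).trans (by simp)
  obtain ⟨i, hi, rfl⟩ := Finset.mem_image.1 hz
  exact Finset.mem_range.2 (h.lt i _ (hf i (Finset.mem_range.1 hi)))

/-- The invariant of the construction of the initial partition. -/
structure Building (inp : Input) (n k : ℕ) (ν : Mem) : Prop where
  num : ν.reg .num = k
  shape : Shape n k ν
  empty : ∀ b, ν.row .remv b = [] ∧ ν.row .cnt b = [] ∧ ν.row .rel b = []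
  lists : StateLists n k (ν.get .nxt 0) (ν.get .prv 0) (ν.get .blk 0) (fun b => prt inp (b - 1))
    fun _ => []
  blk : ∀ z, ν.get .blk 0 z < k
  blocks : BlockList ν [] []
  mark : ∀ b, ν.get .mark 0 b = 0

theorem Building.setReg (h : Building inp n k ν) {r : Reg} {v : ℕ} (hr : r ≠ .cur)
    (hr' : r ≠ .num) : Building inp n k (ν.setReg r v) :=
  ⟨by simp [hr'.symm, h.num], ⟨h.shape.nxt, h.shape.prv, h.shape.blk, h.shape.bnxt, h.shape.bprv,
    h.shape.mark, h.shape.nr, h.shape.nr_remv, h.shape.nr_cnt, h.shape.nr_rel⟩, h.empty, h.lists,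
    h.blk, h.blocks.congr rfl rfl (by simp [hr.symm]), h.mark⟩

open Reg in
/-- Entering the states of a block of the initial partition. -/
theorem wp_enterStates {i₀ : ℕ} (hn : (inp .pre).length = n) (hP : PartOk inp n) (hk : 1 ≤ k)
    (hki : k = i₀ + 1) (hi : μ.reg Reg.i = i₀) (hnum : μ.reg .num = k)
    (hN : (μ.row .nxt 0).length = n + 2 * (k + 1)) (hNP : (μ.row .prv 0).length = n + 2 * (k + 1))
    (hNB : (μ.row .blk 0).length = n)
    (hL : StateLists n k (μ.get .nxt 0) (μ.get .prv 0) (μ.get .blk 0) (fun b => prt inp (b - 1))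
      fun _ => [])
    (hc : Circ (μ.get .nxt 0) (μ.get .prv 0) (n + k + k) [])
    (hcI : Circ (μ.get .nxt 0) (μ.get .prv 0) (n + k + k + 1) [])
    (hblk : ∀ z, μ.get .blk 0 z < k)
    (hQ : ∀ t ν, t ≤ 8 * (prt inp i₀).length + 2 →
      Frame (forRange Reg.k 0 (.inLen .part Reg.i)
      (assign s (.inGet .part Reg.i Reg.k) ;; wr .blk s num ;; linkLast .nxt .prv (hd num) s)) μ ν →
      StateLists n (k + 1) (ν.get .nxt 0) (ν.get .prv 0) (ν.get .blk 0) (fun b => prt inp (b - 1))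
        (fun _ => []) → (∀ z, ν.get .blk 0 z < k + 1) → Q t ν) :
    WP inp N (forRange Reg.k 0 (.inLen .part Reg.i)
      (assign s (.inGet .part Reg.i Reg.k) ;; wr .blk s num ;; linkLast .nxt .prv (hd num) s)) Q μ := by
  have hlt : ∀ b, 1 ≤ b → b < k → ∀ c ∈ prt inp (b - 1), c < n ∧ μ.get .blk 0 c = b :=
    fun b h1 h2 c hc => (hL.mem b h1 h2 c).1 (Or.inl hc)
  refine wp_forRange 0 (prt inp i₀).length (fun j t ν => t ≤ 8 * j + 1 ∧
    Circ (ν.get .nxt 0) (ν.get .prv 0) (n + k + k) ((prt inp i₀).take j) ∧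
    Circ (ν.get .nxt 0) (ν.get .prv 0) (n + k + k + 1) [] ∧
    (∀ b, 1 ≤ b → b < k → Circ (ν.get .nxt 0) (ν.get .prv 0) (n + b + b) (prt inp (b - 1)) ∧
      Circ (ν.get .nxt 0) (ν.get .prv 0) (n + b + b + 1) []) ∧
    ∀ z, ν.get .blk 0 z = if z ∈ (prt inp i₀).take j then k else μ.get .blk 0 z) rfl rfl ?_ ?_ ?_ ?_
  · exact ⟨le_rfl, hc, hcI, fun b h1 h2 => ⟨hL.circ b h1 h2, hL.circI b h1 h2⟩, by simp⟩
  · intro j t ν _ _ hF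
    simp only [ev_inLen, ev_reg, hF.reg Reg.i rfl, hi]; rfl
  · rintro j t ν - hj ⟨ht, hc1, hc2, hc3, hb⟩ hrj hF
    rw [wp_seq, wp_assign, wp_seq, wp_wr]
    have hσ : (Expr.inGet .part Reg.i Reg.k).ev inp ν = (prt inp i₀).getD j 0 := by
      simp only [ev_inGet, ev_reg, hF.reg Reg.i rfl, hi, hrj]; rfl
    rw [hσ, take_succ_of_lt hj]
    have hσm : (prt inp i₀).getD j 0 ∈ prt inp i₀ := getD_mem hj
    have hσn := getD_not_mem_take (hP.nodup i₀) hj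
    set σ := (prt inp i₀).getD j 0 with hσd
    have hσlt := hP.lt _ _ hσm
    have htk : ∀ c ∈ (prt inp i₀).take j, c ∈ prt inp i₀ := fun c hc => List.mem_of_mem_take hc
    have h0 : ∀ b, 1 ≤ b → b < k → ∀ c ∈ prt inp i₀, c ∉ prt inp (b - 1) := by
      intro b h1 h2 c h3 h4
      have := hP.disj _ _ _ h3 h4
      omega
    have hlN : (ν.row .nxt 0).length = n + 2 * (k + 1) := by rw [hF.len .nxt rfl, hN]
    have hlP : (ν.row .prv 0).length = n + 2 * (k + 1) := by rw [hF.len .prv rfl, hNP]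
    have hlB : (ν.row .blk 0).length = n := by rw [hF.len .blk rfl, hNB]
    have hnumν : ν.reg .num = k := by rw [hF.reg .num rfl, hnum]
    have hmem : ∀ c ∈ σ :: (n + k + k) :: (prt inp i₀).take j,
        c = n + k + k ∨ (c < n ∧ c ∈ prt inp i₀) := by
      intro c hc
      simp only [List.mem_cons] at hc
      rcases hc with rfl | rfl | hc
      · exact Or.inr ⟨hσlt, hσm⟩
      · exact Or.inl rfl
      · exact Or.inr ⟨hP.lt _ _ (htk c hc), htk c hc⟩
    refine wp_linkLast (by decide) (hv := n + k + k) (pv := σ) (l := (prt inp i₀).take j) ?_ ?_ ?_ ?_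
      ?_ ?_ ?_
    · intro ν' h; simp [h, hn, hnumν]
    · intro ν' h; simp [h]
    · simpa [Mem.get_setRow_fun] using hc1
    · intro hc
      rcases List.mem_cons.1 hc with h | h
      · omega
      · exact hσn h
    · intro c hc
      simp only [Mem.row_setRow, Mem.row_setReg, reduceCtorEq, false_and, if_false, hlN]
      rcases hmem c hc with h | h <;> omega
    · intro c hc
      simp only [Mem.row_setRow, Mem.row_setReg, reduceCtorEq, false_and, if_false, hlP]
      rcases hmem c hc with h | h <;> omega
    intro lf lg _ _ hcc hf1 hf2
    simp only [Mem.get_setRow_fun, reduceCtorEq, false_and, if_false, Mem.get_setReg, and_self, if_true]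
      at hf1 hf2 ⊢
    refine ⟨by omega, hcc, ?_, fun b h1 h2 => ⟨?_, ?_⟩, fun z => ?_⟩
    · refine hc2.congr (fun c hc => hf1 c fun h => ?_) (fun c hc => hf2 c fun h => ?_) <;>
      · rcases hmem c h with h | h <;> simp at hc <;> omega
    · refine (hc3 b h1 h2).1.congr (fun c hc => hf1 c fun h => ?_) (fun c hc => hf2 c fun h => ?_) <;>
      · rcases List.mem_cons.1 hc with hc | hc
        · rcases hmem c h with h | h <;> omega
        · have := (hlt b h1 h2 c hc).1
          rcases hmem c h with h | h
          · omega
          · exact h0 b h1 h2 c h.2 hc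
    · refine (hc3 b h1 h2).2.congr (fun c hc => hf1 c fun h => ?_) (fun c hc => hf2 c fun h => ?_) <;>
      · rcases hmem c h with h | h <;> simp at hc <;> omega
    · simp only [Mem.row_setReg, ev_reg, Mem.reg_setReg, if_true, reduceCtorEq, if_false, hnumν]
      rw [getD_set, hlB]
      by_cases hz : z = σ
      · subst hz; simp [hσlt]
      · rw [if_neg (fun h => hz h.1), show (ν.row .blk 0).getD z 0 = ν.get .blk 0 z from rfl, hb]
        simp [hz]
  · rintro t ν ⟨ht, hc1, hc2, hc3, hb⟩ - hF
    simp only [Nat.zero_le, max_eq_right, List.take_length] at ht hc1 hb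
    refine hQ _ _ (by omega) hF ⟨?_, ?_, ?_, ?_⟩ ?_
    · intro b h1 h2
      by_cases hbk : b = k
      · subst hbk; rw [hki, Nat.add_sub_cancel, ← hki]; exact hc1
      · exact (hc3 b h1 (by omega)).1
    · intro b h1 h2
      by_cases hbk : b = k
      · subst hbk; exact hc2
      · exact (hc3 b h1 (by omega)).2
    · intro b h1 h2 z
      simp only [List.not_mem_nil, or_false]
      rw [hb]
      by_cases hbk : b = k
      · subst hbk
        rw [hki, Nat.add_sub_cancel, ← hki]
        have := hblk z
        split_ifs with h
        · simp [h, hP.lt _ _ h]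
        · simp only [h, false_iff, not_and]; omega
      · have h3 := hL.mem b h1 (by omega) z
        simp only [List.not_mem_nil, or_false] at h3
        rw [h3]
        split_ifs with h
        · constructor
          · intro h4
            have := hP.disj _ _ _ h (h3.2 h4)
            omega
          · intro h4; omega
        · rfl
    · simp
    · intro z
      have := hblk z
      rw [hb]; split_ifs <;> omega

-- State nodes start as links to themselves. The record with number `0` is not a block; its entries
-- in `bnxt` and `bprv` are the header of the list of blocks. Block `b` receives the states of row
-- `b - 1` of the input.
open Reg in
theorem wp_setupPartition (hn : (inp .pre).length = n) (hP : PartOk inp n) (hN : 3 * n + 1 ≤ N)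
    (hreg : ∀ r, μ.reg r = 0) (hnr : ∀ a, μ.nr a = 1) (hrow : ∀ a b, μ.row a b = [])
    (hQ : ∀ t ν, t ≤ 31 * n + 12 → Building inp n ((inp .part).length + 1) ν → Q t ν) :
    WP inp N setupPartition Q μ := by
  unfold setupPartition
  rw [wp_seq]
  refine wp_forRange 0 n (fun i t ν => t ≤ 5 * i + 1 ∧ (∀ r, r ≠ .s → ν.reg r = 0) ∧
    (∀ a, ν.nr a = 1) ∧ ν.row .nxt 0 = List.range i ∧ ν.row .prv 0 = List.range i ∧
    ν.row .blk 0 = List.replicate i 0 ∧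
    (∀ a, a ≠ .nxt → a ≠ .prv → a ≠ .blk → ∀ b, ν.row a b = [])) rfl rfl ?_ ?_ ?_ ?_
  · exact ⟨le_rfl, fun r hr => by simp [hr, hreg], hnr, by simp [hrow], by simp [hrow], by simp [hrow],
      fun a _ _ _ b => by simp [hrow]⟩
  · intro i t ν _ _ _; simp [hn]
  · rintro i t ν - hi ⟨ht, h1, h2, h3, h4, h5, h6⟩ hri -
    simp only [wp_seq, wp_push, Mem.nr_setRow, h2, Mem.row_setRow, h3, h4, h5, ev_reg, hri,
      Mem.reg_setRow, ev_zero, reduceCtorEq, false_and, if_false, List.length_range,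
      List.length_replicate]
    refine ⟨⟨by omega, by omega⟩, ⟨by omega, by omega⟩, ⟨by omega, by omega⟩, by omega, ?_, ?_, ?_, ?_,
      ?_, ?_⟩
    · intro r hr; simp [hr, h1]
    · simp [h2]
    · simp [List.range_succ]
    · simp [List.range_succ]
    · simp [List.replicate_succ']
    · intro a g1 g2 g3 b; simp [g1, g2, g3, h6]
  rintro t₁ μ₁ ⟨ht₁, h1, h2, h3, h4, h5, h6⟩ - -
  simp only [Nat.zero_le, max_eq_right] at ht₁ h3 h4 h5
  rw [wp_seq]
  refine wp_newRecord (k := 0) (h1 _ (by decide)) hn (by omega) (by simp [h3]) (by simp [h4])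
    (by simp [h6]) (by simp [h6]) (by simp [h6]) (fun a _ => h2 a) ?_
  intro μ₂ hF g1 g2 g3 g4 g5
  have hrow₂ : ∀ a, a = .blk ∨ a = .remv ∨ a = .cnt ∨ a = .rel → μ₂.row a = μ₁.row a := by
    rintro a (rfl | rfl | rfl | rfl) <;> exact hF.row _ rfl
  have hreg₂ : μ₂.reg = μ₁.reg := by funext r; exact hF.reg r rfl
  have hnr₂ : ∀ a, μ₂.nr a = 1 := fun a => by rw [hF.nr a rfl, h2]
  rw [wp_seq, wp_assign]
  simp only [ev_one]
  have hB : Building inp n 1 (μ₂.setReg .num 1) := by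
    refine ⟨by simp, ⟨?_, ?_, ?_, ?_, ?_, ?_, ?_, ?_, ?_, ?_⟩, ?_, ⟨?_, ?_, ?_, ?_⟩, ?_, ⟨?_, ?_⟩, ?_⟩
    · simp [g1, h3]
    · simp [g2, h4]
    · simp [hrow₂, h5]
    · simp [g3, h6]
    · simp [g4, h6]
    · simp [g5, h6]
    · intro a _ _ _; simp [hnr₂]
    · simp [hnr₂]
    · simp [hnr₂]
    · simp [hnr₂]
    · intro b; simp [hrow₂, h6]
    · intro b; omega
    · intro b; omega
    · intro b; omega
    · intro b; omega
    · intro z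
      change (μ₂.row .blk 0).getD z 0 < 1
      rw [hrow₂ .blk (by simp), h5, List.getD_eq_getElem?_getD, List.getElem?_replicate]
      split_ifs <;> simp
    · simp [circ_nil, Mem.get, g3, g4, h6]
    · simp [hreg₂, h1]
    · intro b
      change (μ₂.row .mark 0).getD b 0 = 0
      rw [g5, h6 _ (by decide) (by decide) (by decide)]
      cases b <;> rfl
  generalize μ₂.setReg .num 1 = μ₃ at hB
  have hpn := hP.length_le
  refine wp_forRange 0 (inp .part).length (fun i t ν => t ≤ 1 + 8 * (∑ j ∈ Finset.range i,
    (prt inp j).length) + 17 * i ∧ Building inp n (i + 1) ν) rfl rfl ?_ ?_ ?_ ?_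
  · exact ⟨by simp, hB.setReg (by decide) (by decide)⟩
  · intro i t ν _ _ _; simp
  · rintro i t ν - hi ⟨ht, hBi⟩ hri -
    have hS := hBi.shape
    rw [wp_seq]
    refine wp_newRecord hBi.num hn (by omega) hS.nxt hS.prv hS.bnxt hS.bprv hS.mark
      (by intro a ha; apply hS.nr <;> (rintro rfl; simp at ha)) fun ν₁ hF1 n1 p1 bn1 bp1 m1 => ?_
    rw [wp_seq]
    refine wp_newRows fun _ => ?_
    generalize hν2 : ((ν₁.addRow .remv).addRow .cnt).addRow .rel = ν₂
    have reg2 : ν₂.reg = ν.reg := by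
      subst hν2; funext r; exact hF1.reg r rfl
    have row2 : ν₂.row = ν₁.row := by subst hν2; rfl
    have nr2 : ∀ a, ν₂.nr a = if a = .remv ∨ a = .cnt ∨ a = .rel then ν.nr a + 1 else ν.nr a := by
      intro a; subst hν2
      have := fun a => hF1.nr a rfl
      cases a <;> simp [this]
    have nxt2 : ∀ j, ν₂.get .nxt 0 j = if j = n + (i + 1) + (i + 1) then n + (i + 1) + (i + 1) else
        if j = n + (i + 1) + (i + 1) + 1 then n + (i + 1) + (i + 1) + 1 else ν.get .nxt 0 j := by
      intro j
      have := getD_append_pair (ν.row .nxt 0) (n + (i + 1) + (i + 1)) (n + (i + 1) + (i + 1) + 1) j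
      rw [hS.nxt] at this
      rw [Mem.get, row2, n1, this, show n + 2 * (i + 1) = n + (i + 1) + (i + 1) by ring]; rfl
    have prv2 : ∀ j, ν₂.get .prv 0 j = if j = n + (i + 1) + (i + 1) then n + (i + 1) + (i + 1) else
        if j = n + (i + 1) + (i + 1) + 1 then n + (i + 1) + (i + 1) + 1 else ν.get .prv 0 j := by
      intro j
      have := getD_append_pair (ν.row .prv 0) (n + (i + 1) + (i + 1)) (n + (i + 1) + (i + 1) + 1) j
      rw [hS.prv] at this
      rw [Mem.get, row2, p1, this, show n + 2 * (i + 1) = n + (i + 1) + (i + 1) by ring]; rfl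
    have same2 : ∀ a, a = .blk ∨ a = .remv ∨ a = .cnt ∨ a = .rel → ν₂.row a = ν.row a := by
      rintro a (rfl | rfl | rfl | rfl) <;> rw [row2] <;> exact hF1.row _ rfl
    have blk2 : ν₂.get .blk = ν.get .blk := by funext r j; simp [Mem.get, same2 .blk (by simp)]
    have lenN : (ν₂.row .nxt 0).length = n + 2 * (i + 1 + 1) := by
      rw [row2, n1]; simp [hS.nxt]; ring
    have lenP : (ν₂.row .prv 0).length = n + 2 * (i + 1 + 1) := by
      rw [row2, p1]; simp [hS.prv]; ring
    have bn2 : ν₂.row .bnxt 0 = ν.row .bnxt 0 ++ [i + 1] := by rw [row2, bn1]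
    have bp2 : ν₂.row .bprv 0 = ν.row .bprv 0 ++ [i + 1] := by rw [row2, bp1]
    have m2 : ν₂.row .mark 0 = ν.row .mark 0 ++ [0] := by rw [row2, m1]
    clear hν2
    rw [wp_seq]
    refine wp_enterStates (i₀ := i) hn hP (k := i + 1) (by omega) rfl (by rw [reg2, hri])
      (by rw [reg2, hBi.num]) lenN lenP (by rw [same2 _ (by simp), hS.blk]) ?_ ?_ ?_
      (by rw [blk2]; exact hBi.blk) ?_
    · rw [blk2]
      refine ⟨fun b h1 h2 => ?_, fun b h1 h2 => ?_, hBi.lists.mem, hBi.lists.disj⟩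
      · have hlt : ∀ c ∈ (n + b + b) :: prt inp (b - 1), c < n + (i + 1) + (i + 1) := by
          intro c hc
          rcases List.mem_cons.1 hc with rfl | hc
          · omega
          · have := hP.lt _ _ hc; omega
        refine (hBi.lists.circ b h1 h2).congr (fun c hc => ?_) (fun c hc => ?_)
        · have := hlt c hc; rw [nxt2, if_neg (by omega), if_neg (by omega)]
        · have := hlt c hc; rw [prv2, if_neg (by omega), if_neg (by omega)]
      · refine (hBi.lists.circI b h1 h2).congr (fun c hc => ?_) (fun c hc => ?_)
        · simp at hc; rw [nxt2, if_neg (by omega), if_neg (by omega)]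
        · simp at hc; rw [prv2, if_neg (by omega), if_neg (by omega)]
    · rw [circ_nil, nxt2, prv2]; simp
    · rw [circ_nil, nxt2, prv2]; simp
    intro t' ν₃ ht' hF3 hL3 hb3
    rw [wp_assign]
    have reg3 : ∀ r, r ≠ .s → r ≠ Reg.k → ν₃.reg r = ν.reg r := by
      intro r h1 h2
      rw [hF3.reg r (by cases r <;> first | rfl | exact absurd rfl h1 | exact absurd rfl h2), reg2]
    refine ⟨?_, ?_, ⟨?_, ?_, ?_, ?_, ?_, ?_, ?_, ?_, ?_, ?_⟩, ?_, hL3, hb3, ⟨?_, ?_⟩, ?_⟩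
    · rw [Finset.sum_range_succ]; omega
    · simp [reg3, hBi.num]
    · simp only [Mem.row_setReg]; rw [hF3.len .nxt rfl, lenN]
    · simp only [Mem.row_setReg]; rw [hF3.len .prv rfl, lenP]
    · simp only [Mem.row_setReg]; rw [hF3.len .blk rfl, same2 _ (by simp), hS.blk]
    · simp only [Mem.row_setReg]; rw [hF3.row .bnxt rfl, bn2]; simp [hS.bnxt]
    · simp only [Mem.row_setReg]; rw [hF3.row .bprv rfl, bp2]; simp [hS.bprv]
    · simp only [Mem.row_setReg]; rw [hF3.row .mark rfl, m2]; simp [hS.mark]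
    · intro a g1 g2 g3
      simp only [Mem.nr_setReg]; rw [hF3.nr a rfl, nr2, if_neg (by simp [g1, g2, g3]), hS.nr a g1 g2 g3]
    · simp only [Mem.nr_setReg]; rw [hF3.nr _ rfl, nr2]; simp [hS.nr_remv]
    · simp only [Mem.nr_setReg]; rw [hF3.nr _ rfl, nr2]; simp [hS.nr_cnt]
    · simp only [Mem.nr_setReg]; rw [hF3.nr _ rfl, nr2]; simp [hS.nr_rel]
    · intro b
      simp only [Mem.row_setReg]
      rw [hF3.row .remv rfl, hF3.row .cnt rfl, hF3.row .rel rfl, same2 .remv (by simp),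
        same2 .cnt (by simp), same2 .rel (by simp)]
      exact hBi.empty b
    · refine hBi.blocks.circ.congr (fun c hc => ?_) (fun c hc => ?_) <;> simp at hc <;> subst hc
      · simp only [Mem.get_setReg]
        rw [Mem.get, hF3.row .bnxt rfl, bn2, getD_append_singleton, hS.bnxt, if_neg (by omega)]; rfl
      · simp only [Mem.get_setReg]
        rw [Mem.get, hF3.row .bprv rfl, bp2, getD_append_singleton, hS.bprv, if_neg (by omega)]; rfl
    · have := hBi.blocks.cur
      simp [reg3, this]
    · intro b
      simp only [Mem.get_setReg]
      rw [Mem.get, hF3.row .mark rfl, m2, getD_append_singleton]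
      split_ifs
      · rfl
      · exact hBi.mark b
  · rintro t ν ⟨ht, hBi⟩ - -
    simp only [Nat.zero_le, max_eq_right] at ht hBi
    refine hQ _ _ ?_ hBi
    -- The rows are disjoint, so all the inner loops together enter at most `n` states.
    have hsum : ∑ j ∈ Finset.range (inp .part).length, (prt inp j).length ≤ n := by
      have : ∑ j ∈ Finset.range (inp .part).length, (prt inp j).length =
          ((Finset.range (inp .part).length).biUnion fun j => (prt inp j).toFinset).card := by
        rw [Finset.card_biUnion]
        · exact Finset.sum_congr rfl fun j _ => (List.toFinset_card_of_nodup (hP.nodup j)).symm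
        · intro i _ j _ hij
          simp only [Function.onFun]
          rw [Finset.disjoint_left]
          intro z h1 h2
          exact hij (hP.disj i j z (by simpa using h1) (by simpa using h2))
      rw [this]
      refine (Finset.card_le_card (t := Finset.range n) fun z hz => ?_).trans (by simp)
      simp only [Finset.mem_biUnion, List.mem_toFinset] at hz
      obtain ⟨j, _, hj⟩ := hz
      exact Finset.mem_range.2 (hP.lt j z hj)
    omega

end

/-! ### The initial relation, transition counts and remove sets -/

section
variable {inp : Input} {N n k : ℕ} {Q : ℕ → Mem → Prop} {μ ν : Mem} {L : ℕ → List ℕ}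

-- The unused column `0` is filled too, so that columns can be indexed by block numbers. The cost is
-- quadratic in the number of blocks, which is harmless because that number is at most `n`.
open Reg in
theorem wp_setupRel (hnum : μ.reg .num = k) (hnr : μ.nr .rel = k) (hrow : ∀ b, μ.row .rel b = [])
    (hk : 1 ≤ k) (hN : k ≤ N)
    (hQ : ∀ t ν, t ≤ (3 * k + 5) * k + 2 → Frame setupRel μ ν →
      (∀ b, ν.row .rel b = if 1 ≤ b ∧ b < k then
        (List.range' 0 k).map (fun e => if b = e then 1 else 0) else []) → Q t ν) :
    WP inp N setupRel Q μ := by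
  unfold setupRel
  refine wp_forRange 1 k (fun b t ν => t ≤ 1 + (3 * k + 4) * b ∧
    ∀ c, ν.row .rel c = if 1 ≤ c ∧ c < b then
        (List.range' 0 k).map (fun e => if c = e then 1 else 0) else []) rfl rfl ?_ ?_ ?_ ?_
  · refine ⟨by omega, fun c => ?_⟩
    rw [if_neg (by omega)]; exact hrow c
  · intro b t ν _ _ hF; simp [hF.reg .num rfl, hnum]
  · rintro b t ν h1 h2 ⟨ht, hr⟩ hri hF
    have hb : ν.row .rel b = [] := by rw [hr, if_neg (by omega)]
    refine wp_forRange_push 0 k b (fun e => if b = e then 1 else 0) rfl ?_ ?_ ?_ ?_ ?_ ?_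
    · intro i l; simp [hF.reg .num rfl, hnum]
    · intro i l; simp [hri]
    · intro i l _ _; simp [hri]
    · rw [hF.nr .rel rfl, hnr]; exact h2
    · rw [hb]; simp; omega
    · intro t' ht'
      refine ⟨?_, fun c => ?_⟩
      · have : (3 * k + 4) * (b + 1) = (3 * k + 4) * b + (3 * k + 4) := by ring
        omega
      · simp only [Mem.row_setReg, Mem.row_setRow, true_and, hb, Nat.sub_zero, List.nil_append]
        by_cases hc : c = b
        · subst hc; simp [h1]
        · rw [if_neg hc, hr]
          have : (1 ≤ c ∧ c < b + 1) ↔ (1 ≤ c ∧ c < b) := by omega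
          simp only [this]
  · rintro t ν ⟨ht, hr⟩ - hF
    rw [max_eq_right hk] at ht hr
    refine hQ _ _ ?_ hF hr
    have : (3 * k + 5) * k = (3 * k + 4) * k + k := by ring
    omega

open Reg in
/-- Counting a transition. -/
theorem wp_countTransition {b₀ x₀ : ℕ} (hnum : μ.reg .num = k) (hB : μ.reg .B = b₀)
    (hx : μ.reg .x = x₀) (hb₀ : 1 ≤ b₀ ∧ b₀ < k) (hlen : x₀ < (μ.row .cnt b₀).length)
    (hrel : ∀ b, 1 ≤ b → b < k → (μ.get .rel b b₀ ≠ 0 ↔ b = b₀))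
    (hQ : ∀ t ν, t ≤ 4 * k + 2 → (∀ b z, ν.get .cnt b z =
      μ.get .cnt b z + if b = b₀ ∧ z = x₀ then 1 else 0) → Q t ν) :
    WP inp N (forRange C 1 num (ifThen (.get .rel C B) (wr₂ .cnt C x (.get .cnt C x + 1)))) Q μ := by
  refine wp_forRange 1 k (fun c t ν => t ≤ 1 + 4 * c ∧ ν.reg .x = x₀ ∧ ∀ b z, ν.get .cnt b z =
      μ.get .cnt b z + if b = b₀ ∧ z = x₀ ∧ b < c then 1 else 0) rfl rfl ?_ ?_ ?_ ?_
  · refine ⟨by omega, by simpa using hx, fun b z => ?_⟩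
    rw [if_neg (by omega)]; rfl
  · intro c t ν _ _ hF; simp [hF.reg .num rfl, hnum]
  · rintro c t ν h1 h2 ⟨ht, hx', hc⟩ hrc hF
    have hr : ν.get .rel = μ.get .rel := hF.get .rel rfl
    rw [wp_ifThen]
    simp only [ev_get, ev_reg, hrc, hF.reg .B rfl, hB, hr]
    constructor
    · intro h
      obtain rfl := (hrel c h1 h2).1 h
      rw [wp_wr₂]
      simp only [ev_reg, hrc, hx', ev_add, ev_get, ev_one]
      refine ⟨by omega, by simp [hx'], fun b z => ?_⟩
      have hl : x₀ < (ν.row .cnt c).length := by rw [hF.len .cnt rfl]; exact hlen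
      rw [Mem.get_setReg, Mem.get_setRow]
      by_cases hb : b = c
      · subst hb
        simp only [true_and, if_true]
        rw [getD_set]
        by_cases hz : z = x₀
        · subst hz
          rw [if_pos ⟨rfl, hl⟩, hc]
          simp
        · rw [if_neg (fun h => hz h.1), if_neg (fun h => hz h.1)]
          have := hc b z
          rw [if_neg (fun h => hz h.2.1)] at this
          exact this
      · simp [hb, hc]
    · intro h
      have hne : c ≠ b₀ := fun h' => (hrel c h1 h2).2 h' h
      refine ⟨by omega, by simp [hx'], fun b z => ?_⟩
      rw [Mem.get_setReg, hc]
      congr 1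
      have : (b = b₀ ∧ z = x₀ ∧ b < c) ↔ (b = b₀ ∧ z = x₀ ∧ b < c + 1) := by omega
      simp only [this]
  · rintro t ν ⟨ht, -, hc⟩ - -
    rw [max_eq_right (by omega)] at ht hc
    refine hQ _ _ (by omega) fun b z => ?_
    rw [hc]
    congr 1
    have : (b = b₀ ∧ z = x₀ ∧ b < k) ↔ (b = b₀ ∧ z = x₀) := by omega
    simp only [this]

-- Each transition is offered to all blocks, so the cost is the number of blocks times the total
-- weight. As the relation is the identity, the count for a block is the multiplicity of the state
-- in the predecessor lists of that block.
open Reg in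
theorem wp_setupCount (hnum : μ.reg .num = k) (hn : (inp .pre).length = n) (hk : 1 ≤ k)
    (hnr : μ.nr .cnt = k) (hrow : ∀ b, μ.row .cnt b = []) (hN : n ≤ N)
    (hpr : ∀ w, ∀ z ∈ prd inp w, z < n)
    (hL : StateLists n k (μ.get .nxt 0) (μ.get .prv 0) (μ.get .blk 0) L fun _ => [])
    (hrel : ∀ b c, 1 ≤ b → b < k → c < k → (μ.get .rel b c ≠ 0 ↔ b = c))
    (hQ : ∀ t ν, t ≤ (3 * n + 8) * k + 4 +
        (4 * k + 5) * ∑ b ∈ Finset.Ico 1 k, ((L b).map (wt (prd inp))).sum →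
      Frame setupCount μ ν → (∀ b, (ν.row .cnt b).length = if 1 ≤ b ∧ b < k then n else 0) →
      (∀ b, 1 ≤ b → b < k → ∀ z, ν.get .cnt b z = ((L b).flatMap (prd inp)).count z) → Q t ν) :
    WP inp N setupCount Q μ := by
  refine WP.conseq (Q := fun t ν => Frame setupCount μ ν → Q t ν) ?_ fun t ν h hF => h hF
  unfold setupCount
  rw [wp_seq]
  refine wp_forRange 1 k (fun b t ν => t ≤ 1 + (3 * n + 4) * b ∧
    ∀ c, ν.row .cnt c = if 1 ≤ c ∧ c < b then List.replicate n 0 else []) rfl rfl ?_ ?_ ?_ ?_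
  · refine ⟨by omega, fun c => ?_⟩
    rw [if_neg (by omega)]; exact hrow c
  · intro b t ν _ _ hF; simp [hF.reg .num rfl, hnum]
  · rintro b t ν h1 h2 ⟨ht, hr⟩ hri hF
    have hb : ν.row .cnt b = [] := by rw [hr, if_neg (by omega)]
    refine wp_forRange_push 0 n b (fun _ => 0) rfl ?_ ?_ ?_ ?_ ?_ ?_
    · intro i l; simp [hn]
    · intro i l; simp [hri]
    · intro i l _ _; simp
    · rw [hF.nr .cnt rfl, hnr]; exact h2
    · rw [hb]; simp; omega
    · intro t' ht'
      refine ⟨?_, fun c => ?_⟩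
      · have : (3 * n + 4) * (b + 1) = (3 * n + 4) * b + (3 * n + 4) := by ring
        omega
      · simp only [Mem.row_setReg, Mem.row_setRow, true_and, hb, Nat.sub_zero, List.nil_append]
        by_cases hc : c = b
        · subst hc; simp [h1]
        · rw [if_neg hc, hr]
          have : (1 ≤ c ∧ c < b + 1) ↔ (1 ≤ c ∧ c < b) := by omega
          simp only [this]
  rintro t₁ μ₁ ⟨ht₁, hr₁⟩ - hF₁
  rw [max_eq_right hk] at ht₁ hr₁
  have hnum₁ : μ₁.reg .num = k := by rw [hF₁.reg .num rfl, hnum]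
  have hlen₁ : ∀ b, (μ₁.row .cnt b).length = if 1 ≤ b ∧ b < k then n else 0 := by
    intro b; rw [hr₁]; split_ifs <;> simp
  have hrel₁ : ∀ b c, 1 ≤ b → b < k → c < k → (μ₁.get .rel b c ≠ 0 ↔ b = c) := by
    rw [hF₁.get .rel rfl]; exact hrel
  have hc₁ : ∀ b z, μ₁.get .cnt b z = 0 := by
    intro b z
    rw [Mem.get, hr₁]
    split_ifs
    · rw [List.getD_eq_getElem?_getD, List.getElem?_replicate]; split_ifs <;> rfl
    · rfl
  refine wp_forRange 1 k (fun b t ν => t ≤ 1 + 4 * b +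
      (4 * k + 5) * ∑ b ∈ Finset.Ico 1 b, ((L b).map (wt (prd inp))).sum ∧
    ∀ c z, ν.get .cnt c z = if 1 ≤ c ∧ c < b then ((L c).flatMap (prd inp)).count z else 0)
    rfl rfl ?_ ?_ ?_ ?_
  · refine ⟨by omega, fun c z => ?_⟩
    rw [if_neg (by omega)]; exact hc₁ c z
  · intro b t ν _ _ hF; simp [hF.reg .num rfl, hnum₁]
  · rintro b₀ t ν h1 h2 ⟨ht, hc⟩ hrb hF
    have hmem : ∀ w ∈ L b₀, w < n := fun w hw => ((hL.mem b₀ h1 h2 w).1 (Or.inl hw)).1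
    refine wp_forList (n + b₀ + b₀) (L b₀) (fun l t' ν' => t' ≤
        (4 * k + 5) * (l.map (wt (prd inp))).sum + 1 ∧
      ∀ c z, ν'.get .cnt c z = if 1 ≤ c ∧ c < b₀ then ((L c).flatMap (prd inp)).count z else
        if c = b₀ then (l.flatMap (prd inp)).count z else 0) rfl rfl ?_ ?_ ?_ ?_ ?_
    · intro ν' hF'; simp [hn, hF'.reg .B rfl, hrb]
    · rw [hF.get .nxt rfl, hF.get .prv rfl, hF₁.get .nxt rfl, hF₁.get .prv rfl]
      exact hL.circ b₀ h1 h2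
    · intro v
      refine ⟨by simp, fun c z => ?_⟩
      rw [Mem.get_setReg, hc]; simp
    · rintro l₁ a l₂ t' ν' hl ⟨ht', hc'⟩ hra hF'
      refine wp_forRange 0 (prd inp a).length (fun j t'' ν'' => t'' ≤ (4 * k + 5) * j + 1 ∧
        ∀ c z, ν''.get .cnt c z = if 1 ≤ c ∧ c < b₀ then ((L c).flatMap (prd inp)).count z else
        if c = b₀ then (l₁.flatMap (prd inp)).count z + ((prd inp a).take j).count z else 0)
        rfl rfl ?_ ?_ ?_ ?_
      · exact ⟨by simp, by simpa using hc'⟩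
      · intro j t'' ν'' _ _ hF''
        simp only [ev_inLen, ev_reg, hF''.reg .y rfl, hra]; rfl
      · rintro j t'' ν'' - hj ⟨ht'', hc''⟩ hrj hF''
        rw [wp_seq, wp_assign]
        have hx : (Expr.inGet .pre y Reg.k).ev inp ν'' = (prd inp a).getD j 0 := by
          simp only [ev_inGet, ev_reg, hF''.reg .y rfl, hra, hrj]; rfl
        rw [hx, take_succ_of_lt hj]
        have hx₀ : (prd inp a).getD j 0 < n := hpr a _ (getD_mem hj)
        set x₀ := (prd inp a).getD j 0
        refine wp_countTransition (b₀ := b₀) (x₀ := x₀) (k := k) ?_ ?_ (by simp) ⟨h1, h2⟩ ?_ ?_ ?_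
        · simp [hF''.reg .num rfl, hF'.reg .num rfl, hF.reg .num rfl, hnum₁]
        · simp [hF''.reg .B rfl, hF'.reg .B rfl, hrb]
        · rw [Mem.row_setReg, hF''.len .cnt rfl, hF'.len .cnt rfl, hF.len .cnt rfl, hlen₁,
            if_pos ⟨h1, h2⟩]
          exact hx₀
        · intro b h3 h4
          rw [Mem.get_setReg, hF''.get .rel rfl, hF'.get .rel rfl, hF.get .rel rfl]
          exact hrel₁ b b₀ h3 h4 h2
        · intro t₃ ν₃ ht₃ hc₃
          refine ⟨?_, fun c z => ?_⟩
          · have : (4 * k + 5) * (j + 1) = (4 * k + 5) * j + (4 * k + 5) := by ring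
            omega
          · rw [Mem.get_setReg, hc₃, Mem.get_setReg, hc'']
            by_cases hcb : c = b₀
            · subst hcb
              have : ¬ (1 ≤ c ∧ c < c) := by omega
              simp only [this, if_false, if_true, true_and, List.count_append, List.count_singleton]
              by_cases hz : z = x₀
              · simp [hz]; ring
              · have : (x₀ == z) = false := by simpa using fun h => hz h.symm
                simp [hz, this]
            · simp [hcb]
      · rintro t'' ν'' ⟨ht'', hc''⟩ - -
        simp only [Nat.zero_le, max_eq_right, List.take_length] at ht'' hc''
        intro v
        refine ⟨?_, fun c z => ?_⟩
        · have : wt (prd inp) a = (prd inp a).length + 1 := rfl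
          simp only [List.map_append, List.sum_append, List.map_singleton, List.sum_singleton, this]
          have : (4 * k + 5) * ((l₁.map (wt (prd inp))).sum + ((prd inp a).length + 1)) =
            (4 * k + 5) * (l₁.map (wt (prd inp))).sum + (4 * k + 5) * (prd inp a).length
              + (4 * k + 5) := by ring
          omega
        · rw [Mem.get_setReg, hc'']; simp
    · rintro t' ν' ⟨ht', hc'⟩ -
      refine ⟨?_, fun c z => ?_⟩
      · rw [Finset.sum_Ico_succ_top h1, mul_add (4 * k + 5)]; omega
      · rw [Mem.get_setReg, hc']
        by_cases hcb : c = b₀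
        · subst hcb; simp [h1]
        · have : (1 ≤ c ∧ c < b₀ + 1) ↔ (1 ≤ c ∧ c < b₀) := by omega
          simp only [this, hcb, if_false]
  · rintro t ν ⟨ht, hc⟩ - hF hFF
    rw [max_eq_right hk] at ht hc
    refine hQ _ _ ?_ hFF ?_ ?_
    · have : (3 * n + 8) * k = (3 * n + 4) * k + 4 * k := by ring
      omega
    · intro b; rw [hF.len .cnt rfl, hlen₁]
    · intro b h1 h2 z
      rw [hc, if_pos ⟨h1, h2⟩]

-- A block is put into the list of blocks only after its remove set is complete, so it can be placed
-- in the correct part of the list at once.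
open Reg in
theorem wp_setupRemove (hnum : μ.reg .num = k) (hn : (inp .pre).length = n) (hk : 1 ≤ k)
    (hnr : μ.nr .remv = k) (hrow : ∀ b, μ.row .remv b = []) (hN : n ≤ N)
    (hl : (μ.row .bnxt 0).length = k) (hl' : (μ.row .bprv 0).length = k) (hB : BlockList μ [] [])
    (hQ : ∀ t ν, t ≤ 2 + (4 * n + 12) * k → Frame setupRemove μ ν → BlockInv k ν →
      (∀ b, ν.row .remv b = if 1 ≤ b ∧ b < k then
        (List.range n).filter (fun z => μ.get .cnt b z = 0) else []) → Q t ν) :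
    WP inp N setupRemove Q μ := by
  unfold setupRemove
  refine wp_forRange 1 k (fun b t ν => t ≤ 1 + (4 * n + 12) * b ∧ BlockInv b ν ∧
    ∀ c, ν.row .remv c = if 1 ≤ c ∧ c < b then
        (List.range n).filter (fun z => μ.get .cnt c z = 0) else []) rfl rfl ?_ ?_ ?_ ?_
  · refine ⟨by omega, ⟨[], [], hB.congr rfl rfl (by simp), ?_, by simp, by simp⟩, fun c => ?_⟩
    · intro b; simp; omega
    · rw [if_neg (by omega)]; exact hrow c
  · intro b t ν _ _ hF; simp [hF.reg .num rfl, hnum]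
  · rintro b₀ t ν h1 h2 ⟨ht, hBI, hr⟩ hrb hF
    have hcnt : ν.get .cnt = μ.get .cnt := hF.get .cnt rfl
    rw [wp_seq]
    -- The loop register is `x`, which the dummy assignment of `ifThen` formally modifies; that it
    -- keeps its value is therefore proved along with the body.
    refine wp_forRange_of_reg 0 n (fun i t' ν' => t' ≤ 4 * i + 1 ∧
      (∀ c, ν'.row .remv c = if c = b₀ then (List.range i).filter (fun z => μ.get .cnt c z = 0)
        else ν.row .remv c)) rfl ?_ ?_ ?_ ?_
    · refine ⟨le_rfl, fun c => ?_⟩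
      split_ifs with h
      · simp [h, hr]
      · rfl
    · intro i t' ν' _ _ _; simp [hn]
    · rintro i t' ν' - hi ⟨ht', hr'⟩ hri hF'
      have hc' : ν'.get .cnt = μ.get .cnt := (hF'.get .cnt rfl).trans hcnt
      have hrB : ν'.reg .B = b₀ := by rw [hF'.reg .B rfl, hrb]
      rw [wp_ifThen]
      simp only [ev_eq, ev_get, ev_reg, hrB, hri, hc', ev_zero]
      constructor
      · intro h
        have h0 : μ.get .cnt b₀ i = 0 := by by_contra h'; simp [h'] at h
        rw [wp_push₂]
        simp only [ev_reg, hrB, hri, hr', if_true]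
        refine ⟨⟨?_, ?_⟩, by simp [hri], by omega, fun c => ?_⟩
        · rw [hF'.nr .remv rfl, hF.nr .remv rfl, hnr]; exact h2
        · have := List.length_filter_le (fun z => decide (μ.get .cnt b₀ z = 0)) (List.range i)
          rw [List.length_range] at this
          omega
        · simp only [Mem.row_setReg, Mem.row_setRow, true_and]
          split_ifs with h
          · rw [List.range_succ, List.filter_append, h]; simp [h0]
          · rw [hr', if_neg h]
      · intro h
        have h0 : μ.get .cnt b₀ i ≠ 0 := by intro h'; simp [h'] at h
        refine ⟨by simp, by omega, fun c => ?_⟩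
        rw [Mem.row_setReg, hr']
        split_ifs with h
        · rw [List.range_succ, List.filter_append, h]; simp [h0]
        · rfl
    rintro t₂ ν₂ ⟨ht₂, hr₂⟩ - hF₂
    simp only [Nat.zero_le, max_eq_right] at ht₂ hr₂
    obtain ⟨l₁, l₂, g1, g2, g3, g4⟩ := hBI
    have hne : ∀ b ∈ l₁ ++ l₂, b ≠ b₀ := fun b hb => by have := (g2 b).1 hb; omega
    have hrB : ν₂.reg .B = b₀ := by rw [hF₂.reg .B rfl, hrb]
    refine wp_insertBlock (k := b₀) (r := b₀) (l₁ := l₁) (l₂ := l₂) h1 ?_ g2 ?_ ?_ ?_ ?_ ?_ ?_ Iff.rfl ?_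
    · refine g1.congr ?_ ?_ ?_
      · rw [hF₂.row .bnxt rfl]
      · rw [hF₂.row .bprv rfl]
      · rw [hF₂.reg .cur rfl]
    · intro b hb
      rw [hr₂, if_neg (hne b (by simp [hb]))]; exact g3 b hb
    · intro b hb
      rw [hr₂, if_neg (hne b (by simp [hb]))]; exact g4 b hb
    · rw [hF₂.len .bnxt rfl, hF.len .bnxt rfl, hl]; exact h2
    · rw [hF₂.len .bprv rfl, hF.len .bprv rfl, hl']; exact h2
    · intro ν' h; simp [h, hrB]
    · simp [hrB]
    · intro t₃ ν₃ ht₃ hF₃ hB₃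
      refine ⟨?_, ?_, fun c => ?_⟩
      · have : (4 * n + 12) * (b₀ + 1) = (4 * n + 12) * b₀ + (4 * n + 12) := by ring
        omega
      · obtain ⟨l₁', l₂', h3, h4⟩ := hB₃
        exact ⟨l₁', l₂', h3.congr rfl rfl (by simp), h4⟩
      · rw [Mem.row_setReg, hF₃.row .remv rfl, hr₂]
        by_cases hc : c = b₀
        · subst hc; simp [h1]
        · have : (1 ≤ c ∧ c < b₀ + 1) ↔ (1 ≤ c ∧ c < b₀) := by omega
          rw [if_neg hc, hr]
          simp only [this]
  · rintro t ν ⟨ht, hBI, hr⟩ - hF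
    rw [max_eq_right hk] at ht hBI hr
    exact hQ _ _ (by omega) hF hBI hr

end

/-! ### The initialization as a whole -/

section
variable {inp : Input} {N n k : ℕ} {Q : ℕ → Mem → Prop} {μ ν : Mem} {L : ℕ → List ℕ}

theorem StateLists.sum_map {f g blk : ℕ → ℕ} (h : StateLists n k f g blk L fun _ => [])
    {b : ℕ} (hb : 1 ≤ b ∧ b < k) (w : ℕ → ℕ) :
    ((L b).map w).sum = ∑ z ∈ (Finset.range n).filter (fun z => blk z = b), w z := by
  have h1 : (L b).Nodup := (List.nodup_cons.1 (h.circ b hb.1 hb.2).nodup).2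
  have h2 := h.mem b hb.1 hb.2
  rw [← List.sum_toFinset _ h1]
  refine Finset.sum_congr ?_ fun _ _ => rfl
  ext z
  have := h2 z
  simp only [List.not_mem_nil, or_false] at this
  simp [this]

theorem StateLists.sum_sum_map {f g blk : ℕ → ℕ} (h : StateLists n k f g blk L fun _ => [])
    (hb : ∀ z, z < n → 1 ≤ blk z ∧ blk z < k) (w : ℕ → ℕ) :
    ∑ b ∈ Finset.Ico 1 k, ((L b).map w).sum = ∑ z ∈ Finset.range n, w z := by
  rw [← Finset.sum_fiberwise_of_maps_to (s := Finset.range n) (t := Finset.Ico 1 k) (g := blk)]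
  · exact Finset.sum_congr rfl fun b hb => h.sum_map (Finset.mem_Ico.1 hb) w
  · intro z hz
    exact Finset.mem_Ico.2 (hb z (Finset.mem_range.1 hz))

/-- The initialization. -/
theorem wp_setup (hn : (inp .pre).length = n) (hP : PartOk inp n) (hN : 3 * n + 1 ≤ N)
    (h0 : 0 < n) (hpr : ∀ w, ∀ z ∈ prd inp w, z < n) (hpn : ∀ w, (prd inp w).Nodup)
    (hreg : ∀ r, μ.reg r = 0) (hnr : ∀ a, μ.nr a = 1) (hrow : ∀ a b, μ.row a b = [])
    (hk : k = (inp .part).length + 1)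
    (p : Cmd) (hp : ∀ t ν, t ≤ 100 * (k * ∑ z ∈ Finset.range n, wt (prd inp) z) →
      Core n k ν (fun b => prt inp (b - 1)) (fun _ => []) → CountsOk inp n k ν →
      (∀ b c, 1 ≤ b → b < k → c < k → (ν.get .rel b c ≠ 0 ↔ b = c)) →
      (∀ b, ν.row .remv b = if 1 ≤ b ∧ b < k then
        (List.range n).filter (fun z => ν.get .cnt b z = 0) else []) →
      WP inp N p (fun t' => Q (t + t')) ν) :
    WP inp N (setupPartition ;; setupRel ;; setupCount ;; setupRemove ;; p) Q μ := by
  have hkn : k ≤ n + 1 := by have := hP.length_le; omega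
  rw [wp_seq]
  refine wp_setupPartition hn hP hN hreg hnr hrow fun t₁ ν₁ ht₁ hB => ?_
  rw [← hk] at hB
  rw [wp_seq]
  refine wp_setupRel hB.num hB.shape.nr_rel (fun b => (hB.empty b).2.2) (by omega) (by omega)
    fun t₂ ν₂ ht₂ hF₂ hr₂ => ?_
  have hrel : ∀ b c, 1 ≤ b → b < k → c < k → (ν₂.get .rel b c ≠ 0 ↔ b = c) := by
    intro b c h1 h2 h3
    rw [Mem.get, hr₂, if_pos ⟨h1, h2⟩, List.getD_eq_getElem _ _ (by simpa using h3)]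
    simp
  have hpos : 0 < (inp .part).length := by
    obtain ⟨i, hi⟩ := hP.cover 0 h0
    have := PartOk.lt_length hi
    omega
  have hblk₁ : ∀ z, z < n → 1 ≤ ν₁.get .blk 0 z ∧ ν₁.get .blk 0 z < k := by
    intro z hz
    obtain ⟨i, hi⟩ := hP.cover z hz
    have h1 := PartOk.lt_length hi
    have := (hB.lists.mem (i + 1) (by omega) (by omega) z).1 (Or.inl (by simpa using hi))
    exact ⟨by omega, hB.blk z⟩
  rw [wp_seq]
  refine wp_setupCount (n := n) (k := k) (L := fun b => prt inp (b - 1)) ?_ hn (by omega) ?_ ?_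
    (by omega) hpr ?_ hrel fun t₃ ν₃ ht₃ hF₃ hl₃ hc₃ => ?_
  · rw [hF₂.reg .num rfl, hB.num]
  · rw [hF₂.nr .cnt rfl, hB.shape.nr_cnt]
  · rw [hF₂.row .cnt rfl]; exact fun b => (hB.empty b).2.1
  · rw [hF₂.get .nxt rfl, hF₂.get .prv rfl, hF₂.get .blk rfl]; exact hB.lists
  have hF₁₃ : ∀ a, a ≠ .rel → a ≠ .cnt → ν₃.row a = ν₁.row a := by
    intro a h1 h2
    rw [hF₃.row a (by cases a <;> first | rfl | exact absurd rfl h2),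
      hF₂.row a (by cases a <;> first | rfl | exact absurd rfl h1)]
  have hnr₃ : ∀ a, ν₃.nr a = ν₁.nr a := fun a => by rw [hF₃.nr a rfl, hF₂.nr a rfl]
  rw [wp_seq]
  refine wp_setupRemove (n := n) (k := k) ?_ hn (by omega) ?_ ?_ (by omega) ?_ ?_ ?_
    fun t₄ ν₄ ht₄ hF₄ hB₄ hr₄ => ?_
  · rw [hF₃.reg .num rfl, hF₂.reg .num rfl, hB.num]
  · rw [hnr₃, hB.shape.nr_remv]
  · rw [hF₁₃ _ (by decide) (by decide)]; exact fun b => (hB.empty b).1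
  · rw [hF₁₃ _ (by decide) (by decide)]; exact hB.shape.bnxt
  · rw [hF₁₃ _ (by decide) (by decide)]; exact hB.shape.bprv
  · refine hB.blocks.congr ?_ ?_ ?_
    · rw [hF₁₃ _ (by decide) (by decide)]
    · rw [hF₁₃ _ (by decide) (by decide)]
    · rw [hF₃.reg .cur rfl, hF₂.reg .cur rfl]
  have hF₁₄ : ∀ a, a ∈ [Tab.nxt, .prv, .blk, .mark] → ν₄.row a = ν₁.row a := by
    intro a ha
    simp only [List.mem_cons, List.not_mem_nil, or_false] at ha
    rcases ha with rfl | rfl | rfl | rfl <;>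
    rw [hF₄.row _ rfl, hF₁₃ _ (by decide) (by decide)]
  have hg : ∀ a, a ∈ [Tab.nxt, .prv, .blk, .mark] → ν₄.get a = ν₁.get a := by
    intro a ha; funext r i; rw [Mem.get, hF₁₄ a ha]; rfl
  have hcnt₄ : ν₄.get .cnt = ν₃.get .cnt := hF₄.get .cnt rfl
  have hrel₄ : ν₄.row .rel = ν₂.row .rel := by rw [hF₄.row .rel rfl, hF₃.row .rel rfl]
  have hrelg₄ : ν₄.get .rel = ν₂.get .rel := by funext r i; rw [Mem.get, hrel₄]; rfl
  have hnum₄ : ν₄.reg .num = k := by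
    rw [hF₄.reg .num rfl, hF₃.reg .num rfl, hF₂.reg .num rfl, hB.num]
  have hnr₄ : ∀ a, ν₄.nr a = ν₁.nr a := fun a => by rw [hF₄.nr a rfl, hnr₃]
  have hlists : StateLists n k (ν₄.get .nxt 0) (ν₄.get .prv 0) (ν₄.get .blk 0)
      (fun b => prt inp (b - 1)) fun _ => [] := by
    rw [hg .nxt (by simp), hg .prv (by simp), hg .blk (by simp)]; exact hB.lists
  rw [hB.lists.sum_sum_map hblk₁] at ht₃
  refine (hp (t₁ + (t₂ + (t₃ + t₄))) ν₄ ?_ ?_ ?_ ?_ ?_).mono fun t' ν' h => ?_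
  · set S := ∑ z ∈ Finset.range n, wt (prd inp) z with hS
    have hnS : n ≤ S := by
      rw [hS]
      calc n = ∑ z ∈ Finset.range n, 1 := by simp
        _ ≤ _ := Finset.sum_le_sum fun z _ => by unfold wt; omega
    -- All terms are dominated by the number `k` times the total weight `S`: there is at least one
    -- state, `n ≤ S`, and hence `k ≤ n + 1 ≤ 2 * S`.
    have h1 : n ≤ k * S := hnS.trans (Nat.le_mul_of_pos_left _ (by omega))
    have h2 : k * n ≤ k * S := Nat.mul_le_mul_left _ hnS
    have h3 : k * k ≤ k * (2 * S) := Nat.mul_le_mul_left _ (by omega)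
    have h4 : k ≤ k * S := Nat.le_mul_of_pos_right _ (by omega)
    have h5 : S ≤ k * S := Nat.le_mul_of_pos_left _ (by omega)
    have e1 : (3 * k + 5) * k = 3 * (k * k) + 5 * k := by ring
    have e2 : (3 * n + 8) * k = 3 * (k * n) + 8 * k := by ring
    have e3 : (4 * k + 5) * S = 4 * (k * S) + 5 * S := by ring
    have e4 : (4 * n + 12) * k = 4 * (k * n) + 12 * k := by ring
    have e5 : k * (2 * S) = 2 * (k * S) := by ring
    rw [e1] at ht₂; rw [e2, e3] at ht₃; rw [e4] at ht₄; rw [e5] at h3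
    generalize k * S = KS at *
    generalize k * k = KK at *
    generalize k * n = KN at *
    omega
  · refine ⟨hnum₄, ⟨?_, ?_, ?_, ?_, ?_, ?_, ?_, ?_, ?_, ?_⟩, ?_, ?_, ?_, hlists, hB₄, ?_, ?_, ?_, ?_⟩
    · rw [hF₁₄ _ (by simp), hB.shape.nxt]
    · rw [hF₁₄ _ (by simp), hB.shape.prv]
    · rw [hF₁₄ _ (by simp), hB.shape.blk]
    · rw [hF₄.len .bnxt rfl, hF₁₃ _ (by decide) (by decide), hB.shape.bnxt]
    · rw [hF₄.len .bprv rfl, hF₁₃ _ (by decide) (by decide), hB.shape.bprv]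
    · rw [hF₁₄ _ (by simp), hB.shape.mark]
    · intro a g1 g2 g3; rw [hnr₄, hB.shape.nr a g1 g2 g3]
    · rw [hnr₄, hB.shape.nr_remv]
    · rw [hnr₄, hB.shape.nr_cnt]
    · rw [hnr₄, hB.shape.nr_rel]
    · intro b h1 h2; rw [hF₄.row .cnt rfl, hl₃, if_pos ⟨h1, h2⟩]
    · intro b h1 h2; rw [hrel₄, hr₂, if_pos ⟨h1, h2⟩]; simp
    · intro b hb
      refine ⟨by rw [hr₄, if_neg (by omega)], ?_, by rw [hrel₄, hr₂, if_neg (by omega)]⟩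
      rw [hF₄.row .cnt rfl, ← List.length_eq_zero_iff, hl₃, if_neg (by omega)]
    · rw [hg .blk (by simp)]; exact hblk₁
    · intro b h1 h2
      rw [hg .blk (by simp)]
      obtain ⟨z, hz⟩ := List.exists_mem_of_ne_nil _ (hP.ne_nil (b - 1) (by omega))
      exact ⟨z, (hB.lists.mem b h1 h2 z).1 (Or.inl hz)⟩
    · intro b; rw [hg .mark (by simp)]; exact hB.mark b
    · omega
  · intro b h1 h2 z
    rw [hcnt₄, hc₃ b h1 h2, hlists.count_flatMap hpn ⟨h1, h2⟩]
    congr 1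
    refine Finset.filter_congr fun w hw => ?_
    have := hblk₁ w (Finset.mem_range.1 hw)
    rw [hrelg₄, hg .blk (by simp), hrel b _ h1 h2 this.2, eq_comm (a := b)]
  · rw [hrelg₄]; exact hrel
  · intro b; rw [hr₄, hcnt₄]
  · have e : t₁ + (t₂ + (t₃ + (t₄ + t'))) = t₁ + (t₂ + (t₃ + t₄)) + t' := by ring
    rwa [e]

end

/-! ### One round of the main loop -/

section
variable {inp : Input} {N n k : ℕ} {Q : ℕ → Mem → Prop} {μ ν : Mem} {L : ℕ → List ℕ}
  {le : ℕ → ℕ → Prop} {reps : Finset ℕ}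

/-- The block of `t` is related to the block of `s`. -/
def Rl (n : ℕ) (μ : Mem) (s t : ℕ) : Prop :=
  t < n ∧ μ.get .rel (μ.get .blk 0 s) (μ.get .blk 0 t) ≠ 0

/-- The state `z` belongs to the remove set of the block of `s`. -/
def Rv (n : ℕ) (μ : Mem) (s z : ℕ) : Prop := z < n ∧ z ∈ μ.row .remv (μ.get .blk 0 s)

/-- The link between the array and the abstract invariant: a positive count says that there is a
transition to a related state. -/
theorem CountsOk.pre_iff (hc : CountsOk inp n k μ) (hC : Core n k μ L fun _ => [])
    {s : ℕ} (hs : s < n) (z : ℕ) :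
    Pre (prd inp) (Rl n μ) s z ↔ 0 < μ.get .cnt (μ.get .blk 0 s) z := by
  obtain ⟨h1, h2⟩ := hC.blk s hs
  rw [hc _ h1 h2, Finset.card_pos]
  constructor
  · rintro ⟨w, hw, hwn, hr⟩
    exact ⟨w, by simp [hwn, hw, hr]⟩
  · rintro ⟨w, hw⟩
    simp only [Finset.mem_filter, Finset.mem_range] at hw
    exact ⟨w, hw.2.1, hw.1, hw.2.2⟩

/-- For the commands that only build auxiliary lists: they may write marks, provided that these are
all cleared in the end. -/
theorem Core.of_frame {p : Cmd} (h : Core n k μ L fun _ => []) (hF : Frame p μ ν)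
    (hnum : p.modReg .num = false) (hcur : p.modReg .cur = false) (hnr : ∀ a, p.modNr a = false)
    (htab : ∀ a ∈ [Tab.nxt, .prv, .blk, .bnxt, .bprv, .remv, .cnt, .rel], p.modTab a = false)
    (hlen : ∀ a ∈ [Tab.nxt, .prv, .blk, .bnxt, .bprv, .mark], p.modLen a = false)
    (hm : ∀ b, ν.get .mark 0 b = 0) : Core n k ν L fun _ => [] := by
  simp only [List.mem_cons, List.not_mem_nil, or_false, forall_eq_or_imp, forall_eq] at htab
  obtain ⟨g1, g2, g3, g4, g5, g6, g7, g8⟩ := htab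
  refine ⟨by rw [hF.reg _ hnum, h.num], h.shape.of_frame hF hnr hlen, ?_, ?_, ?_, ?_, ?_, ?_, ?_, hm,
    h.pos⟩
  · rw [hF.row _ g7]; exact h.cnt_len
  · rw [hF.row _ g8]; exact h.rel_len
  · rw [hF.row _ g6, hF.row _ g7, hF.row _ g8]; exact h.empty
  · rw [hF.get _ g1, hF.get _ g2, hF.get _ g3]; exact h.lists
  · obtain ⟨l₁, l₂, h1, h2⟩ := h.blocks
    exact ⟨l₁, l₂, h1.congr (by rw [hF.row _ g4]) (by rw [hF.row _ g5]) (hF.reg _ hcur),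
      by rw [hF.row _ g6]; exact h2⟩
  · rw [hF.get _ g3]; exact h.blk
  · rw [hF.get _ g3]; exact h.nonempty

/-- The memory after the refinement of the relation. -/
theorem Ready.refine (hμ : Ready inp N n k μ L) (hF : Frame refineRel μ ν) (hd : Dropped k μ ν) :
    Ready inp N n k ν L := by
  have hC := hμ.core
  have hZ : ∀ (b : ℕ) (Z : List ℕ), (∀ z, z ∈ Z ↔ 0 < μ.get .cnt b z ∧ ν.get .cnt b z = 0) → ∀ z ∈ Z,
      (1 ≤ b ∧ b < k) ∧ z < n := by
    intro b Z h z hz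
    obtain ⟨h1, h2⟩ := (h z).1 hz
    have hb : 1 ≤ b ∧ b < k := by
      by_contra hb
      have := hd.out b hb
      rw [Mem.get, this] at h2
      exact absurd h1 (by rw [Mem.get, h2]; simp)
    exact ⟨hb, hC.cnt_len b hb.1 hb.2 ▸ lt_of_get_pos h1⟩
  refine ⟨⟨by rw [hF.reg .num rfl, hC.num], hC.shape.of_frame hF (fun a => by cases a <;> rfl) ?_, ?_, ?_,
    ?_, ?_, hd.blocks, ?_, ?_, ?_, hC.pos⟩, hμ.states, hμ.bound, hμ.prd_nodup, ?_, ?_⟩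
  · intro a ha; simp only [List.mem_cons, List.not_mem_nil, or_false] at ha
    rcases ha with rfl | rfl | rfl | rfl | rfl | rfl <;> rfl
  · intro b h1 h2; rw [hd.cnt_len, hC.cnt_len b h1 h2]
  · intro b h1 h2; rw [hF.len .rel rfl, hC.rel_len b h1 h2]
  · intro b hb
    obtain ⟨g1, g2, g3⟩ := hC.empty b hb
    refine ⟨?_, by rw [hd.out b (by omega), g2], ?_⟩
    · obtain ⟨Z, h1, -, h3⟩ := hd.remv b
      rw [h1, g1, List.nil_append]
      refine List.eq_nil_iff_forall_not_mem.2 fun z hz => ?_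
      have := (hZ b Z h3 z hz).1
      omega
    · rw [← List.length_eq_zero_iff, hF.len .rel rfl, g3]; rfl
  · rw [hF.get .nxt rfl, hF.get .prv rfl, hF.get .blk rfl]; exact hC.lists
  · rw [hF.get .blk rfl]; exact hC.blk
  · rw [hF.get .blk rfl]; exact hC.nonempty
  · rw [hF.get .mark rfl]; exact hC.mark
  · intro b g1 g2
    obtain ⟨Z, h1, h2, h3⟩ := hd.remv b
    rw [h1, List.nodup_append]
    refine ⟨hμ.nodup b g1 g2, h2, fun z hz w hw => ?_⟩
    rintro rfl
    have := (hμ.remv b g1 g2 z hz).2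
    have := ((h3 z).1 hw).1
    omega
  · intro b g1 g2 z hz
    obtain ⟨Z, h1, h2, h3⟩ := hd.remv b
    rw [h1] at hz
    rcases List.mem_append.1 hz with hz | hz
    · obtain ⟨h4, h5⟩ := hμ.remv b g1 g2 z hz
      have := hd.cnt_le b z
      exact ⟨h4, by omega⟩
    · exact ⟨(hZ b Z h3 z hz).2, ((h3 z).1 hz).2⟩

/-- One round of the algorithm. -/
theorem wp_round (hS : System n (prd inp) le reps) (hN : 3 * n + 1 ≤ N)
    (hμ : Ready inp N n k μ L) (hcnt : CountsOk inp n k μ)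
    (hG : Good n (prd inp) le (μ.get .blk 0) (Rl n μ) (Rv n μ)) (hcur : μ.reg .cur ≠ 0)
    (hQ : ∀ t ν k' L', t + (15 * n + 70) * k + 59 * pot₁ n (prd inp) reps (Rl n ν) (Rv n ν) +
        46 * pot₂ n (prd inp) reps (Rl n ν) (Rv n ν) + 15 * pot₃ n (prd inp) reps (Rl n ν) + 1 ≤
        (15 * n + 70) * k' + 59 * pot₁ n (prd inp) reps (Rl n μ) (Rv n μ) +
        46 * pot₂ n (prd inp) reps (Rl n μ) (Rv n μ) + 15 * pot₃ n (prd inp) reps (Rl n μ) →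
      Ready inp N n k' ν L' → CountsOk inp n k' ν →
      Good n (prd inp) le (ν.get .blk 0) (Rl n ν) (Rv n ν) → Q t ν) :
    WP inp N (selectBlock ;; splitBlocks ;; removeList ;; predList ;; refineRel) Q μ := by
  have hC := hμ.core
  have hn := hμ.states
  have hkn := hC.le
  have hnr : ∀ a, a ≠ .remv → a ≠ .cnt → a ≠ .rel → μ.nr a = 1 := hC.shape.nr
  obtain ⟨l₁, l₂, hB, hBm, hB1, hB2⟩ := hC.blocks
  obtain ⟨b₀, l₂, rfl⟩ : ∃ b l, l₂ = b :: l := by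
    cases l₂ with
    | nil => exact absurd (by simpa using hB.cur) hcur
    | cons b l => exact ⟨b, l, rfl⟩
  obtain ⟨hb1, hb2⟩ := (hBm b₀).1 (by simp)
  obtain ⟨b, hbn, hb⟩ := hC.nonempty b₀ hb1 hb2
  have hLm : ∀ y, y ∈ L b₀ ↔ y < n ∧ μ.get .blk 0 y = b₀ := fun y => by
    simpa using hC.lists.mem b₀ hb1 hb2 y
  have hLn : (L b₀).Nodup := (hC.lists.circ b₀ hb1 hb2).nodup.of_cons
  have hLlen : (L b₀).length ≤ n := length_le_of_nodup_of_lt hLn fun y hy => ((hLm y).1 hy).1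
  have hrl : ∀ c, 1 ≤ c → c < k → (μ.row .remv c).length ≤ n := fun c h1 h2 =>
    length_le_of_nodup_of_lt (hμ.nodup c h1 h2) fun z hz => (hμ.remv c h1 h2 z hz).1
  -- selection
  rw [wp_seq]
  refine wp_selectBlock (Lb := L b₀) hB ?_ ((hrl b₀ hb1 hb2).trans hμ.bound) (hLlen.trans hμ.bound)
    (hnr _ (by decide) (by decide) (by decide)) (hnr _ (by decide) (by decide) (by decide)) ?_
  · rw [hn]; exact hC.lists.circ b₀ hb1 hb2
  intro t₁ μ₁ ht₁ hF₁ _ hrs₁ hbp₁ hrb₁ hrc₁ hBL₁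
  set Rm := μ.row .remv b₀ with hRm
  have hremv₁ : ∀ c, μ₁.row .remv c = if c = b₀ then [] else μ.row .remv c := by
    intro c; split_ifs with h
    · rw [h, hrb₁]
    · exact hrc₁ c h
  have hC₁ : Core n k μ₁ L fun _ => [] := by
    refine ⟨by rw [hF₁.reg .num rfl, hC.num], hC.shape.of_frame hF₁ (fun a => by cases a <;> rfl) ?_, ?_, ?_, ?_,
      ?_, ⟨l₁ ++ [b₀], l₂, hBL₁, ?_, ?_, ?_⟩, ?_, ?_, ?_, hC.pos⟩
    · intro a ha; simp only [List.mem_cons, List.not_mem_nil, or_false] at ha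
      rcases ha with rfl | rfl | rfl | rfl | rfl | rfl <;> rfl
    · rw [hF₁.row .cnt rfl]; exact hC.cnt_len
    · rw [hF₁.row .rel rfl]; exact hC.rel_len
    · intro c hc
      rw [hF₁.row .cnt rfl, hF₁.row .rel rfl, hremv₁, if_neg (by omega)]
      exact hC.empty c hc
    · rw [hF₁.get .nxt rfl, hF₁.get .prv rfl, hF₁.get .blk rfl]; exact hC.lists
    · intro c; rw [← hBm]; simp
    · intro c hc
      rw [hremv₁]
      split_ifs with h
      · rfl
      · exact hB1 c (by simpa [h] using hc)
    · intro c hc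
      have hcb : c ≠ b₀ := by
        rintro rfl
        have := hB.circ.nodup.of_cons
        rw [List.nodup_append] at this
        exact (List.nodup_cons.1 this.2.1).1 hc
      rw [hremv₁, if_neg hcb]
      exact hB2 c (by simp [hc])
    · rw [hF₁.get .blk rfl]; exact hC.blk
    · rw [hF₁.get .blk rfl]; exact hC.nonempty
    · rw [hF₁.get .mark rfl]; exact hC.mark
  have hRmn : Rm.Nodup := hμ.nodup b₀ hb1 hb2
  have hRmlt : ∀ z ∈ Rm, z < n := fun z hz => (hμ.remv b₀ hb1 hb2 z hz).1
  -- splitting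
  rw [wp_seq]
  refine wp_splitBlocks hn hN hC₁ ?_ hrs₁ hRmn hRmlt ?_
  · intro c g1 g2; rw [hremv₁]; split_ifs
    · simp
    · exact hrl c g1 g2
  intro t₂ μ₂ k' L' ht₂ hF₂ hC₂ hremv₂ hcnt₂ hrel₂ hblk₂
  rw [hF₁.get .blk rfl] at hremv₂ hcnt₂ hrel₂ hblk₂
  rw [hF₁.row .cnt rfl] at hcnt₂
  rw [hF₁.get .rel rfl] at hrel₂
  have hkn' := hC₂.le
  -- the blocks to be removed
  rw [wp_seq]
  refine wp_removeList (R := Rm) (k := k') ?_ (hC₂.shape.nr _ (by decide) (by decide) (by decide)) hC₂.mark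
    hC₂.shape.mark (by omega) (fun z hz => (hC₂.blk z (hRmlt z hz)).2) ?_
  · rw [hF₂.row .rs rfl, hrs₁]
  intro t₃ μ₃ rl ht₃ hF₃ hrl₃ hrln hrlm hrll hm₃
  have hC₃ : Core n k' μ₃ L' fun _ => [] := by
    refine hC₂.of_frame hF₃ rfl rfl (fun a => by cases a <;> rfl) ?_ ?_ hm₃
    · intro a ha; simp only [List.mem_cons, List.not_mem_nil, or_false] at ha
      rcases ha with rfl | rfl | rfl | rfl | rfl | rfl | rfl | rfl <;> rfl
    · intro a ha; simp only [List.mem_cons, List.not_mem_nil, or_false] at ha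
      rcases ha with rfl | rfl | rfl | rfl | rfl | rfl <;> rfl
  have hblk₃ : μ₃.get .blk = μ₂.get .blk := hF₃.get .blk rfl
  -- the predecessors of the selected block
  rw [wp_seq]
  refine wp_predList (Bs := L b₀) (k := k') ?_ (hC₃.shape.nr _ (by decide) (by decide) (by decide)) hC₃.mark
    hC₃.shape.mark (by omega) ?_ ?_
  -- The copy in `bp` was made before the split, so it lists the selected block as it was, even if
  -- that block has been split meanwhile.
  · rw [hF₃.row .bp rfl, hF₂.row .bp rfl, hbp₁]
  · intro y z hz
    exact (hC₃.blk z (hS.pr_lt z y hz).1).2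
  intro t₄ μ₄ cl ht₄ hF₄ hcl₄ hcln hclm hcll hm₄
  rw [hblk₃] at hclm
  have hC₄ : Core n k' μ₄ L' fun _ => [] := by
    refine hC₃.of_frame hF₄ rfl rfl (fun a => by cases a <;> rfl) ?_ ?_ hm₄
    · intro a ha; simp only [List.mem_cons, List.not_mem_nil, or_false] at ha
      rcases ha with rfl | rfl | rfl | rfl | rfl | rfl | rfl | rfl <;> rfl
    · intro a ha; simp only [List.mem_cons, List.not_mem_nil, or_false] at ha
      rcases ha with rfl | rfl | rfl | rfl | rfl | rfl <;> rfl
  have row₄ : ∀ a ∈ [Tab.blk, .remv, .cnt, .rel], μ₄.row a = μ₂.row a := by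
    intro a ha; simp only [List.mem_cons, List.not_mem_nil, or_false] at ha
    rcases ha with rfl | rfl | rfl | rfl <;> rw [hF₄.row _ rfl, hF₃.row _ rfl]
  have get₄ : ∀ a ∈ [Tab.blk, .remv, .cnt, .rel], μ₄.get a = μ₂.get a := by
    intro a ha; funext r i; rw [Mem.get, row₄ a ha]; rfl
  have hblk₄ := get₄ .blk (by simp)
  have hrel₄ := get₄ .rel (by simp)
  have hcnt₄ := get₄ .cnt (by simp)
  have hremv₄ := row₄ .remv (by simp)
  have hrw₄ : ∀ s, s < n → μ₄.row .remv (μ₄.get .blk 0 s) =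
      if μ.get .blk 0 s = b₀ then [] else μ.row .remv (μ.get .blk 0 s) := by
    intro s hs; rw [hremv₄, hblk₄, hremv₂ s hs, hremv₁]
  have hcn₄ : ∀ s, s < n → ∀ z, μ₄.get .cnt (μ₄.get .blk 0 s) z = μ.get .cnt (μ.get .blk 0 s) z := by
    intro s hs z; rw [hcnt₄, hblk₄, Mem.get, hcnt₂ s hs]; rfl
  have hready : Ready inp N n k' μ₄ L' := by
    refine ⟨hC₄, hn, hμ.bound, hμ.prd_nodup, fun c g1 g2 => ?_, fun c g1 g2 z hz => ?_⟩
    · obtain ⟨s, hs, rfl⟩ := hC₄.nonempty c g1 g2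
      rw [hrw₄ s hs]
      split_ifs
      · simp
      · exact hμ.nodup _ (hC.blk s hs).1 (hC.blk s hs).2
    · obtain ⟨s, hs, rfl⟩ := hC₄.nonempty c g1 g2
      rw [hrw₄ s hs] at hz
      rw [hcn₄ s hs]
      split_ifs at hz
      · simp at hz
      · exact hμ.remv _ (hC.blk s hs).1 (hC.blk s hs).2 z hz
  have hcnts₄ : CountsOk inp n k' μ₄ := by
    intro c h1 h2 z
    obtain ⟨s, hs, rfl⟩ := hC₄.nonempty c h1 h2
    have := hC.blk s hs
    rw [hcn₄ s hs, hcnt _ this.1 this.2]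
    congr 1
    refine Finset.filter_congr fun w hw => ?_
    rw [hrel₄, hblk₄, hrel₂ s w hs (Finset.mem_range.1 hw)]
  -- After the split every block lies inside or outside the remove set, so the blocks that meet it
  -- are the blocks contained in it.
  have hRmb : ∀ s, s < n → (μ₂.get .blk 0 s ∈ rl ↔ s ∈ Rm) := by
    intro s hs
    rw [hrlm]
    constructor
    · rintro ⟨z, hz, h⟩
      exact ((hblk₂ z s (hRmlt z hz) hs).1 h).2.1 hz
    · intro h; exact ⟨s, h, rfl⟩
  -- refinement
  refine wp_refineRel hready hcl₄ (by rw [hF₄.row .rl rfl, hrl₃]) hcln hrln ?_ ?_ hcnts₄ ?_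
  · intro c hc
    obtain ⟨y, _, z, hz, rfl⟩ := (hclm c).1 hc
    exact hC₂.blk z (hS.pr_lt z y hz).1
  · intro c hc
    obtain ⟨z, hz, rfl⟩ := (hrlm c).1 hc
    exact hC₂.blk z (hRmlt z hz)
  intro t₅ μ₅ ht₅ hF₅ hd₅ hcnts₅ hrel₅
  have hready₅ := hready.refine hF₅ hd₅
  have hblk₅ : μ₅.get .blk = μ₂.get .blk := (hF₅.get .blk rfl).trans hblk₄
  have hRvb : ∀ z, Rv n μ b z ↔ z ∈ Rm := by
    intro z; rw [Rv, hb]; exact ⟨fun h => h.2, fun h => ⟨hRmlt z h, h⟩⟩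
  -- Here the program meets the abstract refinement step. Stored data are compared after translation
  -- from blocks to states, since splitting renumbers blocks without changing the relation and the
  -- counts on states.
  have hT : Step n (prd inp) b (μ.get .blk 0) (Rl n μ) (Rv n μ) (μ₅.get .blk 0) (Rl n μ₅) (Rv n μ₅) := by
    refine ⟨hbn, ?_, ?_, ?_⟩
    · intro s t hs ht
      rw [hblk₅, hblk₂ s t hs ht, hRvb, hRvb]
    · intro s t hs
      simp only [Rl, hblk₅, hrel₅, hrel₄, hRvb]
      constructor
      · rintro ⟨ht, h⟩
        split_ifs at h with h1
        · exact absurd rfl h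
        · rw [hrel₂ s t hs ht] at h
          refine ⟨⟨ht, h⟩, ?_⟩
          rintro ⟨h2, x, y, hxy, h3, h4⟩
          exact h1 ⟨(hclm _).2 ⟨y, (hLm y).2 ⟨(hS.pr_lt x y hxy).2, h4.trans hb⟩, x, hxy, h3⟩,
            (hRmb t ht).2 h2⟩
      · rintro ⟨⟨ht, h⟩, h2⟩
        refine ⟨ht, ?_⟩
        rw [if_neg]
        · rwa [hrel₂ s t hs ht]
        · rintro ⟨h3, h4⟩
          obtain ⟨y, hy, x, hxy, h5⟩ := (hclm _).1 h3
          exact h2 ⟨(hRmb t ht).1 h4, x, y, hxy, h5, ((hLm y).1 hy).2.trans hb.symm⟩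
    · intro s z hs
      rw [hcnt.pre_iff hC hs, hcnts₅.pre_iff hready₅.core hs]
      obtain ⟨Z, h1, -, h3⟩ := hd₅.remv (μ₄.get .blk 0 s)
      have e : μ₅.get .blk 0 s = μ₄.get .blk 0 s := by rw [hblk₅, hblk₄]
      simp only [Rv, e]
      rw [h1, List.mem_append, h3, hrw₄ s hs, hcn₄ s hs, hb, Nat.pos_iff_ne_zero (n := μ₅.get _ _ _),
        not_not]
      have hzlt : 0 < μ.get .cnt (μ.get .blk 0 s) z → z < n := fun h => by
        have h1 := lt_of_get_pos h
        rwa [hC.cnt_len _ (hC.blk s hs).1 (hC.blk s hs).2] at h1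
      split_ifs with h
      · simp only [List.not_mem_nil, false_or, h, ne_eq, not_true_eq_false, and_false]
        rw [h] at hzlt
        tauto
      · simp only [h, ne_eq, not_false_eq_true, and_true]
        tauto
  have hG₅ : Good n (prd inp) le (μ₅.get .blk 0) (Rl n μ₅) (Rv n μ₅) := by
    refine hT.good hS hG ?_ ?_ ?_
    · rintro s s' t h ⟨h1, h2⟩; exact ⟨h1, by rwa [← h]⟩
    · intro s s' z h h1; rwa [Rv, ← h]
    · intro s z h; exact h.1
  have hRm0 : Rm ≠ [] := hB2 b₀ (by simp)
  have hrl0 : 1 ≤ rl.length := by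
    obtain ⟨z, hz⟩ := List.exists_mem_of_ne_nil _ hRm0
    exact List.length_pos_of_mem ((hrlm _).2 ⟨z, hz, rfl⟩)
  -- The three decreases that pay for this round.
  have p1 := hT.pot₁_add_le hS hG hG₅ (Bs := L b₀) (rl := rl) hLn
    (fun y hy => ⟨((hLm y).1 hy).1, ((hLm y).1 hy).2.trans hb.symm⟩) hrln
    (fun D hD => by
      obtain ⟨z, hz, h⟩ := (hrlm D).1 hD
      exact ⟨z, (hRvb z).2 hz, by rw [hblk₅, h]⟩)
  have p2 := hT.pot₂_add_le hS hG (Rm := Rm) hRmn fun z hz => (hRvb z).2 hz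
  have p3 := hT.pot₃_add_le hS hG₅ (cl := cl) (rl := rl) hcln hrln
    (fun D hD => by
      obtain ⟨y, hy, z, hz, h⟩ := (hclm D).1 hD
      exact ⟨z, y, hz, by rw [hblk₅, h], ((hLm y).1 hy).2.trans hb.symm⟩)
    (fun D hD z hz h => by
      rw [hRvb, ← hRmb z hz, ← hblk₅, h]; exact hD)
    (μ₄.get .rel) (fun s t hs ht h => by
      rw [hrel₄, hblk₅, hrel₂ s t hs ht] at h
      exact ⟨ht, h⟩)
    (fun D => ((L' D).map (wt (prd inp))).sum) (fun D hD => by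
      obtain ⟨z, hz, rfl⟩ := (hrlm D).1 hD
      rw [hblk₅]
      exact hC₂.lists.sum_map (hC₂.blk z (hRmlt z hz)) _)
  set W := ((L b₀).map (wt (prd inp))).sum with hW
  have hLW : (L b₀).length ≤ W := by
    rw [hW]
    calc (L b₀).length = ((L b₀).map fun _ => 1).sum := by simp
      _ ≤ _ := List.sum_le_sum fun y _ => by unfold wt; omega
  have hL0 : 1 ≤ (L b₀).length := List.length_pos_of_mem ((hLm b).2 ⟨hbn, hb⟩)
  -- A nonempty remove set contains at least one block, so terms linear in the weight of the
  -- selected block are absorbed by the product. Constants are absorbed too, as that block is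
  -- nonempty.
  have hWr : W ≤ W * rl.length := Nat.le_mul_of_pos_right _ hrl0
  have hsum : (cl.map fun b => 5 + (rl.map fun e => 7 + (if μ₄.get .rel b e ≠ 0 then
        15 * ((L' e).map (wt (prd inp))).sum else 0)).sum).sum ≤ 12 * (W * rl.length) +
      15 * (cl.map fun C => (rl.map fun D => if μ₄.get .rel C D ≠ 0 then
        ((L' D).map (wt (prd inp))).sum else 0).sum).sum := by
    have e1 : ∀ C, (rl.map fun e => 7 + (if μ₄.get .rel C e ≠ 0 then
        15 * ((L' e).map (wt (prd inp))).sum else 0)).sum = 7 * rl.length +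
        15 * (rl.map fun D => if μ₄.get .rel C D ≠ 0 then
        ((L' D).map (wt (prd inp))).sum else 0).sum := by
      intro C
      rw [List.sum_map_add, ← List.sum_map_mul_left]
      congr 1
      · simp; ring
      · congr 1
        refine List.map_congr_left fun D _ => ?_
        split_ifs <;> simp
    simp only [e1]
    rw [← List.sum_map_mul_left]
    have e2 : ∀ C ∈ cl, 5 + (7 * rl.length +
        15 * (rl.map fun D => if μ₄.get .rel C D ≠ 0 then
        ((L' D).map (wt (prd inp))).sum else 0).sum) ≤ 12 * rl.length + 15 * (rl.map fun D =>
        if μ₄.get .rel C D ≠ 0 then ((L' D).map (wt (prd inp))).sum else 0).sum := by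
      intro C _; omega
    refine (List.sum_le_sum e2).trans ?_
    rw [List.sum_map_add]
    refine Nat.add_le_add_right ?_ _
    have : (cl.map fun _ => 12 * rl.length).sum = 12 * (cl.length * rl.length) := by
      simp; ring
    rw [this]
    exact Nat.mul_le_mul_left _ (Nat.mul_le_mul_right _ hcll)
  -- The coefficients: per element of the remove set 3 + 34 + 9 = 46 steps for selecting, splitting
  -- and listing; 3 + 12 + 12 per unit of the product, plus 32 for the constants and the loop test,
  -- that is 59; and 15 per scanned unit of weight.
  refine hQ _ _ k' L' ?_ hready₅ hcnts₅ hG₅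
  generalize (cl.map fun C => (rl.map fun D => if μ₄.get .rel C D ≠ 0 then
        ((L' D).map (wt (prd inp))).sum else 0).sum).sum = X at *
  generalize W * rl.length = Y at *
  omega

end

/-! ### The main loop and the whole run -/

section
variable {inp : Input} {N n k : ℕ} {Q : ℕ → Mem → Prop} {μ ν : Mem} {L : ℕ → List ℕ}
  {le : ℕ → ℕ → Prop} {reps : Finset ℕ}

/-- Block numbers in use are nonempty unions of simulation classes. This is where the number of
blocks of the simulation partition enters the bounds. -/
theorem Core.le_card_add_one (hC : Core n k μ L fun _ => []) (hS : System n (prd inp) le reps)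
    (hG : Good n (prd inp) le (μ.get .blk 0) (Rl n μ) (Rv n μ)) : k ≤ reps.card + 1 := by
  have := hS.le_card (μ.get .blk 0) (k - 1) hG.blk_eq fun i h1 h2 => hC.nonempty i h1 (by omega)
  omega

/-- The main loop. -/
theorem wp_loop (hS : System n (prd inp) le reps) (hN : 3 * n + 1 ≤ N) (F : ℕ) :
    ∀ (μ : Mem) (k : ℕ) (L : ℕ → List ℕ), Ready inp N n k μ L → CountsOk inp n k μ →
      Good n (prd inp) le (μ.get .blk 0) (Rl n μ) (Rv n μ) →
      59 * pot₁ n (prd inp) reps (Rl n μ) (Rv n μ) + 46 * pot₂ n (prd inp) reps (Rl n μ) (Rv n μ) +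
        15 * pot₃ n (prd inp) reps (Rl n μ) + (15 * n + 70) * (reps.card + 1) ≤
        F + (15 * n + 70) * k →
      WP inp N (.while (.reg .cur) (selectBlock ;; splitBlocks ;; removeList ;; predList ;; refineRel))
        (fun t ν => t ≤ F + 1 ∧ ∀ a, ν.nr a ≤ reps.card + 1) μ := by
  -- The credit `F` consists of the potentials and of the cost of all blocks that may still be
  -- created. A round of `t` steps uses up at least `t + 1`, the additional unit being the test of
  -- the loop, so the loop halts.
  induction F using Nat.strong_induction_on with
  | _ F ih =>
    intro μ k L hμ hc hG hF
    rw [wp_while]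
    refine ⟨fun hcur => ?_, fun _ => ⟨by omega, fun a => ?_⟩⟩
    · refine wp_round hS hN hμ hc hG hcur fun t ν k' L' ht hν hc' hG' => ?_
      have hk' : (15 * n + 70) * k' ≤ (15 * n + 70) * (reps.card + 1) :=
        Nat.mul_le_mul_left _ (hν.core.le_card_add_one hS hG')
      refine (ih (F - (t + 1)) (by omega) ν k' L' hν hc' hG' (by omega)).mono ?_
      rintro t' ν' ⟨h1, h2⟩
      exact ⟨by omega, h2⟩
    · have hk := hμ.core.le_card_add_one hS hG
      have hs := hμ.core.shape
      by_cases h1 : a = .remv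
      · rw [h1, hs.nr_remv]; exact hk
      by_cases h2 : a = .cnt
      · rw [h2, hs.nr_cnt]; exact hk
      by_cases h3 : a = .rel
      · rw [h3, hs.nr_rel]; exact hk
      rw [hs.nr a h1 h2 h3]; omega

/-- The initial memory satisfies `Good`: simulating states have the same label, hence lie in the
same initial block, so the identity relation is closed upwards. -/
theorem wp_SA (hS : System n (prd inp) le reps) (hn : (inp .pre).length = n) (hP : PartOk inp n)
    (hN : 3 * n + 1 ≤ N) (h0 : 0 < n) (hpn : ∀ w, (prd inp w).Nodup)
    (hle : ∀ s t i, le s t → (s ∈ prt inp i ↔ t ∈ prt inp i))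
    (hreg : ∀ r, μ.reg r = 0) (hnr : ∀ a, μ.nr a = 1) (hrow : ∀ a b, μ.row a b = []) :
    WP inp N SA (fun t ν => t ≤ 406 * (reps.card * ∑ z ∈ Finset.range n, wt (prd inp) z) ∧
      ∀ a, ν.nr a ≤ reps.card + 1) μ := by
  unfold SA
  have hpr : ∀ w, ∀ z ∈ prd inp w, z < n := fun w z hz => (hS.pr_lt z w hz).1
  refine wp_setup hn hP hN h0 hpr hpn hreg hnr hrow rfl _ fun t ν ht hC hc hr hv => ?_
  set k := (inp .part).length + 1
  have hmem : ∀ z, z < n → ∀ b, 1 ≤ b → b < k → (z ∈ prt inp (b - 1) ↔ ν.get .blk 0 z = b) := by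
    intro z hz b h1 h2
    have := hC.lists.mem b h1 h2 z
    simpa [hz] using this
  have hblk : ∀ s t, le s t → ν.get .blk 0 s = ν.get .blk 0 t := by
    intro s t h
    obtain ⟨h1, h2⟩ := hS.le_lt s t h
    obtain ⟨h3, h4⟩ := hC.blk s h1
    exact (((hmem t h2 _ h3 h4).1 ((hle s t _ h).1 ((hmem s h1 _ h3 h4).2 rfl)))).symm
  have hR : ∀ s t, s < n → (Rl n ν s t ↔ t < n ∧ ν.get .blk 0 s = ν.get .blk 0 t) := by
    intro s t hs
    refine and_congr_right fun ht => ?_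
    exact hr _ _ (hC.blk s hs).1 (hC.blk s hs).2 (hC.blk t ht).2
  have hRup : ∀ s t t', s < n → Rl n ν s t → le t t' → Rl n ν s t' := by
    intro s t t' hs h h'
    rw [hR s _ hs] at h ⊢
    exact ⟨(hS.le_lt _ _ h').2, h.2.trans (hblk _ _ h')⟩
  -- The initial remove sets are exact complements, so that every pair is live and `cover` holds
  -- trivially.
  have hV : ∀ s z, s < n → (Rv n ν s z ↔ z < n ∧ ¬ Pre (prd inp) (Rl n ν) s z) := by
    intro s z hs
    rw [hc.pre_iff hC hs, Rv, hv, if_pos (hC.blk s hs)]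
    simp only [List.mem_filter, List.mem_range, decide_eq_true_eq]
    omega
  have hG : Good n (prd inp) le (ν.get .blk 0) (Rl n ν) (Rv n ν) := by
    refine ⟨fun s t h _ => hblk s t h, ?_, hRup, fun s z h => h.1, ?_,
      fun s z hs h => ((hV s z hs).1 h).2, ?_, ?_⟩
    · rintro s s' t h ⟨h1, h2⟩; exact ⟨h1, by rwa [← h]⟩
    · rintro s s' z h h1; rwa [Rv, ← h]
    · intro s z z' hs h h1 h2
      rw [hV s _ hs] at h ⊢
      refine ⟨(hS.le_lt _ _ h1).2, ?_⟩
      rintro ⟨y, hy, hR'⟩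
      obtain ⟨y', hy', hle'⟩ := hS.le_step z' z y h2 hy
      exact h.2 ⟨y', hy', hRup s y y' hs hR' hle'⟩
    · intro x y x' hxy h
      by_cases h' : Pre (prd inp) (Rl n ν) y x'
      · exact Or.inl h'
      · exact Or.inr ((hV y x' (hS.pr_lt x y hxy).2).2 ⟨h.1, h'⟩)
  have hready : Ready inp N n k ν (fun b => prt inp (b - 1)) := by
    refine ⟨hC, hn, by omega, hpn, fun b h1 h2 => ?_, fun b h1 h2 z hz => ?_⟩
    · rw [hv, if_pos ⟨h1, h2⟩]; exact List.nodup_range.filter _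
    · rw [hv, if_pos ⟨h1, h2⟩] at hz
      simpa using hz
  have hk := hC.le_card_add_one hS hG
  set S := ∑ z ∈ Finset.range n, wt (prd inp) z with hSd
  have hp : 1 ≤ reps.card := by
    obtain ⟨e, he, -⟩ := hS.exists_rep 0 h0
    exact Finset.card_pos.2 ⟨e, he⟩
  have hnS : n ≤ S := by
    rw [hSd]
    calc n = ∑ z ∈ Finset.range n, 1 := by simp
      _ ≤ _ := Finset.sum_le_sum fun z _ => by unfold wt; omega
  have q1 := pot₁_le (n := n) (pr := prd inp) (reps := reps) (Rl n ν) (Rv n ν)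
  have q2 := pot₂_le (n := n) (pr := prd inp) (reps := reps) (Rl n ν) (Rv n ν)
  have q3 := pot₃_le (n := n) (pr := prd inp) (reps := reps) (Rl n ν)
  rw [mul_comm] at q1 q3
  have e1 : n * reps.card ≤ reps.card * S := by rw [mul_comm]; exact Nat.mul_le_mul_left _ hnS
  have e2 : reps.card ≤ reps.card * S := Nat.le_mul_of_pos_right _ (by omega)
  have e3 : (15 * n + 70) * (reps.card + 1) = 15 * (n * reps.card) + 70 * reps.card + (15 * n + 70) := by ring
  have e4 : 15 * n + 70 ≤ (15 * n + 70) * k := Nat.le_mul_of_pos_right _ (by omega)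
  have e5 : k * S ≤ 2 * (reps.card * S) := by
    rw [← mul_assoc]; exact Nat.mul_le_mul_right _ (by omega)
  -- The potentials contribute 59 + 46 + 15 = 120, and the blocks yet to be created 15 + 70 = 85,
  -- because the credit `15 * n + 70` of one number is already in use. With at most 200 for the
  -- initialization and the last test this gives 406.
  refine (wp_loop hS hN (205 * (reps.card * S)) ν k _ hready hc hG ?_).mono ?_
  · rw [e3]
    generalize reps.card * S = X at *
    generalize n * reps.card = Y at *
    omega
  · rintro t' ν' ⟨h1, h2⟩
    refine ⟨?_, h2⟩
    generalize reps.card * S = X at *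
    omega

end

/-! ### The Kripke structure -/

section
variable {n : ℕ} {AP : Type u} {K : Kripke (Fin n) AP} {inp : Input}

theorem Kripke.simPreorder_refl (K : Kripke (Fin n) AP) (s : Fin n) : K.simPreorder s s :=
  ⟨fun a b => a = b, fun a b h => by subst h; exact ⟨rfl, fun t ht => ⟨t, ht, rfl⟩⟩, rfl⟩

theorem Kripke.isSimulation_simPreorder (K : Kripke (Fin n) AP) :
    K.IsSimulation K.simPreorder := by
  rintro s s' ⟨R, hR, h⟩
  refine ⟨(hR s s' h).1, fun t ht => ?_⟩
  obtain ⟨t', h1, h2⟩ := (hR s s' h).2 t ht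
  exact ⟨t', h1, R, hR, h2⟩

/-- The simulation preorder on numbers. -/
def Kripke.simLe (K : Kripke (Fin n) AP) (a b : ℕ) : Prop :=
  ∃ (ha : a < n) (hb : b < n), K.simPreorder ⟨a, ha⟩ ⟨b, hb⟩

theorem Represents.length_pre (h : Represents inp K) : (inp .pre).length = n := h.1.1

theorem Represents.prd_eq_nil (h : Represents inp K) {y : ℕ} (hy : n ≤ y) : prd inp y = [] :=
  List.getD_eq_default _ _ (by rw [h.length_pre]; exact hy)

theorem Represents.prd_spec (h : Represents inp K) (y : Fin n) :
    (prd inp y).Nodup ∧ ∀ a : ℕ, a ∈ prd inp y ↔ ∃ r : Fin n, (r : ℕ) = a ∧ K.trans r y := by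
  have hy : (y : ℕ) < (inp .pre).length := by rw [h.length_pre]; exact y.2
  refine h.1.2 y _ ?_
  rw [prd, List.getD_eq_getElem _ _ hy, List.getElem?_eq_getElem hy]

theorem Represents.mem_prd (h : Represents inp K) {x y : ℕ} :
    x ∈ prd inp y ↔ ∃ (hx : x < n) (hy : y < n), K.trans ⟨x, hx⟩ ⟨y, hy⟩ := by
  by_cases hy : y < n
  · rw [(h.prd_spec ⟨y, hy⟩).2 x]
    constructor
    · rintro ⟨r, rfl, hr⟩; exact ⟨r.2, hy, hr⟩
    · rintro ⟨hx, _, hr⟩; exact ⟨⟨x, hx⟩, rfl, hr⟩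
  · rw [h.prd_eq_nil (by omega)]
    simp [hy]

theorem Represents.prd_nodup (h : Represents inp K) (y : ℕ) : (prd inp y).Nodup := by
  by_cases hy : y < n
  · exact (h.prd_spec ⟨y, hy⟩).1
  · rw [h.prd_eq_nil (by omega)]; exact List.nodup_nil

theorem Represents.prt_mem {i : ℕ} (hi : i < (inp .part).length) : prt inp i ∈ inp .part := by
  rw [prt, List.getD_eq_getElem _ _ hi]; exact List.getElem_mem hi

theorem Represents.partOk (h : Represents inp K) : PartOk inp n := by
  obtain ⟨-, h1, h2, h3⟩ := h
  have hlt : ∀ i, ∀ z ∈ prt inp i, z < n := by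
    intro i z hz
    obtain ⟨-, s, hs⟩ := h2 _ (Represents.prt_mem (PartOk.lt_length hz))
    obtain ⟨r, rfl, -⟩ := (hs z).1 hz
    exact r.2
  refine ⟨fun i => ?_, fun i hi h0 => ?_, hlt, fun i j z hi hj => ?_, fun z hz => ?_⟩
  · by_cases hi : i < (inp .part).length
    · exact (h2 _ (Represents.prt_mem hi)).1
    · rw [prt, List.getD_eq_default _ _ (by omega)]; exact List.nodup_nil
  · obtain ⟨-, s, hs⟩ := h2 _ (Represents.prt_mem hi)
    have : (s : ℕ) ∈ prt inp i := (hs s).2 ⟨s, rfl, rfl⟩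
    rw [h0] at this
    simp at this
  · have hi' := PartOk.lt_length hi
    have hj' := PartOk.lt_length hj
    obtain ⟨l, -, hl⟩ := h3 ⟨z, hlt i z hi⟩
    have e1 := hl _ ⟨Represents.prt_mem hi', hi⟩
    have e2 := hl _ ⟨Represents.prt_mem hj', hj⟩
    have e3 := e1.trans e2.symm
    rw [prt, prt, List.getD_eq_getElem _ _ hi', List.getD_eq_getElem _ _ hj'] at e3
    exact (h1.getElem_inj_iff).1 e3
  · obtain ⟨l, ⟨hl, hz'⟩, -⟩ := h3 ⟨z, hz⟩
    obtain ⟨i, hi, rfl⟩ := List.getElem_of_mem hl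
    exact ⟨i, by rw [prt, List.getD_eq_getElem _ _ hi]; exact hz'⟩

/-- The rows are label classes, and simulation preserves labels. -/
theorem Represents.prt_iff (h : Represents inp K) {s t : ℕ} (i : ℕ) (hst : K.simLe s t) :
    s ∈ prt inp i ↔ t ∈ prt inp i := by
  obtain ⟨hs, ht, hR⟩ := hst
  have hl := (K.isSimulation_simPreorder _ _ hR).1
  by_cases hi : i < (inp .part).length
  · obtain ⟨-, r, hr⟩ := h.2.2.1 _ (Represents.prt_mem hi)
    rw [hr, hr]
    constructor
    · rintro ⟨q, hq, h'⟩
      exact ⟨⟨t, ht⟩, rfl, by rw [← hl, ← h']; congr 1; exact Fin.ext hq.symm⟩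
    · rintro ⟨q, hq, h'⟩
      exact ⟨⟨s, hs⟩, rfl, by rw [hl, ← h']; congr 1; exact Fin.ext hq.symm⟩
  · rw [prt, List.getD_eq_default _ _ (by omega)]; simp

/-- One representative is chosen for each block of the simulation partition. The inequality for the
cardinality is all that the bounds need, so injectivity of the choice is not proved. -/
theorem Kripke.exists_reps (h0 : 0 < n) (K : Kripke (Fin n) AP) : ∃ reps : Finset ℕ,
    reps.card ≤ K.simPartition.ncard ∧ (∀ e ∈ reps, e < n) ∧
    ∀ s, s < n → ∃ e ∈ reps, K.simLe s e ∧ K.simLe e s := by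
  classical
  have hfin : K.simPartition.Finite := Set.toFinite _
  have hch : ∀ B : Set (Fin n), B ∈ K.simPartition →
      ∃ s, B = {t | K.simPreorder s t ∧ K.simPreorder t s} := fun B hB => hB
  have : Nonempty (Fin n) := ⟨⟨0, h0⟩⟩
  choose! f hf using hch
  refine ⟨hfin.toFinset.attach.image fun B => (f B.1 : ℕ), ?_, ?_, ?_⟩
  · refine Finset.card_image_le.trans ?_
    rw [Finset.card_attach, Set.ncard_eq_toFinset_card _ hfin]
  · intro e he
    obtain ⟨B, -, rfl⟩ := Finset.mem_image.1 he
    exact (f B.1).2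
  · intro s hs
    set B : Set (Fin n) := {t | K.simPreorder ⟨s, hs⟩ t ∧ K.simPreorder t ⟨s, hs⟩} with hB
    have hBm : B ∈ K.simPartition := ⟨_, hB⟩
    have hsB : (⟨s, hs⟩ : Fin n) ∈ B := ⟨K.simPreorder_refl _, K.simPreorder_refl _⟩
    rw [hf B hBm] at hsB
    exact ⟨f B, Finset.mem_image.2 ⟨⟨B, hfin.mem_toFinset.2 hBm⟩, Finset.mem_attach _ _, rfl⟩,
      ⟨hs, (f B).2, hsB.2⟩, ⟨(f B).2, hs, hsB.1⟩⟩

theorem Represents.system (h : Represents inp K) {reps : Finset ℕ} (hr : ∀ e ∈ reps, e < n)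
    (hr' : ∀ s, s < n → ∃ e ∈ reps, K.simLe s e ∧ K.simLe e s) :
    System n (prd inp) K.simLe reps where
  pr_lt x y hxy := by
    obtain ⟨hx, hy, -⟩ := h.mem_prd.1 hxy
    exact ⟨hx, hy⟩
  le_lt a b hab := ⟨hab.1, hab.2.1⟩
  le_step a b y := by
    rintro ⟨ha, hb, hR⟩ hay
    obtain ⟨ha', hy, ht⟩ := h.mem_prd.1 hay
    obtain ⟨y', h1, h2⟩ := (K.isSimulation_simPreorder _ _ hR).2 _ ht
    exact ⟨y', h.mem_prd.2 ⟨hb, y'.2, h1⟩, hy, y'.2, h2⟩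
  reps_lt := hr
  exists_rep := hr'

/-- Counting the transitions by their targets; the summand one in `wt` contributes the number of
states. -/
theorem Represents.sum_wt (h : Represents inp K) :
    ∑ z ∈ Finset.range n, wt (prd inp) z = n + K.numTrans := by
  classical
  have h1 : ∀ y : Fin n, (prd inp y).length = ∑ x : Fin n, if K.trans x y then 1 else 0 := by
    intro y
    rw [← Finset.card_filter, ← List.toFinset_card_of_nodup (h.prd_nodup y),
      ← Finset.card_map Fin.valEmbedding]
    congr 1
    ext a
    simp only [List.mem_toFinset, (h.prd_spec y).2, Finset.mem_map, Finset.mem_filter,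
      Finset.mem_univ, true_and, Fin.valEmbedding_apply]
    exact exists_congr fun r => and_comm
  have h2 : K.numTrans = ∑ y : Fin n, ∑ x : Fin n, if K.trans x y then 1 else 0 := by
    rw [Kripke.numTrans, Set.ncard_eq_toFinset_card', Set.toFinset_ofPred, Finset.card_filter,
      Fintype.sum_prod_type_right]
  rw [Finset.sum_range, h2]
  simp only [wt, h1]
  rw [Finset.sum_add_distrib]
  simp [add_comm]

end

/-! ### Time and space -/

/-- The abstraction of the initial memory. -/
def Mem.start : Mem := ⟨fun _ => 0, fun _ => 1, fun _ _ => []⟩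

theorem abs_start : Abs Store.start Mem.start :=
  ⟨rfl, fun _ => rfl, fun a r => by cases r <;> rfl⟩

theorem fits_start (N : ℕ) (a : Tab) : (Store.start.tab a).Fits N := by
  simp [Store.start, Table.Fits, Vec.empty]

theorem tame_start (n : ℕ) : Store.start.Tame n 1 := by
  constructor <;> simp [Store.start, Vec.empty]

/-- Each of the at most `p` rows accounts for at most `2 * N` cells and for two row slots. -/
theorem Table.Fits.cells_le {N p : ℕ} {t : Table} (h : t.Fits N) (hp : t.rows.length ≤ p) :
    t.cells ≤ p * (2 * N + 2) := by
  have h1 : (t.rows.map Vec.cap).sum ≤ t.rows.length * (2 * N) := by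
    rw [← smul_eq_mul, ← List.length_map (f := Vec.cap)]
    refine List.sum_le_card_nsmul _ _ fun c hc => ?_
    obtain ⟨v, hv, rfl⟩ := List.mem_map.1 hc
    exact (h.2.2 v hv).2
  have h2 : t.rows.length * (2 * N) ≤ p * (2 * N) := Nat.mul_le_mul_right _ hp
  have h3 := h.2.1
  have h4 : p * (2 * N + 2) = p * (2 * N) + 2 * p := by ring
  unfold Table.cells
  omega

/-- Bounds in natural numbers for the time and the space. -/
theorem exec_SA {n : ℕ} {AP : Type u} {K : Kripke (Fin n) AP} {inp : Input} (h0 : 0 < n)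
    (h : Represents inp K) : ∃ t b m, Exec inp SA Store.start t b m ∧
      t ≤ 16576 * (K.simPartition.ncard * (n + K.numTrans)) ∧
      b ≤ bitBound n (336 * (K.simPartition.ncard * n)) (1 + t) := by
  obtain ⟨reps, hr1, hr2, hr3⟩ := K.exists_reps h0
  have hS := h.system hr2 hr3
  have hP := h.partOk
  obtain ⟨k, μ', hx, hk, hnr⟩ := wp_SA (μ := Mem.start) (N := 3 * n + 1) hS h.length_pre hP le_rfl h0
    h.prd_nodup (fun s t i hst => h.prt_iff i hst) (fun _ => rfl) (fun _ => rfl) fun _ _ => rfl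
  obtain ⟨t, b, m, he, ha, hf, ht⟩ := hx.sound (by omega) SA_costLE Store.start abs_start
    (fits_start _)
  rw [h.sum_wt] at hk
  have hp : 1 ≤ reps.card := by
    obtain ⟨e, he, -⟩ := hS.exists_rep 0 h0
    exact Finset.card_pos.2 ⟨e, he⟩
  set P := K.simPartition.ncard
  have hcells : m.cells ≤ 336 * (P * n) := by
    -- There are 14 tables. One-dimensional arrays are rows like any other, so a single bound serves
    -- for all of them.
    have h1 : m.cells ≤ 14 * ((reps.card + 1) * (2 * (3 * n + 1) + 2)) := by
      have hcell : ∀ a, (m.tab a).cells ≤ (reps.card + 1) * (2 * (3 * n + 1) + 2) := fun a =>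
        (hf a).cells_le (by rw [ha.nr]; exact hnr a)
      exact (Finset.sum_le_card_nsmul Finset.univ _ _ fun a _ => hcell a).trans_eq
        (by rw [smul_eq_mul]; rfl)
    have h2 : (reps.card + 1) * (2 * (3 * n + 1) + 2) ≤ (2 * P) * (12 * n) :=
      Nat.mul_le_mul (by omega) (by omega)
    have h3 : (2 * P) * (12 * n) = 24 * (P * n) := by ring
    omega
  refine ⟨t, b, m, he, ?_, ?_⟩
  -- At most 40 per elementary command or test, and 406 of these per unit, make 16240; the remaining
  -- 336 pays for copying through the number of cells.
  · have h1 : reps.card * (n + K.numTrans) ≤ P * (n + K.numTrans) := Nat.mul_le_mul_right _ hr1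
    have h2 : P * n ≤ P * (n + K.numTrans) := Nat.mul_le_mul_left _ (by omega)
    generalize P * (n + K.numTrans) = X at *
    generalize reps.card * (n + K.numTrans) = Y at *
    omega
  -- The bound on the width of numbers uses the time bound already established, through the clock
  -- value `1 + t`.
  · have htame := he.tame (n := n) h.length_pre.le ?_ SA_isTame le_rfl (tame_start n)
    · exact htame.2.2.trans (bitBound_mono hcells le_rfl)
    · rintro a l hl z hz
      obtain ⟨i, hi, rfl⟩ := List.getElem_of_mem hl
      cases a with
      | pre =>
        have : z ∈ prd inp i := by rw [prd, List.getD_eq_getElem _ _ hi]; exact hz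
        exact (hS.pr_lt z i this).1.le
      | part =>
        have : z ∈ prt inp i := by rw [prt, List.getD_eq_getElem _ _ hi]; exact hz
        exact (hP.lt i z this).le

/-- The size is at most one more than the binary logarithm, and this one is absorbed because the
logarithm is at least one for `n ≥ 2`. -/
theorem size_le_log {n : ℕ} (hn : 2 ≤ n) : (Nat.size n : ℝ) ≤ 2 * (Real.log n / Real.log 2) := by
  have h2 : 0 < Real.log 2 := Real.log_pos (by norm_num)
  have hlog : Real.log 2 ≤ Real.log n := Real.log_le_log (by norm_num) (by exact_mod_cast hn)
  have h1 : 1 ≤ Real.log n / Real.log 2 := by rwa [le_div_iff₀ h2, one_mul]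
  have h3 : 1 ≤ Nat.size n := Nat.lt_size.2 (by simp; omega)
  have h4 : 2 ^ (Nat.size n - 1) ≤ n := Nat.lt_size.1 (by omega)
  have h5 : ((Nat.size n - 1 : ℕ) : ℝ) * Real.log 2 ≤ Real.log n := by
    rw [← Real.log_pow]
    refine Real.log_le_log (by positivity) ?_
    exact_mod_cast h4
  rw [← le_div_iff₀ h2] at h5
  push_cast [h3] at h5
  linarith

/-- The time is at most cubic in `n`, so numbers have at most three times as many bits as `n`, up to
a constant; the number of cells is at most quadratic. Only the factor for the number of cells keeps
the dependence on `P`. -/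
theorem bitBound_le {n P T : ℕ} (hn : 2 ≤ n) (hP : 1 ≤ P) (hPn : P ≤ n)
    (hT : T ≤ 1 + 16576 * (P * (n + n * n))) :
    (bitBound n (336 * (P * n)) T : ℝ) ≤ 40000 * ((P : ℝ) * n * Real.log n) := by
  set ℓ := Nat.size n with hℓ
  have hnℓ : n < 2 ^ ℓ := Nat.lt_size_self n
  have hℓ1 : 1 ≤ ℓ := Nat.lt_size.2 (by simp; omega)
  have hlt : ∀ m, m ≤ n * (n * n) → m < 2 ^ (3 * ℓ) := by
    intro m hm
    refine hm.trans_lt ?_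
    calc n * (n * n) < 2 ^ ℓ * (2 ^ ℓ * 2 ^ ℓ) := by gcongr
      _ = 2 ^ (3 * ℓ) := by ring
  have h1 : Nat.size (n + 2 * T + 1) ≤ 17 + 3 * ℓ := by
    rw [Nat.size_le]
    have e1 : P * (n + n * n) ≤ n * (n + n * n) := Nat.mul_le_mul_right _ hPn
    have e2 : n * (n + n * n) = n * n + n * (n * n) := by ring
    have e3 : n * n ≤ n * (n * n) := Nat.mul_le_mul_left _ (Nat.le_mul_of_pos_right _ (by omega))
    have e4 : n ≤ n * n := Nat.le_mul_of_pos_right _ (by omega)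
    have e5 := hlt _ le_rfl
    -- The power 2 ^ 17 = 131072 exceeds the constant factor in front of the cube, which is about
    -- four times 16576.
    have e6 : 2 ^ (17 + 3 * ℓ) = 131072 * 2 ^ (3 * ℓ) := by rw [pow_add]; norm_num
    rw [e6]
    generalize 2 ^ (3 * ℓ) = Z at *
    generalize n * (n * n) = X at *
    generalize n * n = Y at *
    generalize P * (n + Y) = V at *
    omega
  have h2 : Nat.size (336 * (P * n)) ≤ 9 + 2 * ℓ := by
    rw [Nat.size_le]
    have e1 : P * n ≤ n * n := Nat.mul_le_mul_right _ hPn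
    have e2 : n * n < 2 ^ (2 * ℓ) := by
      calc n * n < 2 ^ ℓ * 2 ^ ℓ := by gcongr
        _ = 2 ^ (2 * ℓ) := by ring
    have e3 : 2 ^ (9 + 2 * ℓ) = 512 * 2 ^ (2 * ℓ) := by rw [pow_add]; norm_num
    rw [e3]
    omega
  have h3 : bitBound n (336 * (P * n)) T ≤ (348 * (P * n)) * (36 * ℓ) := by
    unfold bitBound
    have : 1 ≤ P * n := Nat.mul_pos hP (by omega)
    exact Nat.mul_le_mul (by omega) (by omega)
  have h4 := size_le_log hn
  have hlog2 := Real.log_two_gt_d9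
  have hlog0 : 0 ≤ Real.log n := Real.log_natCast_nonneg n
  have h5 : (ℓ : ℝ) ≤ 3 * Real.log n := by
    refine h4.trans ?_
    rw [← mul_div_assoc, div_le_iff₀ (by linarith)]
    nlinarith
  calc (bitBound n (336 * (P * n)) T : ℝ) ≤ ((348 * (P * n)) * (36 * ℓ) : ℕ) := by exact_mod_cast h3
    _ = (12528 * ((P : ℝ) * n)) * ℓ := by push_cast; ring
    _ ≤ (12528 * ((P : ℝ) * n)) * (3 * Real.log n) := by gcongr
    _ ≤ 40000 * ((P : ℝ) * n * Real.log n) := by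
      have : 0 ≤ (P : ℝ) * n * Real.log n := by positivity
      linarith

theorem Kripke.simPartition_ncard_pos {n : ℕ} {AP : Type u} (K : Kripke (Fin n) AP) (h0 : 0 < n) :
    1 ≤ K.simPartition.ncard :=
  (Set.ncard_pos (Set.toFinite _)).2 ⟨_, ⟨0, h0⟩, rfl⟩

theorem Kripke.simPartition_ncard_le {n : ℕ} {AP : Type u} (K : Kripke (Fin n) AP) :
    K.simPartition.ncard ≤ n := by
  have : K.simPartition = Set.range fun s => {t | K.simPreorder s t ∧ K.simPreorder t s} := by
    ext B; exact exists_congr fun s => eq_comm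
  rw [this, ← Set.image_univ]
  exact (Set.ncard_image_le Set.finite_univ).trans (by simp [Set.ncard_univ])

theorem Kripke.numTrans_le {n : ℕ} {AP : Type u} (K : Kripke (Fin n) AP) : K.numTrans ≤ n * n := by
  refine (Set.ncard_le_ncard (Set.subset_univ _)).trans ?_
  simp [Set.ncard_univ]

end SimAlg

theorem theorem3 :
    ∃ c : ℝ, ∀ (n : ℕ) (AP : Type u) (K : SimAlg.Kripke (Fin n) AP) (inp : SimAlg.Input),
      0 < n → SimAlg.Represents inp K →
      ∃ (t b : ℕ) (m : SimAlg.Store),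
        SimAlg.Exec inp SimAlg.SA SimAlg.Store.start t b m ∧
        (n ≤ K.numTrans →
          (t : ℝ) ≤ c * ((K.simPartition.ncard : ℝ) * (K.numTrans : ℝ))) ∧
        (2 ≤ n →
          (b : ℝ) ≤ c * ((K.simPartition.ncard : ℝ) * (n : ℝ) * Real.log n)) := by
  -- Large enough for the time, where `n ≤ K.numTrans` turns 16576 into twice this number, and for
  -- the space constant of `bitBound_le`.
  refine ⟨40000, fun n AP K inp h0 h => ?_⟩
  obtain ⟨t, b, m, he, ht, hb⟩ := SimAlg.exec_SA h0 h
  refine ⟨t, b, m, he, fun hn => ?_, fun hn => ?_⟩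
  · have h1 : K.simPartition.ncard * (n + K.numTrans) ≤ K.simPartition.ncard * (2 * K.numTrans) :=
      Nat.mul_le_mul_left _ (by omega)
    have h2 : K.simPartition.ncard * (2 * K.numTrans) = 2 * (K.simPartition.ncard * K.numTrans) := by
      ring
    have h3 : t ≤ 40000 * (K.simPartition.ncard * K.numTrans) := by omega
    exact_mod_cast h3
  · refine le_trans ?_ (SimAlg.bitBound_le (T := 1 + t) hn (K.simPartition_ncard_pos h0)
      K.simPartition_ncard_le ?_)
    · exact_mod_cast hb
    · have h1 : K.simPartition.ncard * (n + K.numTrans) ≤ K.simPartition.ncard * (n + n * n) :=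
        Nat.mul_le_mul_left _ (by have := K.numTrans_le; omega)
      omega
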